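/- Theorem. Conventions: for a function $u:\mathbb R^2\to\mathbb R$ put $$\widetilde u(l;y)=(2\pi)^{-1/2}\int_{\mathbb R} e^{-ilx}u(x,y)\,dx .$$ Let $\mathbf E_{1,w}$ be the space of real-valued $u\in L^2(\mathbb R^2)$ such that $(1+x^2)^2(1+y^2)^{5/2}u$, $(1+y^2)^2(1-\partial_x^2)^2u$, $(1-\partial_y^2)^2u$, $\partial_x^{-1}u$ and $(1+y^2)^{1/2}\,\partial_x^{-1}\partial_y u$ all lie in $L^2(\mathbb R^2)$ (derivatives in the sense of distributions; $w=\partial_x^{-1}v$ means $\partial_x w=v$). Let $u\in\mathbf E_{1,w}$ and suppose that $$c:=\frac{1}{\sqrt{2\pi}}\iint|\widetilde u(l;y)|\,dl\,dy<1,\qquad \Bigl(\iint|\widetilde u(l;y)|^2\,|l|^{-1}\,dl\,dy\Bigr)^{1/2}<\frac{1-c}{4},\qquad \widetilde c:=\frac{1}{\sqrt{2\pi}}\iint(1+l^2)^{1/2}|\widetilde u(l;y)|\,dl\,dy<1 .$$ Scattering data. Write $H$ for the Heaviside function, and for each sign $\pm$ let $$\int_{\pm l\cdot\infty}^y g(l;\eta)\,d\eta:=\Bigl(H(l)\int_{\pm\infty}^y+H(-l)\int_{\mp\infty}^y\Bigr)g(l;\eta)\,d\eta,\qquad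 g^\pm_{k,u}(h)(l;y)=\frac{i}{\sqrt{2\pi}}\int_{\pm l\cdot\infty}^y e^{-il(l+2k)(y-\eta)}(\widetilde u*h)(l;\eta)\,d\eta ,$$ where $*$ is convolution in $l$. The integral equation $$\widetilde\mu_\sharp^\pm=g^\pm_{k,u}(\sqrt{2\pi}\,\delta)+g^\pm_{k,u}(\widetilde\mu_\sharp^\pm)$$ has a solution $\widetilde\mu_\sharp^\pm=\widetilde\mu^\pm_\sharp(k,l;y)$ in $L^\infty_y(L^2(dk\,dl))\cap L^\infty_{y,k}(L^2(dl))$. For any such solutions put $\widetilde\mu^\pm=\sqrt{2\pi}\,\delta(l)+\widetilde\mu^\pm_\sharp$ and $$T^\pm(k,l)=-\frac{i}{2\pi}H(\pm(l-k))\int_{\mathbb R}e^{i(l^2-k^2)y}(\widetilde u*\widetilde\mu^\pm)(k,l-k;y)\,dy .$$ Local term. For $t>0$ and $(x,y)\in\mathbb R^2$ let $\xi=x/t$, $\eta=y/t$, $a=\frac1{12}\bigl(\xi-\frac{\eta^2}{12}\bigr)$, $$S_0(k,l;\xi,\eta)=(l-k)\xi-(l^2-k^2)\eta+4(l^3-k^3),$$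 $$u_1(t,x,y)=\frac1\pi\int_{\mathbb R^2}e^{itS_0(k,l;\xi,\eta)}\,i(l-k)\,\bigl(T^+(k,l)+T^-(k,l)\bigr)\,dl\,dk .$$ Then $(l-k)(T^++T^-)\in L^1(\mathbb R^2)$, so the integral defining $u_1$ converges absolutely. Moreover, for every $\delta>0$: 1. $u_1(t,x,y)=o(t^{-1})$ as $t\to\infty$, uniformly in $(x,y)$ with $a>\delta$: for every $\varepsilon>0$ there is $t_0>0$ such that $|u_1(t,x,y)|\le\varepsilon t^{-1}$ for all $t\ge t_0$ and all $(x,y)$ with $a>\delta$; 2. there is a constant $C$, depending only on $u$ and $\delta$, with $|u_1(t,x,y)|\le C t^{-2/3}$ for all $t>0$ and all $(x,y)$ with $|a|<\delta$; 3. there is a constant $C$, depending only on $u$ and $\delta$, with $|u_1(t,x,y)|\le C t^{-1}$ for all $t>0$ and all $(x,y)$ with $a<-\delta$. -/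

import Mathlib

namespace KPI

open MeasureTheory Set

noncomputable section

/-! ### The weighted space of initial data

Points of `ℝ × ℝ` are written `z = (x, y)`.  Negative and positive powers of the derivatives are
understood in the sense of distributions, i.e. through test functions. -/

/-- Test functions on the plane. -/
def IsTest (φ : ℝ × ℝ → ℝ) : Prop :=
  ContDiff ℝ (⊤ : ℕ∞) φ ∧ HasCompactSupport φ

/-- `∂ₓⁿ φ`. -/
def dx (n : ℕ) (φ : ℝ × ℝ → ℝ) (z : ℝ × ℝ) : ℝ :=
  iteratedDeriv n (fun x : ℝ => φ (x, z.2)) z.1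

/-- `∂_yⁿ φ`. -/
def dy (n : ℕ) (φ : ℝ × ℝ → ℝ) (z : ℝ × ℝ) : ℝ :=
  iteratedDeriv n (fun y : ℝ => φ (z.1, y)) z.2

/-- `(1 - ∂ₓ²)² u = v` in the sense of distributions. -/
def WeakBesselX (u v : ℝ × ℝ → ℝ) : Prop :=
  ∀ φ, IsTest φ →
    ∫ z, u z * (φ z - 2 * dx 2 φ z + dx 4 φ z) = ∫ z, v z * φ z

/-- `(1 - ∂_y²)² u = v` in the sense of distributions. -/
def WeakBesselY (u v : ℝ × ℝ → ℝ) : Prop :=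
  ∀ φ, IsTest φ →
    ∫ z, u z * (φ z - 2 * dy 2 φ z + dy 4 φ z) = ∫ z, v z * φ z

/-- `∂ₓ w = u` in the sense of distributions, i.e. `w = ∂ₓ⁻¹ u` (for `w ∈ L²` this determines `w`
and says `i p ŵ(p,q) = û(p,q)`). -/
def WeakInvDx (u w : ℝ × ℝ → ℝ) : Prop :=
  ∀ φ, IsTest φ → ∫ z, w z * dx 1 φ z = - ∫ z, u z * φ z

/-- `∂ₓ w = ∂_y u` in the sense of distributions, i.e. `w = ∂ₓ⁻¹ ∂_y u` (for `w ∈ L²` this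
determines `w` and says `p ŵ(p,q) = q û(p,q)`). -/
def WeakInvDxDy (u w : ℝ × ℝ → ℝ) : Prop :=
  ∀ φ, IsTest φ → ∫ z, w z * dx 1 φ z = ∫ z, u z * dy 1 φ z

/-- `u ∈ H^{4,5}(ℝ²)`: `u ∈ L²`, `u ∈ L^{2,4}_x L^{2,5}_y`, `(1+y²)²(1-∂ₓ²)² u ∈ L²` and
`(1-∂_y²)² u ∈ L²`. -/
def MemH45 (u : ℝ × ℝ → ℝ) : Prop :=
  MemLp u 2 volume ∧
  MemLp (fun z : ℝ × ℝ => (1 + z.1 ^ 2) ^ 2 * (1 + z.2 ^ 2) ^ (5 / 2 : ℝ) * u z) 2 volume ∧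
  (∃ v : ℝ × ℝ → ℝ, WeakBesselX u v ∧
    MemLp (fun z : ℝ × ℝ => (1 + z.2 ^ 2) ^ 2 * v z) 2 volume) ∧
  (∃ v : ℝ × ℝ → ℝ, WeakBesselY u v ∧ MemLp v 2 volume)

/-- `u ∈ E_{1,w}(ℝ²)`: `u ∈ H^{4,5}`, `∂ₓ⁻¹ u ∈ L²` and `∂ₓ⁻¹ ∂_y u ∈ L²_x L^{2,1}_y`. -/
def MemE1w (u : ℝ × ℝ → ℝ) : Prop :=
  MemH45 u ∧
  (∃ w : ℝ × ℝ → ℝ, WeakInvDx u w ∧ MemLp w 2 volume) ∧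
  (∃ w : ℝ × ℝ → ℝ, WeakInvDxDy u w ∧
    MemLp (fun z : ℝ × ℝ => (1 + z.2 ^ 2) ^ (1 / 2 : ℝ) * w z) 2 volume)

/-! ### The partial Fourier transform and the smallness conditions -/

/-- `ũ(l; y) = (2π)^{-1/2} ∫ e^{-ilx} u(x,y) dx`. -/
def ut (u : ℝ × ℝ → ℝ) (l y : ℝ) : ℂ :=
  ((1 / Real.sqrt (2 * Real.pi) : ℝ) : ℂ) *
    ∫ x : ℝ, Complex.exp (-Complex.I * l * x) * (u (x, y) : ℂ)

/-- `c = ‖ũ‖_{L¹(ℝ²)} / √(2π)`. -/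
def cNorm (u : ℝ × ℝ → ℝ) : ENNReal :=
  (∫⁻ z : ℝ × ℝ, ‖ut u z.1 z.2‖ₑ) / ENNReal.ofReal (Real.sqrt (2 * Real.pi))

/-- `c̃ = ‖ũ‖_{L^{1,1}_l L¹_y} / √(2π)`. -/
def cTilde (u : ℝ × ℝ → ℝ) : ENNReal :=
  (∫⁻ z : ℝ × ℝ, ENNReal.ofReal (Real.sqrt (1 + z.1 ^ 2)) * ‖ut u z.1 z.2‖ₑ) /
    ENNReal.ofReal (Real.sqrt (2 * Real.pi))

/-- `‖ũ‖_{L²_y L^{2,-1}_l} = (∫ |ũ(l;y)|² |l|⁻¹ dl dy)^{1/2}`. -/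
def normInv (u : ℝ × ℝ → ℝ) : ENNReal :=
  (∫⁻ z : ℝ × ℝ, ‖ut u z.1 z.2‖ₑ ^ 2 / ‖z.1‖ₑ) ^ (1 / 2 : ℝ)

/-! ### Scattering solutions

The sign `±` is a real number `s`, equal to `1` or `-1`.  A function `m k l y` stands for
`μ̃^±_♯(k,l;y) = μ̃^±(k,l;y) - √(2π) δ(l)`. -/

/-- `∫_{s l ∞}^y g(η) dη`, which is `∫_{+∞}^y` if `s l > 0` and `∫_{-∞}^y` if `s l < 0`. -/
def dirInt (s l y : ℝ) (g : ℝ → ℂ) : ℂ :=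
  if 0 < s * l then - ∫ η in Ioi y, g η
  else if s * l < 0 then ∫ η in Iic y, g η
  else 0

/-- `(ũ * μ̃)(k,l;y)`, convolution in `l`, where `μ̃ = √(2π) δ + m`. -/
def convMu (u : ℝ × ℝ → ℝ) (m : ℝ → ℝ → ℝ → ℂ) (k l y : ℝ) : ℂ :=
  (Real.sqrt (2 * Real.pi) : ℂ) * ut u l y + ∫ l' : ℝ, ut u (l - l') y * m k l' y

/-- `g_{k,u}^±(μ̃)(l;y) = (i/√(2π)) ∫_{±l∞}^y e^{-il(l+2k)(y-η)} (ũ * μ̃)(k,l;η) dη`, where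
`μ̃ = √(2π) δ + m`. -/
def gMu (s : ℝ) (u : ℝ × ℝ → ℝ) (m : ℝ → ℝ → ℝ → ℂ) (k l y : ℝ) : ℂ :=
  Complex.I * ((1 / Real.sqrt (2 * Real.pi) : ℝ) : ℂ) *
    dirInt s l y (fun η =>
      Complex.exp (-Complex.I * l * (l + 2 * k) * (y - η)) * convMu u m k l η)

/-- `m ∈ X = L^∞_y(L²(dk dl))`. -/
def MemX (m : ℝ → ℝ → ℝ → ℂ) : Prop :=
  AEStronglyMeasurable (fun z : ℝ × ℝ × ℝ => m z.1 z.2.1 z.2.2) volume ∧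
  ∃ M : NNReal, ∀ᵐ y : ℝ, ∫⁻ z : ℝ × ℝ, ‖m z.1 z.2 y‖ₑ ^ 2 ≤ M

/-- `m ∈ Y = L^∞_{y,k}(L²(dl))`. -/
def MemY (m : ℝ → ℝ → ℝ → ℂ) : Prop :=
  AEStronglyMeasurable (fun z : ℝ × ℝ × ℝ => m z.1 z.2.1 z.2.2) volume ∧
  ∃ M : NNReal, ∀ᵐ z : ℝ × ℝ, ∫⁻ l : ℝ, ‖m z.1 l z.2‖ₑ ^ 2 ≤ M

/-- `m = μ̃^±_♯` is a solution in `X ∩ Y` of the integral equation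
`μ̃_♯ = g_{k,u}^±(√(2π) δ) + g_{k,u}^±(μ̃_♯)`. -/
def IsScatteringSolution (s : ℝ) (u : ℝ × ℝ → ℝ) (m : ℝ → ℝ → ℝ → ℂ) : Prop :=
  MemX m ∧ MemY m ∧
  ∀ᵐ z : ℝ × ℝ × ℝ, m z.1 z.2.1 z.2.2 = gMu s u m z.1 z.2.1 z.2.2

/-! ### Scattering data and the local term -/

/-- `T^±(k,l) = -(i/2π) H(±(l-k)) ∫ e^{i(l²-k²)y} (ũ * μ̃^±)(k,l-k;y) dy`. -/
def scatT (s : ℝ) (u : ℝ × ℝ → ℝ) (m : ℝ → ℝ → ℝ → ℂ) (k l : ℝ) : ℂ :=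
  if 0 < s * (l - k) then
    -Complex.I * ((1 / (2 * Real.pi) : ℝ) : ℂ) *
      ∫ y : ℝ, Complex.exp (Complex.I * (l ^ 2 - k ^ 2) * y) * convMu u m k (l - k) y
  else 0

/-- `f = T⁺ + T⁻`. -/
def scatF (u : ℝ × ℝ → ℝ) (mp mm : ℝ → ℝ → ℝ → ℂ) (k l : ℝ) : ℂ :=
  scatT 1 u mp k l + scatT (-1) u mm k l

/-- `S₀(k,l;ξ,η) = (l-k)ξ - (l²-k²)η + 4(l³-k³)`. -/
def S0 (k l ξ η : ℝ) : ℝ :=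
  (l - k) * ξ - (l ^ 2 - k ^ 2) * η + 4 * (l ^ 3 - k ^ 3)

/-- `u₁(t,x,y) = (1/π) ∫ e^{itS₀(k,l;ξ,η)} i(l-k) f(k,l) dl dk` with `ξ = x/t`, `η = y/t`. -/
def u1 (u : ℝ × ℝ → ℝ) (mp mm : ℝ → ℝ → ℝ → ℂ) (t x y : ℝ) : ℂ :=
  ((1 / Real.pi : ℝ) : ℂ) *
    ∫ z : ℝ × ℝ, Complex.exp (Complex.I * t * (S0 z.1 z.2 (x / t) (y / t) : ℝ)) *
      (Complex.I * (z.2 - z.1) * scatF u mp mm z.1 z.2)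

/-- `a = (ξ - η²/12)/12` with `ξ = x/t`, `η = y/t`. -/
def aPar (t x y : ℝ) : ℝ :=
  (x / t - (y / t) ^ 2 / 12) / 12

end

end KPI

namespace KPI

open MeasureTheory Set Filter Topology
open scoped Convolution fwdDiff ENNReal

noncomputable section

/-! With φ(s) = sξ - s²η + 4s³ the phase splits as S₀ = φ(l) - φ(k), and φ'(s) = 12((s - η/12)² +
a). So `a` decides between no stationary point (a > 0), a degenerate one (a = 0) and two
nondegenerate ones (a < 0), and u₁ is a double integral of conj(e(k)) e(l) F(k,l) with e = exp(itφ).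
The half plane k < l carries T⁺ and l < k carries T⁻; the map (k,l) ↦ (-k,-l), conjugation and y ↦
-y carry the second to the first without changing `a` (`OscData.integral_lower`).

Oscillation. In one variable, e is written as g + w' with small G = ‖g‖₁, B₁ = ‖w‖₁, B = ‖w‖_∞
(`OscPair`), where w = -iβe and β = φ'/(λ + tφ'²) is a regularized 1/(tφ'). In the double integral
one first integrates by parts in l; the amplitude vanishes on the diagonal, so there is no boundary
term there. Then, for fixed l, one integrates by parts in k, but only where |k| and |l - k| are at
most K; outside that region the amplitude has an integrable small tail. This gives
`OscData.norm_integral_le`, and K is a power of t. The sizes of G, B₁, B are 1/t each for a > δ,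
giving t^(-17/16); t^(-1/3), t^(-2/3), t^(-1/3) uniformly in a, giving t^(-2/3); and t^(-1/2),
t^(-15/16), t^(-1/2) for a < -δ, giving t^(-1).

Amplitude. With p = l - k one has l² - k² = p(p + 2k), and F is a constant times pΘ(k,p), where
Θ(k,p) = ∫ exp(ip(p+2k)y) (ũ * μ̃)(k,p;y) dy. Smoothness of u in x gives decay |p|^(-13/4),
smoothness in y gives decay |p(p+2k)|^(-2), and moments give derivatives in p and Lipschitz bounds
in k. Interpolating these (`ThetaData`) produces the tails, Lipschitz bounds and integrability
required of F (`ThetaData.oscData`). All smoothness is measured by finite differences in L¹,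
obtained from the weighted L² hypotheses by interpolation (`IsNice`).

Scattering solution. Since the kernel of the integral operator is unimodular, the Neumann series is
dominated, uniformly in k and y, by a convolution Neumann series in l whose kernel has mass c < 1
(`maj`), and this majorant inherits polynomial decay (`exists_res_le_wt`). Finite differences in y
commute with the operator, and a shift of k amounts to multiplication by exp(2iκly); a Gronwall
principle for the same majorant (`enorm_le_res`) then gives y-regularity (`exists_fwdDiff_mu_le`)
and k-regularity (`exists_modu_mu_sub_le`).

Existence and uniqueness. The series lies in L^∞_{y,k}(L²_l) by its majorant. For L^∞_y(L²_{k,l}),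
Plancherel in k bounds the first term by the norm with weight |l|⁻¹, and every later term gains a
factor c. Two solutions have a difference whose mass-weighted L² norm is at most c times itself,
hence is zero (`ae_eq_mu_of_ae_eq_gop`), so arbitrary solutions yield the same T± almost everywhere.
-/

/-! ### One-variable integration by parts against an oscillating factor. -/

/-- Fundamental theorem of calculus for complex-valued functions that are Lipschitz. -/
lemma integral_deriv_eq_sub_of_lipschitzOn {h : ℝ → ℂ} {a b : ℝ} {K : NNReal}
    (hh : LipschitzOnWith K h (uIcc a b)) (h' : ℝ → ℂ) (hi : IntervalIntegrable h' volume a b)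
    (hd : ∀ᵐ x, x ∈ uIoc a b → HasDerivAt h (h' x) x) :
    ∫ x in a..b, h' x = h b - h a := by
  -- The fundamental theorem for absolutely continuous functions is applied to real-valued
  -- functions; real and imaginary part are the two functionals needed.
  have key : ∀ L : ℂ →L[ℝ] ℝ, ∫ x in a..b, L (h' x) = L (h b) - L (h a) := by
    intro L
    have hL : AbsolutelyContinuousOnInterval (fun x => L (h x)) a b :=
      (L.lipschitz.comp_lipschitzOnWith hh).absolutelyContinuousOnInterval
    rw [← hL.integral_deriv_eq_sub]
    apply intervalIntegral.integral_congr_ae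
    filter_upwards [hd] with x hx hxm
    exact ((L.hasFDerivAt.comp_hasDerivAt x (hx hxm)).deriv).symm
  have h1 := key Complex.reCLM
  have h2 := key Complex.imCLM
  rw [ContinuousLinearMap.intervalIntegral_comp_comm _ hi] at h1 h2
  apply Complex.ext
  · simpa using h1
  · simpa using h2

/-- A decomposition `e = g + w'` of an oscillating factor with small `g` and `w`. -/
structure OscPair (e g w : ℝ → ℂ) (G B₁ B : ℝ) : Prop where
  cont_e : Continuous e
  cont_g : Continuous g
  norm_e : ∀ s, ‖e s‖ = 1
  deriv_w : ∀ s, HasDerivAt w (e s - g s) s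
  int_g : Integrable g
  int_w : Integrable w
  bound_g : ∫ s, ‖g s‖ ≤ G
  bound_w : ∫ s, ‖w s‖ ≤ B₁
  sup_w : ∀ s, ‖w s‖ ≤ B

namespace OscPair
variable {e g w : ℝ → ℂ} {G B₁ B : ℝ}

lemma cont_w (h : OscPair e g w G B₁ B) : Continuous w :=
  continuous_iff_continuousAt.2 fun s => (h.deriv_w s).continuousAt

lemma G_nonneg (h : OscPair e g w G B₁ B) : 0 ≤ G :=
  (integral_nonneg fun _ => norm_nonneg _).trans h.bound_g

lemma B₁_nonneg (h : OscPair e g w G B₁ B) : 0 ≤ B₁ :=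
  (integral_nonneg fun _ => norm_nonneg _).trans h.bound_w

lemma B_nonneg (h : OscPair e g w G B₁ B) : 0 ≤ B := (norm_nonneg _).trans (h.sup_w 0)

lemma conj (h : OscPair e g w G B₁ B) :
    OscPair (fun s => (starRingEnd ℂ) (e s)) (fun s => (starRingEnd ℂ) (g s))
      (fun s => (starRingEnd ℂ) (w s)) G B₁ B where
  cont_e := Complex.continuous_conj.comp h.cont_e
  cont_g := Complex.continuous_conj.comp h.cont_g
  norm_e s := by simpa using h.norm_e s
  deriv_w s := by
    simpa using (h.deriv_w s).star
  int_g := by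
    have := Complex.conjCLE.toContinuousLinearMap.integrable_comp h.int_g
    simpa using this
  int_w := by
    have := Complex.conjCLE.toContinuousLinearMap.integrable_comp h.int_w
    simpa using this
  bound_g := by simpa using h.bound_g
  bound_w := by simpa using h.bound_w
  sup_w s := by simpa using h.sup_w s

/-- Integration by parts against a Lipschitz function on a bounded interval. -/
lemma norm_intervalIntegral_le (h : OscPair e g w G B₁ B) {f : ℝ → ℂ} {a b M L : ℝ} (hab : a ≤ b)
    (hL : 0 ≤ L) (hM : ∀ x ∈ Icc a b, ‖f x‖ ≤ M)
    (hf : ∀ x ∈ Icc a b, ∀ y ∈ Icc a b, ‖f x - f y‖ ≤ L * |x - y|) :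
    ‖∫ x in a..b, e x * f x‖ ≤ M * G + 2 * M * B + L * B₁ := by
  -- Composition with the projection onto [a,b] makes f globally Lipschitz with the same constants,
  -- so that it is differentiable almost everywhere with derivative bounded by L.
  set f₁ : ℝ → ℂ := fun x => f (projIcc a b hab x) with hf₁
  have hM0 : 0 ≤ M := (norm_nonneg _).trans (hM a ⟨le_rfl, hab⟩)
  have hlip : LipschitzWith ⟨L, hL⟩ f₁ := by
    apply LipschitzWith.of_dist_le_mul
    intro x y
    rw [dist_eq_norm]
    refine (hf _ (projIcc a b hab x).2 _ (projIcc a b hab y).2).trans ?_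
    have := (LipschitzWith.projIcc hab).dist_le_mul x y
    rw [Subtype.dist_eq, Real.dist_eq] at this
    simp only [NNReal.coe_one, one_mul] at this
    exact mul_le_mul_of_nonneg_left this hL
  have hbd : ∀ x, ‖f₁ x‖ ≤ M := fun x => hM _ (projIcc a b hab x).2
  have hcong : ∀ x ∈ uIcc a b, f₁ x = f x := by
    intro x hx
    rw [uIcc_of_le hab] at hx
    simp [hf₁, projIcc_of_mem hab hx]
  have hf₁c : Continuous f₁ := hlip.continuous
  have hwc := h.cont_w
  have hdw : Continuous fun s => e s - g s := h.cont_e.sub h.cont_g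
  have hderm : Measurable (deriv f₁) := measurable_deriv f₁
  have hderb : ∀ x, ‖deriv f₁ x‖ ≤ L := fun x => norm_deriv_le_of_lipschitz hlip
  have hderint : IntervalIntegrable (deriv f₁) volume a b := by
    refine (intervalIntegrable_const (c := L)).mono_fun hderm.aestronglyMeasurable ?_
    exact Eventually.of_forall fun x => by simpa [abs_of_nonneg hL] using hderb x
  have hwd : IntervalIntegrable (fun x => w x * deriv f₁ x) volume a b :=
    hderint.continuousOn_mul hwc.continuousOn
  have hI1 : IntervalIntegrable (fun x => (e x - g x) * f₁ x) volume a b :=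
    (hdw.mul hf₁c).intervalIntegrable _ _
  obtain ⟨D, hD⟩ := (isCompact_uIcc (a := a) (b := b)).exists_bound_of_continuousOn hdw.continuousOn
  have hlipw : LipschitzOnWith D.toNNReal w (uIcc a b) := by
    apply (convex_uIcc a b).lipschitzOnWith_of_nnnorm_hasDerivWithin_le
      (fun x _ => (h.deriv_w x).hasDerivWithinAt)
    intro x hx
    rw [← NNReal.coe_le_coe, coe_nnnorm]
    exact (hD x hx).trans (Real.le_coe_toNNReal D)
  have hprod : LipschitzOnWith (B * L + M * D.toNNReal).toNNReal (fun x => w x * f₁ x)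
      (uIcc a b) := by
    apply LipschitzOnWith.of_dist_le_mul
    intro x hx y hy
    rw [Real.coe_toNNReal _ (by have := h.B_nonneg; positivity)]
    have h1 := hlipw.dist_le_mul x hx y hy
    have h2 := hlip.dist_le_mul x y
    rw [dist_eq_norm] at h1 h2 ⊢
    have : w x * f₁ x - w y * f₁ y = w x * (f₁ x - f₁ y) + f₁ y * (w x - w y) := by ring
    rw [this]
    refine (norm_add_le _ _).trans ?_
    rw [norm_mul, norm_mul]
    have e1 := mul_le_mul (h.sup_w x) h2 (norm_nonneg _) h.B_nonneg
    have e2 := mul_le_mul (hbd y) h1 (norm_nonneg _) hM0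
    refine (add_le_add e1 e2).trans (le_of_eq ?_)
    change B * (L * dist x y) + _ = _
    ring
  -- Almost everywhere (w f₁)' = (e - g) f₁ + w f₁'; this identity is the integration by parts.
  have key := integral_deriv_eq_sub_of_lipschitzOn hprod
    (fun x => (e x - g x) * f₁ x + w x * deriv f₁ x) (hI1.add hwd) (by
      filter_upwards [hlip.ae_differentiableAt_real] with x hx _
      exact (h.deriv_w x).mul hx.hasDerivAt)
  have hge : IntervalIntegrable (fun x => g x * f₁ x) volume a b :=
    (h.cont_g.mul hf₁c).intervalIntegrable _ _
  have heq : ∫ x in a..b, e x * f x = (∫ x in a..b, g x * f₁ x) + (w b * f₁ b - w a * f₁ a)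
      - ∫ x in a..b, w x * deriv f₁ x := by
    rw [← key, intervalIntegral.integral_add hI1 hwd]
    have : ∫ x in a..b, e x * f x = (∫ x in a..b, g x * f₁ x) + ∫ x in a..b, (e x - g x) * f₁ x := by
      rw [← intervalIntegral.integral_add hge hI1]
      apply intervalIntegral.integral_congr
      intro x hx
      simp only [hcong x hx]; ring
    rw [this]; ring
  rw [heq]
  have b1 : ‖∫ x in a..b, g x * f₁ x‖ ≤ M * G := by
    rw [intervalIntegral.integral_of_le hab]
    calc ‖∫ x in Ioc a b, g x * f₁ x‖ ≤ ∫ x in Ioc a b, ‖g x * f₁ x‖ := norm_integral_le_integral_norm _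
      _ ≤ ∫ x in Ioc a b, M * ‖g x‖ := by
          apply integral_mono_of_nonneg (Eventually.of_forall fun _ => norm_nonneg _)
          · exact (h.int_g.norm.const_mul M).integrableOn
          · exact Eventually.of_forall fun x => by
              simp only [norm_mul]; rw [mul_comm]
              exact mul_le_mul_of_nonneg_right (hbd x) (norm_nonneg _)
      _ ≤ ∫ x, M * ‖g x‖ := setIntegral_le_integral (h.int_g.norm.const_mul M)
          (Eventually.of_forall fun x => by positivity)
      _ ≤ M * G := by
          rw [integral_const_mul]; exact mul_le_mul_of_nonneg_left h.bound_g hM0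
  have b2 : ‖∫ x in a..b, w x * deriv f₁ x‖ ≤ L * B₁ := by
    rw [intervalIntegral.integral_of_le hab]
    calc ‖∫ x in Ioc a b, w x * deriv f₁ x‖ ≤ ∫ x in Ioc a b, ‖w x * deriv f₁ x‖ :=
          norm_integral_le_integral_norm _
      _ ≤ ∫ x in Ioc a b, L * ‖w x‖ := by
          apply integral_mono_of_nonneg (Eventually.of_forall fun _ => norm_nonneg _)
          · exact (h.int_w.norm.const_mul L).integrableOn
          · exact Eventually.of_forall fun x => by
              simp only [norm_mul]; rw [mul_comm]
              exact mul_le_mul_of_nonneg_right (hderb x) (norm_nonneg _)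
      _ ≤ ∫ x, L * ‖w x‖ := setIntegral_le_integral (h.int_w.norm.const_mul L)
          (Eventually.of_forall fun x => by positivity)
      _ ≤ L * B₁ := by
          rw [integral_const_mul]; exact mul_le_mul_of_nonneg_left h.bound_w hL
  have b3 : ‖w b * f₁ b - w a * f₁ a‖ ≤ 2 * M * B := by
    refine (norm_sub_le _ _).trans ?_
    rw [norm_mul, norm_mul]
    nlinarith [mul_le_mul (h.sup_w b) (hbd b) (norm_nonneg _) h.B_nonneg,
      mul_le_mul (h.sup_w a) (hbd a) (norm_nonneg _) h.B_nonneg]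
  calc _ ≤ ‖∫ x in a..b, g x * f₁ x‖ + ‖w b * f₁ b - w a * f₁ a‖ + ‖∫ x in a..b, w x * deriv f₁ x‖ :=
        (norm_sub_le _ _).trans (add_le_add_left (norm_add_le _ _) _)
    _ ≤ _ := by linarith

/-- Integration by parts on a half-line. -/
lemma integral_Ioi_mul (h : OscPair e g w G B₁ B) {f f' : ℝ → ℂ} {a : ℝ} (hf : ∀ x, HasDerivAt f (f' x) x)
    (hfa : f a = 0) (hfi : IntegrableOn f (Ioi a)) (hfi' : IntegrableOn f' (Ioi a)) (hlim : Tendsto f atTop (𝓝 0)) :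
    ∫ x in Ioi a, e x * f x = ∫ x in Ioi a, (g x * f x - w x * f' x) := by
  have hfc : Continuous f := continuous_iff_continuousAt.2 fun s => (hf s).continuousAt
  obtain ⟨D, hD⟩ : ∃ D, ∀ x ∈ Ioi a, ‖f x‖ ≤ D := by
    have := (hlim.norm.eventually (gt_mem_nhds (show ‖(0 : ℂ)‖ < 1 by simp)))
    obtain ⟨N, hN⟩ := eventually_atTop.1 this
    obtain ⟨D, hD⟩ := (isCompact_Icc (a := a) (b := N)).exists_bound_of_continuousOn hfc.continuousOn
    refine ⟨max D 1, fun x hx => ?_⟩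
    rcases le_total x N with hxN | hxN
    · exact (hD x ⟨le_of_lt hx, hxN⟩).trans (le_max_left _ _)
    · exact (hN x hxN).le.trans (le_max_right _ _)
  have i1 : IntegrableOn (fun x => e x * f x) (Ioi a) :=
    hfi.bdd_mul h.cont_e.aestronglyMeasurable (Eventually.of_forall fun x => (h.norm_e x).le)
  have i2 : IntegrableOn (fun x => g x * f x) (Ioi a) :=
    h.int_g.integrableOn.mul_bdd hfc.aestronglyMeasurable (by
      filter_upwards [ae_restrict_mem measurableSet_Ioi] with x hx using hD x hx)
  have i3 : IntegrableOn (fun x => w x * f' x) (Ioi a) :=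
    hfi'.bdd_mul h.cont_w.aestronglyMeasurable (Eventually.of_forall h.sup_w)
  have i4 : IntegrableOn (fun x => (e x - g x) * f x + w x * f' x) (Ioi a) := by
    simp only [sub_mul]; exact (i1.sub i2).add i3
  -- The integrand is the derivative of w f, which vanishes at a because f does and at infinity
  -- because w is bounded.
  have hz : ∫ x in Ioi a, ((e x - g x) * f x + w x * f' x) = 0 := by
    rw [integral_Ioi_of_hasDerivAt_of_tendsto' (f := fun x => w x * f x) (m := 0)
      (fun x _ => (h.deriv_w x).mul (hf x)) i4]
    · simp [hfa]
    · refine squeeze_zero_norm (a := fun x => B * ‖f x‖) (fun x => ?_) (by simpa using hlim.norm.const_mul B)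
      rw [norm_mul]; exact mul_le_mul_of_nonneg_right (h.sup_w x) (norm_nonneg _)
  have : ∀ x, e x * f x = (g x * f x - w x * f' x) + ((e x - g x) * f x + w x * f' x) := fun x => by ring
  simp_rw [this]
  refine (integral_add (i2.sub i3) i4).trans ?_
  rw [hz, add_zero]; rfl

end OscPair

/-! ### Power tails and the half-line estimate. -/

lemma integrable_comp_abs_of_integrableOn {f : ℝ → ℝ} (hf : IntegrableOn f (Ioi 0)) :
    Integrable fun x => f |x| := by
  have h1 : IntegrableOn (fun x => f |x|) (Ioi 0) :=
    hf.congr_fun (fun x hx => by rw [abs_of_pos hx]) measurableSet_Ioi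
  have h2 : IntegrableOn (fun x => f |x|) (Iic 0) := by
    have := (integrableOn_Ici_iff_integrableOn_Ioi).2 h1
    have h3 := this.comp_neg
    simpa using h3
  rw [← integrableOn_univ, ← Iic_union_Ioi (a := (0 : ℝ))]
  exact h2.union h1

/-- A two-sided power function: `c |x|^{-3/4}` for `|x| < K`, `|x|^{-q}` for `|x| ≥ K`. -/
def tailFn (c q K x : ℝ) : ℝ := if K ≤ |x| then |x| ^ (-q) else c * |x| ^ (-(3 / 4) : ℝ)

lemma tailFn_nonneg {c q K : ℝ} (hc : 0 ≤ c) (x : ℝ) : 0 ≤ tailFn c q K x := by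
  unfold tailFn; split_ifs <;> positivity

lemma tailFn_neg (c q K x : ℝ) : tailFn c q K (-x) = tailFn c q K x := by simp [tailFn]

lemma integrable_tailFn {c q K : ℝ} (hK : 0 < K) (hq : 1 < q) : Integrable (tailFn c q K) ∧
    ∫ x, tailFn c q K x = 2 * (c * (4 * K ^ (1 / 4 : ℝ)) + K ^ (1 - q) / (q - 1)) := by
  set f : ℝ → ℝ := fun x => if K ≤ x then x ^ (-q) else c * x ^ (-(3 / 4) : ℝ) with hf
  have hfe : tailFn c q K = fun x => f |x| := rfl
  have i1 : IntegrableOn f (Ioc 0 K) := by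
    have : IntegrableOn (fun x : ℝ => c * x ^ (-(3 / 4) : ℝ)) (Ioc 0 K) := by
      have := (intervalIntegral.intervalIntegrable_rpow' (a := 0) (b := K) (r := -(3/4)) (by norm_num)).const_mul c
      rwa [intervalIntegrable_iff_integrableOn_Ioc_of_le hK.le] at this
    refine this.congr_fun_ae ?_
    have h0 : ∀ᵐ x : ℝ ∂(volume.restrict (Ioc 0 K)), x ≠ K := by
      apply ae_restrict_of_ae; simp [ae_iff]
    filter_upwards [ae_restrict_mem measurableSet_Ioc, h0] with x hx hne
    have : ¬ K ≤ x := not_le.2 (lt_of_le_of_ne hx.2 hne)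
    simp [hf, this]
  have i2 : IntegrableOn f (Ioi K) := by
    refine (integrableOn_Ioi_rpow_of_lt (a := -q) (by linarith) hK).congr_fun (fun x hx => ?_) measurableSet_Ioi
    simp [hf, le_of_lt (mem_Ioi.1 hx)]
  have v1 : ∫ x in Ioc 0 K, f x = c * (4 * K ^ (1 / 4 : ℝ)) := by
    have h0 : ∀ᵐ x : ℝ ∂(volume.restrict (Ioc 0 K)), x ≠ K := by
      apply ae_restrict_of_ae; simp [ae_iff]
    have : ∫ x in Ioc 0 K, f x = ∫ x in Ioc 0 K, c * x ^ (-(3 / 4) : ℝ) := by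
      apply integral_congr_ae
      filter_upwards [ae_restrict_mem measurableSet_Ioc, h0] with x hx hne
      have : ¬ K ≤ x := not_le.2 (lt_of_le_of_ne hx.2 hne)
      simp [hf, this]
    rw [this, integral_const_mul, ← intervalIntegral.integral_of_le hK.le,
      integral_rpow (Or.inl (by norm_num))]
    rw [Real.zero_rpow (by norm_num)]
    norm_num; left; ring
  have v2 : ∫ x in Ioi K, f x = K ^ (1 - q) / (q - 1) := by
    have : ∫ x in Ioi K, f x = ∫ x in Ioi K, x ^ (-q) := by
      apply setIntegral_congr_fun measurableSet_Ioi
      intro x hx; simp [hf, le_of_lt (mem_Ioi.1 hx)]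
    rw [this, integral_Ioi_rpow_of_lt (by linarith) hK]
    rw [show -q + 1 = 1 - q by ring, ← neg_sub 1 q, div_neg, neg_div]
  have hu : Ioi (0 : ℝ) = Ioc 0 K ∪ Ioi K := (Ioc_union_Ioi_eq_Ioi hK.le).symm
  have i3 : IntegrableOn f (Ioi 0) := by rw [hu]; exact i1.union i2
  have hint : Integrable (tailFn c q K) := by
    rw [hfe]
    exact integrable_comp_abs_of_integrableOn i3
  refine ⟨hint, ?_⟩
  rw [hfe, integral_comp_abs (f := f), hu, setIntegral_union Ioc_disjoint_Ioi_same measurableSet_Ioi i1 i2, v1, v2]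

/-- The inner part contributes K^(-3/4) · 4K^(1/4) and the outer part 4K^(-1/4); the outer one
dominates for K ≥ 1, and the two sides of the origin give 2(4 + 4) = 16. -/
lemma integral_tailFn_Φ {K : ℝ} (hK : 1 ≤ K) :
    ∫ x, tailFn (K ^ (-(3 / 4) : ℝ)) (5 / 4) K x ≤ 16 * K ^ (-(1 / 4) : ℝ) := by
  have h0 : 0 < K := by linarith
  rw [(integrable_tailFn h0 (by norm_num)).2]
  have h1 : K ^ (-(3 / 4) : ℝ) * (4 * K ^ (1 / 4 : ℝ)) = 4 * K ^ (-(1 / 2) : ℝ) := by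
    rw [mul_left_comm, ← Real.rpow_add h0]; norm_num
  have h2 : K ^ (-(1 / 2) : ℝ) ≤ K ^ (-(1 / 4) : ℝ) := Real.rpow_le_rpow_of_exponent_le hK (by norm_num)
  rw [h1]; norm_num at h2 ⊢; linarith

lemma integral_tailFn_F {K : ℝ} (hK : 1 ≤ K) :
    ∫ x, tailFn (K ^ (-(7 / 4) : ℝ)) (9 / 4) K x ≤ 16 * K ^ (-(5 / 4) : ℝ) := by
  have h0 : 0 < K := by linarith
  rw [(integrable_tailFn h0 (by norm_num)).2]
  have h1 : K ^ (-(7 / 4) : ℝ) * (4 * K ^ (1 / 4 : ℝ)) = 4 * K ^ (-(3 / 2) : ℝ) := by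
    rw [mul_left_comm, ← Real.rpow_add h0]; norm_num
  have h2 : K ^ (-(3 / 2) : ℝ) ≤ K ^ (-(5 / 4) : ℝ) := Real.rpow_le_rpow_of_exponent_le hK (by norm_num)
  have h3 : 0 ≤ K ^ (-(5 / 4) : ℝ) := by positivity
  rw [h1]; norm_num at h2 h3 ⊢; linarith

/-- An oscillatory integral over a half-line, with a good bounded region and an integrable tail. -/
lemma OscPair.norm_integral_Iio_le {e g w : ℝ → ℂ} {G B₁ B : ℝ} (h : OscPair e g w G B₁ B)
    {f : ℝ → ℂ} (hfm : Measurable f) {C L K l : ℝ} {T : ℝ → ℝ} (hK : 0 < K) (hC : 0 ≤ C) (hL : 0 ≤ L)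
    (hT0 : ∀ x, 0 ≤ T x) (hT : Integrable T)
    (hb : ∀ k, ‖f k‖ ≤ C) (htail : ∀ k, k ≠ l → K ≤ |l - k| ∨ K ≤ |k| → ‖f k‖ ≤ C * T (l - k))
    (hlip : ∀ k k', |k| ≤ K → |k'| ≤ K → |l - k| ≤ K → |l - k'| ≤ K → ‖f k - f k'‖ ≤ L * |k - k'|) :
    Integrable f ∧ ∫ k, ‖f k‖ ≤ C * ((∫ x, T x) + 2 * K) ∧
    ‖∫ k in Iio l, e k * f k‖ ≤ C * (∫ x, T x) + C * G + 2 * C * B + L * B₁ := by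
  have hTl : Integrable (fun k => T (l - k)) := hT.comp_sub_left l
  have hTI : ∫ k, T (l - k) = ∫ x, T x := integral_sub_left_eq_self T volume l
  have hind : Integrable ((Icc (-K) K).indicator (fun _ : ℝ => (1 : ℝ))) :=
    (integrable_indicator_iff measurableSet_Icc).2 (by simp)
  have hindI : ∫ k, (Icc (-K) K).indicator (fun _ : ℝ => (1 : ℝ)) k = 2 * K := by
    rw [integral_indicator measurableSet_Icc]; simp; rw [max_eq_left (by linarith)]; ring
  -- Where the tail bound fails, k lies in [-K,K] and the constant bound C is integrable there.
  have hdom : ∀ᵐ k, ‖f k‖ ≤ C * (T (l - k) + (Icc (-K) K).indicator (fun _ : ℝ => (1 : ℝ)) k) := by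
    have : ∀ᵐ k : ℝ, k ≠ l := by simp [ae_iff]
    filter_upwards [this] with k hk
    by_cases hbad : K ≤ |l - k| ∨ K ≤ |k|
    · refine (htail k hk hbad).trans ?_
      gcongr
      have : 0 ≤ (Icc (-K) K).indicator (fun _ : ℝ => (1 : ℝ)) k := indicator_nonneg (by simp) _
      linarith
    · push Not at hbad
      have : k ∈ Icc (-K) K := abs_le.1 hbad.2.le
      rw [indicator_of_mem this]
      nlinarith [hb k, hT0 (l - k), mul_nonneg hC (hT0 (l - k))]
  have hfi : Integrable f := Integrable.mono' ((hTl.add hind).const_mul C) hfm.aestronglyMeasurable hdom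
  have hint : ∫ k, ‖f k‖ ≤ C * ((∫ x, T x) + 2 * K) := by
    refine (integral_mono_ae hfi.norm ((hTl.add hind).const_mul C) hdom).trans (le_of_eq ?_)
    rw [integral_const_mul]
    simp only [Pi.add_apply]
    rw [integral_add hTl hind, hTI, hindI]
  refine ⟨hfi, hint, ?_⟩
  have hef : Integrable (fun k => e k * f k) :=
    hfi.bdd_mul h.cont_e.aestronglyMeasurable (Eventually.of_forall fun x => (h.norm_e x).le)
  -- For A < l the interval (A, D] is, up to endpoints, the set of k < l with |k| ≤ K and |l - k| ≤
  -- K. The outer maximum in D makes it empty instead of reversed when no such k exists.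
  set A := max (l - K) (-K) with hA
  set D := max A (min l K) with hD
  have hAD : A ≤ D := le_max_left _ _
  have hDl : D ≤ max A l := max_le_max le_rfl (min_le_left _ _)
  have hsplit : ∫ k in Iio l, e k * f k = (∫ k in Iio l \ Ioc A D, e k * f k) + ∫ k in Iio l ∩ Ioc A D, e k * f k := by
    rw [add_comm, integral_inter_add_sdiff measurableSet_Ioc hef.integrableOn]
  have hgood : ‖∫ k in Iio l ∩ Ioc A D, e k * f k‖ ≤ C * G + 2 * C * B + L * B₁ := by
    by_cases hAl : A < l
    · have : ∫ k in Iio l ∩ Ioc A D, e k * f k = ∫ k in A..D, e k * f k := by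
        rw [intervalIntegral.integral_of_le hAD]
        apply setIntegral_congr_set
        have hne : ∀ᵐ k : ℝ, k ≠ l := by simp [ae_iff]
        filter_upwards [hne] with k hk
        apply propext
        constructor
        · rintro ⟨_, h2⟩; exact h2
        · intro h2
          refine ⟨lt_of_le_of_ne (h2.2.trans (hDl.trans (max_eq_right hAl.le).le)) hk, h2⟩
      rw [this]
      have hin : ∀ x ∈ Icc A D, A < D → |x| ≤ K ∧ |l - x| ≤ K := by
        intro x hx hlt
        have hD' : D = min l K := by
          rcases max_choice A (min l K) with hh | hh
          · rw [← hD] at hh; exact absurd hh hlt.ne'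
          · exact hh
        have a1 : l - K ≤ A := le_max_left _ _
        have a2 : -K ≤ A := le_max_right _ _
        have a3 : D ≤ l := hD' ▸ min_le_left _ _
        have a4 : D ≤ K := hD' ▸ min_le_right _ _
        exact ⟨abs_le.2 ⟨by linarith [hx.1], by linarith [hx.2]⟩,
          abs_le.2 ⟨by linarith [hx.2], by linarith [hx.1]⟩⟩
      rcases hAD.eq_or_lt with hEq | hlt
      · rw [← hEq, intervalIntegral.integral_same, norm_zero]
        have := h.G_nonneg; have := h.B_nonneg; have := h.B₁_nonneg
        positivity
      · exact h.norm_intervalIntegral_le hAD hL (fun x _ => hb x) (fun x hx y hy =>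
          hlip x y (hin x hx hlt).1 (hin y hy hlt).1 (hin x hx hlt).2 (hin y hy hlt).2)
    · have : Iio l ∩ Ioc A D = ∅ := by
        ext k; simp only [mem_inter_iff, mem_Iio, mem_Ioc, mem_empty_iff_false, iff_false]
        rintro ⟨h1, h2, _⟩; linarith [not_lt.1 hAl]
      rw [this]; simp
      have := h.G_nonneg; have := h.B_nonneg; have := h.B₁_nonneg
      positivity
  have hbad : ‖∫ k in Iio l \ Ioc A D, e k * f k‖ ≤ C * ∫ x, T x := by
    refine (norm_integral_le_integral_norm _).trans ?_
    rw [← hTI, ← integral_const_mul]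
    refine (setIntegral_mono_on (g := fun k => C * T (l - k)) hef.norm.integrableOn (hTl.const_mul C).integrableOn
      (measurableSet_Iio.diff measurableSet_Ioc) ?_).trans
      (setIntegral_le_integral (hTl.const_mul C) (Eventually.of_forall fun k => mul_nonneg hC (hT0 _)))
    rintro k ⟨hk, hk2⟩
    rw [norm_mul, h.norm_e, one_mul]
    rw [mem_Iio] at hk
    apply htail k hk.ne
    simp only [mem_Ioc, not_and_or, not_lt, not_le] at hk2
    rcases hk2 with hk2 | hk2
    · rcases le_max_iff.1 hk2 with h3 | h3
      · left; exact le_trans (by linarith) (le_abs_self _)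
      · right; exact le_trans (by linarith) (neg_le_abs _)
    · right
      have h3 := (le_max_right A (min l K)).trans_lt hk2
      rcases min_lt_iff.1 h3 with h4 | h4
      · exact absurd h4 (not_lt.2 hk.le)
      · exact h4.le.trans (le_abs_self _)
  rw [hsplit]
  refine (norm_add_le _ _).trans ?_
  linarith

/-! ### The double oscillatory integral. -/

/-- The amplitude `F` of a double oscillatory integral, with its derivative `Φ` in the second
variable. -/
structure OscData (F Φ : ℝ → ℝ → ℂ) (C : ℝ) : Prop where
  C_nonneg : 0 ≤ C
  meas_F : Measurable (Function.uncurry F)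
  meas_Φ : Measurable (Function.uncurry Φ)
  diag : ∀ k, F k k = 0
  deriv : ∀ k l, HasDerivAt (F k) (Φ k l) l
  bound_F : ∀ k l, ‖F k l‖ ≤ C
  bound_Φ : ∀ k l, ‖Φ k l‖ ≤ C
  tail_F : ∀ K, 1 ≤ K → ∀ k l, k ≠ l → K ≤ |l - k| ∨ K ≤ |k| →
    ‖F k l‖ ≤ C * tailFn (K ^ (-(7 / 4) : ℝ)) (9 / 4) K (l - k)
  tail_Φ : ∀ K, 1 ≤ K → ∀ k l, k ≠ l → K ≤ |l - k| ∨ K ≤ |k| →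
    ‖Φ k l‖ ≤ C * tailFn (K ^ (-(3 / 4) : ℝ)) (5 / 4) K (l - k)
  lip_F : ∀ k k' l, ‖F k l - F k' l‖ ≤ C * |k - k'|
  lip_Φ : ∀ K, 1 ≤ K → ∀ k k' l, |k| ≤ K → |k'| ≤ K → |l - k| ≤ K → |l - k'| ≤ K →
    ‖Φ k l - Φ k' l‖ ≤ C * K ^ 2 * |k - k'|
  int : Integrable (Function.uncurry F)

namespace OscData
variable {F Φ : ℝ → ℝ → ℂ} {C : ℝ}

/-- For fixed k the tail bounds in l - k have exponents 9/4 and 5/4, both larger than 1, and near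
the diagonal F and Φ are bounded. -/
lemma integrable_slice (h : OscData F Φ C) (k : ℝ) : Integrable (F k) ∧ Integrable (Φ k) ∧
    Tendsto (F k) atTop (𝓝 0) := by
  set K := max 1 |k| with hKd
  have hK : 1 ≤ K := le_max_left _ _
  have hK0 : 0 < K := by linarith
  have aux : ∀ (c q : ℝ), 1 < q → ∀ (f : ℝ → ℂ), Measurable f → (∀ l, ‖f l‖ ≤ C) →
      (∀ l, k ≠ l → K ≤ |l - k| → ‖f l‖ ≤ C * tailFn c q K (l - k)) → 0 ≤ c → Integrable f := by
    intro c q hq f hf hb ht hc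
    have h1 := ((integrable_tailFn (c := c) hK0 hq).1.comp_sub_right k)
    have h2 : Integrable ((Icc (k - K) (k + K)).indicator (fun _ : ℝ => (1 : ℝ))) :=
      (integrable_indicator_iff measurableSet_Icc).2 (by simp)
    refine Integrable.mono' ((h1.add h2).const_mul C) hf.aestronglyMeasurable (Eventually.of_forall fun l => ?_)
    have p1 := tailFn_nonneg (q := q) (K := K) hc (l - k)
    have p2 : 0 ≤ (Icc (k - K) (k + K)).indicator (fun _ : ℝ => (1 : ℝ)) l := indicator_nonneg (by simp) _
    have hC := h.C_nonneg
    simp only [Pi.add_apply]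
    by_cases hl : K ≤ |l - k|
    · have hne : k ≠ l := by
        rintro rfl; simp at hl; linarith
      refine (ht l hne hl).trans ?_
      gcongr; linarith
    · have := abs_le.1 (not_le.1 hl).le
      have hm : l ∈ Icc (k - K) (k + K) := ⟨by linarith, by linarith⟩
      rw [indicator_of_mem hm] at p2 ⊢
      nlinarith [hb l, mul_nonneg hC p1]
  refine ⟨aux _ (9/4) (by norm_num) _ (h.meas_F.comp measurable_prodMk_left) (h.bound_F k)
    (fun l hl hl2 => h.tail_F K hK k l hl (Or.inl hl2)) (by positivity),
    aux _ (5/4) (by norm_num) _ (h.meas_Φ.comp measurable_prodMk_left) (h.bound_Φ k)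
    (fun l hl hl2 => h.tail_Φ K hK k l hl (Or.inl hl2)) (by positivity), ?_⟩
  have hz : Tendsto (fun l => C * (l - k) ^ (-(9/4) : ℝ)) atTop (𝓝 0) := by
    have := ((tendsto_rpow_neg_atTop (y := 9/4) (by norm_num)).comp
      (tendsto_atTop_add_const_right atTop (-k) tendsto_id)).const_mul C
    simpa [Function.comp_def, sub_eq_add_neg] using this
  refine squeeze_zero_norm' ?_ hz
  filter_upwards [eventually_ge_atTop (k + K)] with l hl
  have hl2 : K ≤ |l - k| := le_trans (by linarith) (le_abs_self _)
  have := h.tail_F K hK k l (by intro h0; rw [h0] at hl; linarith) (Or.inl hl2)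
  rwa [tailFn, if_pos hl2, abs_of_nonneg (by linarith)] at this

/-- The double oscillatory integral over the half plane `k < l`. -/
theorem norm_integral_le (h : OscData F Φ C) {e g w : ℝ → ℂ} {G B₁ B : ℝ} (ho : OscPair e g w G B₁ B)
    {K : ℝ} (hK : 1 ≤ K) :
    ‖∫ z in {z : ℝ × ℝ | z.1 < z.2}, (starRingEnd ℂ) (e z.1) * e z.2 * F z.1 z.2‖ ≤
      16 * C * (G * (K ^ (-(5 / 4) : ℝ) + G + B + B₁) + B₁ * (K ^ (-(1 / 4) : ℝ) + G + B + K ^ 2 * B₁)) := by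
  have hC := h.C_nonneg
  have hK0 : 0 < K := by linarith
  have hmS : MeasurableSet {z : ℝ × ℝ | z.1 < z.2} := measurableSet_lt measurable_fst measurable_snd
  set S := {z : ℝ × ℝ | z.1 < z.2} with hS
  set ce : ℝ → ℂ := fun s => (starRingEnd ℂ) (e s) with hce
  have hoc := ho.conj
  -- slices in `k`
  have slF := fun l => OscPair.norm_integral_Iio_le hoc (f := fun k => F k l)
    (h.meas_F.comp measurable_prodMk_right) (l := l) (L := C) hK0 hC hC
    (tailFn_nonneg (by positivity)) (integrable_tailFn hK0 (by norm_num)).1 (fun k => h.bound_F k l)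
    (fun k hk hk2 => h.tail_F K hK k l hk hk2) (fun k k' _ _ _ _ => h.lip_F k k' l)
  have slΦ := fun l => OscPair.norm_integral_Iio_le hoc (f := fun k => Φ k l)
    (h.meas_Φ.comp measurable_prodMk_right) (l := l) (L := C * K ^ 2) hK0 hC (by positivity)
    (tailFn_nonneg (by positivity)) (integrable_tailFn hK0 (by norm_num)).1 (fun k => h.bound_Φ k l)
    (fun k hk hk2 => h.tail_Φ K hK k l hk hk2) (fun k k' a b c d => h.lip_Φ K hK k k' l a b c d)
  set Q : ℝ × ℝ → ℂ := fun z => ce z.1 * (g z.2 * F z.1 z.2 - w z.2 * Φ z.1 z.2) with hQ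
  have mg : Measurable g := ho.cont_g.measurable
  have mw : Measurable w := ho.cont_w.measurable
  have me : Measurable e := ho.cont_e.measurable
  have mce : Measurable ce := hoc.cont_e.measurable
  have hQm : Measurable Q :=
    (mce.comp measurable_fst).mul (((mg.comp measurable_snd).mul h.meas_F).sub
      ((mw.comp measurable_snd).mul h.meas_Φ))
  have hnce : ∀ s, ‖ce s‖ = 1 := hoc.norm_e
  have hsliceQ : ∀ l, Integrable (fun k => Q (k, l)) := fun l => by
    refine Integrable.bdd_mul (c := 1) ?_ mce.aestronglyMeasurable (Eventually.of_forall fun x => (hnce x).le)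
    exact ((slF l).1.const_mul (g l)).sub ((slΦ l).1.const_mul (w l))
  obtain ⟨D1, hD1⟩ : ∃ D1, ∀ l, ∫ k, ‖F k l‖ ≤ D1 := ⟨_, fun l => (slF l).2.1⟩
  obtain ⟨D2, hD2⟩ : ∃ D2, ∀ l, ∫ k, ‖Φ k l‖ ≤ D2 := ⟨_, fun l => (slΦ l).2.1⟩
  have hQi : Integrable Q (volume.prod volume) := by
    rw [integrable_prod_iff' hQm.aestronglyMeasurable]
    refine ⟨Eventually.of_forall hsliceQ, ?_⟩
    refine Integrable.mono' (g := fun l => ‖g l‖ * D1 + ‖w l‖ * D2)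
      ((ho.int_g.norm.mul_const _).add (ho.int_w.norm.mul_const _)) ?_ (Eventually.of_forall fun l => ?_)
    · exact (hQm.norm.stronglyMeasurable.integral_prod_left').aestronglyMeasurable
    · rw [Real.norm_of_nonneg (integral_nonneg fun _ => norm_nonneg _)]
      calc ∫ k, ‖Q (k, l)‖ ≤ ∫ k, (‖g l‖ * ‖F k l‖ + ‖w l‖ * ‖Φ k l‖) := by
            apply integral_mono (hsliceQ l).norm
              (((slF l).1.norm.const_mul _).add ((slΦ l).1.norm.const_mul _))
            intro k
            simp only [hQ, norm_mul, hnce, one_mul]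
            refine (norm_sub_le _ _).trans ?_
            simp
        _ = ‖g l‖ * (∫ k, ‖F k l‖) + ‖w l‖ * ∫ k, ‖Φ k l‖ := by
            rw [integral_add ((slF l).1.norm.const_mul _) ((slΦ l).1.norm.const_mul _),
              integral_const_mul, integral_const_mul]
        _ ≤ _ := by
            gcongr
            · exact hD1 l
            · exact hD2 l
  -- first integrate by parts in `l`
  have hE : Integrable (fun z : ℝ × ℝ => ce z.1 * e z.2 * F z.1 z.2) (volume.prod volume) := by
    refine Integrable.bdd_mul (c := 1) h.int
      ((mce.comp measurable_fst).mul (me.comp measurable_snd)).aestronglyMeasurable (Eventually.of_forall fun z => ?_)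
    rw [norm_mul, hnce, ho.norm_e, one_mul]
  have indic : ∀ (f : ℝ × ℝ → ℂ) (k : ℝ), ∫ l, S.indicator f (k, l) = ∫ l in Ioi k, f (k, l) := by
    intro f k
    rw [← integral_indicator measurableSet_Ioi]
    congr 1
  have indic' : ∀ (f : ℝ × ℝ → ℂ) (l : ℝ), ∫ k, S.indicator f (k, l) = ∫ k in Iio l, f (k, l) := by
    intro f l
    rw [← integral_indicator measurableSet_Iio]
    congr 1
  have step1 : ∫ z in S, ce z.1 * e z.2 * F z.1 z.2 = ∫ z in S, Q z := by
    rw [← integral_indicator hmS, ← integral_indicator hmS, Measure.volume_eq_prod,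
      integral_prod _ (hE.indicator hmS), integral_prod _ (hQi.indicator hmS)]
    congr 1; ext k
    rw [indic, indic]
    obtain ⟨a1, a2, a3⟩ := h.integrable_slice k
    have := ho.integral_Ioi_mul (a := k) (h.deriv k) (h.diag k) a1.integrableOn a2.integrableOn a3
    simp only [hQ, mul_assoc]
    rw [integral_const_mul, integral_const_mul, this]
  -- After Fubini the factors g(l) and w(l) leave the inner integral, where conj(e(k)) still
  -- oscillates and can be exploited a second time.
  have step2 : ∫ z in S, Q z = ∫ l, (g l * (∫ k in Iio l, ce k * F k l) - w l * ∫ k in Iio l, ce k * Φ k l) := by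
    rw [← integral_indicator hmS, Measure.volume_eq_prod, integral_prod_symm _ (hQi.indicator hmS)]
    congr 1; ext l
    rw [indic', ← integral_const_mul, ← integral_const_mul, ← integral_sub]
    · congr 1; ext k; simp only [hQ]; ring
    · exact (((slF l).1.bdd_mul mce.aestronglyMeasurable
        (Eventually.of_forall fun x => (hnce x).le)).const_mul _).integrableOn
    · exact (((slΦ l).1.bdd_mul mce.aestronglyMeasurable
        (Eventually.of_forall fun x => (hnce x).le)).const_mul _).integrableOn
  have hG := ho.G_nonneg
  have hB := ho.B_nonneg
  have hB1 := ho.B₁_nonneg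
  set XF := 16 * C * (K ^ (-(5 / 4) : ℝ) + G + B + B₁) with hXF
  set XΦ := 16 * C * (K ^ (-(1 / 4) : ℝ) + G + B + K ^ 2 * B₁) with hXΦ
  have bF : ∀ l, ‖∫ k in Iio l, ce k * F k l‖ ≤ XF := fun l => by
    refine (slF l).2.2.trans ?_
    have := mul_le_mul_of_nonneg_left (integral_tailFn_F hK) hC
    rw [hXF]
    nlinarith [mul_nonneg hC hG, mul_nonneg hC hB, mul_nonneg hC hB1]
  have bΦ : ∀ l, ‖∫ k in Iio l, ce k * Φ k l‖ ≤ XΦ := fun l => by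
    refine (slΦ l).2.2.trans ?_
    have := mul_le_mul_of_nonneg_left (integral_tailFn_Φ hK) hC
    rw [hXΦ]
    have h2 : 0 ≤ C * K ^ 2 * B₁ := by positivity
    nlinarith [mul_nonneg hC hG, mul_nonneg hC hB, mul_nonneg hC hB1]
  have hXF0 : 0 ≤ XF := (norm_nonneg _).trans (bF 0)
  have hXΦ0 : 0 ≤ XΦ := (norm_nonneg _).trans (bΦ 0)
  rw [step1, step2]
  refine (norm_integral_le_integral_norm _).trans ?_
  calc _ ≤ ∫ l, (‖g l‖ * XF + ‖w l‖ * XΦ) := by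
        apply integral_mono_of_nonneg (Eventually.of_forall fun _ => norm_nonneg _)
          ((ho.int_g.norm.mul_const _).add (ho.int_w.norm.mul_const _))
        refine Eventually.of_forall fun l => (norm_sub_le _ _).trans ?_
        rw [norm_mul, norm_mul]
        exact add_le_add (mul_le_mul_of_nonneg_left (bF l) (norm_nonneg _))
          (mul_le_mul_of_nonneg_left (bΦ l) (norm_nonneg _))
    _ = (∫ l, ‖g l‖) * XF + (∫ l, ‖w l‖) * XΦ := by
        rw [integral_add (ho.int_g.norm.mul_const _) (ho.int_w.norm.mul_const _), integral_mul_const,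
          integral_mul_const]
    _ ≤ G * XF + B₁ * XΦ := by
        gcongr
        · exact ho.bound_g
        · exact ho.bound_w
    _ = _ := by rw [hXF, hXΦ]; ring

end OscData

/-! ### Oscillating pairs for the cubic phase. -/

/-- With M = √(-a) the function s ↦ h(|s - c| - M) is a bump around each of the stationary points c
± M; each side of c costs at most one full integral of h, whatever M is. -/
lemma integral_comp_abs_sub_le {h : ℝ → ℝ} (hh : Integrable h) (h0 : ∀ x, 0 ≤ h x) (c M : ℝ) :
    Integrable (fun s => h (|s - c| - M)) ∧ ∫ s, h (|s - c| - M) ≤ 2 * ∫ x, h x := by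
  have h1 : Integrable (fun x => h (x - M)) := hh.comp_sub_right M
  refine ⟨(integrable_comp_abs_of_integrableOn h1.integrableOn).comp_sub_right c, ?_⟩
  rw [integral_sub_right_eq_self (fun s => h (|s| - M)) c, integral_comp_abs (f := fun x => h (x - M))]
  have h2 := setIntegral_le_integral (s := Ioi 0) h1 (Eventually.of_forall fun x => h0 _)
  have h3 := integral_sub_right_eq_self (μ := volume) h M
  rw [h3] at h2
  linarith

/-- The oscillating pair attached to a phase with quadratic derivative. -/
lemma oscPair_of_bounds {t c a lam G B₁ B : ℝ} {φ Gf Wf : ℝ → ℝ} (ht : 0 < t) (hlam : 0 ≤ lam)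
    (hφ : ∀ s, HasDerivAt φ (12 * ((s - c) ^ 2 + a)) s)
    (hpos : ∀ s, 0 < lam + t * (12 * ((s - c) ^ 2 + a)) ^ 2)
    (hGf : Integrable Gf) (hWf : Integrable Wf)
    (hg : ∀ s, (lam + |24 * (s - c)|) / (lam + t * (12 * ((s - c) ^ 2 + a)) ^ 2) ≤ Gf s)
    (hw : ∀ s, |12 * ((s - c) ^ 2 + a)| / (lam + t * (12 * ((s - c) ^ 2 + a)) ^ 2) ≤ Wf s)
    (hGI : ∫ s, Gf s ≤ G) (hWI : ∫ s, Wf s ≤ B₁)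
    (hB : ∀ s, |12 * ((s - c) ^ 2 + a)| / (lam + t * (12 * ((s - c) ^ 2 + a)) ^ 2) ≤ B) :
    ∃ g w, OscPair (fun s => Complex.exp (Complex.I * t * φ s)) g w G B₁ B := by
  set q : ℝ → ℝ := fun s => 12 * ((s - c) ^ 2 + a) with hq
  set D : ℝ → ℝ := fun s => lam + t * q s ^ 2 with hD
  have hpos' : ∀ s, 0 < D s := hpos
  have hq' : ∀ s, HasDerivAt q (24 * (s - c)) s := fun s => by
    have := ((((hasDerivAt_id s).sub_const c).pow 2).add_const a).const_mul 12
    refine this.congr_deriv ?_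
    simp; ring
  have hD' : ∀ s, HasDerivAt D (t * (2 * q s * (24 * (s - c)))) s := fun s => by
    have := (((hq' s).pow 2).const_mul t).const_add lam
    refine this.congr_deriv ?_
    simp
  -- β regularizes 1/(tq). With w = -iβe one gets e - w' = (λ/(λ + tq²) + iβ')e, which becomes g; it
  -- is small because λ/(λ + tq²) is concentrated near the zeros of q and |β'| ≤ |q'|/(λ + tq²).
  set β : ℝ → ℝ := fun s => q s / D s with hβ
  set β' : ℝ → ℝ := fun s => (24 * (s - c)) * (lam - t * q s ^ 2) / D s ^ 2 with hβ'
  have hβd : ∀ s, HasDerivAt β (β' s) s := fun s => by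
    have := (hq' s).div (hD' s) (hpos' s).ne'
    refine this.congr_deriv ?_
    simp only [hβ', hD]; ring
  set e : ℝ → ℂ := fun s => Complex.exp (Complex.I * t * φ s) with he
  have hed : ∀ s, HasDerivAt e (e s * (Complex.I * t * q s)) s := fun s => by
    have := ((hφ s).ofReal_comp.const_mul (Complex.I * (t : ℂ))).cexp
    exact this
  have hqc : Continuous q := continuous_iff_continuousAt.2 fun s => (hq' s).continuousAt
  have hDc : Continuous D := continuous_iff_continuousAt.2 fun s => (hD' s).continuousAt
  have hec : Continuous e := continuous_iff_continuousAt.2 fun s => (hed s).continuousAt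
  have hn : ∀ s, ‖e s‖ = 1 := fun s => by
    simp only [he, Complex.norm_exp]; simp
  set g : ℝ → ℂ := fun s => ((lam / D s : ℝ) + Complex.I * (β' s : ℝ)) * e s with hgdef
  set w : ℝ → ℂ := fun s => -Complex.I * (β s : ℝ) * e s with hwdef
  have hβc : Continuous β := hqc.div hDc fun s => (hpos' s).ne'
  have hβ'c : Continuous β' := by
    refine Continuous.div ?_ (hDc.pow 2) fun s => (pow_pos (hpos' s) 2).ne'
    fun_prop
  have hgc : Continuous g := by
    have : Continuous fun s => lam / D s := continuous_const.div hDc fun s => (hpos' s).ne'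
    fun_prop
  have hwd : ∀ s, HasDerivAt w (e s - g s) s := fun s => by
    have := (((hβd s).ofReal_comp).const_mul (-Complex.I)).mul (hed s)
    refine this.congr_deriv ?_
    have hDs : (D s : ℂ) ≠ 0 := by exact_mod_cast (hpos' s).ne'
    have h1 : ((lam / D s : ℝ) : ℂ) = 1 - (t * q s : ℝ) * (β s : ℝ) := by
      rw [← Complex.ofReal_mul, ← Complex.ofReal_one, ← Complex.ofReal_sub]
      congr 1
      simp only [hβ]
      field_simp [(hpos' s).ne']
      simp only [hD]; ring
    simp only [hgdef, h1]
    push_cast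
    linear_combination (-(q s : ℂ) * β s * t * e s) * Complex.I_sq
  have hgb : ∀ s, ‖g s‖ ≤ Gf s := fun s => by
    refine le_trans ?_ (hg s)
    simp only [hgdef, norm_mul, hn, mul_one]
    refine (norm_add_le _ _).trans ?_
    rw [add_div]
    simp only [norm_mul, Complex.norm_I, one_mul, Complex.norm_real, Real.norm_eq_abs]
    refine add_le_add (le_of_eq (abs_of_nonneg (div_nonneg hlam (hpos' s).le))) ?_
    simp only [hβ', abs_div, abs_mul, abs_of_nonneg (sq_nonneg (D s))]
    have h1 : |lam - t * q s ^ 2| ≤ D s := by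
      rw [abs_le]; constructor <;> simp only [hD] <;> nlinarith [mul_nonneg ht.le (sq_nonneg (q s))]
    change _ ≤ |24| * |s - c| / D s
    rw [div_le_div_iff₀ (pow_pos (hpos' s) 2) (hpos' s)]
    have : 0 ≤ |(24 : ℝ)| * |s - c| * D s := by have := (hpos' s).le; positivity
    nlinarith
  have hwn : ∀ s, ‖w s‖ = |q s| / D s := fun s => by
    simp only [hwdef, norm_mul, hn, mul_one, norm_neg, Complex.norm_I, one_mul, Complex.norm_real,
      Real.norm_eq_abs, hβ, abs_div, abs_of_pos (hpos' s)]
  have hig : Integrable g := hGf.mono' hgc.aestronglyMeasurable (Eventually.of_forall hgb)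
  have hwc : Continuous w := continuous_iff_continuousAt.2 fun s => (hwd s).continuousAt
  have hwb : ∀ s, ‖w s‖ ≤ Wf s := fun s => by rw [hwn]; exact hw s
  have hiw : Integrable w := hWf.mono' hwc.aestronglyMeasurable (Eventually.of_forall hwb)
  exact ⟨g, w, hec, hgc, hn, hwd, hig, hiw, (integral_mono hig.norm hGf hgb).trans hGI,
    (integral_mono hiw.norm hWf hwb).trans hWI, fun s => by rw [hwn]; exact hB s⟩

/-- On σ = |s - c| the integrand is the derivative of (λt)^(-1/2) arctan(√(t/λ) · 12(σ² + a)). The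
arctangent varies by at most π on a half-line, so the bound does not see `a`. -/
lemma integral_arctan_type {t c a lam : ℝ} (ht : 0 < t) (hlam : 0 < lam) :
    Integrable (fun s => |24 * (s - c)| / (lam + t * (12 * ((s - c) ^ 2 + a)) ^ 2)) ∧
    ∫ s, |24 * (s - c)| / (lam + t * (12 * ((s - c) ^ 2 + a)) ^ 2) ≤ 2 * Real.pi / Real.sqrt (lam * t) := by
  set f : ℝ → ℝ := fun x => 24 * x / (lam + t * (12 * (x ^ 2 + a)) ^ 2) with hf
  have hpos : ∀ x : ℝ, 0 < lam + t * (12 * (x ^ 2 + a)) ^ 2 := fun x => by positivity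
  have hfe : (fun s => |24 * (s - c)| / (lam + t * (12 * ((s - c) ^ 2 + a)) ^ 2)) = fun s => f |s - c| := by
    ext s; simp [hf, abs_mul]
  set κ := Real.sqrt (t / lam) with hκ
  have hκ0 : 0 < κ := Real.sqrt_pos.2 (by positivity)
  have hκ2 : κ ^ 2 = t / lam := Real.sq_sqrt (by positivity)
  have hk3 : lam * κ = Real.sqrt (lam * t) := by
    rw [eq_comm, Real.sqrt_eq_iff_mul_self_eq (by positivity) (by positivity)]
    have : lam * κ * (lam * κ) = lam ^ 2 * κ ^ 2 := by ring
    rw [this, hκ2]; field_simp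
  set A : ℝ → ℝ := fun x => (1 / (lam * κ)) * Real.arctan (κ * (12 * (x ^ 2 + a))) with hA
  have hAd : ∀ x, HasDerivAt A (f x) x := fun x => by
    have h1 : HasDerivAt (fun x : ℝ => κ * (12 * (x ^ 2 + a))) (κ * (24 * x)) x := by
      have := ((((hasDerivAt_id x).pow 2).add_const a).const_mul 12).const_mul κ
      refine this.congr_deriv ?_
      simp; left; ring
    have := h1.arctan.const_mul (1 / (lam * κ))
    refine this.congr_deriv ?_
    have : 1 + (κ * (12 * (x ^ 2 + a))) ^ 2 = (lam + t * (12 * (x ^ 2 + a)) ^ 2) / lam := by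
      rw [mul_pow, hκ2]; field_simp
    rw [this]
    simp only [hf]
    have := (hpos x).ne'
    field_simp
  have hlim : Tendsto A atTop (𝓝 ((1 / (lam * κ)) * (Real.pi / 2))) := by
    refine Tendsto.const_mul _ ?_
    refine (Real.tendsto_arctan_atTop.mono_right nhdsWithin_le_nhds).comp ?_
    refine Tendsto.const_mul_atTop hκ0 (Tendsto.const_mul_atTop (by norm_num) ?_)
    exact tendsto_atTop_add_const_right _ _ (tendsto_pow_atTop (by norm_num))
  have hnn : ∀ x ∈ Ioi (0 : ℝ), 0 ≤ f x := fun x hx => by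
    have := hpos x; have : 0 < x := hx; simp only [hf]; positivity
  have i1 : IntegrableOn f (Ioi 0) :=
    integrableOn_Ioi_deriv_of_nonneg' (fun x _ => hAd x) hnn hlim
  have v1 : ∫ x in Ioi 0, f x = (1 / (lam * κ)) * (Real.pi / 2) - A 0 :=
    integral_Ioi_of_hasDerivAt_of_nonneg' (fun x _ => hAd x) hnn hlim
  rw [hfe]
  refine ⟨(integrable_comp_abs_of_integrableOn i1).comp_sub_right c, ?_⟩
  rw [integral_sub_right_eq_self (fun s => f |s|) c, integral_comp_abs (f := f), v1, ← hk3]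
  have : -(Real.pi / 2) ≤ Real.arctan (κ * (12 * (0 ^ 2 + a))) := (Real.neg_pi_div_two_lt_arctan _).le
  have h5 : 0 ≤ 1 / (lam * κ) := by positivity
  simp only [hA]
  have := mul_le_mul_of_nonneg_left this h5
  rw [mul_div_assoc, show Real.pi / (lam * κ) = (1 / (lam * κ)) * Real.pi by ring]
  linarith

/-- The arithmetic-geometric mean inequality gives λ + tq² ≥ 2√(λt)|q|. -/
lemma abs_div_le_inv_sqrt {t lam : ℝ} (ht : 0 < t) (hlam : 0 < lam) (q : ℝ) :
    |q| / (lam + t * q ^ 2) ≤ 1 / Real.sqrt (lam * t) := by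
  have h1 : 0 < Real.sqrt (lam * t) := Real.sqrt_pos.2 (by positivity)
  have h2 : 0 < lam + t * q ^ 2 := by positivity
  rw [div_le_div_iff₀ h2 h1, one_mul]
  have h3 : Real.sqrt (lam * t) = Real.sqrt lam * Real.sqrt t := Real.sqrt_mul hlam.le t
  have h4 := Real.sq_sqrt hlam.le
  have h5 := Real.sq_sqrt ht.le
  rw [h3]
  have h6 : q ^ 2 = |q| ^ 2 := (sq_abs q).symm
  rw [h6]
  nlinarith [sq_nonneg (Real.sqrt lam - Real.sqrt t * |q|), mul_nonneg (mul_nonneg (Real.sqrt_nonneg lam) (Real.sqrt_nonneg t)) (abs_nonneg q)]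

/-- For a < 0 one factors σ² + a = (|σ| - M)(|σ| + M) with M = √(-a) and uses |σ| + M ≥ ||σ| - M|.
For a ≥ 0 the square root of a nonpositive number is 0, and the same formula says σ² ≤ σ² + a; this
makes the uniform regime free of case distinctions. -/
lemma sq_abs_sub_sqrt_le (a σ : ℝ) : (|σ| - Real.sqrt (-a)) ^ 2 ≤ |σ ^ 2 + a| := by
  rcases le_total 0 a with h | h
  · rw [Real.sqrt_eq_zero_of_nonpos (by linarith), sub_zero, sq_abs]
    exact le_trans (by linarith) (le_abs_self _)
  · set M := Real.sqrt (-a) with hM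
    have hM2 : M ^ 2 = -a := Real.sq_sqrt (by linarith)
    have hM0 : 0 ≤ M := Real.sqrt_nonneg _
    have : σ ^ 2 + a = (|σ| - M) * (|σ| + M) := by
      have := sq_abs σ; nlinarith
    rw [this, abs_mul, abs_of_nonneg (by positivity : 0 ≤ |σ| + M), ← sq_abs, sq]
    gcongr
    rw [abs_le]; constructor <;> nlinarith [abs_nonneg σ]

/-- When the two stationary points are at least 2√δ apart, the factor |σ| + M is bounded below by
√δ, so φ' vanishes only linearly at each of them. -/
lemma abs_sub_sqrt_mul_le {a δ : ℝ} (hδ : 0 ≤ δ) (ha : a ≤ -δ) (σ : ℝ) :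
    Real.sqrt δ * |(|σ| - Real.sqrt (-a))| ≤ |σ ^ 2 + a| := by
  set M := Real.sqrt (-a) with hM
  have hM2 : M ^ 2 = -a := Real.sq_sqrt (by linarith)
  have hM0 : 0 ≤ M := Real.sqrt_nonneg _
  have : σ ^ 2 + a = (|σ| - M) * (|σ| + M) := by
    have := sq_abs σ; nlinarith
  rw [this, abs_mul, abs_of_nonneg (by positivity : 0 ≤ |σ| + M), mul_comm]
  have : Real.sqrt δ ≤ M := Real.sqrt_le_sqrt (by linarith)
  gcongr
  have := abs_nonneg σ
  linarith

/-- Without stationary points no regularization is needed: λ = 0, and φ' dominates a multiple of 1 +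
(s - c)², so g and w are O(1/t) times (1 + (s - c)²)⁻¹. -/
lemma oscPair_elliptic {δ : ℝ} (hδ : 0 < δ) : ∃ D : ℝ, 0 ≤ D ∧ ∀ (t c a : ℝ) (φ : ℝ → ℝ), 0 < t → δ < a →
    (∀ s, HasDerivAt φ (12 * ((s - c) ^ 2 + a)) s) →
    ∃ g w, OscPair (fun s => Complex.exp (Complex.I * t * φ s)) g w (D / t) (D / t) (D / t) := by
  set m := min 1 δ with hm
  have hm0 : 0 < m := lt_min one_pos hδ
  have hm1 : m ≤ 1 := min_le_left _ _
  have hmδ : m ≤ δ := min_le_right _ _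
  refine ⟨Real.pi / m ^ 2, by positivity, fun t c a φ ht ha hφ => ?_⟩
  have hi : Integrable (fun s : ℝ => 1 / (m ^ 2 * t) * (1 + (s - c) ^ 2)⁻¹) :=
    (integrable_inv_one_add_sq.comp_sub_right c).const_mul _
  have hI : ∫ s : ℝ, 1 / (m ^ 2 * t) * (1 + (s - c) ^ 2)⁻¹ = Real.pi / m ^ 2 / t := by
    rw [integral_const_mul, integral_sub_right_eq_self (fun s : ℝ => (1 + s ^ 2)⁻¹) c,
      integral_univ_inv_one_add_sq]
    field_simp
  have hq : ∀ s, 12 * m * (1 + (s - c) ^ 2) ≤ 12 * ((s - c) ^ 2 + a) := fun s => by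
    nlinarith [mul_nonneg (sub_nonneg.2 hm1) (sq_nonneg (s - c))]
  have hq0 : ∀ s, 0 < 12 * ((s - c) ^ 2 + a) := fun s => by have := sq_nonneg (s - c); linarith
  have hw : ∀ s, |12 * ((s - c) ^ 2 + a)| / (0 + t * (12 * ((s - c) ^ 2 + a)) ^ 2) ≤
      1 / (m ^ 2 * t) * (1 + (s - c) ^ 2)⁻¹ := fun s => by
    have h0 := hq0 s
    have h1 := hq s
    set Q := 12 * ((s - c) ^ 2 + a) with hQ
    set σ := (s - c) ^ 2 with hσ
    have hσ0 : 0 ≤ σ := sq_nonneg _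
    rw [abs_of_pos h0, zero_add, ← one_div, div_mul_div_comm, one_mul, div_le_div_iff₀ (by positivity) (by positivity)]
    have h2 : m ^ 2 * (1 + σ) ≤ Q := by nlinarith [mul_nonneg hm0.le hσ0, mul_nonneg (sub_nonneg.2 hm1) (mul_nonneg hm0.le (by positivity : 0 ≤ 1 + σ))]
    nlinarith [mul_le_mul_of_nonneg_left h2 (mul_nonneg ht.le h0.le)]
  refine oscPair_of_bounds ht le_rfl hφ (fun s => ?_) hi hi (fun s => ?_) hw hI.le hI.le (fun s => ?_)
  · have := hq0 s; positivity
  · have h0 := hq0 s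
    have h1 := hq s
    set Q := 12 * ((s - c) ^ 2 + a) with hQ
    set σ := s - c with hσ
    have hσ0 : |24 * σ| ≤ 12 * (1 + σ ^ 2) := by
      rw [abs_le]; constructor <;> nlinarith [sq_nonneg (σ - 1), sq_nonneg (σ + 1)]
    rw [zero_add, zero_add, ← one_div, div_mul_div_comm, one_mul, div_le_div_iff₀ (by positivity) (by positivity)]
    have h3 : 0 ≤ 12 * m * (1 + σ ^ 2) := by positivity
    have h2 : (12 * m * (1 + σ ^ 2)) ^ 2 ≤ Q ^ 2 := by gcongr
    have h4 := mul_le_mul_of_nonneg_right hσ0 (by positivity : 0 ≤ m ^ 2 * t * (1 + σ ^ 2))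
    have h5 := mul_le_mul_of_nonneg_left h2 ht.le
    have h6 : 0 ≤ m ^ 2 * t * (1 + σ ^ 2) ^ 2 := by positivity
    nlinarith
  · refine (hw s).trans ?_
    have : (1 + (s - c) ^ 2)⁻¹ ≤ Real.pi := by
      refine le_trans (inv_le_one_of_one_le₀ ?_) (by linarith [Real.pi_gt_three])
      have := sq_nonneg (s - c); linarith
    calc _ ≤ 1 / (m ^ 2 * t) * Real.pi := by gcongr
      _ = _ := by field_simp

lemma integrable_two_mul_inv {τ : ℝ} (hτ : 0 < τ) (A : ℝ) :
    Integrable (fun x : ℝ => A * (1 + (τ * x) ^ 2)⁻¹) ∧ ∫ x : ℝ, A * (1 + (τ * x) ^ 2)⁻¹ = A * Real.pi / τ := by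
  refine ⟨(integrable_inv_one_add_sq.comp_mul_left' hτ.ne').const_mul A, ?_⟩
  rw [integral_const_mul, Measure.integral_comp_mul_left (fun x : ℝ => (1 + x ^ 2)⁻¹) τ,
    integral_univ_inv_one_add_sq, abs_of_pos (by positivity)]
  simp; ring

/-- The Airy scale: t = τ³ and λ = 1/τ, so √(λt) = τ. The ratio λ/(λ + tφ'²) equals 1/(1 + (τ²φ')²),
and |φ'| ≥ v², with v = |s - c| - √(-a), bounds it by a bump of width 1/τ. No lower bound on |a|
enters. -/
lemma oscPair_uniform : ∃ D : ℝ, 0 ≤ D ∧ ∀ (τ c a : ℝ) (φ : ℝ → ℝ), 0 < τ →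
    (∀ s, HasDerivAt φ (12 * ((s - c) ^ 2 + a)) s) →
    ∃ g w, OscPair (fun s => Complex.exp (Complex.I * (τ ^ 3 : ℝ) * φ s)) g w (D / τ) (D / τ ^ 2) (D / τ) := by
  refine ⟨6 * Real.pi, by positivity, fun τ c a φ hτ hφ => ?_⟩
  have hlam : 0 < 1 / τ := by positivity
  have ht : 0 < τ ^ 3 := by positivity
  have hs : Real.sqrt (1 / τ * τ ^ 3) = τ := by
    rw [show 1 / τ * τ ^ 3 = τ ^ 2 by field_simp]; exact Real.sqrt_sq hτ.le
  obtain ⟨i1, v1⟩ := integral_arctan_type (c := c) (a := a) ht hlam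
  rw [hs] at v1
  obtain ⟨i2, v2⟩ := integrable_two_mul_inv hτ 2
  obtain ⟨i3, v3⟩ := integral_comp_abs_sub_le i2 (fun x => by positivity) c (Real.sqrt (-a))
  rw [v2] at v3
  have hq : ∀ s, 12 * (|s - c| - Real.sqrt (-a)) ^ 2 ≤ |12 * ((s - c) ^ 2 + a)| := fun s => by
    rw [abs_mul, abs_of_pos (by norm_num : (0:ℝ) < 12)]
    have := sq_abs_sub_sqrt_le a (s - c); linarith
  refine oscPair_of_bounds ht hlam.le hφ (fun s => by positivity) (i3.add i1) (i3.const_mul (1 / τ))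
    (fun s => ?_) (fun s => ?_) ?_ ?_ (fun s => ?_)
  · rw [add_div]
    refine add_le_add ?_ le_rfl
    have h1 := hq s
    set Q := 12 * ((s - c) ^ 2 + a) with hQ
    set v := |s - c| - Real.sqrt (-a) with hv
    have hQ2 : (τ ^ 2 * |Q|) ^ 2 = τ ^ 4 * Q ^ 2 := by rw [← sq_abs Q]; ring
    have e1 : 1 / τ / (1 / τ + τ ^ 3 * Q ^ 2) = 1 / (1 + (τ ^ 2 * |Q|) ^ 2) := by
      rw [hQ2]; field_simp
    have h2 : (τ * v) ^ 2 ≤ τ ^ 2 * |Q| := by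
      rw [mul_pow]; gcongr; nlinarith [sq_nonneg v]
    change _ ≤ 2 * (1 + (τ * v) ^ 2)⁻¹
    rw [e1, ← one_div, mul_one_div, div_le_div_iff₀ (by positivity) (by positivity)]
    set x := (τ * v) ^ 2
    set Y := τ ^ 2 * |Q|
    nlinarith [sq_nonneg (Y - 1)]
  · have h1 := hq s
    set Q := 12 * ((s - c) ^ 2 + a) with hQ
    set v := |s - c| - Real.sqrt (-a) with hv
    have hQ2 : (τ ^ 2 * |Q|) ^ 2 = τ ^ 4 * Q ^ 2 := by rw [← sq_abs Q]; ring
    have e1 : |Q| / (1 / τ + τ ^ 3 * Q ^ 2) = 1 / τ * ((τ ^ 2 * |Q|) / (1 + (τ ^ 2 * |Q|) ^ 2)) := by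
      rw [hQ2]; field_simp
    have h2 : (τ * v) ^ 2 ≤ τ ^ 2 * |Q| := by
      rw [mul_pow]; gcongr; nlinarith [sq_nonneg v]
    rw [e1]
    gcongr
    rw [← one_div, mul_one_div, div_le_div_iff₀ (by positivity) (by positivity)]
    have hx : 0 ≤ (τ * v) ^ 2 := by positivity
    set x := (τ * v) ^ 2
    set Y := τ ^ 2 * |Q|
    nlinarith [sq_nonneg (Y - 1)]
  · refine (integral_add i3 i1).le.trans ((add_le_add v3 v1).trans (le_of_eq ?_))
    field_simp; ring
  · rw [integral_const_mul]
    refine (mul_le_mul_of_nonneg_left v3 hlam.le).trans ?_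
    rw [show 1 / τ * (2 * (2 * Real.pi / τ)) = 4 * Real.pi / τ ^ 2 by field_simp; ring]
    gcongr; norm_num
  · refine (abs_div_le_inv_sqrt ht hlam _).trans ?_
    rw [hs]
    gcongr
    linarith [Real.pi_gt_three]

/-- The exponents lie strictly on the two sides of 1. Working at exponent 1 would produce a
logarithm in ‖w‖₁; the small loss of powers avoids it. -/
lemma integrable_stationary_weight :
    Integrable (fun x : ℝ => if 1 ≤ |x| then |x| ^ (-(7 / 4) : ℝ) else |x| ^ (-(7 / 8) : ℝ)) := by
  refine integrable_comp_abs_of_integrableOn (f := fun x : ℝ => if 1 ≤ x then x ^ (-(7 / 4) : ℝ) else x ^ (-(7 / 8) : ℝ)) ?_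
  rw [(Ioc_union_Ioi_eq_Ioi (zero_le_one' ℝ)).symm]
  refine IntegrableOn.union ?_ ?_
  · have : IntegrableOn (fun x : ℝ => x ^ (-(7 / 8) : ℝ)) (Ioc 0 1) := by
      have := (intervalIntegral.intervalIntegrable_rpow' (a := 0) (b := 1) (r := -(7/8)) (by norm_num))
      rwa [intervalIntegrable_iff_integrableOn_Ioc_of_le zero_le_one] at this
    refine this.congr_fun_ae ?_
    have h0 : ∀ᵐ x : ℝ ∂(volume.restrict (Ioc 0 1)), x ≠ 1 := by
      apply ae_restrict_of_ae; simp [ae_iff]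
    filter_upwards [ae_restrict_mem measurableSet_Ioc, h0] with x hx hne
    rw [if_neg (not_le.2 (lt_of_le_of_ne hx.2 hne))]
  · refine (integrableOn_Ioi_rpow_of_lt (a := -(7/4)) (by norm_num) one_pos).congr_fun (fun x hx => ?_) measurableSet_Ioi
    simp [le_of_lt (mem_Ioi.1 hx)]

/-- The scale of a nondegenerate stationary point: t = τ² and λ = 1. With v = |s - c| - √(-a), φ' is
at least a multiple of |v| near a stationary point, which makes g a bump of width 1/τ, and at least
a multiple of v² far away, which makes w integrable. -/
lemma oscPair_hyperbolic {δ : ℝ} (hδ : 0 < δ) : ∃ D : ℝ, 0 ≤ D ∧ ∀ (τ c a : ℝ) (φ : ℝ → ℝ), 0 < τ → a ≤ -δ →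
    (∀ s, HasDerivAt φ (12 * ((s - c) ^ 2 + a)) s) →
    ∃ g w, OscPair (fun s => Complex.exp (Complex.I * (τ ^ 2 : ℝ) * φ s)) g w (D / τ)
      (D * τ ^ (-(15 / 8) : ℝ)) (D / τ) := by
  set m := min 1 (Real.sqrt δ) with hm
  have hm0 : 0 < m := lt_min one_pos (Real.sqrt_pos.2 hδ)
  have hm1 : m ≤ 1 := min_le_left _ _
  have hmδ : m ≤ Real.sqrt δ := min_le_right _ _
  set H : ℝ → ℝ := fun x : ℝ => m ^ (-(7 / 8) : ℝ) * if 1 ≤ |x| then |x| ^ (-(7 / 4) : ℝ) else |x| ^ (-(7 / 8) : ℝ) with hH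
  have hHi : Integrable H := integrable_stationary_weight.const_mul _
  have hH0 : ∀ x, 0 ≤ H x := fun x => by simp only [hH]; split_ifs <;> positivity
  set IH := ∫ x, H x with hIH
  have hIH0 : 0 ≤ IH := integral_nonneg hH0
  refine ⟨4 * Real.pi / m + 2 * IH, by positivity, fun τ c a φ hτ ha hφ => ?_⟩
  have hlam : (0 : ℝ) < 1 := one_pos
  have ht : 0 < τ ^ 2 := by positivity
  have hs : Real.sqrt (1 * τ ^ 2) = τ := by rw [one_mul]; exact Real.sqrt_sq hτ.le
  obtain ⟨i1, v1⟩ := integral_arctan_type (c := c) (a := a) ht hlam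
  rw [hs] at v1
  obtain ⟨i2, v2⟩ := integrable_two_mul_inv (mul_pos hm0 hτ) 1
  obtain ⟨i3, v3⟩ := integral_comp_abs_sub_le i2 (fun x => by positivity) c (Real.sqrt (-a))
  rw [v2] at v3
  obtain ⟨i4, v4⟩ := integral_comp_abs_sub_le hHi hH0 c (Real.sqrt (-a))
  have hq1 : ∀ s, m * (|s - c| - Real.sqrt (-a)) ^ 2 ≤ |12 * ((s - c) ^ 2 + a)| := fun s => by
    rw [abs_mul, abs_of_pos (by norm_num : (0:ℝ) < 12)]
    have := sq_abs_sub_sqrt_le a (s - c)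
    have h2 := sq_nonneg (|s - c| - Real.sqrt (-a))
    nlinarith
  have hq2 : ∀ s, m * |(|s - c| - Real.sqrt (-a))| ≤ |12 * ((s - c) ^ 2 + a)| := fun s => by
    rw [abs_mul, abs_of_pos (by norm_num : (0:ℝ) < 12)]
    have := abs_sub_sqrt_mul_le hδ.le ha (s - c)
    have h2 := abs_nonneg (|s - c| - Real.sqrt (-a))
    nlinarith [mul_le_mul_of_nonneg_right hmδ h2, abs_nonneg ((s - c) ^ 2 + a)]
  have hG : Real.pi / m ≥ Real.pi := by
    rw [ge_iff_le, le_div_iff₀ hm0]; nlinarith [Real.pi_pos]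
  have hpi := Real.pi_pos
  refine oscPair_of_bounds ht hlam.le hφ (fun s => by positivity) (i3.add i1) (i4.const_mul (τ ^ (-(15 / 8) : ℝ)))
    (fun s => ?_) (fun s => ?_) ?_ ?_ (fun s => ?_)
  · rw [add_div]
    refine add_le_add ?_ le_rfl
    have h1 := hq2 s
    set Q := 12 * ((s - c) ^ 2 + a) with hQ
    set v := |s - c| - Real.sqrt (-a) with hv
    have h2 : (m * v) ^ 2 ≤ Q ^ 2 := by
      rw [← sq_abs Q, mul_pow, ← sq_abs v, ← mul_pow]; gcongr
    change _ ≤ 1 * (1 + (m * τ * v) ^ 2)⁻¹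
    rw [one_mul, ← one_div]
    gcongr
    nlinarith [mul_le_mul_of_nonneg_left h2 ht.le]
  · have h1 := hq1 s
    have h2 := hq2 s
    set Q := 12 * ((s - c) ^ 2 + a) with hQ
    set v := |s - c| - Real.sqrt (-a) with hv
    -- At a stationary point negative powers of Q are meaningless, but the left side vanishes.
    rcases eq_or_ne Q 0 with h0 | h0
    · rw [h0]
      have := hH0 v
      simp only [abs_zero, zero_div]; positivity
    have hX : 0 < |Q| := abs_pos.2 h0
    have hXQ : Q ^ 2 = |Q| ^ 2 := (sq_abs Q).symm
    rw [hXQ]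
    set X := |Q| with hXdef
    -- From (τX)^(15/8) ≤ 1 + (τX)², since 15/8 lies between 0 and 2; the exponent leaves X^(-7/8),
    -- whose square-root and linear lower bounds on v give 7/4 and 7/8.
    have b1 : X / (1 + τ ^ 2 * X ^ 2) ≤ τ ^ (-(15 / 8) : ℝ) * X ^ (-(7 / 8) : ℝ) := by
      have hz : 0 < τ * X := by positivity
      have b2 : (τ * X) ^ (15 / 8 : ℝ) ≤ 1 + τ ^ 2 * X ^ 2 := by
        rcases le_total (τ * X) 1 with h | h
        · have := Real.rpow_le_one hz.le h (by norm_num : (0:ℝ) ≤ 15 / 8)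
          have : 0 ≤ τ ^ 2 * X ^ 2 := by positivity
          linarith
        · have := Real.rpow_le_rpow_of_exponent_le h (by norm_num : (15 / 8 : ℝ) ≤ (2 : ℕ))
          rw [Real.rpow_natCast, mul_pow] at this
          linarith
      rw [div_le_iff₀ (by positivity)]
      have b3 : X = τ ^ (-(15 / 8) : ℝ) * X ^ (-(7 / 8) : ℝ) * (τ * X) ^ (15 / 8 : ℝ) := by
        rw [Real.mul_rpow hτ.le hX.le, mul_mul_mul_comm, ← Real.rpow_add hτ, ← Real.rpow_add hX]
        norm_num
      calc X = τ ^ (-(15 / 8) : ℝ) * X ^ (-(7 / 8) : ℝ) * (τ * X) ^ (15 / 8 : ℝ) := b3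
        _ ≤ _ := by gcongr
    refine b1.trans (mul_le_mul_of_nonneg_left ?_ (by positivity))
    simp only [hH]
    rcases eq_or_ne v 0 with hv0 | hv0
    · exfalso
      have : Q = 0 := by
        have : |s - c| = Real.sqrt (-a) := by linarith
        have h3 : (s - c) ^ 2 = -a := by rw [← sq_abs, this, Real.sq_sqrt (by linarith)]
        rw [hQ, h3]; ring
      exact h0 this
    have hvp : 0 < |v| := abs_pos.2 hv0
    split_ifs with hv1
    · have e : |v| ^ (-(7 / 4) : ℝ) = (v ^ 2) ^ (-(7 / 8) : ℝ) := by
        rw [← sq_abs, ← Real.rpow_natCast, ← Real.rpow_mul hvp.le]; norm_num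
      rw [e, ← Real.mul_rpow hm0.le (sq_nonneg v)]
      exact Real.rpow_le_rpow_of_nonpos (by positivity) h1 (by norm_num)
    · rw [← Real.mul_rpow hm0.le hvp.le]
      exact Real.rpow_le_rpow_of_nonpos (by positivity) h2 (by norm_num)
  · refine (integral_add i3 i1).le.trans ((add_le_add v3 v1).trans ?_)
    rw [show 2 * (1 * Real.pi / (m * τ)) + 2 * Real.pi / τ = (2 * (Real.pi / m) + 2 * Real.pi) / τ by field_simp]
    refine div_le_div_of_nonneg_right ?_ hτ.le
    rw [mul_div_assoc]; linarith
  · rw [integral_const_mul, mul_comm]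
    gcongr
    have : 0 ≤ 4 * Real.pi / m := by positivity
    linarith
  · refine (abs_div_le_inv_sqrt ht hlam _).trans ?_
    rw [hs]
    gcongr
    rw [mul_div_assoc]; linarith [Real.pi_gt_three]

/-! ### Decay rates in the three regimes. -/

/-- The oscillatory integral with phase `t S₀` over the half plane `k < l`. -/
def halfOsc (F : ℝ → ℝ → ℂ) (t x y : ℝ) : ℂ :=
  ∫ z in {z : ℝ × ℝ | z.1 < z.2},
    Complex.exp (Complex.I * t * (S0 z.1 z.2 (x / t) (y / t) : ℝ)) * F z.1 z.2

lemma norm_cexp_I_mul_ofReal (t a : ℝ) : ‖Complex.exp (Complex.I * t * a)‖ = 1 := by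
  rw [Complex.norm_exp]; simp

namespace OscData
variable {F Φ : ℝ → ℝ → ℂ} {C : ℝ}

/-- The function φ(s) = s(x/t) - s²(y/t) + 4s³ satisfies S₀ = φ(l) - φ(k), so the exponential
factors as conj(e(k)) e(l); completing the square in φ' produces `aPar`. -/
lemma norm_halfOsc_le (h : OscData F Φ C) {t x y G B₁ B : ℝ}
    (H : ∀ φ : ℝ → ℝ, (∀ s, HasDerivAt φ (12 * ((s - y / t / 12) ^ 2 + aPar t x y)) s) →
      ∃ g w, OscPair (fun s => Complex.exp (Complex.I * t * φ s)) g w G B₁ B) {K : ℝ} (hK : 1 ≤ K) :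
    ‖halfOsc F t x y‖ ≤
      16 * C * (G * (K ^ (-(5 / 4) : ℝ) + G + B + B₁) + B₁ * (K ^ (-(1 / 4) : ℝ) + G + B + K ^ 2 * B₁)) := by
  obtain ⟨g, w, ho⟩ := H (fun s => s * (x / t) - s ^ 2 * (y / t) + 4 * s ^ 3) (fun s => by
    have h1 := ((hasDerivAt_id s).mul_const (x / t)).sub (((hasDerivAt_id s).pow 2).mul_const (y / t))
    have h2 := h1.add (((hasDerivAt_id s).pow 3).const_mul 4)
    refine h2.congr_deriv ?_
    simp [aPar]; ring)
  refine le_trans (le_of_eq ?_) (h.norm_integral_le ho hK)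
  congr 1
  unfold halfOsc
  congr 1; ext z
  congr 1
  rw [← Complex.exp_conj, ← Complex.exp_add]
  congr 1
  have h4 : (starRingEnd ℂ) 4 = 4 := map_ofNat _ 4
  simp [S0, h4]; ring

lemma norm_halfOsc_le_integral (_ : OscData F Φ C) (t x y : ℝ) :
    ‖halfOsc F t x y‖ ≤ ∫ z : ℝ × ℝ, ‖F z.1 z.2‖ := by
  refine (norm_integral_le_integral_norm _).trans ?_
  simp only [norm_mul, norm_cexp_I_mul_ofReal, one_mul]
  by_cases hi : Integrable (fun z : ℝ × ℝ => ‖F z.1 z.2‖)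
  · exact setIntegral_le_integral hi (Eventually.of_forall fun _ => norm_nonneg _)
  · exact absurd (OscData.int ‹_›).norm hi

/-- With G, B₁, B of size 1/t and K = t^(1/4), the tail gives K^(-1/4) = t^(-1/16) and the Lipschitz
term K²/t = t^(-1/2). Any positive gain over 1/t is enough for o(1/t). -/
lemma halfOsc_elliptic (h : OscData F Φ C) {δ : ℝ} (hδ : 0 < δ) : ∃ C' : ℝ, 0 ≤ C' ∧ ∀ t x y : ℝ, 1 ≤ t →
    δ < aPar t x y → ‖halfOsc F t x y‖ ≤ C' * t ^ (-(17 / 16) : ℝ) := by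
  obtain ⟨D, hD, H⟩ := oscPair_elliptic hδ
  have hC := h.C_nonneg
  refine ⟨16 * C * (D * (1 + 3 * D) + D * (1 + 3 * D)), by positivity, fun t x y ht ha => ?_⟩
  have ht0 : 0 < t := by linarith
  have hK : 1 ≤ t ^ (1 / 4 : ℝ) := Real.one_le_rpow ht (by norm_num)
  refine (h.norm_halfOsc_le (fun φ hφ => H t _ _ φ ht0 ha hφ) hK).trans ?_
  have e1 : (t ^ (1 / 4 : ℝ)) ^ (-(5 / 4) : ℝ) ≤ t ^ (-(1 / 16) : ℝ) := by
    rw [← Real.rpow_mul ht0.le]; exact Real.rpow_le_rpow_of_exponent_le ht (by norm_num)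
  have e2 : (t ^ (1 / 4 : ℝ)) ^ (-(1 / 4) : ℝ) ≤ t ^ (-(1 / 16) : ℝ) := by
    rw [← Real.rpow_mul ht0.le]; exact Real.rpow_le_rpow_of_exponent_le ht (by norm_num)
  have e3 : D / t ≤ D * t ^ (-(1 / 16) : ℝ) := by
    rw [div_eq_mul_inv D, ← Real.rpow_neg_one]
    gcongr ?_ * ?_
    exact Real.rpow_le_rpow_of_exponent_le ht (by norm_num)
  have e4 : (t ^ (1 / 4 : ℝ)) ^ 2 * (D / t) ≤ D * t ^ (-(1 / 16) : ℝ) := by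
    rw [div_eq_mul_inv D, ← Real.rpow_neg_one, ← Real.rpow_natCast, ← Real.rpow_mul ht0.le, mul_left_comm,
      ← Real.rpow_add ht0]
    gcongr ?_ * ?_
    exact Real.rpow_le_rpow_of_exponent_le ht (by norm_num)
  have e5 : D / t * t ^ (-(1 / 16) : ℝ) = D * t ^ (-(17 / 16) : ℝ) := by
    rw [div_eq_mul_inv D, ← Real.rpow_neg_one, mul_assoc, ← Real.rpow_add ht0]; norm_num
  set X := t ^ (-(1 / 16) : ℝ)
  have hX : 0 ≤ X := by positivity
  calc _ ≤ 16 * C * (D / t * (X + D * X + D * X + D * X) + D / t * (X + D * X + D * X + D * X)) := by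
        gcongr
    _ = 16 * C * (1 + 3 * D + (1 + 3 * D)) * (D / t * X) := by ring
    _ = _ := by rw [e5]; ring

/-- With τ = t^(1/3), G and B are O(1/τ) and B₁ is O(1/τ²). The choice K = τ keeps K²B₁ bounded and
makes the tail of F smaller than 1/τ, so both contributions are O(τ^(-2)). -/
lemma halfOsc_uniform (h : OscData F Φ C) : ∃ C' : ℝ, 0 ≤ C' ∧ ∀ t x y : ℝ, 1 ≤ t →
    ‖halfOsc F t x y‖ ≤ C' * t ^ (-(2 / 3) : ℝ) := by
  obtain ⟨D, hD, H⟩ := oscPair_uniform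
  have hC := h.C_nonneg
  refine ⟨16 * C * (D * (1 + 3 * D) + D * (1 + 3 * D)), by positivity, fun t x y ht => ?_⟩
  have ht0 : 0 < t := by linarith
  set τ := t ^ (1 / 3 : ℝ) with hτd
  have hτ : 1 ≤ τ := Real.one_le_rpow ht (by norm_num)
  have hτ0 : 0 < τ := by linarith
  have hτ3 : τ ^ 3 = t := by
    rw [hτd, ← Real.rpow_natCast, ← Real.rpow_mul ht0.le]; norm_num
  have hτ2 : (τ ^ 2)⁻¹ = t ^ (-(2 / 3) : ℝ) := by
    rw [hτd, ← Real.rpow_natCast, ← Real.rpow_mul ht0.le, ← Real.rpow_neg ht0.le]; norm_num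
  refine (h.norm_halfOsc_le (G := D / τ) (B₁ := D / τ ^ 2) (B := D / τ) (fun φ hφ => ?_) hτ).trans ?_
  · have := H τ (y / t / 12) (aPar t x y) φ hτ0 hφ
    rwa [hτ3] at this
  have i1 : τ⁻¹ ≤ 1 := inv_le_one_of_one_le₀ hτ
  have e1 : τ ^ (-(5 / 4) : ℝ) ≤ τ⁻¹ := by
    rw [← Real.rpow_neg_one]; exact Real.rpow_le_rpow_of_exponent_le hτ (by norm_num)
  have e2 : τ ^ (-(1 / 4) : ℝ) ≤ 1 := Real.rpow_le_one_of_one_le_of_nonpos hτ (by norm_num)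
  have e3 : D / τ ^ 2 ≤ D * τ⁻¹ := by
    rw [div_eq_mul_inv, pow_two, mul_inv]
    have : 0 ≤ τ⁻¹ := by positivity
    gcongr
    nlinarith
  have e4 : D / τ ≤ D := div_le_self hD hτ
  have e5 : τ ^ 2 * (D / τ ^ 2) = D := by field_simp
  rw [← hτ2]
  have i2 : 0 ≤ τ⁻¹ := by positivity
  calc _ ≤ 16 * C * (D / τ * (τ⁻¹ + D * τ⁻¹ + D * τ⁻¹ + D * τ⁻¹) + D / τ ^ 2 * (1 + D + D + D)) := by
        rw [e5]
        gcongr <;> exact le_of_eq (div_eq_mul_inv _ _)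
    _ = _ := by field_simp; ring

/-- With τ = t^(1/2) and K = τ^(4/5), the tail K^(-5/4) of F is exactly 1/τ and G contributes
τ^(-2). Since B₁ has size τ^(-15/8), the other bracket must be O(τ^(-1/8)): its terms are τ^(-1/5),
τ^(-1) and K²B₁ = τ^(-11/40). -/
lemma halfOsc_hyperbolic (h : OscData F Φ C) {δ : ℝ} (hδ : 0 < δ) : ∃ C' : ℝ, 0 ≤ C' ∧ ∀ t x y : ℝ, 1 ≤ t →
    aPar t x y < -δ → ‖halfOsc F t x y‖ ≤ C' * t⁻¹ := by
  obtain ⟨D, hD, H⟩ := oscPair_hyperbolic hδ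
  have hC := h.C_nonneg
  refine ⟨16 * C * (D * (1 + 3 * D) + D * (1 + 3 * D)), by positivity, fun t x y ht ha => ?_⟩
  have ht0 : 0 < t := by linarith
  set τ := t ^ (1 / 2 : ℝ) with hτd
  have hτ : 1 ≤ τ := Real.one_le_rpow ht (by norm_num)
  have hτ0 : 0 < τ := by linarith
  have hτ2 : τ ^ 2 = t := by
    rw [hτd, ← Real.rpow_natCast, ← Real.rpow_mul ht0.le]; norm_num
  have hK : 1 ≤ τ ^ (4 / 5 : ℝ) := Real.one_le_rpow hτ (by norm_num)
  refine (h.norm_halfOsc_le (G := D / τ) (B₁ := D * τ ^ (-(15 / 8) : ℝ)) (B := D / τ) (fun φ hφ => ?_) hK).trans ?_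
  · have := H τ (y / t / 12) (aPar t x y) φ hτ0 ha.le hφ
    rwa [hτ2] at this
  have e1 : (τ ^ (4 / 5 : ℝ)) ^ (-(5 / 4) : ℝ) ≤ τ⁻¹ := by
    rw [← Real.rpow_neg_one, ← Real.rpow_mul hτ0.le]; exact Real.rpow_le_rpow_of_exponent_le hτ (by norm_num)
  have e2 : (τ ^ (4 / 5 : ℝ)) ^ (-(1 / 4) : ℝ) ≤ τ ^ (-(1 / 8) : ℝ) := by
    rw [← Real.rpow_mul hτ0.le]; exact Real.rpow_le_rpow_of_exponent_le hτ (by norm_num)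
  have e3 : D * τ ^ (-(15 / 8) : ℝ) ≤ D * τ⁻¹ := by
    rw [← Real.rpow_neg_one]
    gcongr ?_ * ?_
    exact Real.rpow_le_rpow_of_exponent_le hτ (by norm_num)
  have e4 : D / τ ≤ D * τ ^ (-(1 / 8) : ℝ) := by
    rw [div_eq_mul_inv D, ← Real.rpow_neg_one]
    gcongr ?_ * ?_
    exact Real.rpow_le_rpow_of_exponent_le hτ (by norm_num)
  have e5 : (τ ^ (4 / 5 : ℝ)) ^ 2 * (D * τ ^ (-(15 / 8) : ℝ)) ≤ D * τ ^ (-(1 / 8) : ℝ) := by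
    rw [← Real.rpow_natCast, ← Real.rpow_mul hτ0.le, mul_left_comm, ← Real.rpow_add hτ0]
    gcongr ?_ * ?_
    exact Real.rpow_le_rpow_of_exponent_le hτ (by norm_num)
  have e6 : τ ^ (-(15 / 8) : ℝ) * τ ^ (-(1 / 8) : ℝ) = t⁻¹ := by
    rw [← Real.rpow_add hτ0, ← hτ2, ← Real.rpow_natCast, ← Real.rpow_neg hτ0.le]; norm_num
  have i2 : 0 ≤ τ⁻¹ := by positivity
  have e7 : τ⁻¹ * τ⁻¹ = t⁻¹ := by rw [← hτ2]; field_simp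
  have e8 : D / τ = D * τ⁻¹ := div_eq_mul_inv _ _
  set X := τ ^ (-(1 / 8) : ℝ) with hX
  have hX0 : 0 ≤ X := by positivity
  calc _ ≤ 16 * C * (D * τ⁻¹ * (τ⁻¹ + D * τ⁻¹ + D * τ⁻¹ + D * τ⁻¹)
        + D * τ ^ (-(15 / 8) : ℝ) * (X + D * X + D * X + D * X)) := by
        gcongr <;> exact e8.le
    _ = 16 * C * (D * (1 + 3 * D) * (τ⁻¹ * τ⁻¹) + D * (1 + 3 * D) * (τ ^ (-(15 / 8) : ℝ) * X)) := by ring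
    _ = _ := by rw [e6, e7]; ring

lemma reflect (h : OscData F Φ C) :
    OscData (fun k l => (starRingEnd ℂ) (F (-k) (-l))) (fun k l => -(starRingEnd ℂ) (Φ (-k) (-l))) C where
  C_nonneg := h.C_nonneg
  meas_F := Complex.continuous_conj.measurable.comp
    (h.meas_F.comp ((measurable_fst.neg).prodMk measurable_snd.neg))
  meas_Φ := (Complex.continuous_conj.measurable.comp
    (h.meas_Φ.comp ((measurable_fst.neg).prodMk measurable_snd.neg))).neg
  diag k := by simp [h.diag]
  deriv k l := by
    have h1 := (h.deriv (-k) (-l)).scomp l (hasDerivAt_neg l)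
    have h2 := h1.star
    simpa using h2
  bound_F k l := by simpa using h.bound_F (-k) (-l)
  bound_Φ k l := by simpa using h.bound_Φ (-k) (-l)
  tail_F K hK k l hkl hd := by
    have := h.tail_F K hK (-k) (-l) (fun h => hkl (neg_injective h)) (by
      rwa [abs_neg, show -l - -k = -(l - k) by ring, abs_neg])
    rw [show -l - -k = -(l - k) by ring, tailFn_neg] at this
    simpa using this
  tail_Φ K hK k l hkl hd := by
    have := h.tail_Φ K hK (-k) (-l) (fun h => hkl (neg_injective h)) (by
      rwa [abs_neg, show -l - -k = -(l - k) by ring, abs_neg])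
    rw [show -l - -k = -(l - k) by ring, tailFn_neg] at this
    simpa using this
  lip_F k k' l := by
    have := h.lip_F (-k) (-k') (-l)
    rw [← map_sub, RCLike.norm_conj]
    rwa [show -k - -k' = -(k - k') by ring, abs_neg] at this
  lip_Φ K hK k k' l h1 h2 h3 h4 := by
    have := h.lip_Φ K hK (-k) (-k') (-l) (by rwa [abs_neg]) (by rwa [abs_neg])
      (by rwa [show -l - -k = -(l - k) by ring, abs_neg]) (by rwa [show -l - -k' = -(l - k') by ring, abs_neg])
    rw [neg_sub_neg, ← map_sub, RCLike.norm_conj, norm_sub_rev]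
    rwa [show -k - -k' = -(k - k') by ring, abs_neg] at this
  int := by
    have h1 : Integrable (fun z : ℝ × ℝ => Function.uncurry F (-z)) := h.int.comp_neg
    have := Complex.conjCLE.toContinuousLinearMap.integrable_comp h1
    exact this

/-- Under (k,l) ↦ (-k,-l) the phase S₀(·;ξ,η) becomes -S₀(·;ξ,-η), and the sign is removed by
conjugation. -/
lemma integral_lower (t x y : ℝ) (F : ℝ → ℝ → ℂ) :
    ∫ z in {z : ℝ × ℝ | z.2 < z.1},
      Complex.exp (Complex.I * t * (S0 z.1 z.2 (x / t) (y / t) : ℝ)) * F z.1 z.2 =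
    (starRingEnd ℂ) (halfOsc (fun k l => (starRingEnd ℂ) (F (-k) (-l))) t x (-y)) := by
  unfold halfOsc
  rw [← integral_conj, ← integral_indicator (measurableSet_lt measurable_fst measurable_snd),
    ← integral_indicator (measurableSet_lt measurable_snd measurable_fst),
    ← integral_neg_eq_self]
  congr 1; ext z
  simp only [indicator, mem_ofPred_eq, Prod.fst_neg, Prod.snd_neg, neg_lt_neg_iff]
  split_ifs with hz
  · rw [map_mul, Complex.conj_conj, ← Complex.exp_conj]
    congr 2
    have h4 : (starRingEnd ℂ) 4 = 4 := map_ofNat _ 4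
    simp [S0, h4]; ring
  · rfl

end OscData

/-! ### Assembly of the two half planes. -/

/-- Decay of the local term, from amplitude data on the two half planes. -/
theorem decay_of_oscData {u : ℝ × ℝ → ℝ} {mp mm : ℝ → ℝ → ℝ → ℂ} {Fp Φp Fm Φm : ℝ → ℝ → ℂ} {Cp Cm : ℝ}
    (hp : OscData Fp Φp Cp) (hm : OscData Fm Φm Cm)
    (ep : ∀ᵐ z : ℝ × ℝ, z.1 < z.2 → ((z.2 : ℂ) - z.1) * scatF u mp mm z.1 z.2 = Fp z.1 z.2)
    (em : ∀ᵐ z : ℝ × ℝ, z.2 < z.1 → ((z.2 : ℂ) - z.1) * scatF u mp mm z.1 z.2 = Fm z.1 z.2) :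
    Integrable (fun z : ℝ × ℝ => ((z.2 : ℂ) - z.1) * scatF u mp mm z.1 z.2) volume ∧
      ∀ δ : ℝ, 0 < δ →
        (∀ ε : ℝ, 0 < ε → ∃ t₀ : ℝ, 0 < t₀ ∧ ∀ t x y : ℝ, t₀ ≤ t → δ < aPar t x y →
          ‖u1 u mp mm t x y‖ ≤ ε * t⁻¹) ∧
        (∃ C : ℝ, ∀ t x y : ℝ, 0 < t → |aPar t x y| < δ →
          ‖u1 u mp mm t x y‖ ≤ C * t ^ (-(2 / 3) : ℝ)) ∧
        (∃ C : ℝ, ∀ t x y : ℝ, 0 < t → aPar t x y < -δ →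
          ‖u1 u mp mm t x y‖ ≤ C * t⁻¹) := by
  set Sp := {z : ℝ × ℝ | z.1 < z.2} with hSp
  set Sm := {z : ℝ × ℝ | z.2 < z.1} with hSm
  have mSp : MeasurableSet Sp := measurableSet_lt measurable_fst measurable_snd
  have mSm : MeasurableSet Sm := measurableSet_lt measurable_snd measurable_fst
  set A : ℝ × ℝ → ℂ := fun z => ((z.2 : ℂ) - z.1) * scatF u mp mm z.1 z.2 with hA
  set A' : ℝ × ℝ → ℂ := fun z => Sp.indicator (Function.uncurry Fp) z + Sm.indicator (Function.uncurry Fm) z with hA'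
  have hi1 : Integrable (Sp.indicator (Function.uncurry Fp)) := hp.int.indicator mSp
  have hi2 : Integrable (Sm.indicator (Function.uncurry Fm)) := hm.int.indicator mSm
  have hAA : A =ᵐ[volume] A' := by
    filter_upwards [ep, em] with z h1 h2
    rcases lt_trichotomy z.1 z.2 with h | h | h
    · have a1 : z ∈ Sp := h
      have a2 : z ∉ Sm := not_lt.2 h.le
      simp only [hA, hA', indicator_of_mem a1, indicator_of_notMem a2, add_zero, h1 h, Function.uncurry]
    · have a1 : z ∉ Sp := fun h' => (ne_of_lt h') h
      have a2 : z ∉ Sm := fun h' => (ne_of_lt h') h.symm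
      simp only [hA, hA', indicator_of_notMem a1, indicator_of_notMem a2, add_zero, h, sub_self, zero_mul]
    · have a1 : z ∉ Sp := not_lt.2 h.le
      have a2 : z ∈ Sm := h
      simp only [hA, hA', indicator_of_notMem a1, indicator_of_mem a2, zero_add, h2 h, Function.uncurry]
  have hAi : Integrable A := (hi1.add hi2).congr hAA.symm
  refine ⟨hAi, ?_⟩
  set Fr : ℝ → ℝ → ℂ := fun k l => (starRingEnd ℂ) (Fm (-k) (-l)) with hFr
  have hr := hm.reflect
  have key : ∀ t x y, ‖u1 u mp mm t x y‖ ≤ ‖halfOsc Fp t x y‖ + ‖halfOsc Fr t x (-y)‖ := by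
    intro t x y
    have hE : ∀ {f : ℝ × ℝ → ℂ}, Integrable f →
        Integrable (fun z : ℝ × ℝ => Complex.exp (Complex.I * t * (S0 z.1 z.2 (x / t) (y / t) : ℝ)) * f z) := by
      intro f hf
      refine hf.bdd_mul (c := 1) ?_ (Eventually.of_forall fun z => (norm_cexp_I_mul_ofReal _ _).le)
      refine Continuous.aestronglyMeasurable ?_
      unfold S0; fun_prop
    have e1 : u1 u mp mm t x y = ((1 / Real.pi : ℝ) : ℂ) * (Complex.I *
        (halfOsc Fp t x y + (starRingEnd ℂ) (halfOsc Fr t x (-y)))) := by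
      unfold u1
      congr 1
      rw [← OscData.integral_lower, halfOsc, ← integral_indicator mSp, ← integral_indicator mSm,
        ← integral_add, ← integral_const_mul]
      · apply integral_congr_ae
        filter_upwards [hAA] with z hz
        have : Complex.I * ((z.2 : ℂ) - z.1) * scatF u mp mm z.1 z.2 = Complex.I * A' z := by
          rw [← hz]; simp only [hA]; ring
        rw [this]
        simp only [hA', indicator]
        split_ifs <;> simp [Function.uncurry] <;> ring
      · refine (hE hi1).congr (Eventually.of_forall fun z => ?_)
        simp only [indicator]; split_ifs <;> simp [Function.uncurry]
      · refine (hE hi2).congr (Eventually.of_forall fun z => ?_)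
        simp only [indicator]; split_ifs <;> simp [Function.uncurry]
    rw [e1, norm_mul, norm_mul, Complex.norm_I, one_mul, Complex.norm_real, Real.norm_eq_abs,
      abs_of_pos (by positivity)]
    have h1 : 1 / Real.pi ≤ 1 := by
      rw [div_le_one Real.pi_pos]; linarith [Real.pi_gt_three]
    refine (mul_le_of_le_one_left (norm_nonneg _) h1).trans ((norm_add_le _ _).trans ?_)
    rw [RCLike.norm_conj]
  have haPar : ∀ t x y, aPar t x (-y) = aPar t x y := by
    intro t x y; simp [aPar, neg_div]
  set I₀ := (∫ z : ℝ × ℝ, ‖Fp z.1 z.2‖) + ∫ z : ℝ × ℝ, ‖Fr z.1 z.2‖ with hI₀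
  have hI₀0 : 0 ≤ I₀ := add_nonneg (integral_nonneg fun _ => norm_nonneg _) (integral_nonneg fun _ => norm_nonneg _)
  -- The rates above hold for t ≥ 1. For t ≤ 1 both t^(-2/3) and 1/t are at least 1, so the L¹ norm
  -- of the amplitude is an admissible constant.
  have triv : ∀ t x y, ‖u1 u mp mm t x y‖ ≤ I₀ := fun t x y =>
    (key t x y).trans (add_le_add (hp.norm_halfOsc_le_integral _ _ _) (hr.norm_halfOsc_le_integral _ _ _))
  intro δ hδ
  refine ⟨fun ε hε => ?_, ?_, ?_⟩
  · obtain ⟨C1, hC1, H1⟩ := hp.halfOsc_elliptic hδ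
    obtain ⟨C2, hC2, H2⟩ := hr.halfOsc_elliptic hδ
    have hz : Tendsto (fun t : ℝ => (C1 + C2) * t ^ (-(1 / 16) : ℝ)) atTop (𝓝 0) := by
      simpa using (tendsto_rpow_neg_atTop (y := 1 / 16) (by norm_num)).const_mul (C1 + C2)
    obtain ⟨t₀, ht₀⟩ := eventually_atTop.1 (hz.eventually (gt_mem_nhds hε))
    refine ⟨max 1 t₀, by positivity, fun t x y ht ha => ?_⟩
    have ht1 : 1 ≤ t := (le_max_left _ _).trans ht
    have ht0 : 0 < t := by linarith
    refine (key t x y).trans ((add_le_add (H1 t x y ht1 ha) (H2 t x (-y) ht1 (by rwa [haPar]))).trans ?_)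
    have e5 : t ^ (-(17 / 16) : ℝ) = t ^ (-(1 / 16) : ℝ) * t⁻¹ := by
      rw [← Real.rpow_neg_one, ← Real.rpow_add ht0]; norm_num
    rw [e5, ← add_mul, ← mul_assoc]
    gcongr
    exact (ht₀ t ((le_max_right _ _).trans ht)).le
  · obtain ⟨C1, hC1, H1⟩ := hp.halfOsc_uniform
    obtain ⟨C2, hC2, H2⟩ := hr.halfOsc_uniform
    refine ⟨C1 + C2 + I₀, fun t x y ht _ => ?_⟩
    have hp0 : 0 ≤ t ^ (-(2 / 3) : ℝ) := by positivity
    rcases le_total 1 t with h1 | h1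
    · refine (key t x y).trans ((add_le_add (H1 t x y h1) (H2 t x (-y) h1)).trans ?_)
      nlinarith [mul_nonneg hI₀0 hp0]
    · refine (triv t x y).trans ?_
      have : 1 ≤ t ^ (-(2 / 3) : ℝ) := Real.one_le_rpow_of_pos_of_le_one_of_nonpos ht h1 (by norm_num)
      nlinarith [mul_nonneg hC1 hp0, mul_nonneg hC2 hp0]
  · obtain ⟨C1, hC1, H1⟩ := hp.halfOsc_hyperbolic hδ
    obtain ⟨C2, hC2, H2⟩ := hr.halfOsc_hyperbolic hδ
    refine ⟨C1 + C2 + I₀, fun t x y ht ha => ?_⟩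
    have hp0 : 0 ≤ t⁻¹ := by positivity
    rcases le_total 1 t with h1 | h1
    · refine (key t x y).trans ((add_le_add (H1 t x y h1 ha) (H2 t x (-y) h1 (by rwa [haPar]))).trans ?_)
      nlinarith [mul_nonneg hI₀0 hp0]
    · refine (triv t x y).trans ?_
      have : 1 ≤ t⁻¹ := (one_le_inv₀ ht).2 h1
      nlinarith [mul_nonneg hC1 hp0, mul_nonneg hC2 hp0]

/-! ### Finite differences from weak derivatives in L². -/

lemma abs_integral_mul_le {α : Type*} [MeasurableSpace α] {μ : Measure α} {f g : α → ℝ}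
    (hf : MemLp f 2 μ) (hg : MemLp g 2 μ) :
    |∫ x, f x * g x ∂μ| ≤ (eLpNorm f 2 μ).toReal * (eLpNorm g 2 μ).toReal := by
  have h1 : ∫ x, f x * g x ∂μ = inner ℝ (hf.toLp f) (hg.toLp g) := by
    rw [L2.inner_def]
    apply integral_congr_ae
    filter_upwards [hf.coeFn_toLp, hg.coeFn_toLp] with x h1 h2
    rw [h1, h2]; simp [mul_comm]
  rw [h1, ← Lp.norm_toLp f hf, ← Lp.norm_toLp g hg]
  exact abs_real_inner_le_norm _ _

/-- Duality: the `L²` norm is determined by pairing with test functions. -/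
lemma eLpNorm_le_of_test {F : ℝ × ℝ → ℝ} (hF : MemLp F 2 volume) {C : ℝ}
    (h : ∀ φ, IsTest φ → |∫ z, F z * φ z| ≤ C * (eLpNorm φ 2 volume).toReal) :
    (eLpNorm F 2 volume).toReal ≤ C := by
  set N := (eLpNorm F 2 volume).toReal with hN
  have hN0 : 0 ≤ N := ENNReal.toReal_nonneg
  have hNN : N * N = ∫ z, F z * F z := by
    have h1 : ∫ z, F z * F z = inner ℝ (hF.toLp F) (hF.toLp F) := by
      rw [L2.inner_def]
      apply integral_congr_ae
      filter_upwards [hF.coeFn_toLp] with x h1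
      rw [h1]; simp [sq]
    rw [h1, real_inner_self_eq_norm_mul_norm, Lp.norm_toLp]
  -- F is approximated by a test function φ within ε in L², and ‖F‖² = ⟨F, F - φ⟩ + ⟨F, φ⟩ is
  -- estimated term by term.
  have key : ∀ ε : ℝ, 0 < ε → ∃ n : ℝ, |n - N| ≤ ε ∧ 0 ≤ n ∧ N * N ≤ N * ε + C * n := by
    intro ε hε
    obtain ⟨φ, hφ1, hφ2, hφ3⟩ := hF.exist_eLpNorm_sub_le (by norm_num) (by norm_num) hε
    have hφL : MemLp φ 2 volume := hφ2.continuous.memLp_of_hasCompactSupport hφ1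
    have hd : (eLpNorm (F - φ) 2 volume).toReal ≤ ε := ENNReal.toReal_le_of_le_ofReal hε.le hφ3
    refine ⟨(eLpNorm φ 2 volume).toReal, ?_, ENNReal.toReal_nonneg, ?_⟩
    · have e1 := Lp.norm_toLp (F - φ) (hF.sub hφL)
      rw [MemLp.toLp_sub hF hφL] at e1
      have e2 := abs_norm_sub_norm_le (hφL.toLp φ) (hF.toLp F)
      rw [norm_sub_rev, e1, Lp.norm_toLp, Lp.norm_toLp] at e2
      exact e2.trans hd
    · have e1 := abs_integral_mul_le hF (hF.sub hφL)
      have e2 := h φ ⟨hφ2, hφ1⟩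
      have e3 : ∫ z, F z * F z = (∫ z, F z * (F - φ) z) + ∫ z, F z * φ z := by
        refine Eq.trans ?_ (integral_add (hF.integrable_mul (hF.sub hφL)) (hF.integrable_mul hφL))
        congr 1; ext z; simp; ring
      rw [hNN, e3]
      refine add_le_add ((le_abs_self _).trans (e1.trans (by gcongr))) ((le_abs_self _).trans e2)
  have hlim : N * N ≤ C * N := by
    apply le_of_forall_pos_le_add
    intro η hη
    set ε := η / (N + |C| + 1) with hε
    have hε0 : 0 < ε := by positivity
    obtain ⟨n, h1, h2, h3⟩ := key ε hε0
    have h4 : C * n ≤ C * N + |C| * ε := by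
      have : C * (n - N) ≤ |C| * ε := (le_abs_self _).trans (by rw [abs_mul]; gcongr)
      linarith
    have h5 : N * ε + |C| * ε ≤ η := by
      rw [← add_mul, hε, mul_div_assoc', div_le_iff₀ (by positivity)]
      nlinarith [abs_nonneg C]
    linarith
  rcases hN0.eq_or_lt with h0 | h0
  · rw [← h0]
    by_contra hC
    obtain ⟨n, h1, h2, h3⟩ := key 1 one_pos
    -- choose any test function: the bound forces `0 ≤ C`
    have ⟨φ, hφ⟩ : ∃ φ, IsTest φ ∧ 0 < (eLpNorm φ 2 volume).toReal := by
      let b : ContDiffBump (0 : ℝ × ℝ) := ⟨1, 2, one_pos, by norm_num⟩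
      refine ⟨b, ⟨b.contDiff, b.hasCompactSupport⟩, ?_⟩
      have hb : MemLp b 2 volume := b.continuous.memLp_of_hasCompactSupport b.hasCompactSupport
      refine ENNReal.toReal_pos ?_ hb.2.ne
      intro h0
      rw [eLpNorm_eq_zero_iff hb.1 (by norm_num)] at h0
      have := (b.continuous.ae_eq_iff_eq volume continuous_const).1 h0
      have h1 : b 0 = 0 := congr_fun this 0
      rw [b.one_of_mem_closedBall (Metric.mem_closedBall_self b.rIn_pos.le)] at h1
      exact one_ne_zero h1
    have := h φ hφ.1
    nlinarith [abs_nonneg (∫ z, F z * φ z), hφ.2, not_le.1 hC]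
  · exact le_of_mul_le_mul_right hlim h0

/-- The derivative in the direction `e`. -/
def dirD (e : ℝ × ℝ) (φ : ℝ × ℝ → ℝ) (z : ℝ × ℝ) : ℝ := fderiv ℝ φ z e

lemma IsTest.dirD {φ : ℝ × ℝ → ℝ} (h : IsTest φ) (e : ℝ × ℝ) : IsTest (dirD e φ) :=
  ⟨(h.1.fderiv_right (m := (⊤ : ℕ∞)) le_rfl).clm_apply contDiff_const, h.2.fderiv_apply ℝ e⟩

lemma IsTest.iter_dirD {φ : ℝ × ℝ → ℝ} (h : IsTest φ) (e : ℝ × ℝ) (n : ℕ) : IsTest ((KPI.dirD e)^[n] φ) := by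
  induction n with
  | zero => exact h
  | succ n ih => rw [Function.iterate_succ_apply']; exact ih.dirD e

lemma IsTest.hasFDerivAt {φ : ℝ × ℝ → ℝ} (h : IsTest φ) (z : ℝ × ℝ) : HasFDerivAt φ (fderiv ℝ φ z) z :=
  (h.1.differentiable (by simp) z).hasFDerivAt

lemma IsTest.memLp {φ : ℝ × ℝ → ℝ} (h : IsTest φ) : MemLp φ 2 volume :=
  h.1.continuous.memLp_of_hasCompactSupport h.2

lemma IsTest.dx_eq {φ : ℝ × ℝ → ℝ} (h : IsTest φ) (n : ℕ) : dx n φ = (KPI.dirD (1, 0))^[n] φ := by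
  induction n with
  | zero => ext z; simp [dx]
  | succ n ih =>
    ext z
    rw [Function.iterate_succ_apply']
    unfold dx
    rw [iteratedDeriv_succ]
    have : (fun x => iteratedDeriv n (fun x => φ (x, z.2)) x) = fun x => (KPI.dirD (1, 0))^[n] φ (x, z.2) := by
      ext x; rw [← ih]; rfl
    change deriv (fun x => iteratedDeriv n (fun x => φ (x, z.2)) x) z.1 = _
    rw [this]
    have h1 := ((h.iter_dirD (1, 0) n).hasFDerivAt z).comp_hasDerivAt z.1
      ((hasDerivAt_id z.1).prodMk (hasDerivAt_const z.1 z.2))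
    exact h1.deriv

lemma IsTest.dy_eq {φ : ℝ × ℝ → ℝ} (h : IsTest φ) (n : ℕ) : dy n φ = (KPI.dirD (0, 1))^[n] φ := by
  induction n with
  | zero => ext z; simp [dy]
  | succ n ih =>
    ext z
    rw [Function.iterate_succ_apply']
    unfold dy
    rw [iteratedDeriv_succ]
    have : (fun y => iteratedDeriv n (fun y => φ (z.1, y)) y) = fun y => (KPI.dirD (0, 1))^[n] φ (z.1, y) := by
      ext y; rw [← ih]; rfl
    change deriv (fun y => iteratedDeriv n (fun y => φ (z.1, y)) y) z.2 = _
    rw [this]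
    have h1 := ((h.iter_dirD (0, 1) n).hasFDerivAt z).comp_hasDerivAt z.2
      ((hasDerivAt_const z.2 z.1).prodMk (hasDerivAt_id z.2))
    exact h1.deriv

lemma IsTest.reflect {φ : ℝ × ℝ → ℝ} (h : IsTest φ) (p : ℝ × ℝ) : IsTest (fun z => φ (p - z)) := by
  refine ⟨h.1.comp (contDiff_const.sub contDiff_id), ?_⟩
  exact h.2.comp_homeomorph (Homeomorph.subLeft p)

lemma IsTest.dirD_reflect {φ : ℝ × ℝ → ℝ} (h : IsTest φ) (p e : ℝ × ℝ) :
    KPI.dirD e (fun z => φ (p - z)) = fun z => -KPI.dirD e φ (p - z) := by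
  ext z
  have h1 := (h.hasFDerivAt (p - z)).comp z ((hasFDerivAt_id z).const_sub p)
  change fderiv ℝ (φ ∘ (HSub.hSub p)) z e = _
  rw [h1.fderiv]; simp [KPI.dirD]

lemma IsTest.iter_dirD_reflect {φ : ℝ × ℝ → ℝ} (h : IsTest φ) (p e : ℝ × ℝ) (n : ℕ) :
    (KPI.dirD e)^[n] (fun z => φ (p - z)) = fun z => (-1) ^ n * (KPI.dirD e)^[n] φ (p - z) := by
  induction n with
  | zero => simp
  | succ n ih =>
    rw [Function.iterate_succ_apply', ih, Function.iterate_succ_apply']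
    have h2 := (h.iter_dirD e n).dirD_reflect p e
    ext z
    have h3 := ((((h.iter_dirD e n).reflect p)).hasFDerivAt z).const_mul ((-1 : ℝ) ^ n)
    have h4 : KPI.dirD e (fun z => (-1) ^ n * (KPI.dirD e)^[n] φ (p - z)) z =
        (-1) ^ n * KPI.dirD e (fun z => (KPI.dirD e)^[n] φ (p - z)) z := by
      unfold KPI.dirD at h3 ⊢
      rw [h3.fderiv]; simp
    rw [h4, h2]; ring

lemma abs_sub_le_of_abs_deriv_le {f f' : ℝ → ℝ} (hf : ∀ s, HasDerivAt f (f' s) s) {B : ℝ} (hB : ∀ s, |f' s| ≤ B)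
    (x y : ℝ) : |f y - f x| ≤ B * |y - x| := by
  have := Convex.norm_image_sub_le_of_norm_hasDerivWithin_le (f := f) (f' := f') (s := univ) (C := B)
    (fun x _ => (hf x).hasDerivWithinAt) (fun x _ => hB x) convex_univ (mem_univ x) (mem_univ y)
  simpa using this

/-- Landau's inequality with parameter `η`. -/
lemma abs_deriv_le_landau {f f' f'' : ℝ → ℝ} (hf : ∀ s, HasDerivAt f (f' s) s)
    (hf' : ∀ s, HasDerivAt f' (f'' s) s) {A B η : ℝ} (hη : 0 < η) (hA : ∀ s, |f s| ≤ A) (hB : ∀ s, |f'' s| ≤ B)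
    (s : ℝ) : |f' s| ≤ 2 * A / η + η * B := by
  -- At some ξ in (s, s + η) the derivative equals the mean slope, at most 2A/η; between ξ and s it
  -- changes by at most ηB.
  obtain ⟨ξ, ⟨h1, h2⟩, h3⟩ := exists_hasDerivAt_eq_slope f f' (show s < s + η by linarith)
    (continuous_iff_continuousAt.2 fun x => (hf x).continuousAt).continuousOn (fun x _ => hf x)
  rw [add_sub_cancel_left] at h3
  have e1 : |f' ξ| ≤ 2 * A / η := by
    rw [h3, abs_div, abs_of_pos hη]
    gcongr
    refine (abs_sub _ _).trans ?_
    linarith [hA (s + η), hA s]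
  have e2 := abs_sub_le_of_abs_deriv_le hf' hB ξ s
  have e3 : |s - ξ| ≤ η := by rw [abs_le]; constructor <;> linarith
  have hB0 : 0 ≤ B := (abs_nonneg _).trans (hB 0)
  have e4 : |f' s| ≤ |f' ξ| + |f' s - f' ξ| := by
    have := abs_add_le (f' ξ) (f' s - f' ξ)
    rwa [add_sub_cancel] at this
  nlinarith [mul_le_mul_of_nonneg_left e3 hB0]

/-- A bounded solution of `c - 2c'' + c'''' = b` has derivatives bounded in terms of `c` and `b`. -/
lemma abs_derivs_le_of_bessel {c : ℕ → ℝ → ℝ} (hc : ∀ n s, HasDerivAt (c n) (c (n + 1) s) s)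
    (hbd : ∀ n, ∃ B, ∀ s, |c n s| ≤ B) {A : ℝ} (hA : ∀ s, |c 0 s| ≤ A)
    (hb : ∀ s, |c 0 s - 2 * c 2 s + c 4 s| ≤ A) (n : ℕ) (hn : n ≤ 4) (s : ℝ) : |c n s| ≤ 10 ^ 6 * A := by
  -- The least upper bounds are finite by the qualitative hypothesis `hbd`, which is what permits
  -- absorbing them into the left sides below.
  have hS : ∀ n, ∃ S, (∀ s, |c n s| ≤ S) ∧ ∀ B, (∀ s, |c n s| ≤ B) → S ≤ B := fun n => by
    obtain ⟨B, hB⟩ := hbd n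
    have : BddAbove (range fun s => |c n s|) := ⟨B, by rintro _ ⟨s, rfl⟩; exact hB s⟩
    exact ⟨⨆ s, |c n s|, fun s => le_ciSup this s, fun B hB => ciSup_le hB⟩
  obtain ⟨S1, a1, b1⟩ := hS 1
  obtain ⟨S2, a2, b2⟩ := hS 2
  obtain ⟨S3, a3, b3⟩ := hS 3
  obtain ⟨S4, a4, b4⟩ := hS 4
  have hA0 : 0 ≤ A := (abs_nonneg _).trans (hA 0)
  have hS2 : 0 ≤ S2 := (abs_nonneg _).trans (a2 0)
  have i4 : S4 ≤ A + A + 2 * S2 := b4 _ fun s => by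
    have := hb s; have := hA s; have := a2 s
    rw [abs_le] at *
    constructor <;> linarith [this.1, this.2]
  have i3 : S3 ≤ 2 * S2 / 1 + 1 * S4 := b3 _ (abs_deriv_le_landau (hc 2) (hc 3) one_pos a2 a4)
  -- The lengths 1/16 and 1/128 make S2 return with coefficient 4/16 + 32/128 = 1/2 after S1, S3 and
  -- S4 are eliminated.
  have i2 : S2 ≤ 2 * S1 / (1 / 16) + (1 / 16) * S3 := b2 _ (abs_deriv_le_landau (hc 1) (hc 2) (by norm_num) a1 a3)
  have i1 : S1 ≤ 2 * A / (1 / 128) + (1 / 128) * S2 := b1 _ (abs_deriv_le_landau (hc 0) (hc 1) (by norm_num) hA a2)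
  norm_num at i1 i2 i3 i4
  interval_cases n
  · linarith [hA s]
  · linarith [a1 s]
  · linarith [a2 s]
  · linarith [a3 s]
  · linarith [a4 s]

/-- Differences commute with differentiation, so the mean value theorem can be applied j times, each
time trading one difference for a derivative and a factor h. -/
lemma abs_fwdDiff_iter_le {c : ℕ → ℝ → ℝ} (hc : ∀ n s, HasDerivAt (c n) (c (n + 1) s) s) {h : ℝ} (hh : 0 ≤ h)
    (j : ℕ) : ∀ (n : ℕ) (M : ℝ), (∀ s, |c (n + j) s| ≤ M) → ∀ s, |Δ_[h] ^[j] (c n) s| ≤ h ^ j * M := by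
  have hder : ∀ (j n : ℕ) (s : ℝ), HasDerivAt (Δ_[h] ^[j] (c n)) (Δ_[h] ^[j] (c (n + 1)) s) s := by
    intro j
    induction j with
    | zero => exact hc
    | succ j ih =>
      intro n s
      rw [Function.iterate_succ_apply', Function.iterate_succ_apply']
      exact ((ih n (s + h)).comp_add_const s h).sub (ih n s)
  induction j with
  | zero => intro n M hM s; simpa using hM s
  | succ j ih =>
    intro n M hM s
    rw [Function.iterate_succ_apply']
    have h1 : ∀ s, |Δ_[h] ^[j] (c (n + 1)) s| ≤ h ^ j * M := ih (n + 1) M (by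
      intro s; have := hM s; rwa [show n + 1 + j = n + (j + 1) by ring])
    have := abs_sub_le_of_abs_deriv_le (hder j n) h1 s (s + h)
    rw [add_sub_cancel_left, abs_of_nonneg hh] at this
    change |Δ_[h] ^[j] (c n) (s + h) - Δ_[h] ^[j] (c n) s| ≤ _
    refine this.trans (le_of_eq (by ring))

/-- The weak form of `(1 - ∂_e²)² f = g`. -/
def WeakBessel (e : ℝ × ℝ) (f g : ℝ × ℝ → ℝ) : Prop :=
  ∀ φ, IsTest φ → ∫ z, f z * (φ z - 2 * (dirD e)^[2] φ z + (dirD e)^[4] φ z) = ∫ z, g z * φ z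

/-- Finite differences of a function with four weak derivatives in `L²`. -/
theorem eLpNorm_fwdDiff_le {e : ℝ × ℝ} {f g : ℝ × ℝ → ℝ} (hf : MemLp f 2 volume) (hg : MemLp g 2 volume)
    (hw : WeakBessel e f g) : ∃ C : ℝ, 0 ≤ C ∧ ∀ h : ℝ, 0 ≤ h → ∀ j ≤ 4,
      eLpNorm (Δ_[h • e] ^[j] f) 2 volume ≤ ENNReal.ofReal (C * h ^ j) := by
  set N := max (eLpNorm f 2 volume).toReal (eLpNorm g 2 volume).toReal with hN
  have hN0 : 0 ≤ N := le_max_of_le_left ENNReal.toReal_nonneg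
  have hfl : LocallyIntegrable f volume := hf.locallyIntegrable (by norm_num)
  have htr : ∀ v : ℝ × ℝ, MemLp (fun z => f (z + v)) 2 volume := fun v =>
    hf.comp_measurePreserving (measurePreserving_add_right volume v)
  refine ⟨10 ^ 6 * N, by positivity, fun h hh j hj => ?_⟩
  have hsum : Δ_[h • e] ^[j] f = ∑ k ∈ Finset.range (j + 1), fun z => ((-1 : ℤ) ^ (j - k) * j.choose k) • f (z + k • h • e) := by
    ext z; rw [fwdDiff_iter_eq_sum_shift, Finset.sum_apply]
  have hmem : MemLp (Δ_[h • e] ^[j] f) 2 volume := by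
    rw [hsum]
    refine memLp_finsetSum' _ fun k _ => ?_
    have := (htr (k • h • e)).const_mul (((-1 : ℤ) ^ (j - k) * j.choose k : ℤ) : ℝ)
    simpa only [zsmul_eq_mul] using this
  rw [← ENNReal.ofReal_toReal hmem.2.ne]
  apply ENNReal.ofReal_le_ofReal
  apply eLpNorm_le_of_test hmem
  intro ψ hψ
  -- the reflected test function
  set φ : ℝ × ℝ → ℝ := fun z => ψ (0 - z) with hφ
  have hφt : IsTest φ := hψ.reflect 0
  have hφψ : ∀ z, φ (0 - z) = ψ z := fun z => by simp [hφ]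
  set m := (eLpNorm ψ 2 volume).toReal with hm
  have hm0 : 0 ≤ m := ENNReal.toReal_nonneg
  set conv : (ℝ × ℝ → ℝ) → ℝ × ℝ → ℝ := fun η p => ∫ z, f z * η (p - z) with hconv
  have hrefl : ∀ p, MemLp (fun z => φ (p - z)) 2 volume ∧
      (eLpNorm (fun z => φ (p - z)) 2 volume).toReal = m := fun p => by
    have hmp : MeasurePreserving (fun z : ℝ × ℝ => z - p) volume volume := measurePreserving_sub_right volume p
    have h1 : (fun z => φ (p - z)) = ψ ∘ (fun z => z - p) := by ext z; simp [hφ]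
    rw [h1]
    exact ⟨hψ.memLp.comp_measurePreserving hmp, by
      rw [eLpNorm_comp_measurePreserving hψ.memLp.1 hmp]⟩
  -- The weak equation becomes an ordinary one along the line s ↦ s • e: pairing f with translated
  -- test functions gives smooth bounded functions of s with c₀ - 2c₂ + c₄ equal to the pairing of
  -- g.
  set c : ℕ → ℝ → ℝ := fun n s => conv ((dirD e)^[n] φ) (s • e) with hc
  have hder : ∀ n s, HasDerivAt (c n) (c (n + 1) s) s := by
    intro n s
    have ht := hφt.iter_dirD e n
    have h1 := ht.2.hasFDerivAt_convolution_right (ContinuousLinearMap.mul ℝ ℝ) (μ := volume) hfl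
      (ht.1.of_le (by simp)) (s • e)
    have h2 := h1.comp_hasDerivAt s ((hasDerivAt_id s).smul_const e)
    rw [one_smul, convolution_precompR_apply (ContinuousLinearMap.mul ℝ ℝ) hfl (ht.2.fderiv ℝ)
      (ht.1.continuous_fderiv (by simp))] at h2
    simp only [hc, hconv]
    rw [Function.iterate_succ_apply']
    exact h2
  have hbd : ∀ n, ∃ B, ∀ s, |c n s| ≤ B := by
    intro n
    have ht := hφt.iter_dirD e n
    refine ⟨(eLpNorm f 2 volume).toReal * (eLpNorm (fun z => (dirD e)^[n] φ (0 - z)) 2 volume).toReal, fun s => ?_⟩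
    have hmp : MeasurePreserving (fun z : ℝ × ℝ => z - s • e) volume volume := measurePreserving_sub_right volume _
    have e1 : (fun z => (dirD e)^[n] φ (s • e - z)) = (fun z => (dirD e)^[n] φ (0 - z)) ∘ (fun z => z - s • e) := by
      ext z; simp
    have h1 := abs_integral_mul_le hf (ht.reflect (s • e)).memLp
    rwa [e1, eLpNorm_comp_measurePreserving (ht.reflect 0).memLp.1 hmp] at h1
  have hA : ∀ s, |c 0 s| ≤ N * m := fun s => by
    have h1 := abs_integral_mul_le hf (hrefl (s • e)).1
    rw [(hrefl (s • e)).2] at h1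
    exact h1.trans (mul_le_mul_of_nonneg_right (le_max_left _ _) hm0)
  have hb : ∀ s, |c 0 s - 2 * c 2 s + c 4 s| ≤ N * m := fun s => by
    have h1 := abs_integral_mul_le hg (hrefl (s • e)).1
    rw [(hrefl (s • e)).2] at h1
    have h2 := hw _ (hφt.reflect (s • e))
    rw [hφt.iter_dirD_reflect, hφt.iter_dirD_reflect] at h2
    have hint : ∀ n, Integrable (fun z => f z * (dirD e)^[n] φ (s • e - z)) := fun n =>
      hf.integrable_mul ((hφt.iter_dirD e n).reflect (s • e)).memLp
    have h3 : c 0 s - 2 * c 2 s + c 4 s = ∫ z, g z * φ (s • e - z) := by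
      rw [← h2]
      simp only [hc, hconv]
      rw [← integral_const_mul, ← integral_sub (hint 0) ((hint 2).const_mul 2)]
      refine (integral_add ((hint 0).sub ((hint 2).const_mul 2)) (hint 4)).symm.trans ?_
      congr 1; ext z; simp; ring
    rw [h3]
    exact h1.trans (mul_le_mul_of_nonneg_right (le_max_right _ _) hm0)
  have hfin := abs_derivs_le_of_bessel hder hbd hA hb
  have h1 := abs_fwdDiff_iter_le hder hh j 0 _ (fun s => by simpa using hfin j hj s) 0
  -- Translations pass from f to the test function, so the pairing of a difference of f is a
  -- difference of c₀ at 0, already bounded through its derivatives.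
  have h2 : ∫ z, Δ_[h • e] ^[j] f z * ψ z = Δ_[h] ^[j] (c 0) 0 := by
    rw [fwdDiff_iter_eq_sum_shift]
    simp only [fwdDiff_iter_eq_sum_shift, Finset.sum_mul]
    rw [integral_finsetSum]
    · refine Finset.sum_congr rfl fun k _ => ?_
      simp only [zsmul_eq_mul, mul_assoc]
      rw [integral_const_mul]
      congr 1
      simp only [hc, hconv]
      refine Eq.trans ?_ (integral_add_right_eq_self _ (k • h • e))
      congr 1; ext z
      simp only [Function.iterate_zero, id, hφ]
      congr 2
      rw [zero_add, smul_assoc]; abel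
    · intro k _
      simp only [zsmul_eq_mul, mul_assoc]
      exact ((htr _).integrable_mul hψ.memLp).const_mul _
  rw [h2]
  refine h1.trans (le_of_eq (by ring))

/-! ### Weighted L¹ bounds for differences of the potential. -/

lemma lintegral_enorm_mul_le {α : Type*} [MeasurableSpace α] {μ : Measure α} {f g : α → ℝ}
    (hf : AEStronglyMeasurable f μ) (hg : AEStronglyMeasurable g μ) :
    ∫⁻ x, ‖f x‖ₑ * ‖g x‖ₑ ∂μ ≤ eLpNorm f 2 μ * eLpNorm g 2 μ := by
  have h := ENNReal.lintegral_mul_le_Lp_mul_Lq μ Real.HolderConjugate.two_two hf.enorm hg.enorm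
  refine h.trans (le_of_eq ?_)
  rw [eLpNorm_eq_lintegral_rpow_enorm_toReal (by norm_num) (by norm_num),
    eLpNorm_eq_lintegral_rpow_enorm_toReal (by norm_num) (by norm_num)]
  norm_num

/-- The square-integrable weight `(1 + x²)^{-3/8} (1 + y²)^{-3/8}`. -/
def kap (z : ℝ × ℝ) : ℝ := (1 + z.1 ^ 2) ^ (-(3 / 8) : ℝ) * (1 + z.2 ^ 2) ^ (-(3 / 8) : ℝ)

lemma continuous_one_add_sq_rpow (r : ℝ) : Continuous fun x : ℝ => (1 + x ^ 2) ^ r :=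
  (by fun_prop : Continuous fun x : ℝ => 1 + x ^ 2).rpow_const fun x => Or.inl (by positivity)

lemma continuous_kap : Continuous kap :=
  ((continuous_one_add_sq_rpow _).comp continuous_fst).mul ((continuous_one_add_sq_rpow _).comp continuous_snd)

lemma memLp_kap : MemLp kap 2 volume := by
  rw [memLp_two_iff_integrable_sq continuous_kap.aestronglyMeasurable]
  have h1 : Integrable (fun x : ℝ => (1 + x ^ 2) ^ (-(3 / 4) : ℝ)) := by
    have := integrable_rpow_neg_one_add_norm_sq (E := ℝ) (μ := volume) (r := 3 / 2) (by simp; norm_num)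
    simp only [Real.norm_eq_abs, sq_abs] at this
    convert this using 3; norm_num
  have h2 : (fun z : ℝ × ℝ => kap z ^ 2) = fun z => (1 + z.1 ^ 2) ^ (-(3 / 4) : ℝ) * (1 + z.2 ^ 2) ^ (-(3 / 4) : ℝ) := by
    ext z
    have hx : 0 ≤ 1 + z.1 ^ 2 := by positivity
    have hy : 0 ≤ 1 + z.2 ^ 2 := by positivity
    have e : ∀ a : ℝ, 0 ≤ a → (a ^ (-(3 / 8) : ℝ)) ^ 2 = a ^ (-(3 / 4) : ℝ) := fun a ha => by
      rw [← Real.rpow_natCast, ← Real.rpow_mul ha]; norm_num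
    rw [kap, mul_pow, e _ hx, e _ hy]
  rw [h2]
  exact h1.mul_prod h1

/-- Interpolation between an `L²` bound and a weighted `L²` bound, with an `L¹` conclusion. -/
lemma lintegral_weight_le_of_interp {f W ω : ℝ × ℝ → ℝ} (hf : AEStronglyMeasurable f volume) (hW : Continuous W)
    (hW0 : ∀ z, 0 ≤ W z) {A ε θ Kc : ℝ} (hA : 0 ≤ A) (hε : 0 < ε) (hθ0 : 0 ≤ θ) (hθ1 : θ ≤ 1) (hK : 0 ≤ Kc)
    (h1 : eLpNorm f 2 volume ≤ ENNReal.ofReal (A * ε))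
    (h2 : eLpNorm (fun z => W z * f z) 2 volume ≤ ENNReal.ofReal A)
    (hω : ∀ z, ω z ≤ Kc * W z ^ θ * kap z) :
    ∫⁻ z, ENNReal.ofReal (ω z) * ‖f z‖ₑ ≤
      ENNReal.ofReal (2 * Kc * (eLpNorm kap 2 volume).toReal * A * ε ^ (1 - θ)) := by
  have hkap : ∀ z, 0 ≤ kap z := fun z => by unfold kap; positivity
  -- The combination (1 + εW)f has L² norm at most 2Aε and dominates ε^θ W^θ |f|; one Cauchy–Schwarz
  -- against `kap` then gives the L¹ bound.
  set g : ℝ × ℝ → ℝ := fun z => f z + ε * (W z * f z) with hg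
  have hWf : AEStronglyMeasurable (fun z => ε * (W z * f z)) volume :=
    (hW.aestronglyMeasurable.mul hf).const_mul ε
  have hgm : AEStronglyMeasurable g volume := hf.add hWf
  have hgn : eLpNorm g 2 volume ≤ ENNReal.ofReal (2 * A * ε) := by
    have e1 : eLpNorm (fun z => ε * (W z * f z)) 2 volume ≤ ENNReal.ofReal (A * ε) := by
      have := eLpNorm_const_smul ε (fun z => W z * f z) 2 (volume : Measure (ℝ × ℝ))
      have e2 : (ε • fun z => W z * f z) = fun z => ε * (W z * f z) := by ext z; simp
      rw [e2] at this
      rw [this, Real.enorm_of_nonneg hε.le, mul_comm A, ENNReal.ofReal_mul hε.le]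
      gcongr
    refine (eLpNorm_add_le hf hWf (by norm_num)).trans ((add_le_add h1 e1).trans ?_)
    rw [← ENNReal.ofReal_add (by positivity) (by positivity)]
    apply ENNReal.ofReal_le_ofReal; linarith
  have hpt : ∀ z, ENNReal.ofReal (ω z) * ‖f z‖ₑ ≤ ENNReal.ofReal (Kc * ε ^ (-θ)) * (‖kap z‖ₑ * ‖g z‖ₑ) := by
    intro z
    have hWz := hW0 z
    rw [← ofReal_norm, ← ofReal_norm, ← ofReal_norm, ← ENNReal.ofReal_mul (norm_nonneg _),
      ← ENNReal.ofReal_mul' (norm_nonneg (f z)), ← ENNReal.ofReal_mul (by positivity)]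
    apply ENNReal.ofReal_le_ofReal
    have e1 : ‖g z‖ = (1 + ε * W z) * ‖f z‖ := by
      have : g z = (1 + ε * W z) * f z := by simp only [hg]; ring
      rw [this, norm_mul, Real.norm_of_nonneg (by positivity)]
    rw [e1, Real.norm_of_nonneg (hkap z)]
    have e2 : ε ^ θ * W z ^ θ ≤ 1 + ε * W z := by
      rw [← Real.mul_rpow hε.le hWz]
      have hz : 0 ≤ ε * W z := by positivity
      rcases le_total (ε * W z) 1 with h | h
      · have := Real.rpow_le_one hz h hθ0; linarith
      · have := Real.rpow_le_rpow_of_exponent_le h hθ1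
        rw [Real.rpow_one] at this; linarith
    have e3 : ε ^ (-θ) * ε ^ θ = 1 := by rw [← Real.rpow_add hε]; simp
    have e4 : W z ^ θ ≤ ε ^ (-θ) * (1 + ε * W z) := by
      calc W z ^ θ = ε ^ (-θ) * (ε ^ θ * W z ^ θ) := by rw [← mul_assoc, e3, one_mul]
        _ ≤ _ := by gcongr
    have hkz := hkap z
    calc ω z * ‖f z‖ ≤ (Kc * W z ^ θ * kap z) * ‖f z‖ := by gcongr; exact hω z
      _ ≤ (Kc * (ε ^ (-θ) * (1 + ε * W z)) * kap z) * ‖f z‖ := by gcongr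
      _ = _ := by ring
  calc ∫⁻ z, ENNReal.ofReal (ω z) * ‖f z‖ₑ
      ≤ ∫⁻ z, ENNReal.ofReal (Kc * ε ^ (-θ)) * (‖kap z‖ₑ * ‖g z‖ₑ) := lintegral_mono hpt
    _ = ENNReal.ofReal (Kc * ε ^ (-θ)) * ∫⁻ z, ‖kap z‖ₑ * ‖g z‖ₑ := by
        rw [lintegral_const_mul' _ _ ENNReal.ofReal_ne_top]
    _ ≤ ENNReal.ofReal (Kc * ε ^ (-θ)) * (eLpNorm kap 2 volume * eLpNorm g 2 volume) := by
        gcongr; exact lintegral_enorm_mul_le continuous_kap.aestronglyMeasurable hgm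
    _ ≤ ENNReal.ofReal (Kc * ε ^ (-θ)) * (ENNReal.ofReal (eLpNorm kap 2 volume).toReal * ENNReal.ofReal (2 * A * ε)) := by
        rw [ENNReal.ofReal_toReal memLp_kap.2.ne]; gcongr
    _ = _ := by
        rw [← ENNReal.ofReal_mul ENNReal.toReal_nonneg, ← ENNReal.ofReal_mul (by positivity)]
        congr 1
        rw [show (1 - θ) = -θ + 1 by ring, Real.rpow_add hε, Real.rpow_one]; ring

/-- The weight `(1 + x²)² (1 + y²)²`. -/
def wgt (z : ℝ × ℝ) : ℝ := (1 + z.1 ^ 2) ^ 2 * (1 + z.2 ^ 2) ^ 2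

lemma continuous_wgt : Continuous wgt := by unfold wgt; fun_prop

lemma wgt_nonneg (z : ℝ × ℝ) : 0 ≤ wgt z := by unfold wgt; positivity

lemma wgt_shift_le (z v : ℝ × ℝ) (h1 : |v.1| ≤ 4) (h2 : |v.2| ≤ 4) : wgt (z - v) ≤ 34 ^ 4 * wgt z := by
  have aux : ∀ x t : ℝ, |t| ≤ 4 → 1 + (x - t) ^ 2 ≤ 34 * (1 + x ^ 2) := by
    intro x t ht
    have := abs_le.1 ht
    nlinarith [sq_nonneg (x + t), sq_nonneg x]
  have e1 := aux z.1 v.1 h1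
  have e2 := aux z.2 v.2 h2
  simp only [wgt, Prod.fst_sub, Prod.snd_sub]
  calc (1 + (z.1 - v.1) ^ 2) ^ 2 * (1 + (z.2 - v.2) ^ 2) ^ 2
      ≤ (34 * (1 + z.1 ^ 2)) ^ 2 * (34 * (1 + z.2 ^ 2)) ^ 2 := by gcongr
    _ = _ := by ring

/-- Translations by at most four steps of length at most 1 change `wgt` by a bounded factor.
Carrying the translate m • v through the induction is what makes the difference operator split into
two terms of the same form. -/
lemma eLpNorm_wgt_fwdDiff_le {u : ℝ × ℝ → ℝ} {B : ℝ≥0∞} (hu : AEStronglyMeasurable u volume)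
    (hB : eLpNorm (fun z => wgt z * u z) 2 volume ≤ B) {v : ℝ × ℝ} (h1 : |v.1| ≤ 1) (h2 : |v.2| ≤ 1) (j : ℕ) :
    ∀ m : ℕ, m + j ≤ 4 → eLpNorm (fun z => wgt z * Δ_[v] ^[j] u (z + m • v)) 2 volume ≤
      2 ^ j * (34 ^ 4 * B) := by
  have hm : ∀ (j : ℕ) (w : ℝ × ℝ), AEStronglyMeasurable (fun z => Δ_[v] ^[j] u (z + w)) volume := by
    intro j
    induction j with
    | zero =>
      intro w
      exact hu.comp_measurePreserving (measurePreserving_add_right volume w)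
    | succ j ih =>
      intro w
      have := (ih (w + v)).sub (ih w)
      simp only [Function.iterate_succ_apply', fwdDiff]
      refine this.congr (Eventually.of_forall fun z => ?_)
      simp [add_assoc]
  induction j with
  | zero =>
    intro m hm4
    have hmp : MeasurePreserving (fun z : ℝ × ℝ => z + m • v) volume volume := measurePreserving_add_right volume _
    have hm' : (m : ℝ) ≤ 4 := by exact_mod_cast (by simpa using hm4)
    have e1 : (fun z => wgt z * u (z + m • v)) = (fun z => wgt (z - m • v) * u z) ∘ (fun z => z + m • v) := by
      ext z; simp
    have hc : Continuous fun z : ℝ × ℝ => wgt (z - m • v) := continuous_wgt.comp (by fun_prop)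
    simp only [Function.iterate_zero, id, pow_zero, one_mul]
    have hmm : AEStronglyMeasurable (fun z => wgt (z - m • v) * u z) volume := hc.aestronglyMeasurable.mul hu
    rw [e1, eLpNorm_comp_measurePreserving hmm hmp]
    have e2 : eLpNorm (fun z => wgt (z - m • v) * u z) 2 volume ≤
        eLpNorm (((34 : ℝ) ^ 4) • fun z => wgt z * u z) 2 volume := by
      refine eLpNorm_mono fun z => ?_
      have a1 : |(m • v).1| ≤ 4 := by
        change |m • v.1| ≤ 4
        rw [nsmul_eq_mul, abs_mul, Nat.abs_cast]
        nlinarith [abs_nonneg v.1, (Nat.cast_nonneg m : (0:ℝ) ≤ m)]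
      have a2 : |(m • v).2| ≤ 4 := by
        change |m • v.2| ≤ 4
        rw [nsmul_eq_mul, abs_mul, Nat.abs_cast]
        nlinarith [abs_nonneg v.2, (Nat.cast_nonneg m : (0:ℝ) ≤ m)]
      have := wgt_shift_le z (m • v) a1 a2
      simp only [Pi.smul_apply, smul_eq_mul, norm_mul, Real.norm_of_nonneg (wgt_nonneg _)]
      rw [← mul_assoc]
      gcongr
      rwa [Real.norm_of_nonneg (by positivity)]
    refine e2.trans ?_
    rw [eLpNorm_const_smul]
    gcongr
    rw [Real.enorm_of_nonneg (by positivity)]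
    norm_num
  | succ j ih =>
    intro m hm4
    have e1 : (fun z => wgt z * Δ_[v] ^[j + 1] u (z + m • v)) =
        (fun z => wgt z * Δ_[v] ^[j] u (z + (m + 1) • v)) - fun z => wgt z * Δ_[v] ^[j] u (z + m • v) := by
      ext z
      simp only [Function.iterate_succ_apply', fwdDiff, Pi.sub_apply, add_smul, one_smul, add_assoc]
      ring
    rw [e1]
    refine (eLpNorm_sub_le (continuous_wgt.aestronglyMeasurable.mul (hm _ _))
      (continuous_wgt.aestronglyMeasurable.mul (hm _ _)) (by norm_num)).trans ?_
    refine (add_le_add (ih (m + 1) (by omega)) (ih m (by omega))).trans (le_of_eq ?_)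
    rw [pow_succ]; ring

/-- The Leibniz rule has a single lower-order term because second differences of an additive
function vanish. -/
lemma fwdDiff_iter_mul_additive (ℓ : ℝ × ℝ →+ ℝ) (v : ℝ × ℝ) (u : ℝ × ℝ → ℝ) (n : ℕ) (z : ℝ × ℝ) :
    Δ_[v] ^[n + 1] (fun z => ℓ z * u z) z =
      (ℓ z + (n + 1) * ℓ v) * Δ_[v] ^[n + 1] u z + (n + 1) * ℓ v * Δ_[v] ^[n] u z := by
  induction n generalizing z with
  | zero => simp [fwdDiff]; ring
  | succ n ih =>
    rw [Function.iterate_succ_apply']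
    simp only [fwdDiff, ih]
    rw [Function.iterate_succ_apply' (f := fwdDiff v) (n := n + 1)]
    simp only [fwdDiff, map_add]
    rw [Function.iterate_succ_apply' (f := fwdDiff v) (n := n)]
    simp only [fwdDiff]
    push_cast; ring

lemma fwdDiff_iter_mul_invariant {w : ℝ × ℝ → ℝ} {v : ℝ × ℝ} (hw : ∀ z, w (z + v) = w z) (u : ℝ × ℝ → ℝ) (n : ℕ)
    (z : ℝ × ℝ) : Δ_[v] ^[n] (fun z => w z * u z) z = w z * Δ_[v] ^[n] u z := by
  induction n generalizing z with
  | zero => rfl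
  | succ n ih =>
    rw [Function.iterate_succ_apply', Function.iterate_succ_apply']
    simp only [fwdDiff, ih, hw]; ring

/-- Quantitative regularity and decay of the potential, expressed through finite differences. -/
structure IsNice (u : ℝ × ℝ → ℝ) (C : ℝ) : Prop where
  meas : Measurable u
  slice : ∀ y, ∫⁻ x, ENNReal.ofReal (1 + x ^ 2) * ‖u (x, y)‖ₑ < ∞
  mom : ∫⁻ z : ℝ × ℝ, ENNReal.ofReal ((1 + z.1 ^ 2) * (1 + z.2 ^ 2)) * ‖u z‖ₑ ≤ ENNReal.ofReal C
  diffY : ∀ h : ℝ, 0 < h → h ≤ 1 → ∀ j : ℕ, j ≤ 4 →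
    ∫⁻ z : ℝ × ℝ, ‖Δ_[((0 : ℝ), h)] ^[j] u z‖ₑ ≤ ENNReal.ofReal (C * h ^ (3 / 4 * j : ℝ))
  diffY_wgt : ∀ h : ℝ, 0 < h → h ≤ 1 → ∀ j : ℕ, j ≤ 4 →
    ∫⁻ z : ℝ × ℝ, ENNReal.ofReal ((1 + |z.1|) * (1 + |z.2|)) * ‖Δ_[((0 : ℝ), h)] ^[j] u z‖ₑ ≤
      ENNReal.ofReal (C * h ^ (1 / 2 * j : ℝ))
  diffX : ∀ h : ℝ, 0 < h → h ≤ 1 →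
    ∫⁻ z : ℝ × ℝ, ENNReal.ofReal (1 + z.2 ^ 2) * ‖Δ_[(h, (0 : ℝ))] ^[4] u z‖ₑ ≤
      ENNReal.ofReal (C * h ^ (13 / 4 : ℝ))
  diffX_mul : ∀ h : ℝ, 0 < h → h ≤ 1 →
    ∫⁻ z : ℝ × ℝ, ENNReal.ofReal (1 + z.2 ^ 2) * ‖Δ_[(h, (0 : ℝ))] ^[4] (fun z => z.1 * u z) z‖ₑ ≤
      ENNReal.ofReal (C * h ^ (9 / 4 : ℝ))

lemma sq_rpow {a : ℝ} (ha : 0 ≤ a) (θ : ℝ) : (a ^ 2) ^ θ = a ^ (2 * θ) := by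
  rw [← Real.rpow_natCast, ← Real.rpow_mul ha]; push_cast; rfl

lemma rpow_wgt_mul_kap (θ : ℝ) (z : ℝ × ℝ) :
    wgt z ^ θ * kap z = (1 + z.1 ^ 2) ^ (2 * θ - 3 / 8) * (1 + z.2 ^ 2) ^ (2 * θ - 3 / 8) := by
  have hx : 0 < 1 + z.1 ^ 2 := by positivity
  have hy : 0 < 1 + z.2 ^ 2 := by positivity
  rw [wgt, kap, Real.mul_rpow (by positivity) (by positivity), sq_rpow hx.le, sq_rpow hy.le, mul_mul_mul_comm,
    ← Real.rpow_add hx, ← Real.rpow_add hy]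
  rfl

lemma rpow_wgtX_mul_kap (θ : ℝ) (z : ℝ × ℝ) :
    ((1 + z.1 ^ 2) ^ 2) ^ θ * kap z = (1 + z.1 ^ 2) ^ (2 * θ - 3 / 8) * (1 + z.2 ^ 2) ^ (-(3 / 8) : ℝ) := by
  have hx : 0 < 1 + z.1 ^ 2 := by positivity
  rw [kap, sq_rpow hx.le, ← mul_assoc, ← Real.rpow_add hx]
  rfl

lemma one_add_abs_le (x : ℝ) : 1 + |x| ≤ 2 * (1 + x ^ 2) ^ (1 / 2 : ℝ) := by
  rw [← Real.sqrt_eq_rpow]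
  have h1 : 1 ≤ Real.sqrt (1 + x ^ 2) := Real.one_le_sqrt.2 (by nlinarith [sq_nonneg x])
  have h2 : |x| ≤ Real.sqrt (1 + x ^ 2) := Real.abs_le_sqrt (by linarith)
  linarith

lemma measurable_fwdDiff_iter {u : ℝ × ℝ → ℝ} (hu : Measurable u) (v : ℝ × ℝ) (n : ℕ) :
    Measurable (Δ_[v] ^[n] u) := by
  induction n with
  | zero => exact hu
  | succ n ih =>
    rw [Function.iterate_succ_apply']
    exact (ih.comp (measurable_add_const v)).sub ih

lemma IsTest.mul_sq {φ : ℝ × ℝ → ℝ} (h : IsTest φ) : IsTest (fun z => (1 + z.2 ^ 2) ^ 2 * φ z) := by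
  have hp : ContDiff ℝ (⊤ : ℕ∞) fun z : ℝ × ℝ => (1 + z.2 ^ 2) ^ 2 := by fun_prop
  refine ⟨ContDiff.mul (𝔸 := ℝ) hp h.1, ?_⟩
  exact h.2.mul_left

lemma dx_mul_sq (φ : ℝ × ℝ → ℝ) (n : ℕ) (z : ℝ × ℝ) :
    dx n (fun z => (1 + z.2 ^ 2) ^ 2 * φ z) z = (1 + z.2 ^ 2) ^ 2 * dx n φ z := by
  unfold dx
  exact iteratedDeriv_const_mul_field ((1 + z.2 ^ 2) ^ 2) (fun x => φ (x, z.2))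

/-- Each bound interpolates an L² bound h^j for the j-th difference with a weighted L² bound
independent of h. The moment bound is stated apart from the hypothesis on slices because it is what
shows that almost every slice is finite. -/
lemma exists_isNice_of_measurable {u : ℝ × ℝ → ℝ} (hm : Measurable u) (hu : MemH45 u) : ∃ C,
    ∫⁻ z : ℝ × ℝ, ENNReal.ofReal ((1 + z.1 ^ 2) * (1 + z.2 ^ 2)) * ‖u z‖ₑ ≤ ENNReal.ofReal C ∧
    ((∀ y, ∫⁻ x, ENNReal.ofReal (1 + x ^ 2) * ‖u (x, y)‖ₑ < ∞) → IsNice u C) := by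
  obtain ⟨hu2, hwu, ⟨v, hv, hv2⟩, ⟨v', hv', hv2'⟩⟩ := hu
  have hW : MemLp (fun z => wgt z * u z) 2 volume := by
    refine hwu.mono (continuous_wgt.measurable.mul hm).aestronglyMeasurable (Eventually.of_forall fun z => ?_)
    rw [norm_mul (wgt z), norm_mul (_ * _) (u z), Real.norm_of_nonneg (wgt_nonneg z),
      Real.norm_of_nonneg (r := (1 + z.1 ^ 2) ^ 2 * (1 + z.2 ^ 2) ^ (5 / 2 : ℝ)) (by positivity)]
    unfold wgt
    gcongr ?_ * ?_ * _
    rw [← Real.rpow_natCast]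
    exact Real.rpow_le_rpow_of_exponent_le (by nlinarith [sq_nonneg z.2]) (by norm_num)
  set B := (eLpNorm (fun z => wgt z * u z) 2 volume).toReal with hB
  have hB0 : 0 ≤ B := ENNReal.toReal_nonneg
  have hBe : eLpNorm (fun z => wgt z * u z) 2 volume ≤ ENNReal.ofReal B := by
    rw [hB, ENNReal.ofReal_toReal hW.2.ne]
  -- the weighted function for the `x` direction
  set f : ℝ × ℝ → ℝ := fun z => (1 + z.2 ^ 2) ^ 2 * u z with hf
  have hfm : Measurable f := by
    have : Measurable fun z : ℝ × ℝ => (1 + z.2 ^ 2) ^ 2 := by fun_prop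
    exact this.mul hm
  have hfL : MemLp f 2 volume := by
    refine hW.mono hfm.aestronglyMeasurable (Eventually.of_forall fun z => ?_)
    simp only [hf]
    rw [norm_mul _ (u z), norm_mul _ (u z), Real.norm_of_nonneg (by positivity), Real.norm_of_nonneg (wgt_nonneg z), wgt]
    have : 1 ≤ (1 + z.1 ^ 2) ^ 2 := one_le_pow₀ (by nlinarith [sq_nonneg z.1])
    have h2 : 0 ≤ (1 + z.2 ^ 2) ^ 2 * ‖u z‖ := by positivity
    nlinarith
  obtain ⟨Cx, hCx, Hx⟩ := eLpNorm_fwdDiff_le (e := (1, 0)) hfL hv2 (by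
    intro φ hφ
    rw [← hφ.dx_eq, ← hφ.dx_eq]
    have := hv _ hφ.mul_sq
    simp only [dx_mul_sq] at this
    convert this using 2
    · ext z; simp only [hf]; ring
    · ext z; ring)
  obtain ⟨Cy, hCy, Hy⟩ := eLpNorm_fwdDiff_le (e := (0, 1)) hu2 hv2' (by
    intro φ hφ
    rw [← hφ.dy_eq, ← hφ.dy_eq]
    exact hv' φ hφ)
  set A := Cx + Cy + 2 ^ 4 * (34 ^ 4 * B) with hA
  have hA0 : 0 ≤ A := by positivity
  have hWd : ∀ v : ℝ × ℝ, |v.1| ≤ 1 → |v.2| ≤ 1 → ∀ j ≤ 4,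
      eLpNorm (fun z => wgt z * Δ_[v] ^[j] u z) 2 volume ≤ ENNReal.ofReal A := by
    intro v h1 h2 j hj
    have := eLpNorm_wgt_fwdDiff_le hm.aestronglyMeasurable hBe h1 h2 j 0 (by omega)
    simp only [zero_smul, add_zero] at this
    refine this.trans ?_
    have e1 : (2 : ℝ≥0∞) ^ j * (34 ^ 4 * ENNReal.ofReal B) = ENNReal.ofReal (2 ^ j * (34 ^ 4 * B)) := by
      rw [ENNReal.ofReal_mul (by positivity), ENNReal.ofReal_mul (by positivity), ENNReal.ofReal_pow (by norm_num),
        ENNReal.ofReal_pow (by norm_num)]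
      norm_num
    rw [e1]
    apply ENNReal.ofReal_le_ofReal
    have : (2 : ℝ) ^ j ≤ 2 ^ 4 := pow_le_pow_right₀ (by norm_num) hj
    have : (2 : ℝ) ^ j * (34 ^ 4 * B) ≤ 2 ^ 4 * (34 ^ 4 * B) := by gcongr
    linarith
  set κ := (eLpNorm kap 2 volume).toReal with hκ
  have hκ0 : 0 ≤ κ := ENNReal.toReal_nonneg
  have one_le : ∀ (t r : ℝ), 0 ≤ r → 1 ≤ (1 + t ^ 2) ^ r := fun t r hr =>
    Real.one_le_rpow (by nlinarith [sq_nonneg t]) hr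
  -- differences in `y`
  have HY : ∀ (h : ℝ), 0 < h → h ≤ 1 → ∀ j ≤ 4, ∀ (θ Kc : ℝ) (ω : ℝ × ℝ → ℝ), 0 ≤ θ → θ ≤ 1 → 0 ≤ Kc →
      (∀ z, ω z ≤ Kc * wgt z ^ θ * kap z) →
      ∫⁻ z, ENNReal.ofReal (ω z) * ‖Δ_[((0 : ℝ), h)] ^[j] u z‖ₑ ≤
        ENNReal.ofReal (2 * Kc * κ * A * h ^ ((1 - θ) * j)) := by
    intro h h0 h1 j hj θ Kc ω hθ0 hθ1 hKc hω
    have e1 := Hy h h0.le j hj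
    rw [show h • ((0 : ℝ), (1 : ℝ)) = (0, h) by simp] at e1
    have := lintegral_weight_le_of_interp (measurable_fwdDiff_iter hm _ _).aestronglyMeasurable continuous_wgt wgt_nonneg
      hA0 (pow_pos h0 j) hθ0 hθ1 hKc
      (e1.trans (ENNReal.ofReal_le_ofReal (by gcongr; linarith [show 0 ≤ 2 ^ 4 * (34 ^ 4 * B) by positivity])))
      (hWd (0, h) (by simp) (by simpa [abs_of_pos h0] using h1) j hj) hω
    rwa [← Real.rpow_natCast, ← Real.rpow_mul h0.le, mul_comm (j : ℝ)] at this
  -- differences in `x`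
  have HX : ∀ (h : ℝ), 0 < h → h ≤ 1 → ∀ j ≤ 4, ∀ (θ Kc : ℝ) (ω : ℝ × ℝ → ℝ), 0 ≤ θ → θ ≤ 1 → 0 ≤ Kc →
      (∀ z, 0 ≤ ω z) → (∀ z, ω z / (1 + z.2 ^ 2) ^ 2 ≤ Kc * ((1 + z.1 ^ 2) ^ 2) ^ θ * kap z) →
      ∫⁻ z, ENNReal.ofReal (ω z) * ‖Δ_[(h, (0 : ℝ))] ^[j] u z‖ₑ ≤
        ENNReal.ofReal (2 * Kc * κ * A * h ^ ((1 - θ) * j)) := by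
    intro h h0 h1 j hj θ Kc ω hθ0 hθ1 hKc hω0 hω
    have e1 := Hx h h0.le j hj
    rw [show h • ((1 : ℝ), (0 : ℝ)) = (h, 0) by simp] at e1
    have e2 : ∀ z, Δ_[(h, (0 : ℝ))] ^[j] f z = (1 + z.2 ^ 2) ^ 2 * Δ_[(h, (0 : ℝ))] ^[j] u z := fun z =>
      fwdDiff_iter_mul_invariant (w := fun z => (1 + z.2 ^ 2) ^ 2) (by simp) u j z
    have e3 := hWd (h, 0) (by simpa [abs_of_pos h0] using h1) (by simp) j hj
    have := lintegral_weight_le_of_interp (W := fun z : ℝ × ℝ => (1 + z.1 ^ 2) ^ 2)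
      (measurable_fwdDiff_iter hfm (h, 0) j).aestronglyMeasurable (by fun_prop) (fun z => by positivity)
      hA0 (pow_pos h0 j) hθ0 hθ1 hKc
      (e1.trans (ENNReal.ofReal_le_ofReal (by gcongr; linarith [show 0 ≤ 2 ^ 4 * (34 ^ 4 * B) by positivity])))
      (by
        refine le_trans (le_of_eq ?_) e3
        congr 1; ext z; rw [e2, wgt]; ring) hω
    rw [← Real.rpow_natCast, ← Real.rpow_mul h0.le, mul_comm (j : ℝ)] at this
    refine le_trans (le_of_eq ?_) this
    congr 1; ext z
    have hp : 0 < (1 + z.2 ^ 2) ^ 2 := by positivity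
    rw [e2, ← ofReal_norm, ← ofReal_norm, ← ENNReal.ofReal_mul (hω0 z), norm_mul, Real.norm_of_nonneg hp.le,
      ← ENNReal.ofReal_mul (div_nonneg (hω0 z) hp.le), ← mul_assoc, div_mul_cancel₀ _ hp.ne']
  have hmom : ∫⁻ z : ℝ × ℝ, ENNReal.ofReal ((1 + z.1 ^ 2) * (1 + z.2 ^ 2)) * ‖u z‖ₑ ≤ ENNReal.ofReal (100 * κ * A) := by
    have := HY 1 one_pos le_rfl 0 (by norm_num) 1 1 (fun z => (1 + z.1 ^ 2) * (1 + z.2 ^ 2)) (by norm_num) le_rfl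
      (by norm_num) (fun z => by
        rw [one_mul, rpow_wgt_mul_kap]
        gcongr <;> exact Real.self_le_rpow_of_one_le (by nlinarith [sq_nonneg z.1, sq_nonneg z.2]) (by norm_num))
    refine this.trans (ENNReal.ofReal_le_ofReal ?_)
    rw [Real.one_rpow]; nlinarith [mul_nonneg hκ0 hA0]
  refine ⟨100 * κ * A, hmom, fun hs => ⟨hm, hs, hmom, ?_, ?_, ?_, ?_⟩⟩
  · intro h h0 h1 j hj
    -- At θ = 1/4 the weight exponent 2θ - 3/8 = 1/8 is nonnegative, so no weight is lost, and h
    -- keeps the power 3j/4.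
    have := HY h h0 h1 j hj (1 / 4) 1 (fun z => 1) (by norm_num) (by norm_num) (by norm_num) (fun z => by
        rw [one_mul, rpow_wgt_mul_kap]
        exact one_le_mul_of_one_le_of_one_le (one_le _ _ (by norm_num)) (one_le _ _ (by norm_num)))
    simp only [ENNReal.ofReal_one, one_mul] at this
    refine this.trans (ENNReal.ofReal_le_ofReal ?_)
    rw [show (1 - 1 / 4 : ℝ) = 3 / 4 by norm_num]
    gcongr; norm_num
  · intro h h0 h1 j hj
    -- At θ = 1/2 the exponent 2θ - 3/8 = 5/8 covers one power of |x| and one of |y|.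
    have := HY h h0 h1 j hj (1 / 2) 4 (fun z => (1 + |z.1|) * (1 + |z.2|)) (by norm_num) (by norm_num) (by norm_num)
      (fun z => by
        rw [mul_assoc, rpow_wgt_mul_kap]
        have a : ∀ t : ℝ, 1 + |t| ≤ 2 * (1 + t ^ 2) ^ (2 * (1 / 2) - 3 / 8 : ℝ) := fun t =>
          (one_add_abs_le t).trans (by
            gcongr 2 * ?_
            exact Real.rpow_le_rpow_of_exponent_le (by nlinarith [sq_nonneg t]) (by norm_num))
        calc (1 + |z.1|) * (1 + |z.2|) ≤ (2 * (1 + z.1 ^ 2) ^ (2 * (1 / 2) - 3 / 8 : ℝ)) * (2 * (1 + z.2 ^ 2) ^ (2 * (1 / 2) - 3 / 8 : ℝ)) := by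
              gcongr <;> exact a _
          _ = _ := by ring)
    refine this.trans (ENNReal.ofReal_le_ofReal ?_)
    rw [show (1 - 1 / 2 : ℝ) = 1 / 2 by norm_num]
    gcongr; norm_num
  · intro h h0 h1
    -- θ = 3/16 just cancels the decay of `kap` in x, and 4(1 - θ) = 13/4. The weight in y was built
    -- into the differenced function.
    have := HX h h0 h1 4 le_rfl (3 / 16) 1 (fun z => 1 + z.2 ^ 2) (by norm_num) (by norm_num) (by norm_num)
      (fun z => by positivity) (fun z => by
        rw [one_mul, rpow_wgtX_mul_kap]
        have hy : 0 < 1 + z.2 ^ 2 := by positivity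
        have e1 : (1 + z.2 ^ 2) / (1 + z.2 ^ 2) ^ 2 = (1 + z.2 ^ 2) ^ (-1 : ℝ) := by
          rw [Real.rpow_neg_one]; field_simp
        rw [e1, show (2 * (3 / 16) - 3 / 8 : ℝ) = 0 by norm_num, Real.rpow_zero, one_mul]
        exact Real.rpow_le_rpow_of_exponent_le (by nlinarith [sq_nonneg z.2]) (by norm_num))
    refine this.trans (ENNReal.ofReal_le_ofReal ?_)
    rw [show ((1 - 3 / 16) * (4 : ℕ) : ℝ) = 13 / 4 by norm_num]
    gcongr; norm_num
  · intro h h0 h1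
    have e3 := HX h h0 h1 3 (by norm_num) (3 / 16) 1 (fun z => 1 + z.2 ^ 2) (by norm_num) (by norm_num) (by norm_num)
      (fun z => by positivity) (fun z => by
        rw [one_mul, rpow_wgtX_mul_kap]
        have hy : 0 < 1 + z.2 ^ 2 := by positivity
        have e1 : (1 + z.2 ^ 2) / (1 + z.2 ^ 2) ^ 2 = (1 + z.2 ^ 2) ^ (-1 : ℝ) := by
          rw [Real.rpow_neg_one]; field_simp
        rw [e1, show (2 * (3 / 16) - 3 / 8 : ℝ) = 0 by norm_num, Real.rpow_zero, one_mul]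
        exact Real.rpow_le_rpow_of_exponent_le (by nlinarith [sq_nonneg z.2]) (by norm_num))
    -- θ = 7/16 leaves exponent 1/2 in x, enough for one factor |x|, and 4(1 - θ) = 9/4.
    have e4 := HX h h0 h1 4 le_rfl (7 / 16) 8 (fun z => (1 + z.2 ^ 2) * (|z.1| + 4)) (by norm_num) (by norm_num) (by norm_num)
      (fun z => by positivity) (fun z => by
        rw [mul_assoc, rpow_wgtX_mul_kap]
        have hy : 0 < 1 + z.2 ^ 2 := by positivity
        have e1 : (1 + z.2 ^ 2) * (|z.1| + 4) / (1 + z.2 ^ 2) ^ 2 = (|z.1| + 4) * (1 + z.2 ^ 2) ^ (-1 : ℝ) := by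
          rw [Real.rpow_neg_one]; field_simp
        rw [e1, show (2 * (7 / 16) - 3 / 8 : ℝ) = 1 / 2 by norm_num, ← mul_assoc]
        gcongr
        · have := one_add_abs_le z.1
          have := abs_nonneg z.1
          linarith
        · nlinarith [sq_nonneg z.2]
        · norm_num)
    have hpt : ∀ z : ℝ × ℝ, ENNReal.ofReal (1 + z.2 ^ 2) * ‖Δ_[(h, (0 : ℝ))] ^[4] (fun z => z.1 * u z) z‖ₑ ≤
        ENNReal.ofReal ((1 + z.2 ^ 2) * (|z.1| + 4)) * ‖Δ_[(h, (0 : ℝ))] ^[4] u z‖ₑ +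
        ENNReal.ofReal (4 * h) * (ENNReal.ofReal (1 + z.2 ^ 2) * ‖Δ_[(h, (0 : ℝ))] ^[3] u z‖ₑ) := by
      intro z
      have := fwdDiff_iter_mul_additive (AddMonoidHom.fst ℝ ℝ) (h, 0) u 3 z
      simp only [AddMonoidHom.coe_fst] at this
      rw [this]
      simp only [← ofReal_norm]
      rw [← ENNReal.ofReal_mul (by positivity), ← ENNReal.ofReal_mul (by positivity), ← ENNReal.ofReal_mul (by positivity),
        ← ENNReal.ofReal_mul (by positivity), ← ENNReal.ofReal_add (by positivity) (by positivity)]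
      apply ENNReal.ofReal_le_ofReal
      set a := Δ_[(h, (0 : ℝ))] ^[3 + 1] u z
      set b := Δ_[(h, (0 : ℝ))] ^[3] u z
      have n1 : ‖(z.1 + ((3 : ℕ) + 1) * h) * a + ((3 : ℕ) + 1) * h * b‖ ≤ (|z.1| + 4) * ‖a‖ + 4 * h * ‖b‖ := by
        refine (norm_add_le _ _).trans ?_
        simp only [norm_mul, Real.norm_eq_abs]
        rw [abs_of_pos h0]
        have : |z.1 + ((3 : ℕ) + 1) * h| ≤ |z.1| + 4 := by
          refine (abs_add_le _ _).trans ?_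
          rw [abs_of_nonneg (by positivity : 0 ≤ (((3 : ℕ) : ℝ) + 1) * h)]
          push_cast; linarith
        gcongr
        norm_num
      calc _ ≤ (1 + z.2 ^ 2) * ((|z.1| + 4) * ‖a‖ + 4 * h * ‖b‖) := by gcongr
        _ = _ := by ring
    refine (lintegral_mono hpt).trans ?_
    rw [lintegral_add_left (by
      have h5 := measurable_fwdDiff_iter hm (h, 0) 4
      fun_prop), lintegral_const_mul' _ _ ENNReal.ofReal_ne_top]
    refine (add_le_add e4 (mul_le_mul_right e3 _)).trans ?_
    rw [← ENNReal.ofReal_mul (by positivity), ← ENNReal.ofReal_add (by positivity) (by positivity)]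
    apply ENNReal.ofReal_le_ofReal
    rw [show ((1 - 7 / 16) * (4 : ℕ) : ℝ) = 9 / 4 by norm_num]
    have hle : h * h ^ ((1 - 3 / 16) * (3 : ℕ) : ℝ) ≤ h ^ (9 / 4 : ℝ) := by
      rw [← Real.rpow_one_add' h0.le (by norm_num)]
      exact Real.rpow_le_rpow_of_exponent_ge h0 h1 (by norm_num)
    have := mul_le_mul_of_nonneg_left hle (mul_nonneg hκ0 hA0)
    have h7 : 0 ≤ κ * A * h ^ (9 / 4 : ℝ) := by positivity
    nlinarith

/-! ### Convolution majorants and their Neumann series. -/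

/-- The weight `(1 + |l|)^{-s}`. -/
def wt (s l : ℝ) : ℝ≥0∞ := ENNReal.ofReal ((1 + |l|) ^ (-s))

@[fun_prop]
lemma measurable_wt (s : ℝ) : Measurable (wt s) := by
  unfold wt
  have : Measurable fun l : ℝ => (1 + |l|) ^ (-s) := by fun_prop
  exact this.ennreal_ofReal

lemma wt_ne_top (s l : ℝ) : wt s l ≠ ∞ := ENNReal.ofReal_ne_top

lemma wt_anti {s s' : ℝ} (h : s' ≤ s) (l : ℝ) : wt s l ≤ wt s' l :=
  ENNReal.ofReal_le_ofReal (Real.rpow_le_rpow_of_exponent_le (by have := abs_nonneg l; linarith) (by linarith))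

lemma wt_le_one {s : ℝ} (hs : 0 ≤ s) (l : ℝ) : wt s l ≤ 1 := by
  refine (wt_anti hs l).trans ?_
  simp [wt]

lemma lintegral_wt_lt_top {s : ℝ} (hs : 1 < s) : ∫⁻ l, wt s l < ∞ := by
  have := integrable_one_add_norm (E := ℝ) (μ := volume) (r := s) (by simpa using hs)
  exact this.lintegral_lt_top

lemma wt_le_of_le {s δ l q : ℝ} (hs : 0 ≤ s) (hδ : 0 < δ) (h : δ * (1 + |l|) ≤ 1 + |q|) :
    wt s q ≤ ENNReal.ofReal (δ ^ (-s)) * wt s l := by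
  unfold wt
  have := abs_nonneg l
  rw [← ENNReal.ofReal_mul (by positivity), ← Real.mul_rpow hδ.le (by positivity)]
  exact ENNReal.ofReal_le_ofReal (Real.rpow_le_rpow_of_nonpos (by positivity) h (by linarith))

/-- Convolution of nonnegative functions. -/
def cv (a g : ℝ → ℝ≥0∞) (l : ℝ) : ℝ≥0∞ := ∫⁻ q, a (l - q) * g q

lemma measurable_cv {a g : ℝ → ℝ≥0∞} (ha : Measurable a) (hg : Measurable g) : Measurable (cv a g) := by
  unfold cv
  apply Measurable.lintegral_prod_right'
    (f := fun z : ℝ × ℝ => a (z.1 - z.2) * g z.2)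
  exact (ha.comp (measurable_fst.sub measurable_snd)).mul (hg.comp measurable_snd)

lemma measurable_const_sub {a : ℝ → ℝ≥0∞} (ha : Measurable a) (l : ℝ) : Measurable fun q => a (l - q) := by
  fun_prop

lemma cv_mono {a a' g g' : ℝ → ℝ≥0∞} (h : ∀ l, a l ≤ a' l) (h' : ∀ l, g l ≤ g' l) (l : ℝ) :
    cv a g l ≤ cv a' g' l := lintegral_mono fun _ => mul_le_mul' (h _) (h' _)

lemma cv_add_right {a g g' : ℝ → ℝ≥0∞} (ha : Measurable a) (hg : Measurable g) (l : ℝ) :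
    cv a (fun q => g q + g' q) l = cv a g l + cv a g' l := by
  unfold cv
  simp only [mul_add]
  exact lintegral_add_left ((measurable_const_sub ha l).mul hg) _

lemma cv_const_mul_right {a g : ℝ → ℝ≥0∞} {c : ℝ≥0∞} (hc : c ≠ ∞) (l : ℝ) :
    cv a (fun q => c * g q) l = c * cv a g l := by
  unfold cv
  rw [← lintegral_const_mul' _ _ hc]
  congr 1; ext q; ring

lemma cv_const_mul_left {a g : ℝ → ℝ≥0∞} {c : ℝ≥0∞} (hc : c ≠ ∞) (l : ℝ) :
    cv (fun q => c * a q) g l = c * cv a g l := by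
  unfold cv
  rw [← lintegral_const_mul' _ _ hc]
  congr 1; ext q; ring

lemma lintegral_cv {a g : ℝ → ℝ≥0∞} (ha : Measurable a) (hg : Measurable g) :
    ∫⁻ l, cv a g l = (∫⁻ l, a l) * ∫⁻ l, g l := by
  unfold cv
  rw [lintegral_lintegral_swap]
  · have : ∀ q, ∫⁻ l, a (l - q) * g q = (∫⁻ l, a l) * g q := fun q => by
      rw [lintegral_mul_const _ (by fun_prop : Measurable fun l => a (l - q)),
        lintegral_sub_right_eq_self (fun l => a l) q]
    simp only [this]
    rw [lintegral_const_mul _ hg]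
  · exact ((ha.comp (measurable_fst.sub measurable_snd)).mul (hg.comp measurable_snd)).aemeasurable

/-- Splitting estimate for a convolution of two functions with power decay. -/
lemma cv_le_wt {a g : ℝ → ℝ≥0∞} {s δ : ℝ} (hs : 0 ≤ s) (hδ : 0 < δ) (hδ1 : δ < 1)
    {Ca Cg : ℝ≥0∞} (hac : ∀ l, a l ≤ Ca * wt s l) (hgc : ∀ l, g l ≤ Cg * wt s l)
    (ha : Measurable a) (hg : Measurable g) (l : ℝ) :
    cv a g l ≤ (Cg * ENNReal.ofReal ((1 - δ) ^ (-s)) * (∫⁻ q, a q) +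
      Ca * ENNReal.ofReal (δ ^ (-s)) * ∫⁻ q, g q) * wt s l := by
  have hpt : ∀ q, a (l - q) * g q ≤ (Cg * ENNReal.ofReal ((1 - δ) ^ (-s)) * wt s l) * a (l - q) +
      (Ca * ENNReal.ofReal (δ ^ (-s)) * wt s l) * g q := by
    intro q
    -- Either q is almost as large as l, or l - q is at least a fraction δ of it. The first case
    -- costs only (1 - δ)^(-s), a factor as close to 1 as desired.
    rcases le_total |l - q| (δ * (1 + |l|)) with h | h
    · have h1 : (1 - δ) * (1 + |l|) ≤ 1 + |q| := by
        have := abs_sub_abs_le_abs_sub l q; linarith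
      have h2 : g q ≤ Cg * ENNReal.ofReal ((1 - δ) ^ (-s)) * wt s l :=
        (hgc q).trans (by rw [mul_assoc]; gcongr; exact wt_le_of_le hs (by linarith) h1)
      refine le_add_right ?_
      rw [mul_comm]; gcongr
    · have h1 : δ * (1 + |l|) ≤ 1 + |l - q| := by linarith
      have h2 : a (l - q) ≤ Ca * ENNReal.ofReal (δ ^ (-s)) * wt s l :=
        (hac _).trans (by rw [mul_assoc]; gcongr; exact wt_le_of_le hs hδ h1)
      refine le_add_left ?_
      gcongr
  unfold cv
  refine (lintegral_mono hpt).trans ?_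
  rw [lintegral_add_right _ (hg.const_mul _), lintegral_const_mul _ (measurable_const_sub ha l),
    lintegral_const_mul _ hg]
  have : ∫⁻ q, a (l - q) = ∫⁻ q, a q := lintegral_sub_left_eq_self a l
  rw [this]
  apply le_of_eq; ring

lemma exists_cv_le_wt {a g : ℝ → ℝ≥0∞} {s : ℝ} (hs : 1 < s) {Ca Cg : ℝ≥0∞} (hCa : Ca ≠ ∞) (hCg : Cg ≠ ∞)
    (hac : ∀ l, a l ≤ Ca * wt s l) (hgc : ∀ l, g l ≤ Cg * wt s l) (ha : Measurable a) (hg : Measurable g) :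
    ∃ C : ℝ≥0∞, C ≠ ∞ ∧ ∀ l, cv a g l ≤ C * wt s l := by
  have h1 : ∀ {f : ℝ → ℝ≥0∞} {c : ℝ≥0∞}, c ≠ ∞ → (∀ l, f l ≤ c * wt s l) → ∫⁻ q, f q ≠ ∞ := by
    intro f c hc hf
    refine ((lintegral_mono hf).trans_lt ?_).ne
    rw [lintegral_const_mul _ (measurable_wt s)]
    exact ENNReal.mul_lt_top hc.lt_top (lintegral_wt_lt_top hs)
  refine ⟨_, ?_, cv_le_wt (δ := 1 / 2) (by linarith) (by norm_num) (by norm_num) hac hgc ha hg⟩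
  have := h1 hCa hac
  have := h1 hCg hgc
  finiteness

/-- The Neumann series `∑ (a ⋆)^N f`. -/
def res (a f : ℝ → ℝ≥0∞) (l : ℝ) : ℝ≥0∞ := ∑' N : ℕ, (cv a)^[N] f l

section res
variable {a f : ℝ → ℝ≥0∞}

lemma measurable_cv_iter (ha : Measurable a) (hf : Measurable f) (N : ℕ) : Measurable ((cv a)^[N] f) := by
  induction N with
  | zero => exact hf
  | succ N ih => rw [Function.iterate_succ_apply']; exact measurable_cv ha ih

lemma measurable_res (ha : Measurable a) (hf : Measurable f) : Measurable (res a f) :=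
  Measurable.tsum fun N => measurable_cv_iter ha hf N

lemma res_eq (ha : Measurable a) (hf : Measurable f) (l : ℝ) : res a f l = f l + cv a (res a f) l := by
  unfold res
  rw [tsum_eq_zero_add' ENNReal.summable]
  congr 1
  have e1 : cv a (fun l => ∑' N : ℕ, (cv a)^[N] f l) l = ∫⁻ q, ∑' N : ℕ, a (l - q) * (cv a)^[N] f q := by
    simp only [cv, ENNReal.tsum_mul_left]
  have e2 : ∀ N, AEMeasurable (fun q => a (l - q) * (cv a)^[N] f q) := fun N =>
    ((measurable_const_sub ha l).mul (measurable_cv_iter ha hf N)).aemeasurable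
  rw [e1, lintegral_tsum e2]
  refine tsum_congr fun N => ?_
  rw [Function.iterate_succ_apply']
  rfl

lemma cv_res_le (ha : Measurable a) (hf : Measurable f) (l : ℝ) : cv a (res a f) l ≤ res a f l := by
  rw [res_eq ha hf]; exact le_add_self

/-- Masses multiply under convolution, so the total mass is a geometric series of ratio ∫ a < 1. -/
lemma lintegral_res_ne_top (ha : Measurable a) (hf : Measurable f) (ha1 : ∫⁻ l, a l < 1) (hfi : ∫⁻ l, f l ≠ ∞) :
    ∫⁻ l, res a f l ≠ ∞ := by
  have h1 : ∀ N, ∫⁻ l, (cv a)^[N] f l = (∫⁻ l, a l) ^ N * ∫⁻ l, f l := by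
    intro N
    induction N with
    | zero => simp
    | succ N ih =>
      rw [Function.iterate_succ_apply', lintegral_cv ha (measurable_cv_iter ha hf N), ih, pow_succ]; ring
  unfold res
  rw [lintegral_tsum fun N => (measurable_cv_iter ha hf N).aemeasurable]
  simp only [h1]
  rw [ENNReal.tsum_mul_right, ENNReal.tsum_geometric]
  refine ENNReal.mul_ne_top (ENNReal.inv_ne_top.2 ?_) hfi
  exact (tsub_pos_of_lt ha1).ne'

/-- The Neumann series inherits power decay. -/
lemma exists_res_le_wt (ha : Measurable a) (hf : Measurable f) {s : ℝ} (hs : 1 < s) {C : ℝ≥0∞} (hC : C ≠ ∞)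
    (hac : ∀ l, a l ≤ C * wt s l) (hfc : ∀ l, f l ≤ C * wt s l) (ha1 : ∫⁻ l, a l < 1) :
    ∃ C' : ℝ≥0∞, C' ≠ ∞ ∧ ∀ l, res a f l ≤ C' * wt s l := by
  have hfi : ∫⁻ l, f l ≠ ∞ := by
    refine ((lintegral_mono hfc).trans_lt ?_).ne
    rw [lintegral_const_mul _ (measurable_wt s)]
    exact ENNReal.mul_lt_top hC.lt_top (lintegral_wt_lt_top hs)
  set I := ∫⁻ l, res a f l with hI
  have hIt : I ≠ ∞ := lintegral_res_ne_top ha hf ha1 hfi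
  set α := ∫⁻ l, a l with hα
  have hαt : α ≠ ∞ := (ha1.trans ENNReal.one_lt_top).ne
  -- choose `δ` so small that `θ < 1`
  obtain ⟨δ, hδ0, hδ1, hθ⟩ : ∃ δ : ℝ, 0 < δ ∧ δ < 1 ∧ ENNReal.ofReal ((1 - δ) ^ (-s)) * α < 1 := by
    have hc : Tendsto (fun δ : ℝ => ENNReal.ofReal ((1 - δ) ^ (-s)) * α) (𝓝[>] 0) (𝓝 (ENNReal.ofReal ((1 - 0) ^ (-s)) * α)) := by
      refine ENNReal.Tendsto.mul_const (ENNReal.tendsto_ofReal ?_) (Or.inr hαt)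
      have : ContinuousAt (fun δ : ℝ => (1 - δ) ^ (-s)) 0 :=
        (continuousAt_const.sub continuousAt_id).rpow_const (Or.inl (by simp))
      exact this.tendsto.mono_left nhdsWithin_le_nhds
    have hlt : ENNReal.ofReal ((1 - 0) ^ (-s)) * α < 1 := by simpa using ha1
    have h3 := (hc.eventually (gt_mem_nhds hlt)).and (Ioo_mem_nhdsGT (zero_lt_one' ℝ))
    obtain ⟨δ, h4, h5⟩ := h3.exists
    exact ⟨δ, h5.1, h5.2, h4⟩
  set θ := ENNReal.ofReal ((1 - δ) ^ (-s)) * α with hθd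
  set E := C + C * ENNReal.ofReal (δ ^ (-s)) * I with hE
  have hEt : E ≠ ∞ := by rw [hE]; finiteness
  set C' := E * (1 - θ)⁻¹ with hC'
  have h1θ : 1 - θ ≠ 0 := (tsub_pos_of_lt hθ).ne'
  have hC't : C' ≠ ∞ := ENNReal.mul_ne_top hEt (ENNReal.inv_ne_top.2 h1θ)
  -- C' is the fixed point of the affine map that bounds one convolution step; the constant in the
  -- bound for the partial sums therefore does not grow with N.
  have hfix : E + C' * θ = C' := by
    have e1 : C' * (1 - θ) = E := by
      rw [hC', mul_assoc, ENNReal.inv_mul_cancel h1θ (by finiteness), mul_one]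
    rw [← e1, ← mul_add, tsub_add_cancel_of_le hθ.le, mul_one]
  refine ⟨C', hC't, fun l => ?_⟩
  -- partial sums
  have hpart : ∀ N : ℕ, ∀ l, ∑ j ∈ Finset.range N, (cv a)^[j] f l ≤ C' * wt s l := by
    intro N
    induction N with
    | zero => intro l; simp
    | succ N ih =>
      intro l
      set S : ℝ → ℝ≥0∞ := fun l => ∑ j ∈ Finset.range N, (cv a)^[j] f l with hS
      have hSm : Measurable S := Finset.measurable_fun_sum _ fun j _ => measurable_cv_iter ha hf j
      have hSle : ∫⁻ q, S q ≤ I := lintegral_mono fun q => ENNReal.sum_le_tsum _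
      have hrec : ∑ j ∈ Finset.range (N + 1), (cv a)^[j] f l = f l + cv a S l := by
        rw [Finset.sum_range_succ', add_comm]
        congr 1
        have e1 : cv a S l = ∫⁻ q, ∑ j ∈ Finset.range N, a (l - q) * (cv a)^[j] f q := by
          simp only [cv, hS, Finset.mul_sum]
        have e2 : ∀ j ∈ Finset.range N, Measurable fun q => a (l - q) * (cv a)^[j] f q := fun j _ =>
          (measurable_const_sub ha l).mul (measurable_cv_iter ha hf j)
        rw [e1, lintegral_finsetSum _ e2]
        refine Finset.sum_congr rfl fun j _ => ?_
        rw [Function.iterate_succ_apply']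
        rfl
      rw [hrec]
      have h1 := cv_le_wt (by linarith) hδ0 hδ1 hac ih ha hSm l
      calc f l + cv a S l ≤ C * wt s l + (C' * ENNReal.ofReal ((1 - δ) ^ (-s)) * α + C * ENNReal.ofReal (δ ^ (-s)) * I) * wt s l := by
            refine add_le_add (hfc l) (h1.trans ?_)
            gcongr
        _ = (E + C' * θ) * wt s l := by rw [hE, hθd]; ring
        _ = _ := by rw [hfix]
  unfold res
  rw [ENNReal.tsum_eq_iSup_nat]
  exact iSup_le fun N => hpart N l

end res

/-! ### The partial Fourier transform of the potential. -/

/-- Measurable functions of the plane, integrable on every horizontal line. -/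
def SliceInt (v : ℝ × ℝ → ℝ) : Prop := Measurable v ∧ ∀ y, Integrable fun x => v (x, y)

lemma SliceInt.shift {v : ℝ × ℝ → ℝ} (hv : SliceInt v) (p : ℝ × ℝ) : SliceInt (fun z => v (z + p)) :=
  ⟨hv.1.comp (measurable_add_const p), fun y => (hv.2 (y + p.2)).comp_add_right p.1⟩

lemma SliceInt.fwdDiff_iter {v : ℝ × ℝ → ℝ} (hv : SliceInt v) (p : ℝ × ℝ) (n : ℕ) : SliceInt (Δ_[p] ^[n] v) := by
  induction n with
  | zero => exact hv
  | succ n ih =>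
    rw [Function.iterate_succ_apply']
    exact ⟨(ih.shift p).1.sub ih.1, fun y => ((ih.shift p).2 y).sub (ih.2 y)⟩

lemma IsNice.sliceInt_mul {u : ℝ × ℝ → ℝ} {C : ℝ} (h : IsNice u C) {w : ℝ × ℝ → ℝ} (hw : Measurable w)
    (hb : ∀ y, ∃ D : ℝ, ∀ x, |w (x, y)| ≤ D * (1 + x ^ 2)) : SliceInt (fun z => w z * u z) := by
  refine ⟨hw.mul h.meas, fun y => ⟨((hw.mul h.meas).comp measurable_prodMk_right).aestronglyMeasurable, ?_⟩⟩
  obtain ⟨D, hD⟩ := hb y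
  have hD0 : 0 ≤ D := by have := (abs_nonneg _).trans (hD 0); simpa using this
  refine lt_of_le_of_lt (lintegral_mono (g := fun x => ENNReal.ofReal D * (ENNReal.ofReal (1 + x ^ 2) * ‖u (x, y)‖ₑ)) fun x => ?_) ?_
  · dsimp only
    rw [enorm_mul, ← mul_assoc, ← ENNReal.ofReal_mul hD0]
    gcongr
    rw [← ofReal_norm]
    exact ENNReal.ofReal_le_ofReal (hD x)
  · rw [lintegral_const_mul' _ _ ENNReal.ofReal_ne_top]
    exact ENNReal.mul_lt_top ENNReal.ofReal_lt_top (h.slice y)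

lemma IsNice.sliceInt {u : ℝ × ℝ → ℝ} {C : ℝ} (h : IsNice u C) : SliceInt u := by
  have := h.sliceInt_mul (w := fun _ => 1) measurable_const fun y => ⟨1, fun x => by
    rw [abs_one, one_mul]; nlinarith [sq_nonneg x]⟩
  simpa using this

lemma inv_sqrt_two_pi_le_one : 1 / Real.sqrt (2 * Real.pi) ≤ 1 := by
  rw [div_le_one (by positivity)]
  exact Real.one_le_sqrt.2 (by linarith [Real.pi_gt_three])

lemma norm_cexp_neg_I_mul (l x : ℝ) : ‖Complex.exp (-Complex.I * l * x)‖ = 1 := by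
  rw [Complex.norm_exp]; simp

lemma measurable_ut {v : ℝ × ℝ → ℝ} (hv : Measurable v) : Measurable fun z : ℝ × ℝ => ut v z.1 z.2 := by
  unfold ut
  refine Measurable.const_mul ?_ _
  apply StronglyMeasurable.measurable
  apply StronglyMeasurable.integral_prod_right
    (f := fun (z : ℝ × ℝ) (x : ℝ) => Complex.exp (-Complex.I * z.1 * x) * (v (x, z.2) : ℂ))
  apply Measurable.stronglyMeasurable
  unfold Function.uncurry
  have h1 : Measurable fun p : (ℝ × ℝ) × ℝ => v (p.2, p.1.2) := hv.comp (by fun_prop)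
  fun_prop

lemma integrable_cexp_mul {f : ℝ → ℝ} (hf : Integrable f) (l : ℝ) :
    Integrable fun x : ℝ => Complex.exp (-Complex.I * l * x) * (f x : ℂ) := by
  refine hf.ofReal.bdd_mul (c := 1) ?_ (Eventually.of_forall fun x => (norm_cexp_neg_I_mul l x).le)
  exact Continuous.aestronglyMeasurable (by fun_prop)

lemma enorm_ut_le (v : ℝ × ℝ → ℝ) (l y : ℝ) : ‖ut v l y‖ₑ ≤ ∫⁻ x, ‖v (x, y)‖ₑ := by
  unfold ut
  rw [enorm_mul]
  have h1 : ‖((1 / Real.sqrt (2 * Real.pi) : ℝ) : ℂ)‖ₑ ≤ 1 := by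
    rw [← ofReal_norm, Complex.norm_real, Real.norm_of_nonneg (by positivity), ENNReal.ofReal_le_one]
    exact inv_sqrt_two_pi_le_one
  refine (mul_le_mul' h1 (enorm_integral_le_lintegral_enorm _)).trans ?_
  rw [one_mul]
  refine lintegral_mono fun x => le_of_eq ?_
  rw [enorm_mul, ← ofReal_norm, norm_cexp_neg_I_mul, ENNReal.ofReal_one, one_mul, ← ofReal_norm, ← ofReal_norm,
    Complex.norm_real]

lemma ut_sub {v w : ℝ × ℝ → ℝ} (hv : SliceInt v) (hw : SliceInt w) (l y : ℝ) :
    ut (fun z => v z - w z) l y = ut v l y - ut w l y := by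
  unfold ut
  rw [← mul_sub, ← integral_sub (integrable_cexp_mul (hv.2 y) l) (integrable_cexp_mul (hw.2 y) l)]
  congr 2; ext x; push_cast; ring

lemma fwdDiff_iter_ut_y {v : ℝ × ℝ → ℝ} (hv : SliceInt v) (h : ℝ) (n : ℕ) (l y : ℝ) :
    Δ_[h] ^[n] (fun y => ut v l y) y = ut (Δ_[((0 : ℝ), h)] ^[n] v) l y := by
  induction n generalizing y with
  | zero => rfl
  | succ n ih =>
    rw [Function.iterate_succ_apply', Function.iterate_succ_apply']
    have hs := hv.fwdDiff_iter (0, h) n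
    have e : Δ_[((0 : ℝ), h)] (Δ_[((0 : ℝ), h)] ^[n] v) =
      fun z => Δ_[((0 : ℝ), h)] ^[n] v (z + (0, h)) - Δ_[((0 : ℝ), h)] ^[n] v z := rfl
    have e' : Δ_[h] (Δ_[h] ^[n] fun y => ut v l y) y =
      Δ_[h] ^[n] (fun y => ut v l y) (y + h) - Δ_[h] ^[n] (fun y => ut v l y) y := rfl
    rw [e, e', ut_sub (hs.shift (0, h)) hs l y, ih, ih]
    congr 1
    simp only [ut, Prod.mk_add_mk, add_zero]

lemma ut_shift_x (v : ℝ × ℝ → ℝ) (h l y : ℝ) :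
    ut (fun z => v (z + (h, 0))) l y = Complex.exp (Complex.I * l * h) * ut v l y := by
  unfold ut
  have e : (∫ x : ℝ, Complex.exp (-Complex.I * l * x) * (v ((x, y) + (h, 0)) : ℂ)) =
      Complex.exp (Complex.I * l * h) * ∫ x : ℝ, Complex.exp (-Complex.I * l * x) * (v (x, y) : ℂ) := by
    rw [← integral_const_mul, ← integral_add_right_eq_self
      (fun x : ℝ => Complex.exp (Complex.I * l * h) * (Complex.exp (-Complex.I * l * x) * (v (x, y) : ℂ))) h]
    refine integral_congr_ae (Eventually.of_forall fun x => ?_)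
    dsimp only
    rw [← mul_assoc, ← Complex.exp_add]
    simp only [Prod.mk_add_mk, add_zero]
    congr 2; push_cast; ring
  rw [e]; ring

lemma ut_fwdDiff_iter_x {v : ℝ × ℝ → ℝ} (hv : SliceInt v) (h : ℝ) (n : ℕ) (l y : ℝ) :
    ut (Δ_[(h, (0 : ℝ))] ^[n] v) l y = (Complex.exp (Complex.I * l * h) - 1) ^ n * ut v l y := by
  induction n with
  | zero => simp
  | succ n ih =>
    rw [Function.iterate_succ_apply']
    have hs := hv.fwdDiff_iter (h, 0) n
    have e : Δ_[(h, (0 : ℝ))] (Δ_[(h, (0 : ℝ))] ^[n] v) =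
      fun z => Δ_[(h, (0 : ℝ))] ^[n] v (z + (h, 0)) - Δ_[(h, (0 : ℝ))] ^[n] v z := rfl
    rw [e, ut_sub (hs.shift (h, 0)) hs l y, ut_shift_x, ih]; ring

lemma ut_mul_snd (v : ℝ × ℝ → ℝ) (l y : ℝ) : ut (fun z => z.2 * v z) l y = y * ut v l y := by
  unfold ut
  have e : (∫ x : ℝ, Complex.exp (-Complex.I * l * x) * ((y * v (x, y) : ℝ) : ℂ)) =
      y * ∫ x : ℝ, Complex.exp (-Complex.I * l * x) * (v (x, y) : ℂ) := by
    rw [← integral_const_mul]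
    refine integral_congr_ae (Eventually.of_forall fun x => ?_)
    push_cast; ring
  dsimp only
  rw [e]; ring

lemma lintegral_plane (f : ℝ × ℝ → ℝ≥0∞) (hf : Measurable f) :
    ∫⁻ z, f z = ∫⁻ y, ∫⁻ x, f (x, y) := by
  rw [Measure.volume_eq_prod, lintegral_prod_symm' _ hf]

/-- Decay of the partial Fourier transform from fourth differences in `x`. -/
lemma exists_lintegral_ut_le_wt {v : ℝ × ℝ → ℝ} (hv : SliceInt v) {C s : ℝ} (hs : 0 ≤ s)
    (h0 : ∫⁻ z : ℝ × ℝ, ENNReal.ofReal (1 + z.2 ^ 2) * ‖v z‖ₑ ≤ ENNReal.ofReal C)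
    (h4 : ∀ h : ℝ, 0 < h → h ≤ 1 → ∫⁻ z : ℝ × ℝ, ENNReal.ofReal (1 + z.2 ^ 2) * ‖Δ_[(h, (0 : ℝ))] ^[4] v z‖ₑ ≤
      ENNReal.ofReal (C * h ^ s)) :
    ∃ K : ℝ≥0∞, K ≠ ∞ ∧ ∀ l, ∫⁻ y, ENNReal.ofReal (1 + y ^ 2) * ‖ut v l y‖ₑ ≤ K * wt s l := by
  have hpi := Real.pi_gt_three
  have hgen : ∀ w : ℝ × ℝ → ℝ, Measurable w → ∀ l, ∫⁻ y, ENNReal.ofReal (1 + y ^ 2) * ‖ut w l y‖ₑ ≤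
      ∫⁻ z : ℝ × ℝ, ENNReal.ofReal (1 + z.2 ^ 2) * ‖w z‖ₑ := by
    intro w hw l
    rw [lintegral_plane _ (by fun_prop)]
    refine lintegral_mono fun y => ?_
    dsimp only
    rw [lintegral_const_mul' _ _ ENNReal.ofReal_ne_top]
    gcongr
    exact enorm_ut_le w l y
  refine ⟨ENNReal.ofReal |C| * ENNReal.ofReal ((2 * Real.pi) ^ s), by finiteness, fun l => ?_⟩
  have hl := abs_nonneg l
  have hwt : ENNReal.ofReal ((2 * Real.pi) ^ s) * wt s l = ENNReal.ofReal ((2 * Real.pi / (1 + |l|)) ^ s) := by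
    unfold wt
    rw [← ENNReal.ofReal_mul (by positivity), Real.div_rpow (by positivity) (by positivity), Real.rpow_neg (by positivity),
      div_eq_mul_inv]
  rw [mul_assoc, hwt]
  -- Below π the weight is bounded from below and the undifferenced bound suffices; above π the step
  -- π/|l| is at most 1 and hence admissible.
  rcases lt_or_ge |l| Real.pi with hlt | hge
  · refine (hgen v hv.1 l).trans (h0.trans ?_)
    rw [← ENNReal.ofReal_mul (abs_nonneg C)]
    apply ENNReal.ofReal_le_ofReal
    refine (le_abs_self C).trans (le_mul_of_one_le_right (abs_nonneg C) (Real.one_le_rpow ?_ hs))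
    rw [one_le_div (by positivity)]; linarith
  · have hl0 : 0 < |l| := by linarith
    -- This step makes e^{ilh} = -1, so a fourth difference in x multiplies ũ by exactly 16.
    set h := Real.pi / |l| with hh
    have hh0 : 0 < h := by positivity
    have hh1 : h ≤ 1 := (div_le_one hl0).2 hge
    have hexp : ‖(Complex.exp (Complex.I * l * h) - 1) ^ 4‖ₑ = 16 := by
      have : Complex.exp (Complex.I * l * h) = -1 := by
        rcases le_total 0 l with hp | hn
        · have e : Complex.I * l * h = Real.pi * Complex.I := by
            have : l * h = Real.pi := by rw [hh, abs_of_nonneg hp]; rw [abs_of_nonneg hp] at hl0; field_simp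
            rw [mul_assoc, ← Complex.ofReal_mul, this]; ring
          rw [e, Complex.exp_pi_mul_I]
        · have e : Complex.I * l * h = -(Real.pi * Complex.I) := by
            have : l * h = -Real.pi := by
              rw [hh, abs_of_nonpos hn]; rw [abs_of_nonpos hn] at hl0
              have : l ≠ 0 := by linarith
              field_simp
            rw [mul_assoc, ← Complex.ofReal_mul, this]; push_cast; ring
          rw [e, Complex.exp_neg, Complex.exp_pi_mul_I]; norm_num
      rw [this]; norm_num [← ofReal_norm]
    have h1 := (hgen _ (measurable_fwdDiff_iter hv.1 (h, 0) 4) l).trans (h4 h hh0 hh1)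
    simp only [ut_fwdDiff_iter_x hv, enorm_mul, hexp] at h1
    calc ∫⁻ y, ENNReal.ofReal (1 + y ^ 2) * ‖ut v l y‖ₑ
        ≤ ∫⁻ y, ENNReal.ofReal (1 + y ^ 2) * (16 * ‖ut v l y‖ₑ) := by
          refine lintegral_mono fun y => ?_
          dsimp only
          gcongr
          exact le_mul_of_one_le_left' (by norm_num)
      _ ≤ ENNReal.ofReal (C * h ^ s) := h1
      _ ≤ ENNReal.ofReal |C| * ENNReal.ofReal ((2 * Real.pi / (1 + |l|)) ^ s) := by
          rw [← ENNReal.ofReal_mul (abs_nonneg C)]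
          apply ENNReal.ofReal_le_ofReal
          have : h ≤ 2 * Real.pi / (1 + |l|) := by
            rw [hh, div_le_div_iff₀ hl0 (by positivity)]; nlinarith
          calc C * h ^ s ≤ |C| * h ^ s := by gcongr; exact le_abs_self C
            _ ≤ _ := by gcongr

lemma lintegral_fwdDiff_ut_le {v : ℝ × ℝ → ℝ} (hv : SliceInt v) (h : ℝ) (n : ℕ) (l : ℝ) :
    ∫⁻ y, ‖Δ_[h] ^[n] (fun y => ut v l y) y‖ₑ ≤ ∫⁻ z, ‖Δ_[((0 : ℝ), h)] ^[n] v z‖ₑ := by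
  have := measurable_fwdDiff_iter hv.1 (0, h) n
  rw [lintegral_plane _ (by fun_prop)]
  refine lintegral_mono fun y => ?_
  dsimp only
  rw [fwdDiff_iter_ut_y hv]
  exact enorm_ut_le _ _ _

lemma measurable_fwdDiff_iter_real {f : ℝ → ℂ} (hf : Measurable f) (h : ℝ) (n : ℕ) :
    Measurable (Δ_[h] ^[n] f) := by
  induction n with
  | zero => exact hf
  | succ n ih =>
    rw [Function.iterate_succ_apply']
    exact (ih.comp (measurable_add_const h)).sub ih

lemma lintegral_fwdDiff_iter_le {f : ℝ → ℂ} (hf : Measurable f) (h : ℝ) (n : ℕ) :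
    ∫⁻ y, ‖Δ_[h] ^[n] f y‖ₑ ≤ 2 ^ n * ∫⁻ y, ‖f y‖ₑ := by
  induction n with
  | zero => simp
  | succ n ih =>
    have hm := measurable_fwdDiff_iter_real hf h n
    rw [Function.iterate_succ_apply']
    calc ∫⁻ y, ‖fwdDiff h (Δ_[h] ^[n] f) y‖ₑ ≤ ∫⁻ y, (‖Δ_[h] ^[n] f (y + h)‖ₑ + ‖Δ_[h] ^[n] f y‖ₑ) :=
          lintegral_mono fun y => enorm_sub_le
      _ = (∫⁻ y, ‖Δ_[h] ^[n] f (y + h)‖ₑ) + ∫⁻ y, ‖Δ_[h] ^[n] f y‖ₑ :=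
          lintegral_add_left (by fun_prop) _
      _ = 2 * ∫⁻ y, ‖Δ_[h] ^[n] f y‖ₑ := by
          rw [lintegral_add_right_eq_self (fun y => ‖Δ_[h] ^[n] f y‖ₑ) h]; ring
      _ ≤ _ := by rw [pow_succ', mul_assoc]; gcongr

namespace IsNice
variable {u : ℝ × ℝ → ℝ} {C : ℝ}

lemma sliceInt_fst (h : IsNice u C) : SliceInt (fun z => z.1 * u z) :=
  h.sliceInt_mul measurable_fst fun y => ⟨1, fun x => by
    rw [abs_le]; constructor <;> nlinarith [sq_nonneg (x - 1), sq_nonneg (x + 1)]⟩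

lemma sliceInt_snd (h : IsNice u C) : SliceInt (fun z => z.2 * u z) :=
  h.sliceInt_mul measurable_snd fun y => ⟨|y|, fun x => by
    have := abs_nonneg y; dsimp only; nlinarith [sq_nonneg x]⟩

lemma lintegral_weight_le (h : IsNice u C) {w : ℝ × ℝ → ℝ} (hw : ∀ z, |w z| ≤ (1 + z.1 ^ 2) * (1 + z.2 ^ 2)) :
    ∫⁻ z, ‖w z * u z‖ₑ ≤ ENNReal.ofReal C := by
  refine le_trans (lintegral_mono fun z => ?_) h.mom
  rw [enorm_mul]
  gcongr
  rw [← ofReal_norm]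
  exact ENNReal.ofReal_le_ofReal (hw z)

lemma exists_ut_wt (h : IsNice u C) :
    ∃ K : ℝ≥0∞, K ≠ ∞ ∧ ∀ l, ∫⁻ y, ENNReal.ofReal (1 + y ^ 2) * ‖ut u l y‖ₑ ≤ K * wt (13 / 4) l := by
  refine exists_lintegral_ut_le_wt (C := C) h.sliceInt (by norm_num) ?_ h.diffX
  refine le_trans (lintegral_mono fun z => ?_) h.mom
  gcongr
  nlinarith [mul_nonneg (sq_nonneg z.1) (by positivity : 0 ≤ 1 + z.2 ^ 2)]

lemma exists_ut_fst_wt (h : IsNice u C) :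
    ∃ K : ℝ≥0∞, K ≠ ∞ ∧ ∀ l, ∫⁻ y, ENNReal.ofReal (1 + y ^ 2) * ‖ut (fun z => z.1 * u z) l y‖ₑ ≤ K * wt (9 / 4) l := by
  refine exists_lintegral_ut_le_wt (C := C) h.sliceInt_fst (by norm_num) ?_ h.diffX_mul
  refine le_trans (lintegral_mono fun z => ?_) h.mom
  have h1 : |z.1| ≤ 1 + z.1 ^ 2 := by
    rw [abs_le]; constructor <;> nlinarith [sq_nonneg (z.1 - 1), sq_nonneg (z.1 + 1)]
  have h2 : ‖z.1‖ₑ ≤ ENNReal.ofReal (1 + z.1 ^ 2) := by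
    rw [← ofReal_norm]; exact ENNReal.ofReal_le_ofReal h1
  rw [enorm_mul, ← mul_assoc, mul_comm (1 + z.1 ^ 2), ENNReal.ofReal_mul (by positivity)]
  gcongr

lemma lintegral_ut_le (_ : IsNice u C) (l : ℝ) :
    ∫⁻ y, ‖ut u l y‖ₑ ≤ ∫⁻ y, ENNReal.ofReal (1 + y ^ 2) * ‖ut u l y‖ₑ := by
  refine lintegral_mono fun y => le_mul_of_one_le_left' ?_
  rw [ENNReal.one_le_ofReal]; nlinarith [sq_nonneg y]

lemma measurable_ut_slice (h : IsNice u C) (l : ℝ) : Measurable fun y => ut u l y := by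
  have h1 := measurable_ut h.meas
  have h2 : Measurable (fun y : ℝ => ((l, y) : ℝ × ℝ)) := by fun_prop
  have h3 := h1.comp h2
  simpa only [Function.comp_def] using h3

/-- Geometric interpolation of h^(3i/4), uniform in l, with the decay of order 13/4 in l, at weights
2/3 and 1/3. The result keeps h^(i/2) and the exponent 13/12, still larger than 1 and so integrable
in l. -/
lemma exists_fwdDiff_ut_wt (H : IsNice u C) : ∃ K : ℝ≥0∞, K ≠ ∞ ∧ ∀ h : ℝ, 0 < h → h ≤ 1 → ∀ i : ℕ, i ≤ 4 → ∀ l,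
    ∫⁻ y, ‖Δ_[h] ^[i] (fun y => ut u l y) y‖ₑ ≤ ENNReal.ofReal (h ^ (1 / 2 : ℝ)) ^ i * (K * wt (13 / 12) l) := by
  obtain ⟨K0, hK0, hA⟩ := H.exists_ut_wt
  refine ⟨ENNReal.ofReal C ^ (2 / 3 : ℝ) * (2 ^ 4 * K0) ^ (1 / 3 : ℝ), by finiteness, fun h h0 h1 i hi l => ?_⟩
  set X := ∫⁻ y, ‖Δ_[h] ^[i] (fun y => ut u l y) y‖ₑ with hX
  have b1 : X ≤ ENNReal.ofReal (C * h ^ (3 / 4 * i : ℝ)) :=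
    (lintegral_fwdDiff_ut_le H.sliceInt h i l).trans (H.diffY h h0 h1 i hi)
  have b2 : X ≤ (2 ^ 4 * K0) * wt (13 / 4) l := by
    refine (lintegral_fwdDiff_iter_le (H.measurable_ut_slice l) h i).trans ?_
    rw [mul_assoc]
    gcongr
    · norm_num
    · exact (H.lintegral_ut_le l).trans (hA l)
  have b3 : X = X ^ (2 / 3 : ℝ) * X ^ (1 / 3 : ℝ) := by
    rw [← ENNReal.rpow_add_of_nonneg _ _ (by norm_num) (by norm_num)]; norm_num
  have e1 : wt (13 / 4) l ^ (1 / 3 : ℝ) = wt (13 / 12) l := by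
    unfold wt
    have := abs_nonneg l
    rw [ENNReal.ofReal_rpow_of_nonneg (by positivity) (by norm_num), ← Real.rpow_mul (by positivity)]
    norm_num
  have e2 : ENNReal.ofReal (C * h ^ (3 / 4 * i : ℝ)) ^ (2 / 3 : ℝ) = ENNReal.ofReal C ^ (2 / 3 : ℝ) * ENNReal.ofReal (h ^ (1 / 2 : ℝ)) ^ i := by
    rw [ENNReal.ofReal_mul' (by positivity), ENNReal.mul_rpow_of_nonneg _ _ (by norm_num),
      ENNReal.ofReal_rpow_of_nonneg (x := h ^ (3 / 4 * i : ℝ)) (by positivity) (by norm_num), ← Real.rpow_mul h0.le,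
      ← ENNReal.ofReal_pow (by positivity), ← Real.rpow_natCast, ← Real.rpow_mul h0.le]
    ring_nf
  calc X = X ^ (2 / 3 : ℝ) * X ^ (1 / 3 : ℝ) := b3
    _ ≤ ENNReal.ofReal (C * h ^ (3 / 4 * i : ℝ)) ^ (2 / 3 : ℝ) * ((2 ^ 4 * K0) * wt (13 / 4) l) ^ (1 / 3 : ℝ) := by gcongr
    _ = _ := by
        rw [e2, ENNReal.mul_rpow_of_nonneg _ _ (by norm_num), e1]; ring

/-- Multiplication by x commutes with differences in y. Multiplication by y produces one extra term
with a difference of one order less, but with a factor h, which is at most the missing h^(1/2). -/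
lemma fwdDiff_ut_le (H : IsNice u C) {h : ℝ} (h0 : 0 < h) (h1 : h ≤ 1) {i : ℕ} (hi : i ≤ 4) (l : ℝ) :
    ∫⁻ y, ‖Δ_[h] ^[i] (fun y => ut u l y) y‖ₑ ≤ ENNReal.ofReal (h ^ (1 / 2 : ℝ)) ^ i * ENNReal.ofReal (8 * C) ∧
    ∫⁻ y, ‖Δ_[h] ^[i] (fun y => ut (fun z => z.1 * u z) l y) y‖ₑ ≤ ENNReal.ofReal (h ^ (1 / 2 : ℝ)) ^ i * ENNReal.ofReal (8 * C) ∧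
    ∫⁻ y, ‖Δ_[h] ^[i] (fun y => ut (fun z => z.2 * u z) l y) y‖ₑ ≤ ENNReal.ofReal (h ^ (1 / 2 : ℝ)) ^ i * ENNReal.ofReal (8 * C) := by
  set τ := h ^ (1 / 2 : ℝ) with hτ
  have hτ0 : 0 < τ := by positivity
  have hτ2 : τ ^ 2 = h := by rw [hτ, ← Real.rpow_natCast, ← Real.rpow_mul h0.le]; norm_num
  have hτ1 : τ ≤ 1 := Real.rpow_le_one h0.le h1 (by norm_num)
  have hpow : ∀ j : ℕ, h ^ (1 / 2 * j : ℝ) = τ ^ j := fun j => by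
    rw [hτ, ← Real.rpow_natCast, ← Real.rpow_mul h0.le]
  have hW : ∀ j ≤ 4, ∫⁻ z : ℝ × ℝ, ENNReal.ofReal ((1 + |z.1|) * (1 + |z.2|)) * ‖Δ_[((0 : ℝ), h)] ^[j] u z‖ₑ ≤
      ENNReal.ofReal (τ ^ j) * ENNReal.ofReal C := fun j hj => by
    have := H.diffY_wgt h h0 h1 j hj
    rwa [hpow, mul_comm, ENNReal.ofReal_mul (by positivity)] at this
  have hC8 : ENNReal.ofReal (8 * C) = 8 * ENNReal.ofReal C := by
    rw [ENNReal.ofReal_mul (by norm_num)]; norm_num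
  have hbd : ∀ {a b : ℝ}, 0 ≤ a → 0 ≤ b → 1 ≤ (1 + a) * (1 + b) ∧ a ≤ (1 + a) * (1 + b) ∧ b ≤ (1 + a) * (1 + b) := by
    intro a b ha hb
    refine ⟨?_, ?_, ?_⟩ <;> nlinarith [mul_nonneg ha hb]
  rw [← ENNReal.ofReal_pow hτ0.le, hC8]
  have fin : ∀ {X : ℝ≥0∞}, X ≤ ENNReal.ofReal (τ ^ i) * ENNReal.ofReal C → X ≤ ENNReal.ofReal (τ ^ i) * (8 * ENNReal.ofReal C) := by
    intro X hX
    refine hX.trans ?_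
    gcongr
    exact le_mul_of_one_le_left' (by norm_num)
  refine ⟨fin ?_, fin ?_, ?_⟩
  · refine (lintegral_fwdDiff_ut_le H.sliceInt h i l).trans (le_trans (lintegral_mono fun z => ?_) (hW i hi))
    refine le_mul_of_one_le_left' ?_
    rw [ENNReal.one_le_ofReal]; exact (hbd (abs_nonneg _) (abs_nonneg _)).1
  · refine (lintegral_fwdDiff_ut_le H.sliceInt_fst h i l).trans (le_trans (lintegral_mono fun z => ?_) (hW i hi))
    rw [fwdDiff_iter_mul_invariant (w := fun z : ℝ × ℝ => z.1) (by simp), enorm_mul]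
    gcongr
    rw [← ofReal_norm]
    exact ENNReal.ofReal_le_ofReal (hbd (abs_nonneg _) (abs_nonneg _)).2.1
  · refine (lintegral_fwdDiff_ut_le H.sliceInt_snd h i l).trans ?_
    cases i with
    | zero =>
      refine fin (le_trans (lintegral_mono fun z => ?_) (hW 0 hi))
      simp only [Function.iterate_zero, id, enorm_mul]
      gcongr
      rw [← ofReal_norm]
      exact ENNReal.ofReal_le_ofReal (hbd (abs_nonneg _) (abs_nonneg _)).2.2
    | succ n =>
      have hn4 : (n : ℝ) + 1 ≤ 4 := by exact_mod_cast hi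
      have hpt : ∀ z : ℝ × ℝ, ‖Δ_[((0 : ℝ), h)] ^[n + 1] (fun z => z.2 * u z) z‖ₑ ≤
          ENNReal.ofReal ((1 + |z.1|) * (1 + |z.2|)) * (4 * ‖Δ_[((0 : ℝ), h)] ^[n + 1] u z‖ₑ) +
          ENNReal.ofReal ((1 + |z.1|) * (1 + |z.2|)) * (ENNReal.ofReal τ * (4 * ‖Δ_[((0 : ℝ), h)] ^[n] u z‖ₑ)) := by
        intro z
        have e0 := fwdDiff_iter_mul_additive (AddMonoidHom.snd ℝ ℝ) (0, h) u n z
        simp only [AddMonoidHom.coe_snd] at e0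
        rw [e0]
        have ha := abs_nonneg z.1
        have hb := abs_nonneg z.2
        have hn0 : (0 : ℝ) ≤ n := by positivity
        refine (enorm_add_le _ _).trans (add_le_add ?_ ?_)
        · rw [enorm_mul, ← mul_assoc, mul_comm (ENNReal.ofReal _) 4, show (4 : ℝ≥0∞) = ENNReal.ofReal 4 by norm_num,
            ← ENNReal.ofReal_mul (by norm_num)]
          gcongr
          rw [← ofReal_norm]
          apply ENNReal.ofReal_le_ofReal
          refine (norm_add_le _ _).trans ?_
          rw [Real.norm_eq_abs, Real.norm_of_nonneg (by positivity)]
          nlinarith [mul_nonneg ha hb]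
        · rw [enorm_mul]
          have h3 : ‖((n : ℝ) + 1) * h‖ₑ ≤ ENNReal.ofReal ((1 + |z.1|) * (1 + |z.2|)) * (ENNReal.ofReal τ * 4) := by
            rw [show (4 : ℝ≥0∞) = ENNReal.ofReal 4 by norm_num, ← ENNReal.ofReal_mul (by positivity),
              ← ENNReal.ofReal_mul (by positivity), ← ofReal_norm, Real.norm_of_nonneg (by positivity)]
            apply ENNReal.ofReal_le_ofReal
            have h5 : h ≤ τ := by nlinarith
            calc ((n : ℝ) + 1) * h ≤ 4 * τ := by gcongr
              _ ≤ (1 + |z.1|) * (1 + |z.2|) * (4 * τ) :=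
                le_mul_of_one_le_left (by positivity) (hbd ha hb).1
              _ = _ := by ring
          calc _ ≤ ENNReal.ofReal ((1 + |z.1|) * (1 + |z.2|)) * (ENNReal.ofReal τ * 4) * ‖Δ_[((0 : ℝ), h)] ^[n] u z‖ₑ := by gcongr
            _ = _ := by ring
      have m1 := measurable_fwdDiff_iter H.meas (0, h) (n + 1)
      refine (lintegral_mono hpt).trans ?_
      rw [lintegral_add_left (by fun_prop)]
      have e1 : ∀ z : ℝ × ℝ, ENNReal.ofReal ((1 + |z.1|) * (1 + |z.2|)) * (4 * ‖Δ_[((0 : ℝ), h)] ^[n + 1] u z‖ₑ) =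
        4 * (ENNReal.ofReal ((1 + |z.1|) * (1 + |z.2|)) * ‖Δ_[((0 : ℝ), h)] ^[n + 1] u z‖ₑ) := fun z => by ring
      have e2 : ∀ z : ℝ × ℝ, ENNReal.ofReal ((1 + |z.1|) * (1 + |z.2|)) * (ENNReal.ofReal τ * (4 * ‖Δ_[((0 : ℝ), h)] ^[n] u z‖ₑ)) =
        (ENNReal.ofReal τ * 4) * (ENNReal.ofReal ((1 + |z.1|) * (1 + |z.2|)) * ‖Δ_[((0 : ℝ), h)] ^[n] u z‖ₑ) := fun z => by ring
      simp only [e1, e2]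
      rw [lintegral_const_mul' _ _ (by finiteness), lintegral_const_mul' _ _ (by finiteness)]
      calc _ ≤ 4 * (ENNReal.ofReal (τ ^ (n + 1)) * ENNReal.ofReal C) +
            ENNReal.ofReal τ * 4 * (ENNReal.ofReal (τ ^ n) * ENNReal.ofReal C) := by
            gcongr
            · exact hW _ hi
            · exact hW _ (by omega)
        _ = _ := by
            rw [pow_succ', ENNReal.ofReal_mul hτ0.le]; ring

end IsNice

/-! ### The scattering operator and its Neumann series. -/

/-- Partial convolution in the first variable. -/
def cnv (V m : ℝ → ℝ → ℂ) (l y : ℝ) : ℂ := ∫ l' : ℝ, V (l - l') y * m l' y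

/-- The integral in `y` of the modulus of a function of `(l, y)`. -/
def prof (V : ℝ → ℝ → ℂ) (l : ℝ) : ℝ≥0∞ := ∫⁻ y, ‖V l y‖ₑ

/-- The linear integral operator underlying the scattering equation. -/
def gop (s k : ℝ) (F : ℝ → ℝ → ℂ) (l y : ℝ) : ℂ :=
  Complex.I * ((1 / Real.sqrt (2 * Real.pi) : ℝ) : ℂ) *
    dirInt s l y (fun η => Complex.exp (-Complex.I * l * (l + 2 * k) * (y - η)) * F l η)

/-- `(2π)^{-1/2}` as an extended nonnegative real. -/
def c1 : ℝ≥0∞ := ENNReal.ofReal (1 / Real.sqrt (2 * Real.pi))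

lemma c1_ne_top : c1 ≠ ∞ := ENNReal.ofReal_ne_top

lemma c1_le_one : c1 ≤ 1 := ENNReal.ofReal_le_one.2 inv_sqrt_two_pi_le_one

lemma c1_mul_sqrt : c1 * ‖(Real.sqrt (2 * Real.pi) : ℂ)‖ₑ = 1 := by
  rw [← ofReal_norm, Complex.norm_real, Real.norm_of_nonneg (by positivity), c1, ← ENNReal.ofReal_mul (by positivity),
    one_div_mul_cancel (by positivity), ENNReal.ofReal_one]

lemma norm_cexp_phase (l k y η : ℝ) : ‖Complex.exp (-Complex.I * l * (l + 2 * k) * (y - η))‖ = 1 := by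
  rw [Complex.norm_exp]; simp

lemma enorm_cexp_phase (l k y η : ℝ) : ‖Complex.exp (-Complex.I * l * (l + 2 * k) * (y - η))‖ₑ = 1 := by
  rw [← ofReal_norm, norm_cexp_phase, ENNReal.ofReal_one]

lemma enorm_dirInt_le (s l y : ℝ) (g : ℝ → ℂ) : ‖dirInt s l y g‖ₑ ≤ ∫⁻ η, ‖g η‖ₑ := by
  unfold dirInt
  split_ifs
  · rw [enorm_neg]
    exact (enorm_integral_le_lintegral_enorm _).trans (setLIntegral_le_lintegral _ _)
  · exact (enorm_integral_le_lintegral_enorm _).trans (setLIntegral_le_lintegral _ _)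
  · simp

/-- The exponential is unimodular, so the integral from ±∞ to y is controlled by the total mass in
η. The bound is independent of k, y and the sign, which is why majorants in l alone suffice. -/
lemma enorm_gop_le (s k : ℝ) (F : ℝ → ℝ → ℂ) (l y : ℝ) : ‖gop s k F l y‖ₑ ≤ c1 * prof F l := by
  unfold gop
  rw [mul_assoc, enorm_mul, ← ofReal_norm Complex.I, Complex.norm_I, ENNReal.ofReal_one, one_mul, enorm_mul]
  have h1 : ‖((1 / Real.sqrt (2 * Real.pi) : ℝ) : ℂ)‖ₑ = c1 := by
    rw [← ofReal_norm, Complex.norm_real, Real.norm_of_nonneg (by positivity), c1]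
  rw [h1]
  gcongr
  refine (enorm_dirInt_le _ _ _ _).trans (le_of_eq (lintegral_congr fun η => ?_))
  rw [enorm_mul, enorm_cexp_phase, one_mul]

lemma dirInt_add (s l y : ℝ) {f g : ℝ → ℂ} (hf : Integrable f) (hg : Integrable g) :
    dirInt s l y (fun η => f η + g η) = dirInt s l y f + dirInt s l y g := by
  unfold dirInt
  split_ifs
  · rw [integral_add hf.integrableOn hg.integrableOn]; ring
  · rw [integral_add hf.integrableOn hg.integrableOn]
  · simp

lemma dirInt_const_mul (s l y : ℝ) (c : ℂ) (f : ℝ → ℂ) :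
    dirInt s l y (fun η => c * f η) = c * dirInt s l y f := by
  unfold dirInt
  split_ifs
  · rw [integral_const_mul]; ring
  · rw [integral_const_mul]
  · simp

lemma dirInt_shift (s l y h : ℝ) (f : ℝ → ℂ) :
    dirInt s l (y + h) f = dirInt s l y (fun η => f (η + h)) := by
  unfold dirInt
  have e1 : (∫ η in Ioi (y + h), f η) = ∫ η in Ioi y, f (η + h) := by
    rw [← integral_indicator measurableSet_Ioi, ← integral_indicator measurableSet_Ioi,
      ← integral_add_right_eq_self _ h]
    congr 1; ext η; simp [indicator]
  have e2 : (∫ η in Iic (y + h), f η) = ∫ η in Iic y, f (η + h) := by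
    rw [← integral_indicator measurableSet_Iic, ← integral_indicator measurableSet_Iic,
      ← integral_add_right_eq_self _ h]
    congr 1; ext η; simp [indicator]
  rw [e1, e2]

lemma dirInt_tsum (s l y : ℝ) {f : ℕ → ℝ → ℂ} (hf : ∀ N, Measurable (f N)) (h : ∑' N, ∫⁻ η, ‖f N η‖ₑ ≠ ∞) :
    dirInt s l y (fun η => ∑' N, f N η) = ∑' N, dirInt s l y (f N) := by
  have hS : ∀ S : Set ℝ, ∫ η in S, ∑' N, f N η = ∑' N, ∫ η in S, f N η := fun S => by
    refine integral_tsum (fun N => (hf N).aestronglyMeasurable) (ne_top_of_le_ne_top h ?_)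
    exact ENNReal.tsum_le_tsum fun N => setLIntegral_le_lintegral _ _
  unfold dirInt
  split_ifs
  · rw [hS, tsum_neg]
  · rw [hS]
  · simp

lemma measurable_dirInt (s : ℝ) {α : Type*} [MeasurableSpace α] {g : α → ℝ → ℂ} {L Y : α → ℝ} (hL : Measurable L)
    (hY : Measurable Y) (hg : Measurable (Function.uncurry g)) :
    Measurable fun a => dirInt s (L a) (Y a) (g a) := by
  have m1 : Measurable fun a => ∫ η in Ioi (Y a), g a η := by
    simp only [← integral_indicator measurableSet_Ioi]
    apply StronglyMeasurable.measurable
    apply StronglyMeasurable.integral_prod_right (f := fun a η => (Ioi (Y a)).indicator (g a) η)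
    apply Measurable.stronglyMeasurable
    have : (Function.uncurry fun a η => (Ioi (Y a)).indicator (g a) η) =
      {p : α × ℝ | Y p.1 < p.2}.indicator (Function.uncurry g) := by
      ext p; simp [indicator, Function.uncurry]
    rw [this]
    exact hg.indicator (measurableSet_lt (hY.comp measurable_fst) measurable_snd)
  have m2 : Measurable fun a => ∫ η in Iic (Y a), g a η := by
    simp only [← integral_indicator measurableSet_Iic]
    apply StronglyMeasurable.measurable
    apply StronglyMeasurable.integral_prod_right (f := fun a η => (Iic (Y a)).indicator (g a) η)
    apply Measurable.stronglyMeasurable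
    have : (Function.uncurry fun a η => (Iic (Y a)).indicator (g a) η) =
      {p : α × ℝ | p.2 ≤ Y p.1}.indicator (Function.uncurry g) := by
      ext p; simp [indicator, Function.uncurry]
    rw [this]
    exact hg.indicator (measurableSet_le measurable_snd (hY.comp measurable_fst))
  unfold dirInt
  refine Measurable.ite (measurableSet_lt measurable_const (by fun_prop)) m1.neg ?_
  exact Measurable.ite (measurableSet_lt (by fun_prop) measurable_const) m2 measurable_const

lemma gop_add (s k : ℝ) {F G : ℝ → ℝ → ℂ} {l : ℝ} (hF : Integrable (F l)) (hG : Integrable (G l)) (y : ℝ) :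
    gop s k (fun l y => F l y + G l y) l y = gop s k F l y + gop s k G l y := by
  unfold gop
  rw [← mul_add, ← dirInt_add]
  · simp only [mul_add]
  · exact hF.bdd_mul (c := 1) (Continuous.aestronglyMeasurable (by fun_prop))
      (Eventually.of_forall fun η => (norm_cexp_phase l k y η).le)
  · exact hG.bdd_mul (c := 1) (Continuous.aestronglyMeasurable (by fun_prop))
      (Eventually.of_forall fun η => (norm_cexp_phase l k y η).le)

lemma gop_const_mul (s k : ℝ) (c : ℂ) (F : ℝ → ℝ → ℂ) (l y : ℝ) :
    gop s k (fun l y => c * F l y) l y = c * gop s k F l y := by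
  unfold gop
  rw [show c * (Complex.I * ((1 / Real.sqrt (2 * Real.pi) : ℝ) : ℂ) *
    dirInt s l y (fun η => Complex.exp (-Complex.I * l * (l + 2 * k) * (y - η)) * F l η)) =
    Complex.I * ((1 / Real.sqrt (2 * Real.pi) : ℝ) : ℂ) *
    (c * dirInt s l y (fun η => Complex.exp (-Complex.I * l * (l + 2 * k) * (y - η)) * F l η)) by ring, ← dirInt_const_mul s l y c]
  congr 2; ext η; ring

/-- The kernel depends on y - η and the endpoint moves with y, so translations in y, and with them
finite differences, commute with the operator. -/
lemma gop_shift (s k : ℝ) (F : ℝ → ℝ → ℂ) (l y h : ℝ) :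
    gop s k F l (y + h) = gop s k (fun l y => F l (y + h)) l y := by
  unfold gop
  rw [dirInt_shift]
  congr 2; ext η
  congr 2; push_cast; ring

/-- The parameter k enters the kernel only through e^{-2ikl(y-η)}, so a change of k is conjugation
by e^{2iκly}. -/
lemma gop_modulate (s k κ : ℝ) (F : ℝ → ℝ → ℂ) (l y : ℝ) :
    Complex.exp (2 * Complex.I * κ * l * y) * gop s (k + κ) F l y =
      gop s k (fun l y => Complex.exp (2 * Complex.I * κ * l * y) * F l y) l y := by
  unfold gop
  rw [show ∀ a b c d : ℂ, a * (b * c * d) = b * c * (a * d) by intros; ring, ← dirInt_const_mul]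
  congr 2; ext η
  rw [← mul_assoc, ← mul_assoc, ← Complex.exp_add, ← Complex.exp_add]
  congr 2; push_cast; ring

lemma gop_tsum (s k : ℝ) {F : ℕ → ℝ → ℝ → ℂ} {l : ℝ} (hF : ∀ N, Measurable (F N l)) (h : ∑' N, prof (F N) l ≠ ∞) (y : ℝ) :
    gop s k (fun l y => ∑' N, F N l y) l y = ∑' N, gop s k (F N) l y := by
  unfold gop
  rw [tsum_mul_left, ← dirInt_tsum]
  · congr 2; ext η; rw [tsum_mul_left]
  · intro N
    have := hF N
    fun_prop
  · simpa only [enorm_mul, enorm_cexp_phase, one_mul, prof] using h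

lemma measurable_gop (s : ℝ) {F : ℝ → ℝ → ℝ → ℂ} (hF : Measurable fun z : ℝ × ℝ × ℝ => F z.1 z.2.1 z.2.2) :
    Measurable fun z : ℝ × ℝ × ℝ => gop s z.1 (F z.1) z.2.1 z.2.2 := by
  unfold gop
  refine Measurable.const_mul ?_ _
  refine measurable_dirInt s (by fun_prop) (by fun_prop) ?_
  unfold Function.uncurry
  have : Measurable fun p : (ℝ × ℝ × ℝ) × ℝ => F p.1.1 p.1.2.1 p.2 :=
    hF.comp (by fun_prop : Measurable fun p : (ℝ × ℝ × ℝ) × ℝ => (p.1.1, p.1.2.1, p.2))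
  fun_prop

/-- Potentials: jointly measurable and bounded in `l` for every `y`. -/
structure Slab (V : ℝ → ℝ → ℂ) : Prop where
  meas : Measurable fun z : ℝ × ℝ => V z.1 z.2
  bdd : ∀ y, ∃ B : ℝ, ∀ l, ‖V l y‖ ≤ B

/-- Jointly measurable functions with an integrable majorant depending on `l` only. -/
structure Dom (m : ℝ → ℝ → ℂ) (φ : ℝ → ℝ≥0∞) : Prop where
  meas : Measurable fun z : ℝ × ℝ => m z.1 z.2
  meas_bound : Measurable φ
  lintegral_ne_top : ∫⁻ l, φ l ≠ ∞
  le : ∀ l y, ‖m l y‖ₑ ≤ φ l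

lemma measurable_slice_left {f : ℝ → ℝ → ℂ} (hf : Measurable fun z : ℝ × ℝ => f z.1 z.2) (l : ℝ) : Measurable (f l) := by
  have h2 : Measurable (fun y : ℝ => ((l, y) : ℝ × ℝ)) := by fun_prop
  have h3 := hf.comp h2
  simpa only [Function.comp_def] using h3

lemma measurable_slice_right {f : ℝ → ℝ → ℂ} (hf : Measurable fun z : ℝ × ℝ => f z.1 z.2) (y : ℝ) :
    Measurable fun l => f l y := by
  have h2 : Measurable (fun l : ℝ => ((l, y) : ℝ × ℝ)) := by fun_prop
  have h3 := hf.comp h2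
  simpa only [Function.comp_def] using h3

lemma measurable_prof {V : ℝ → ℝ → ℂ} (hV : Measurable fun z : ℝ × ℝ => V z.1 z.2) : Measurable (prof V) := by
  unfold prof
  exact Measurable.lintegral_prod_right' (f := fun z : ℝ × ℝ => ‖V z.1 z.2‖ₑ) hV.enorm

lemma Dom.integrable {m : ℝ → ℝ → ℂ} {φ : ℝ → ℝ≥0∞} (hm : Dom m φ) (y : ℝ) : Integrable fun l => m l y :=
  ⟨(measurable_slice_right hm.meas y).aestronglyMeasurable,
    (lintegral_mono fun l => hm.le l y).trans_lt hm.lintegral_ne_top.lt_top⟩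

lemma integrable_cnv {V m : ℝ → ℝ → ℂ} {φ : ℝ → ℝ≥0∞} (hV : Slab V) (hm : Dom m φ) (l y : ℝ) :
    Integrable fun l' => V (l - l') y * m l' y := by
  obtain ⟨B, hB⟩ := hV.bdd y
  have h := measurable_slice_right hV.meas y
  exact (hm.integrable y).bdd_mul (c := B) (h.comp (measurable_const.sub measurable_id)).aestronglyMeasurable
    (Eventually.of_forall fun l' => hB _)

lemma measurable_cnv {V : ℝ → ℝ → ℂ} (hV : Measurable fun z : ℝ × ℝ => V z.1 z.2) {α : Type*} [MeasurableSpace α]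
    {m : α → ℝ → ℝ → ℂ} (hm : Measurable fun z : α × ℝ × ℝ => m z.1 z.2.1 z.2.2) :
    Measurable fun z : α × ℝ × ℝ => cnv V (m z.1) z.2.1 z.2.2 := by
  unfold cnv
  apply StronglyMeasurable.measurable
  apply StronglyMeasurable.integral_prod_right
    (f := fun (z : α × ℝ × ℝ) (l' : ℝ) => V (z.2.1 - l') z.2.2 * m z.1 l' z.2.2)
  apply Measurable.stronglyMeasurable
  unfold Function.uncurry
  have h1 : Measurable fun p : (α × ℝ × ℝ) × ℝ => V (p.1.2.1 - p.2) p.1.2.2 :=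
    hV.comp (by fun_prop : Measurable fun p : (α × ℝ × ℝ) × ℝ => (p.1.2.1 - p.2, p.1.2.2))
  have h2 : Measurable fun p : (α × ℝ × ℝ) × ℝ => m p.1.1 p.2 p.1.2.2 :=
    hm.comp (by fun_prop : Measurable fun p : (α × ℝ × ℝ) × ℝ => (p.1.1, p.2, p.1.2.2))
  exact h1.mul h2

lemma measurable_cnv' {V m : ℝ → ℝ → ℂ} (hV : Measurable fun z : ℝ × ℝ => V z.1 z.2)
    (hm : Measurable fun z : ℝ × ℝ => m z.1 z.2) : Measurable fun z : ℝ × ℝ => cnv V m z.1 z.2 := by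
  have := measurable_cnv hV (α := Unit) (m := fun _ => m)
    (hm.comp (by fun_prop : Measurable fun z : Unit × ℝ × ℝ => (z.2.1, z.2.2)))
  exact this.comp (by fun_prop : Measurable fun z : ℝ × ℝ => ((), z.1, z.2))

/-- Minkowski bound for the partial convolution, with `y`-dependence estimated under the integral. -/
lemma lintegral_lintegral_conv_le {g : ℝ → ℝ → ℝ → ℂ} (hg : Measurable fun z : ℝ × ℝ × ℝ => g z.1 z.2.1 z.2.2) (l : ℝ) :
    ∫⁻ y, ‖∫ l', g l l' y‖ₑ ≤ ∫⁻ l', ∫⁻ y, ‖g l l' y‖ₑ := by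
  calc ∫⁻ y, ‖∫ l', g l l' y‖ₑ ≤ ∫⁻ y, ∫⁻ l', ‖g l l' y‖ₑ := lintegral_mono fun y => enorm_integral_le_lintegral_enorm _
    _ = ∫⁻ l', ∫⁻ y, ‖g l l' y‖ₑ := by
        rw [lintegral_lintegral_swap]
        have : Measurable fun p : ℝ × ℝ => g l p.2 p.1 :=
          hg.comp (by fun_prop : Measurable fun p : ℝ × ℝ => (l, p.2, p.1))
        exact this.enorm.aemeasurable

lemma measurable_conv_integrand {V m : ℝ → ℝ → ℂ} (hV : Measurable fun z : ℝ × ℝ => V z.1 z.2)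
    (hm : Measurable fun z : ℝ × ℝ => m z.1 z.2) :
    Measurable fun z : ℝ × ℝ × ℝ => V (z.1 - z.2.1) z.2.2 * m z.2.1 z.2.2 := by
  have h1 : Measurable fun p : ℝ × ℝ × ℝ => V (p.1 - p.2.1) p.2.2 :=
    hV.comp (by fun_prop : Measurable fun p : ℝ × ℝ × ℝ => (p.1 - p.2.1, p.2.2))
  have h2 : Measurable fun p : ℝ × ℝ × ℝ => m p.2.1 p.2.2 :=
    hm.comp (by fun_prop : Measurable fun p : ℝ × ℝ × ℝ => (p.2.1, p.2.2))
  exact h1.mul h2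

/-- By Tonelli the y-integral falls on V alone, since m is bounded in y by φ. The weight w serves
the moments of the potential. -/
lemma lintegral_weight_cnv_le {V m : ℝ → ℝ → ℂ} {φ : ℝ → ℝ≥0∞} {w : ℝ → ℝ≥0∞} (hw : Measurable w)
    (hV : Measurable fun z : ℝ × ℝ => V z.1 z.2)
    (hm : Measurable fun z : ℝ × ℝ => m z.1 z.2) (hle : ∀ l y, ‖m l y‖ₑ ≤ φ l) (l : ℝ) :
    ∫⁻ y, w y * ‖cnv V m l y‖ₑ ≤ cv (fun l => ∫⁻ y, w y * ‖V l y‖ₑ) φ l := by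
  have hVs : ∀ l, Measurable (V l) := measurable_slice_left hV
  calc ∫⁻ y, w y * ‖cnv V m l y‖ₑ ≤ ∫⁻ y, w y * ∫⁻ l', ‖V (l - l') y * m l' y‖ₑ := by
        refine lintegral_mono fun y => ?_
        dsimp only
        gcongr
        exact enorm_integral_le_lintegral_enorm _
    _ = ∫⁻ y, ∫⁻ l', w y * ‖V (l - l') y * m l' y‖ₑ := by
        refine lintegral_congr fun y => ?_
        rw [lintegral_const_mul]
        have := (measurable_conv_integrand hV hm).comp (by fun_prop : Measurable fun l' : ℝ => (l, l', y))
        exact this.enorm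
    _ = ∫⁻ l', ∫⁻ y, w y * ‖V (l - l') y * m l' y‖ₑ := by
        rw [lintegral_lintegral_swap]
        have := (measurable_conv_integrand hV hm).comp (by fun_prop : Measurable fun p : ℝ × ℝ => (l, p.2, p.1))
        exact ((hw.comp measurable_fst).mul this.enorm).aemeasurable
    _ ≤ ∫⁻ l', (∫⁻ y, w y * ‖V (l - l') y‖ₑ) * φ l' := by
        refine lintegral_mono fun l' => ?_
        dsimp only
        rw [← lintegral_mul_const]
        · refine lintegral_mono fun y => ?_
          dsimp only
          rw [enorm_mul, mul_assoc]
          gcongr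
          exact hle l' y
        · have := (hVs (l - l')).enorm
          fun_prop
    _ = _ := rfl

lemma prof_cnv_le {V m : ℝ → ℝ → ℂ} {φ : ℝ → ℝ≥0∞} (hV : Measurable fun z : ℝ × ℝ => V z.1 z.2)
    (hm : Measurable fun z : ℝ × ℝ => m z.1 z.2) (hle : ∀ l y, ‖m l y‖ₑ ≤ φ l) (l : ℝ) :
    prof (cnv V m) l ≤ cv (prof V) φ l := by
  have := lintegral_weight_cnv_le (w := fun _ => 1) measurable_const hV hm hle l
  simp only [one_mul] at this
  exact this

/-- Dominated by the summed masses of the majorants, with V bounded in l at the given height y. -/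
lemma cnv_tsum {V : ℝ → ℝ → ℂ} (hV : Slab V) {d : ℕ → ℝ → ℝ → ℂ} {φ : ℕ → ℝ → ℝ≥0∞}
    (hd : ∀ N, Dom (d N) (φ N)) (hs : ∑' N, ∫⁻ l, φ N l ≠ ∞) (l y : ℝ) :
    cnv V (fun l y => ∑' N, d N l y) l y = ∑' N, cnv V (d N) l y := by
  unfold cnv
  simp only [← tsum_mul_left]
  obtain ⟨B, hB⟩ := hV.bdd y
  refine integral_tsum (fun N => (integrable_cnv hV (hd N) l y).1) ?_
  have : ∑' N, ∫⁻ l', ‖V (l - l') y * d N l' y‖ₑ ≤ ∑' N, ENNReal.ofReal B * ∫⁻ l, φ N l := by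
    refine ENNReal.tsum_le_tsum fun N => ?_
    rw [← lintegral_const_mul' _ _ ENNReal.ofReal_ne_top]
    refine lintegral_mono fun l' => ?_
    dsimp only
    rw [enorm_mul]
    gcongr
    · rw [← ofReal_norm]; exact ENNReal.ofReal_le_ofReal (hB _)
    · exact (hd N).le _ _
  refine ne_top_of_le_ne_top ?_ this
  rw [ENNReal.tsum_mul_left]
  exact ENNReal.mul_ne_top ENNReal.ofReal_ne_top hs

/-- The convolution kernel majorizing the scattering operator. -/
def ker (u : ℝ × ℝ → ℝ) (l : ℝ) : ℝ≥0∞ := c1 * prof (ut u) l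

/-- The terms of the Neumann series of the scattering equation. -/
def ser (s : ℝ) (u : ℝ × ℝ → ℝ) : ℕ → ℝ → ℝ → ℝ → ℂ
  | 0 => fun k => gop s k fun l y => (Real.sqrt (2 * Real.pi) : ℂ) * ut u l y
  | N + 1 => fun k => gop s k (cnv (ut u) (ser s u N k))

/-- The scattering solution, as a Neumann series. -/
def mu (s : ℝ) (u : ℝ × ℝ → ℝ) (k l y : ℝ) : ℂ := ∑' N, ser s u N k l y

/-- The majorant of the scattering solution. -/
def maj (u : ℝ × ℝ → ℝ) : ℝ → ℝ≥0∞ := res (ker u) (prof (ut u))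

lemma gMu_eq_gop (s : ℝ) (u : ℝ × ℝ → ℝ) (m : ℝ → ℝ → ℝ → ℂ) (k l y : ℝ) :
    gMu s u m k l y = gop s k (convMu u m k) l y := rfl

lemma convMu_eq (u : ℝ × ℝ → ℝ) (m : ℝ → ℝ → ℝ → ℂ) (k l y : ℝ) :
    convMu u m k l y = (Real.sqrt (2 * Real.pi) : ℂ) * ut u l y + cnv (ut u) (m k) l y := rfl

lemma measurable_ser (s : ℝ) {u : ℝ × ℝ → ℝ} (hu : Measurable u) (N : ℕ) :
    Measurable fun z : ℝ × ℝ × ℝ => ser s u N z.1 z.2.1 z.2.2 := by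
  induction N with
  | zero =>
    refine measurable_gop s (F := fun _ l y => (Real.sqrt (2 * Real.pi) : ℂ) * ut u l y) ?_
    exact ((measurable_ut hu).comp (by fun_prop : Measurable fun z : ℝ × ℝ × ℝ => (z.2.1, z.2.2))).const_mul _
  | succ N ih =>
    exact measurable_gop s (F := fun k => cnv (ut u) (ser s u N k)) (measurable_cnv (measurable_ut hu) ih)

lemma measurable_section {m : ℝ → ℝ → ℝ → ℂ} (hm : Measurable fun z : ℝ × ℝ × ℝ => m z.1 z.2.1 z.2.2) (k : ℝ) :
    Measurable fun z : ℝ × ℝ => m k z.1 z.2 :=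
  hm.comp (by fun_prop : Measurable fun z : ℝ × ℝ => (k, z.1, z.2))

/-- One application of the operator costs one convolution with `ker`. In the first term the
normalization (2π)^(-1/2) of the operator cancels the √(2π) of the delta function. -/
lemma enorm_ser_le (s : ℝ) {u : ℝ × ℝ → ℝ} (hu : Measurable u) (N : ℕ) (k l y : ℝ) :
    ‖ser s u N k l y‖ₑ ≤ (cv (ker u))^[N] (prof (ut u)) l := by
  induction N generalizing l y with
  | zero =>
    refine (enorm_gop_le s k _ l y).trans (le_of_eq ?_)
    simp only [prof, enorm_mul]
    rw [lintegral_const_mul' _ _ enorm_ne_top, ← mul_assoc, c1_mul_sqrt, one_mul]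
    rfl
  | succ N ih =>
    rw [Function.iterate_succ_apply']
    refine (enorm_gop_le s k _ l y).trans ?_
    unfold ker
    rw [cv_const_mul_left c1_ne_top]
    gcongr
    exact prof_cnv_le (measurable_ut hu) (measurable_section (measurable_ser s hu N) k) ih l

lemma measurable_ker {u : ℝ × ℝ → ℝ} (hu : Measurable u) : Measurable (ker u) :=
  (measurable_prof (measurable_ut hu)).const_mul _

/-- This is where the smallness hypothesis enters: the mass of the convolution kernel is the
constant c. -/
lemma lintegral_ker {u : ℝ × ℝ → ℝ} (hu : Measurable u) : ∫⁻ l, ker u l = cNorm u := by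
  have hpi := Real.pi_pos
  unfold ker cNorm prof
  rw [lintegral_const_mul' _ _ c1_ne_top, Measure.volume_eq_prod, lintegral_prod _ (measurable_ut hu).enorm.aemeasurable, c1,
    one_div, ENNReal.ofReal_inv_of_pos (by positivity), ENNReal.div_eq_inv_mul]

lemma IsNice.slab {u : ℝ × ℝ → ℝ} {C : ℝ} (H : IsNice u C) : Slab (ut u) := by
  refine ⟨measurable_ut H.meas, fun y => ⟨(∫⁻ x, ‖u (x, y)‖ₑ).toReal, fun l => ?_⟩⟩
  have h : ∫⁻ x, ‖u (x, y)‖ₑ ≠ ∞ := (H.sliceInt.2 y).2.ne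
  rw [← toReal_enorm]
  exact ENNReal.toReal_mono h (enorm_ut_le u l y)

lemma IsNice.prof_le {u : ℝ × ℝ → ℝ} {C : ℝ} (H : IsNice u C) :
    ∃ K : ℝ≥0∞, K ≠ ∞ ∧ ∀ l, prof (ut u) l ≤ K * wt (13 / 4) l := by
  obtain ⟨K, hK, h⟩ := H.exists_ut_wt
  exact ⟨K, hK, fun l => (H.lintegral_ut_le l).trans (h l)⟩

lemma IsNice.lintegral_prof_ne_top {u : ℝ × ℝ → ℝ} {C : ℝ} (H : IsNice u C) : ∫⁻ l, prof (ut u) l ≠ ∞ := by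
  obtain ⟨K, hK, h⟩ := H.prof_le
  refine ((lintegral_mono h).trans_lt ?_).ne
  rw [lintegral_const_mul' _ _ hK]
  exact ENNReal.mul_lt_top hK.lt_top (lintegral_wt_lt_top (by norm_num))

lemma ker_le_prof (u : ℝ × ℝ → ℝ) (l : ℝ) : ker u l ≤ prof (ut u) l :=
  mul_le_of_le_one_left' c1_le_one

lemma IsNice.exists_maj_le {u : ℝ × ℝ → ℝ} {C : ℝ} (H : IsNice u C) (hc : cNorm u < 1) :
    ∃ K : ℝ≥0∞, K ≠ ∞ ∧ ∀ l, maj u l ≤ K * wt (13 / 4) l := by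
  obtain ⟨K, hK, h⟩ := H.prof_le
  exact exists_res_le_wt (measurable_ker H.meas) (measurable_prof (measurable_ut H.meas)) (by norm_num) hK
    (fun l => (ker_le_prof u l).trans (h l)) h (by rwa [lintegral_ker H.meas])

lemma measurable_maj {u : ℝ × ℝ → ℝ} (hu : Measurable u) : Measurable (maj u) :=
  measurable_res (measurable_ker hu) (measurable_prof (measurable_ut hu))

lemma IsNice.lintegral_maj_ne_top {u : ℝ × ℝ → ℝ} {C : ℝ} (H : IsNice u C) (hc : cNorm u < 1) : ∫⁻ l, maj u l ≠ ∞ :=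
  lintegral_res_ne_top (measurable_ker H.meas) (measurable_prof (measurable_ut H.meas)) (by rwa [lintegral_ker H.meas])
    H.lintegral_prof_ne_top

lemma IsNice.maj_ne_top {u : ℝ × ℝ → ℝ} {C : ℝ} (H : IsNice u C) (hc : cNorm u < 1) (l : ℝ) : maj u l ≠ ∞ := by
  obtain ⟨K, hK, h⟩ := H.exists_maj_le hc
  exact ne_top_of_le_ne_top (ENNReal.mul_ne_top hK (wt_ne_top _ _)) (h l)

lemma summable_of_tsum_enorm_ne_top {f : ℕ → ℂ} (h : ∑' N, ‖f N‖ₑ ≠ ∞) : Summable f := by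
  refine Summable.of_norm ?_
  have := ENNReal.summable_toReal h
  simpa only [toReal_enorm] using this

lemma enorm_tsum_le {f : ℕ → ℂ} : ‖∑' N, f N‖ₑ ≤ ∑' N, ‖f N‖ₑ := by
  by_cases h : ∑' N, ‖f N‖ₑ = ∞
  · rw [h]; exact le_top
  have h1 := ENNReal.summable_toReal h
  simp only [toReal_enorm] at h1
  rw [← ofReal_norm]
  refine (ENNReal.ofReal_le_ofReal (norm_tsum_le_tsum_norm h1)).trans (le_of_eq ?_)
  rw [ENNReal.ofReal_tsum_of_nonneg (fun _ => norm_nonneg _) h1]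
  simp only [ofReal_norm]

lemma tsum_enorm_ser_le (s : ℝ) {u : ℝ × ℝ → ℝ} (hu : Measurable u) (k l y : ℝ) :
    ∑' N, ‖ser s u N k l y‖ₑ ≤ maj u l := ENNReal.tsum_le_tsum fun N => enorm_ser_le s hu N k l y

lemma IsNice.summable_ser {u : ℝ × ℝ → ℝ} {C : ℝ} (H : IsNice u C) (hc : cNorm u < 1) (s k l y : ℝ) :
    Summable fun N => ser s u N k l y :=
  summable_of_tsum_enorm_ne_top (ne_top_of_le_ne_top (H.maj_ne_top hc l) (tsum_enorm_ser_le s H.meas k l y))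

lemma enorm_mu_le (s : ℝ) {u : ℝ × ℝ → ℝ} (hu : Measurable u) (k l y : ℝ) : ‖mu s u k l y‖ₑ ≤ maj u l :=
  enorm_tsum_le.trans (tsum_enorm_ser_le s hu k l y)

lemma IsNice.measurable_mu {u : ℝ × ℝ → ℝ} {C : ℝ} (H : IsNice u C) (hc : cNorm u < 1) (s : ℝ) :
    Measurable fun z : ℝ × ℝ × ℝ => mu s u z.1 z.2.1 z.2.2 := by
  have h1 : ∀ n : ℕ, Measurable fun z : ℝ × ℝ × ℝ => ∑ N ∈ Finset.range n, ser s u N z.1 z.2.1 z.2.2 := fun n =>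
    Finset.measurable_fun_sum _ fun N _ => measurable_ser s H.meas N
  refine measurable_of_tendsto_metrizable h1 ?_
  rw [tendsto_pi_nhds]
  intro z
  exact (H.summable_ser hc s z.1 z.2.1 z.2.2).hasSum.tendsto_sum_nat

lemma IsNice.dom_mu {u : ℝ × ℝ → ℝ} {C : ℝ} (H : IsNice u C) (hc : cNorm u < 1) (s k : ℝ) :
    Dom (mu s u k) (maj u) :=
  ⟨measurable_section (H.measurable_mu hc s) k, measurable_maj H.meas, H.lintegral_maj_ne_top hc, enorm_mu_le s H.meas k⟩

lemma integrable_of_prof {V : ℝ → ℝ → ℂ} (hV : Measurable fun z : ℝ × ℝ => V z.1 z.2) {l : ℝ} (h : prof V l ≠ ∞) :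
    Integrable (V l) :=
  ⟨(measurable_slice_left hV l).aestronglyMeasurable, h.lt_top⟩

lemma IsNice.prof_ut_ne_top {u : ℝ × ℝ → ℝ} {C : ℝ} (H : IsNice u C) (l : ℝ) : prof (ut u) l ≠ ∞ := by
  obtain ⟨K, hK, h⟩ := H.prof_le
  exact ne_top_of_le_ne_top (ENNReal.mul_ne_top hK (wt_ne_top _ _)) (h l)

lemma c1_ne_zero : c1 ≠ 0 := by
  have := Real.pi_pos
  rw [c1, Ne, ENNReal.ofReal_eq_zero, not_le]; positivity

lemma cv_prof_ne_top {u : ℝ × ℝ → ℝ} {φ : ℝ → ℝ≥0∞} {l : ℝ} (h : cv (ker u) φ l ≠ ∞) : cv (prof (ut u)) φ l ≠ ∞ := by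
  unfold ker at h
  rw [cv_const_mul_left c1_ne_top] at h
  exact fun h' => h (by rw [h', ENNReal.mul_top c1_ne_zero])

/-- The Neumann series solves the scattering equation, everywhere. -/
lemma IsNice.mu_eq {u : ℝ × ℝ → ℝ} {C : ℝ} (H : IsNice u C) (hc : cNorm u < 1) (s k l y : ℝ) :
    mu s u k l y = gMu s u (mu s u) k l y := by
  have ma := measurable_ker H.meas
  have mf := measurable_prof (measurable_ut H.meas)
  have hks : ∫⁻ l, ker u l < 1 := by rwa [lintegral_ker H.meas]
  have hsum : ∑' N, ∫⁻ l, (cv (ker u))^[N] (prof (ut u)) l ≠ ∞ := by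
    rw [← lintegral_tsum fun N => (measurable_cv_iter ma mf N).aemeasurable]
    exact H.lintegral_maj_ne_top hc
  have hd : ∀ N, Dom (ser s u N k) ((cv (ker u))^[N] (prof (ut u))) := fun N =>
    ⟨measurable_section (measurable_ser s H.meas N) k, measurable_cv_iter ma mf N,
      ne_top_of_le_ne_top hsum (ENNReal.le_tsum N), enorm_ser_le s H.meas N k⟩
  have e1 : cnv (ut u) (mu s u k) = fun l y => ∑' N, cnv (ut u) (ser s u N k) l y := by
    ext l y
    exact cnv_tsum H.slab hd hsum l y
  have hcv : cv (prof (ut u)) (maj u) l ≠ ∞ :=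
    cv_prof_ne_top (ne_top_of_le_ne_top (H.maj_ne_top hc l) (cv_res_le ma mf l))
  -- The profiles of the convolved terms sum to at most `prof` convolved with `maj`, finite because
  -- c₁ times it is one further application of the resolvent.
  have hser : ∑' N, prof (cnv (ut u) (ser s u N k)) l ≠ ∞ := by
    refine ne_top_of_le_ne_top hcv ?_
    calc ∑' N, prof (cnv (ut u) (ser s u N k)) l ≤ ∑' N, cv (prof (ut u)) ((cv (ker u))^[N] (prof (ut u))) l :=
          ENNReal.tsum_le_tsum fun N => prof_cnv_le (measurable_ut H.meas) (hd N).meas (hd N).le l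
      _ = cv (prof (ut u)) (maj u) l := by
          change ∑' N, ∫⁻ q, prof (ut u) (l - q) * (cv (ker u))^[N] (prof (ut u)) q =
            ∫⁻ q, prof (ut u) (l - q) * ∑' N, (cv (ker u))^[N] (prof (ut u)) q
          rw [← lintegral_tsum]
          · simp only [ENNReal.tsum_mul_left]
          · exact fun N => ((measurable_const_sub mf l).mul (measurable_cv_iter ma mf N)).aemeasurable
  have hmc : ∀ N, Measurable (cnv (ut u) (ser s u N k) l) := fun N =>
    measurable_slice_left (measurable_cnv' (measurable_ut H.meas) (hd N).meas) l
  have i1 : Integrable (fun y => (Real.sqrt (2 * Real.pi) : ℂ) * ut u l y) :=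
    (integrable_of_prof (measurable_ut H.meas) (H.prof_ut_ne_top l)).const_mul _
  have i2 : Integrable (cnv (ut u) (mu s u k) l) := by
    refine integrable_of_prof (measurable_cnv' (measurable_ut H.meas) (H.dom_mu hc s k).meas) ?_
    exact ne_top_of_le_ne_top hcv (prof_cnv_le (measurable_ut H.meas) (H.dom_mu hc s k).meas (H.dom_mu hc s k).le l)
  have e2 : convMu u (mu s u) k = fun l y => (Real.sqrt (2 * Real.pi) : ℂ) * ut u l y + cnv (ut u) (mu s u k) l y := rfl
  rw [gMu_eq_gop, e2, gop_add s k i1 i2, e1, gop_tsum s k hmc hser, mu, (H.summable_ser hc s k l y).tsum_eq_zero_add]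
  rfl

/-! ### Gronwall principle and differences of the solution in y. -/

lemma cv_iter_const_mul {a f : ℝ → ℝ≥0∞} {c : ℝ≥0∞} (hc : c ≠ ∞) (N : ℕ) :
    (cv a)^[N] (fun l => c * f l) = fun l => c * (cv a)^[N] f l := by
  induction N with
  | zero => rfl
  | succ N ih =>
    rw [Function.iterate_succ_apply', Function.iterate_succ_apply', ih]
    ext l
    exact cv_const_mul_right hc l

lemma res_const_mul {a f : ℝ → ℝ≥0∞} {c : ℝ≥0∞} (hc : c ≠ ∞) (l : ℝ) :
    res a (fun l => c * f l) l = c * res a f l := by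
  unfold res
  rw [← ENNReal.tsum_mul_left]
  exact tsum_congr fun N => congrFun (cv_iter_const_mul hc N) l

/-- A Gronwall principle: a function satisfying `‖D‖ ≤ f + a * φ` for each of its majorants `φ` is
majorized by the resolvent of `f`. -/
lemma enorm_le_res {a f φ₀ : ℝ → ℝ≥0∞} (ha : Measurable a) (hf : Measurable f) (hφ₀ : Measurable φ₀)
    {D : ℝ → ℝ → ℂ} (h0 : ∀ l y, ‖D l y‖ₑ ≤ φ₀ l) (hfin : ∀ l, res a φ₀ l ≠ ∞)
    (step : ∀ φ, Measurable φ → (∀ l y, ‖D l y‖ₑ ≤ φ l) → ∀ l y, ‖D l y‖ₑ ≤ f l + cv a φ l) (l y : ℝ) :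
    ‖D l y‖ₑ ≤ res a f l := by
  have mi : ∀ N, Measurable fun l => ∑ j ∈ Finset.range N, (cv a)^[j] f l := fun N =>
    Finset.measurable_fun_sum _ fun j _ => measurable_cv_iter ha hf j
  have cvs : ∀ N l, f l + cv a (fun l => ∑ j ∈ Finset.range N, (cv a)^[j] f l) l =
      ∑ j ∈ Finset.range (N + 1), (cv a)^[j] f l := by
    intro N l
    rw [Finset.sum_range_succ', add_comm]
    congr 1
    have : ∀ j, (cv a)^[j + 1] f l = ∫⁻ q, a (l - q) * (cv a)^[j] f q := fun j => by
      rw [Function.iterate_succ_apply']; rfl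
    simp only [this]
    rw [← lintegral_finsetSum]
    · simp only [cv, Finset.mul_sum]
    · exact fun j _ => (measurable_const_sub ha l).mul (measurable_cv_iter ha hf j)
  have key : ∀ N l y, ‖D l y‖ₑ ≤ (∑ j ∈ Finset.range N, (cv a)^[j] f l) + (cv a)^[N] φ₀ l := by
    intro N
    induction N with
    | zero => simpa using h0
    | succ N ih =>
      intro l y
      refine (step _ ((mi N).add (measurable_cv_iter ha hφ₀ N)) ih l y).trans (le_of_eq ?_)
      have e := cv_add_right (g' := (cv a)^[N] φ₀) ha (mi N) l
      rw [← cvs, add_assoc, Function.iterate_succ_apply' _ N φ₀]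
      exact congrArg _ e
  -- After N steps the remainder is the N-th term of the finite series `res a φ₀ l`, hence tends to
  -- 0. Thus φ₀ may be any crude majorant with a finite resolvent.
  have ht : Tendsto (fun N => res a f l + (cv a)^[N] φ₀ l) atTop (𝓝 (res a f l + 0)) :=
    tendsto_const_nhds.add (ENNReal.tendsto_atTop_zero_of_tsum_ne_top (hfin l))
  rw [add_zero] at ht
  exact ge_of_tendsto' ht fun N => (key N l y).trans (by gcongr; exact ENNReal.sum_le_tsum _)

section Leibniz
variable {h : ℝ} {t : ℝ≥0∞}

lemma fwdDiff_mul_eq (f g : ℝ → ℂ) :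
    Δ_[h] (fun y => f y * g y) = fun y => Δ_[h] f y * g (y + h) + f y * Δ_[h] g y := by
  ext y; simp only [fwdDiff]; ring

lemma fwdDiff_iter_add_fun (n : ℕ) (f g : ℝ → ℂ) :
    Δ_[h] ^[n] (fun y => f y + g y) = fun y => Δ_[h] ^[n] f y + Δ_[h] ^[n] g y :=
  fwdDiff_iter_add h f g n

lemma fwdDiff_iter_comp_add (n : ℕ) (g : ℝ → ℂ) (y : ℝ) :
    Δ_[h] ^[n] (fun y => g (y + h)) y = Δ_[h] ^[n] g (y + h) := by
  induction n generalizing y with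
  | zero => rfl
  | succ n ih => rw [Function.iterate_succ_apply', Function.iterate_succ_apply', fwdDiff, fwdDiff, ih, ih]

/-- `L¹` bound for differences of a product. -/
lemma lintegral_fwdDiff_mul_le (n : ℕ) {f g : ℝ → ℂ} (hf : Measurable f) (hg : Measurable g) {p M : ℝ≥0∞}
    (hp : ∀ i ≤ n, ∫⁻ y, ‖Δ_[h] ^[i] f y‖ₑ ≤ t ^ i * p) (hM : ∀ j ≤ n, ∀ y, ‖Δ_[h] ^[j] g y‖ₑ ≤ t ^ j * M) :
    ∫⁻ y, ‖Δ_[h] ^[n] (fun y => f y * g y) y‖ₑ ≤ t ^ n * (2 ^ n * (p * M)) := by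
  induction n generalizing f g p M with
  | zero =>
    have h1 := hp 0 le_rfl
    have h2 := hM 0 le_rfl
    simp only [Function.iterate_zero, id, pow_zero, one_mul, enorm_mul] at *
    calc ∫⁻ y, ‖f y‖ₑ * ‖g y‖ₑ ≤ ∫⁻ y, ‖f y‖ₑ * M := lintegral_mono fun y => mul_le_mul' le_rfl (h2 y)
      _ = (∫⁻ y, ‖f y‖ₑ) * M := lintegral_mul_const _ (by fun_prop)
      _ ≤ p * M := by gcongr
  | succ n ih =>
    have mg : Measurable fun y => g (y + h) := by fun_prop
    have mf : Measurable (Δ_[h] f) := measurable_fwdDiff_iter_real hf h 1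
    have mg' : Measurable (Δ_[h] g) := measurable_fwdDiff_iter_real hg h 1
    rw [Function.iterate_succ_apply, fwdDiff_mul_eq, fwdDiff_iter_add_fun]
    have b1 := ih (f := Δ_[h] f) (g := fun y => g (y + h)) mf mg (p := t * p) (M := M)
      (fun i hi => by
        have := hp (i + 1) (by omega)
        rw [Function.iterate_succ_apply] at this
        refine this.trans (le_of_eq (by ring)))
      (fun j hj y => by rw [fwdDiff_iter_comp_add]; exact hM j (by omega) _)
    have b2 := ih (f := f) (g := Δ_[h] g) hf mg' (p := p) (M := t * M)
      (fun i hi => hp i (by omega))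
      (fun j hj y => by
        have := hM (j + 1) (by omega) y
        rw [Function.iterate_succ_apply] at this
        refine this.trans (le_of_eq (by ring)))
    calc _ ≤ ∫⁻ y, (‖Δ_[h] ^[n] (fun y => Δ_[h] f y * g (y + h)) y‖ₑ + ‖Δ_[h] ^[n] (fun y => f y * Δ_[h] g y) y‖ₑ) :=
          lintegral_mono fun y => enorm_add_le _ _
      _ = (∫⁻ y, ‖Δ_[h] ^[n] (fun y => Δ_[h] f y * g (y + h)) y‖ₑ) + ∫⁻ y, ‖Δ_[h] ^[n] (fun y => f y * Δ_[h] g y) y‖ₑ :=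
          lintegral_add_left (measurable_fwdDiff_iter_real (mf.mul mg) h n).enorm _
      _ ≤ _ := add_le_add b1 b2
      _ = _ := by ring

/-- In the differences of a product, all terms but one involve lower differences of the second
factor only. -/
lemma lintegral_fwdDiff_mul_sub_le (n : ℕ) {f g : ℝ → ℂ} (hf : Measurable f) (hg : Measurable g) {p M : ℝ≥0∞}
    (hp : ∀ i ≤ n, ∫⁻ y, ‖Δ_[h] ^[i] f y‖ₑ ≤ t ^ i * p) (hM : ∀ j < n, ∀ y, ‖Δ_[h] ^[j] g y‖ₑ ≤ t ^ j * M) :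
    ∫⁻ y, ‖Δ_[h] ^[n] (fun y => f y * g y) y - f y * Δ_[h] ^[n] g y‖ₑ ≤ t ^ n * (2 ^ n * (p * M)) := by
  induction n generalizing g M with
  | zero => simp
  | succ n ih =>
    have mg : Measurable fun y => g (y + h) := by fun_prop
    have mf : Measurable (Δ_[h] f) := measurable_fwdDiff_iter_real hf h 1
    have mg' : Measurable (Δ_[h] g) := measurable_fwdDiff_iter_real hg h 1
    rw [Function.iterate_succ_apply, Function.iterate_succ_apply, fwdDiff_mul_eq, fwdDiff_iter_add_fun]
    have b1 := lintegral_fwdDiff_mul_le n (h := h) (t := t) (f := Δ_[h] f) (g := fun y => g (y + h)) mf mg (p := t * p) (M := M)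
      (fun i hi => by
        have := hp (i + 1) (by omega)
        rw [Function.iterate_succ_apply] at this
        refine this.trans (le_of_eq (by ring)))
      (fun j hj y => by rw [fwdDiff_iter_comp_add]; exact hM j (by omega) _)
    have b2 := ih (g := Δ_[h] g) mg' (M := t * M)
      (fun i hi => hp i (by omega))
      (fun j hj y => by
        have := hM (j + 1) (by omega) y
        rw [Function.iterate_succ_apply] at this
        refine this.trans (le_of_eq (by ring)))
    calc _ ≤ ∫⁻ y, (‖Δ_[h] ^[n] (fun y => Δ_[h] f y * g (y + h)) y‖ₑ +
            ‖Δ_[h] ^[n] (fun y => f y * Δ_[h] g y) y - f y * Δ_[h] ^[n] (Δ_[h] g) y‖ₑ) :=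
          lintegral_mono fun y => by
            dsimp only
            rw [add_sub_assoc]
            exact enorm_add_le _ _
      _ = (∫⁻ y, ‖Δ_[h] ^[n] (fun y => Δ_[h] f y * g (y + h)) y‖ₑ) +
            ∫⁻ y, ‖Δ_[h] ^[n] (fun y => f y * Δ_[h] g y) y - f y * Δ_[h] ^[n] (Δ_[h] g) y‖ₑ :=
          lintegral_add_left (measurable_fwdDiff_iter_real (mf.mul mg) h n).enorm _
      _ ≤ _ := add_le_add b1 b2
      _ = _ := by ring

lemma fwdDiff_iter_integral {g : ℝ → ℝ → ℂ} (hg : ∀ y, Integrable fun l' => g l' y) (n : ℕ) (y : ℝ) :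
    (Integrable fun l' => Δ_[h] ^[n] (g l') y) ∧
      Δ_[h] ^[n] (fun y => ∫ l', g l' y) y = ∫ l', Δ_[h] ^[n] (g l') y := by
  induction n generalizing y with
  | zero => exact ⟨hg y, rfl⟩
  | succ n ih =>
    simp only [Function.iterate_succ_apply' _ n, fwdDiff]
    exact ⟨(ih (y + h)).1.sub (ih y).1, by rw [(ih (y + h)).2, (ih y).2, integral_sub (ih (y + h)).1 (ih y).1]⟩

/-- A consequence of translation invariance; integrability of each difference is carried along
because additivity of the operator requires it. -/
lemma gop_fwdDiff_iter (s k : ℝ) {F : ℝ → ℝ → ℂ} {l : ℝ} (hF : Integrable (F l)) (n : ℕ) (y : ℝ) :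
    Integrable (Δ_[h] ^[n] (F l)) ∧
      Δ_[h] ^[n] (gop s k F l) y = gop s k (fun l => Δ_[h] ^[n] (F l)) l y := by
  induction n generalizing y with
  | zero => exact ⟨hF, rfl⟩
  | succ n ih =>
    have i1 := (ih 0).1
    have i2 := i1.comp_add_right h
    refine ⟨by rw [Function.iterate_succ_apply']; exact i2.sub i1, ?_⟩
    rw [Function.iterate_succ_apply', fwdDiff, (ih (y + h)).2, (ih y).2, gop_shift]
    have e : (fun l => Δ_[h] ^[n + 1] (F l)) = fun l y => Δ_[h] ^[n] (F l) (y + h) + (-1) * Δ_[h] ^[n] (F l) y := by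
      ext l y; rw [Function.iterate_succ_apply', fwdDiff]; ring
    have := gop_add s k (F := fun l y => Δ_[h] ^[n] (F l) (y + h)) (G := fun l y => (-1) * Δ_[h] ^[n] (F l) y) (l := l)
      i2 (i1.const_mul _) y
    rw [e, this, gop_const_mul]; ring

end Leibniz

lemma enorm_fwdDiff_iter_le {f : ℝ → ℂ} {M : ℝ≥0∞} (hf : ∀ y, ‖f y‖ₑ ≤ M) (h : ℝ) (n : ℕ) (y : ℝ) :
    ‖Δ_[h] ^[n] f y‖ₑ ≤ 2 ^ n * M := by
  induction n generalizing y with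
  | zero => simpa using hf y
  | succ n ih =>
    rw [Function.iterate_succ_apply', fwdDiff]
    refine enorm_sub_le.trans ((add_le_add (ih _) (ih _)).trans (le_of_eq (by ring)))

/-- Differences in `y` of the partial convolution. -/
lemma prof_fwdDiff_cnv_le {V m : ℝ → ℝ → ℂ} {φ : ℝ → ℝ≥0∞} (hV : Slab V) (hm : Dom m φ) (h : ℝ) (n : ℕ) (l : ℝ) :
    ∫⁻ y, ‖Δ_[h] ^[n] (cnv V m l) y‖ₑ ≤ ∫⁻ l', ∫⁻ y, ‖Δ_[h] ^[n] (fun y => V (l - l') y * m l' y) y‖ₑ := by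
  have e : ∀ y, Δ_[h] ^[n] (cnv V m l) y = ∫ l', Δ_[h] ^[n] (fun y => V (l - l') y * m l' y) y := fun y =>
    (fwdDiff_iter_integral (g := fun l' y => V (l - l') y * m l' y) (fun y => integrable_cnv hV hm l y) n y).2
  simp only [e]
  refine lintegral_lintegral_conv_le (g := fun l l' y => Δ_[h] ^[n] (fun y => V (l - l') y * m l' y) y) ?_ l
  have m0 := measurable_conv_integrand hV.meas hm.meas
  clear e
  induction n with
  | zero => exact m0
  | succ n ih =>
    simp only [Function.iterate_succ_apply' _ n, fwdDiff]
    exact (ih.comp (by fun_prop : Measurable fun z : ℝ × ℝ × ℝ => (z.1, z.2.1, z.2.2 + h))).sub ih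

/-- The source term `√(2π) V + V * m`. -/
def src (V m : ℝ → ℝ → ℂ) (l y : ℝ) : ℂ := (Real.sqrt (2 * Real.pi) : ℂ) * V l y + cnv V m l y

lemma measurable_src {V m : ℝ → ℝ → ℂ} (hV : Measurable fun z : ℝ × ℝ => V z.1 z.2)
    (hm : Measurable fun z : ℝ × ℝ => m z.1 z.2) : Measurable fun z : ℝ × ℝ => src V m z.1 z.2 :=
  (hV.const_mul _).add (measurable_cnv' hV hm)

lemma enorm_sqrt_two_pi : ‖(Real.sqrt (2 * Real.pi) : ℂ)‖ₑ = ENNReal.ofReal (Real.sqrt (2 * Real.pi)) := by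
  rw [← ofReal_norm, Complex.norm_real, Real.norm_of_nonneg (by positivity)]

lemma sqrt_two_pi_le : ‖(Real.sqrt (2 * Real.pi) : ℂ)‖ₑ ≤ 3 := by
  rw [enorm_sqrt_two_pi, show (3 : ℝ≥0∞) = ENNReal.ofReal 3 by norm_num]
  apply ENNReal.ofReal_le_ofReal
  rw [Real.sqrt_le_left (by norm_num)]
  nlinarith [Real.pi_lt_four]

lemma lintegral_weight_src_le {V m : ℝ → ℝ → ℂ} {φ : ℝ → ℝ≥0∞} {w : ℝ → ℝ≥0∞} (hw : Measurable w)
    (hV : Measurable fun z : ℝ × ℝ => V z.1 z.2)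
    (hm : Measurable fun z : ℝ × ℝ => m z.1 z.2) (hle : ∀ l y, ‖m l y‖ₑ ≤ φ l) (l : ℝ) :
    ∫⁻ y, w y * ‖src V m l y‖ₑ ≤ 3 * (∫⁻ y, w y * ‖V l y‖ₑ) + cv (fun l => ∫⁻ y, w y * ‖V l y‖ₑ) φ l := by
  have h1 := measurable_slice_left hV l
  refine le_trans (lintegral_mono (g := fun y => 3 * (w y * ‖V l y‖ₑ) + w y * ‖cnv V m l y‖ₑ) fun y => ?_) ?_
  · dsimp only [src]
    refine (mul_le_mul' le_rfl (enorm_add_le _ _)).trans ?_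
    rw [enorm_mul, mul_add]
    gcongr ?_ + _
    rw [mul_left_comm]
    gcongr
    exact sqrt_two_pi_le
  · rw [lintegral_add_left (by fun_prop), lintegral_const_mul' _ _ (by finiteness)]
    gcongr
    exact lintegral_weight_cnv_le hw hV hm hle l

lemma prof_src_le {V m : ℝ → ℝ → ℂ} {φ : ℝ → ℝ≥0∞} (hV : Measurable fun z : ℝ × ℝ => V z.1 z.2)
    (hm : Measurable fun z : ℝ × ℝ => m z.1 z.2) (hle : ∀ l y, ‖m l y‖ₑ ≤ φ l) (l : ℝ) :
    prof (src V m) l ≤ 3 * prof V l + cv (prof V) φ l := by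
  have := lintegral_weight_src_le (w := fun _ => 1) measurable_const hV hm hle l
  simp only [one_mul] at this
  exact this

lemma lintegral_le_of_le_wt {f : ℝ → ℝ≥0∞} {s : ℝ} (hs : 1 < s) {K : ℝ≥0∞} (hK : K ≠ ∞) (h : ∀ l, f l ≤ K * wt s l) :
    ∫⁻ l, f l ≠ ∞ := by
  refine ((lintegral_mono h).trans_lt ?_).ne
  rw [lintegral_const_mul' _ _ hK]
  exact ENNReal.mul_lt_top hK.lt_top (lintegral_wt_lt_top hs)

namespace IsNice
variable {u : ℝ × ℝ → ℝ} {C : ℝ}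

/-- `maj` itself decays like the kernel, so it is an admissible source for the resolvent. It
supplies the crude starting majorant in the Gronwall arguments. -/
lemma res_maj_ne_top (H : IsNice u C) (hc : cNorm u < 1) (c : ℝ≥0∞) (hcf : c ≠ ∞) (l : ℝ) :
    res (ker u) (fun l => c * maj u l) l ≠ ∞ := by
  obtain ⟨K, hK, hp⟩ := H.prof_le
  obtain ⟨K', hK', hm⟩ := H.exists_maj_le hc
  obtain ⟨K'', hK'', h⟩ := exists_res_le_wt (C := K + K') (measurable_ker H.meas) (measurable_maj H.meas)
    (by norm_num : (1 : ℝ) < 13 / 4) (by finiteness)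
    (fun l => (ker_le_prof u l).trans ((hp l).trans (by gcongr; exact le_self_add)))
    (fun l => (hm l).trans (by gcongr; exact le_add_self)) (by rwa [lintegral_ker H.meas])
  rw [res_const_mul hcf]
  exact ENNReal.mul_ne_top hcf (ne_top_of_le_ne_top (ENNReal.mul_ne_top hK'' (wt_ne_top _ _)) (h l))

lemma integrable_src (H : IsNice u C) (hc : cNorm u < 1) (s k l : ℝ) : Integrable (src (ut u) (mu s u k) l) := by
  refine integrable_of_prof (measurable_src (measurable_ut H.meas) (H.dom_mu hc s k).meas) ?_
  refine ne_top_of_le_ne_top ?_ (prof_src_le (measurable_ut H.meas) (H.dom_mu hc s k).meas (H.dom_mu hc s k).le l)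
  have := cv_prof_ne_top (ne_top_of_le_ne_top (H.maj_ne_top hc l)
    (cv_res_le (measurable_ker H.meas) (measurable_prof (measurable_ut H.meas)) l))
  have h2 := H.prof_ut_ne_top l
  exact ENNReal.add_ne_top.2 ⟨by finiteness, this⟩

lemma mu_eq' (H : IsNice u C) (hc : cNorm u < 1) (s k l y : ℝ) :
    mu s u k l y = gop s k (src (ut u) (mu s u k)) l y := H.mu_eq hc s k l y

/-- Differences of the scattering solution in `y`. -/
lemma exists_fwdDiff_mu_le (H : IsNice u C) (hc : cNorm u < 1) (s : ℝ) : ∃ K : ℝ≥0∞, K ≠ ∞ ∧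
    ∀ j ≤ 4, ∀ h : ℝ, 0 < h → h ≤ 1 → ∀ k l y, ‖Δ_[h] ^[j] (mu s u k l) y‖ₑ ≤
      ENNReal.ofReal (h ^ (1 / 2 : ℝ)) ^ j * (K * wt (13 / 12) l) := by
  suffices h : ∀ n ≤ 4, ∃ K : ℝ≥0∞, K ≠ ∞ ∧ ∀ j ≤ n, ∀ h : ℝ, 0 < h → h ≤ 1 → ∀ k l y, ‖Δ_[h] ^[j] (mu s u k l) y‖ₑ ≤
      ENNReal.ofReal (h ^ (1 / 2 : ℝ)) ^ j * (K * wt (13 / 12) l) from h 4 le_rfl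
  obtain ⟨K0, hK0, hU⟩ := H.exists_fwdDiff_ut_wt
  obtain ⟨K1, hK1, hP⟩ := H.prof_le
  have mk := measurable_ker H.meas
  have mP := measurable_prof (measurable_ut H.meas)
  intro n hn
  induction n with
  | zero =>
    obtain ⟨K, hK, hm⟩ := H.exists_maj_le hc
    refine ⟨K, hK, fun j hj h h0 h1 k l y => ?_⟩
    obtain rfl : j = 0 := by omega
    simp only [Function.iterate_zero, id, pow_zero, one_mul]
    exact (enorm_mu_le s H.meas k l y).trans ((hm l).trans (by gcongr; exact wt_anti (by norm_num) l))
  | succ n ih =>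
    obtain ⟨K, hK, hm⟩ := ih (by omega)
    set p : ℝ → ℝ≥0∞ := fun l => K0 * wt (13 / 12) l with hp
    set M : ℝ → ℝ≥0∞ := fun l => K * wt (13 / 12) l with hM
    have mp : Measurable p := (measurable_wt _).const_mul _
    have mM : Measurable M := (measurable_wt _).const_mul _
    -- The inhomogeneity of the equation for the top difference: the difference of the source ũ plus
    -- all Leibniz terms with lower differences of the solution, which the induction hypothesis
    -- controls.
    set f : ℝ → ℝ≥0∞ := fun l => p l + 2 ^ (n + 1) * cv p M l with hf
    have mf : Measurable f := mp.add ((measurable_cv mp mM).const_mul _)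
    obtain ⟨K2, hK2, hcv⟩ := exists_cv_le_wt (by norm_num : (1 : ℝ) < 13 / 12) hK0 hK (fun _ => le_rfl) (fun _ => le_rfl) mp mM
    obtain ⟨K3, hK3, hres⟩ := exists_res_le_wt (C := K1 + (K0 + 2 ^ (n + 1) * K2)) mk mf
      (by norm_num : (1 : ℝ) < 13 / 12) (by finiteness)
      (fun l => (ker_le_prof u l).trans ((hP l).trans
        (mul_le_mul' le_self_add (wt_anti (by norm_num) l))))
      (fun l => by
        calc f l ≤ K0 * wt (13 / 12) l + 2 ^ (n + 1) * (K2 * wt (13 / 12) l) := by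
              simp only [hf, hp]; gcongr; exact hcv l
          _ = (K0 + 2 ^ (n + 1) * K2) * wt (13 / 12) l := by ring
          _ ≤ (K1 + (K0 + 2 ^ (n + 1) * K2)) * wt (13 / 12) l := mul_le_mul' le_add_self le_rfl)
      (by rwa [lintegral_ker H.meas])
    refine ⟨K + K3, by finiteness, fun j hj h h0 h1 k l y => ?_⟩
    rcases Nat.lt_or_ge j (n + 1) with hlt | hge
    · refine (hm j (by omega) h h0 h1 k l y).trans ?_
      gcongr; exact le_self_add
    obtain rfl : j = n + 1 := by omega
    set t := ENNReal.ofReal (h ^ (1 / 2 : ℝ)) with ht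
    have htf : t ^ (n + 1) ≠ ∞ := by finiteness
    have hdom := H.dom_mu hc s k
    -- The top difference solves the scattering equation with the source just described. The rough
    -- bound 2^(n+1) `maj` is independent of h and serves only to start the iteration.
    have main : ‖Δ_[h] ^[n + 1] (mu s u k l) y‖ₑ ≤ res (ker u) (fun l => t ^ (n + 1) * f l) l := by
      refine enorm_le_res (D := fun l y => Δ_[h] ^[n + 1] (mu s u k l) y) (φ₀ := fun l => 2 ^ (n + 1) * maj u l) mk
        (mf.const_mul _) ((measurable_maj H.meas).const_mul _)
        (fun l y => enorm_fwdDiff_iter_le (hdom.le l) h (n + 1) y) (H.res_maj_ne_top hc _ (by finiteness)) ?_ l y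
      intro φ mφ hφ l y
      have e1 : mu s u k l = gop s k (src (ut u) (mu s u k)) l := funext fun y => H.mu_eq' hc s k l y
      rw [e1, (gop_fwdDiff_iter s k (H.integrable_src hc s k l) (n + 1) y).2]
      refine (enorm_gop_le s k _ l y).trans ?_
      have e2 : src (ut u) (mu s u k) l = fun y => (Real.sqrt (2 * Real.pi) : ℂ) * ut u l y + cnv (ut u) (mu s u k) l y := rfl
      have e3 : ∀ y, Δ_[h] ^[n + 1] (fun y => (Real.sqrt (2 * Real.pi) : ℂ) * ut u l y) y =
          (Real.sqrt (2 * Real.pi) : ℂ) * Δ_[h] ^[n + 1] (ut u l) y := fun y =>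
        congrFun (fwdDiff_iter_const_smul (R := ℂ) h (Real.sqrt (2 * Real.pi) : ℂ) (ut u l) (n + 1)) y
      have mU := measurable_fwdDiff_iter_real (H.measurable_ut_slice l) h (n + 1)
      have b1 : prof (fun l => Δ_[h] ^[n + 1] (src (ut u) (mu s u k) l)) l ≤
          ‖(Real.sqrt (2 * Real.pi) : ℂ)‖ₑ * (t ^ (n + 1) * p l) + ∫⁻ y, ‖Δ_[h] ^[n + 1] (cnv (ut u) (mu s u k) l) y‖ₑ := by
        unfold prof
        dsimp only
        rw [e2, fwdDiff_iter_add_fun]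
        simp only [e3]
        refine (lintegral_mono fun y => enorm_add_le _ _).trans ?_
        rw [lintegral_add_left ((mU.const_mul _).enorm)]
        simp only [enorm_mul]
        rw [lintegral_const_mul' _ _ enorm_ne_top]
        gcongr
        exact hU h h0 h1 (n + 1) hn l
      have b2 : ∫⁻ y, ‖Δ_[h] ^[n + 1] (cnv (ut u) (mu s u k) l) y‖ₑ ≤
          cv (prof (ut u)) φ l + t ^ (n + 1) * (2 ^ (n + 1) * cv p M l) := by
        refine (prof_fwdDiff_cnv_le H.slab hdom h (n + 1) l).trans ?_
        have b3 : ∀ l', ∫⁻ y, ‖Δ_[h] ^[n + 1] (fun y => ut u (l - l') y * mu s u k l' y) y‖ₑ ≤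
            prof (ut u) (l - l') * φ l' + t ^ (n + 1) * (2 ^ (n + 1) * (p (l - l') * M l')) := by
          intro l'
          have mfU : Measurable (ut u (l - l')) := H.measurable_ut_slice _
          have mg : Measurable (mu s u k l') := measurable_slice_left hdom.meas l'
          -- Subtracting ũ · Δ^(n+1)μ removes the one term in which the unknown top difference
          -- occurs; that term reproduces the kernel `ker`, whose mass is less than 1.
          have c1 := lintegral_fwdDiff_mul_sub_le (h := h) (t := t) (n + 1) mfU mg (p := p (l - l')) (M := M l')
            (fun i hi => hU h h0 h1 i (by omega) _) (fun j hj y => hm j (by omega) h h0 h1 k l' y)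
          calc _ ≤ ∫⁻ y, (‖ut u (l - l') y‖ₑ * φ l' + ‖Δ_[h] ^[n + 1] (fun y => ut u (l - l') y * mu s u k l' y) y -
                ut u (l - l') y * Δ_[h] ^[n + 1] (mu s u k l') y‖ₑ) := by
                refine lintegral_mono fun y => ?_
                dsimp only
                calc _ = ‖ut u (l - l') y * Δ_[h] ^[n + 1] (mu s u k l') y + (Δ_[h] ^[n + 1] (fun y => ut u (l - l') y * mu s u k l' y) y -
                    ut u (l - l') y * Δ_[h] ^[n + 1] (mu s u k l') y)‖ₑ := by congr 1; ring
                  _ ≤ _ := by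
                    refine (enorm_add_le _ _).trans ?_
                    gcongr
                    rw [enorm_mul]
                    gcongr
                    exact hφ l' y
            _ = (∫⁻ y, ‖ut u (l - l') y‖ₑ) * φ l' + ∫⁻ y, ‖Δ_[h] ^[n + 1] (fun y => ut u (l - l') y * mu s u k l' y) y -
                ut u (l - l') y * Δ_[h] ^[n + 1] (mu s u k l') y‖ₑ := by
                rw [lintegral_add_left (by fun_prop), lintegral_mul_const _ (by fun_prop)]
            _ ≤ _ := by gcongr; exact le_rfl
        refine (lintegral_mono b3).trans ?_
        rw [lintegral_add_left (by fun_prop : Measurable fun q => prof (ut u) (l - q) * φ q), lintegral_const_mul' _ _ htf,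
          lintegral_const_mul' _ _ (by finiteness)]
        exact le_rfl
      calc c1 * prof (fun l => Δ_[h] ^[n + 1] (src (ut u) (mu s u k) l)) l
          ≤ c1 * (‖(Real.sqrt (2 * Real.pi) : ℂ)‖ₑ * (t ^ (n + 1) * p l) +
              (cv (prof (ut u)) φ l + t ^ (n + 1) * (2 ^ (n + 1) * cv p M l))) := by
            gcongr; exact b1.trans (by gcongr)
        _ = (c1 * ‖(Real.sqrt (2 * Real.pi) : ℂ)‖ₑ) * (t ^ (n + 1) * p l) + c1 * cv (prof (ut u)) φ l +
              c1 * (t ^ (n + 1) * (2 ^ (n + 1) * cv p M l)) := by ring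
        _ ≤ 1 * (t ^ (n + 1) * p l) + cv (ker u) φ l + 1 * (t ^ (n + 1) * (2 ^ (n + 1) * cv p M l)) := by
            rw [c1_mul_sqrt]
            unfold ker
            rw [cv_const_mul_left c1_ne_top]
            gcongr
            exact c1_le_one
        _ = t ^ (n + 1) * f l + cv (ker u) φ l := by simp only [hf]; ring
    rw [res_const_mul htf] at main
    refine main.trans ?_
    gcongr
    exact (hres l).trans (by gcongr; exact le_add_self)

end IsNice

/-! ### Lipschitz dependence of the solution on k. -/

/-- The modulation `e^{2iκly}`. -/
def modu (κ l y : ℝ) : ℂ := Complex.exp (2 * Complex.I * κ * l * y)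

lemma enorm_modu (κ l y : ℝ) : ‖modu κ l y‖ₑ = 1 := by
  unfold modu
  rw [← ofReal_norm, Complex.norm_exp]; simp

@[fun_prop]
lemma continuous_modu (κ : ℝ) : Continuous fun z : ℝ × ℝ => modu κ z.1 z.2 := by
  unfold modu; fun_prop

lemma enorm_modu_sub_one_le (κ l y : ℝ) : ‖modu κ l y - 1‖ₑ ≤ ‖κ‖ₑ * ‖2 * l * y‖ₑ := by
  rw [← enorm_mul, ← ofReal_norm, ← ofReal_norm]
  apply ENNReal.ofReal_le_ofReal
  have h := Real.norm_exp_I_mul_ofReal_sub_one_le (x := κ * (2 * l * y))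
  unfold modu
  rwa [show 2 * Complex.I * κ * l * y = Complex.I * ((κ * (2 * l * y) : ℝ) : ℂ) by push_cast; ring]

/-- The mass of the `κ`-derivative of the modulated potential. -/
def profMod (V : ℝ → ℝ → ℂ) (l : ℝ) : ℝ≥0∞ := ∫⁻ y, ‖2 * l * y‖ₑ * ‖V l y‖ₑ

lemma measurable_profMod {V : ℝ → ℝ → ℂ} (hV : Measurable fun z : ℝ × ℝ => V z.1 z.2) : Measurable (profMod V) := by
  unfold profMod
  refine Measurable.lintegral_prod_right' (f := fun z : ℝ × ℝ => ‖2 * z.1 * z.2‖ₑ * ‖V z.1 z.2‖ₑ) ?_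
  have := hV.enorm
  fun_prop

lemma modu_mul (κ l l' y : ℝ) : modu κ (l - l') y * modu κ l' y = modu κ l y := by
  unfold modu
  rw [← Complex.exp_add]; congr 1; push_cast; ring

/-- The effect on a source term of shifting `k`. -/
lemma prof_modu_src_sub_le {V m m' : ℝ → ℝ → ℂ} {φ ψ : ℝ → ℝ≥0∞} (κ : ℝ) (hV : Slab V) (hm : Dom m φ) (hm' : Dom m' φ)
    (hψ : ∀ l y, ‖modu κ l y * m' l y - m l y‖ₑ ≤ ψ l) (l : ℝ) :
    ∫⁻ y, ‖modu κ l y * src V m' l y - src V m l y‖ₑ ≤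
      ‖κ‖ₑ * (‖(Real.sqrt (2 * Real.pi) : ℂ)‖ₑ * profMod V l + cv (profMod V) φ l) + cv (prof V) ψ l := by
  set V' : ℝ → ℝ → ℂ := fun l y => (modu κ l y - 1) * V l y with hV'
  set n : ℝ → ℝ → ℂ := fun l y => modu κ l y * m' l y with hn
  have cm : Measurable fun z : ℝ × ℝ => modu κ z.1 z.2 := (continuous_modu κ).measurable
  have sV' : Slab V' := by
    refine ⟨(cm.sub_const 1).mul hV.meas, fun y => ?_⟩
    obtain ⟨B, hB⟩ := hV.bdd y
    refine ⟨2 * B, fun l => ?_⟩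
    have h1 : ‖modu κ l y‖ = 1 := by rw [← toReal_enorm, enorm_modu]; rfl
    rw [hV', norm_mul]
    exact mul_le_mul ((norm_sub_le _ _).trans (by rw [h1, norm_one]; norm_num)) (hB l) (norm_nonneg _) (by norm_num)
  have dn : Dom n φ := ⟨cm.mul hm'.meas, hm.meas_bound, hm.lintegral_ne_top, fun l y => by
    rw [hn, enorm_mul, enorm_modu, one_mul]; exact hm'.le l y⟩
  set d : ℝ → ℝ → ℂ := fun l y => n l y - m l y with hd
  have dd : Measurable fun z : ℝ × ℝ => d z.1 z.2 := dn.meas.sub hm.meas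
  -- Since the modulation is multiplicative in l, it distributes over the convolution: one factor on
  -- V, where modulus minus one is O(|κ| |l y|), the other on m', where it forms the difference to
  -- be estimated.
  have e : ∀ y, modu κ l y * src V m' l y - src V m l y =
      (Real.sqrt (2 * Real.pi) : ℂ) * V' l y + (cnv V' n l y + cnv V d l y) := by
    intro y
    have i1 := integrable_cnv sV' dn l y
    have i2 := integrable_cnv hV dn l y
    have i3 := integrable_cnv hV hm l y
    have e1 : modu κ l y * cnv V m' l y = cnv V' n l y + cnv V n l y := by
      unfold cnv
      rw [← integral_const_mul, ← integral_add i1 i2]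
      refine integral_congr_ae (Eventually.of_forall fun l' => ?_)
      simp only [hV', hn]
      rw [← modu_mul κ l l' y]; ring
    have e2 : cnv V d l y = cnv V n l y - cnv V m l y := by
      unfold cnv
      rw [← integral_sub i2 i3]
      refine integral_congr_ae (Eventually.of_forall fun l' => ?_)
      simp only [hd]; ring
    unfold src
    rw [e2, mul_add, e1]
    simp only [hV']; ring
  have pV' : ∀ l, prof V' l ≤ ‖κ‖ₑ * profMod V l := by
    intro l
    unfold prof profMod
    rw [← lintegral_const_mul' _ _ enorm_ne_top]
    refine lintegral_mono fun y => ?_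
    dsimp only [hV']
    rw [enorm_mul, ← mul_assoc]
    gcongr
    exact enorm_modu_sub_one_le κ l y
  have m1 := measurable_slice_left sV'.meas l
  have m2 := measurable_slice_left (measurable_cnv' sV'.meas dn.meas) l
  calc _ ≤ ∫⁻ y, (‖(Real.sqrt (2 * Real.pi) : ℂ)‖ₑ * ‖V' l y‖ₑ + (‖cnv V' n l y‖ₑ + ‖cnv V d l y‖ₑ)) := by
        refine lintegral_mono fun y => ?_
        rw [e y, ← enorm_mul]
        refine (enorm_add_le _ _).trans ?_
        gcongr
        exact enorm_add_le _ _
    _ = ‖(Real.sqrt (2 * Real.pi) : ℂ)‖ₑ * prof V' l + (prof (cnv V' n) l + prof (cnv V d) l) := by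
        rw [lintegral_add_left (by fun_prop), lintegral_add_left (by fun_prop), lintegral_const_mul' _ _ enorm_ne_top]
        rfl
    _ ≤ ‖(Real.sqrt (2 * Real.pi) : ℂ)‖ₑ * (‖κ‖ₑ * profMod V l) + (‖κ‖ₑ * cv (profMod V) φ l + cv (prof V) ψ l) := by
        gcongr
        · exact pV' l
        · refine (prof_cnv_le sV'.meas dn.meas dn.le l).trans ?_
          rw [← cv_const_mul_left enorm_ne_top]
          exact cv_mono pV' (fun _ => le_rfl) l
        · exact prof_cnv_le hV.meas dd hψ l
    _ = _ := by ring

namespace IsNice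
variable {u : ℝ × ℝ → ℝ} {C : ℝ}

/-- The factor 2ly costs one power of l, hence 9/4 instead of 13/4; the factor |y| is covered by the
moment 1 + y². -/
lemma profMod_le (H : IsNice u C) : ∃ K : ℝ≥0∞, K ≠ ∞ ∧ ∀ l, profMod (ut u) l ≤ K * wt (9 / 4) l := by
  obtain ⟨K, hK, h⟩ := H.exists_ut_wt
  refine ⟨2 * K, by finiteness, fun l => ?_⟩
  have hl := abs_nonneg l
  have h1 : ∀ y : ℝ, ‖2 * l * y‖ₑ ≤ ENNReal.ofReal (2 * (1 + |l|)) * ENNReal.ofReal (1 + y ^ 2) := fun y => by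
    rw [← ENNReal.ofReal_mul (by positivity), ← ofReal_norm]
    apply ENNReal.ofReal_le_ofReal
    rw [Real.norm_eq_abs, abs_mul, abs_mul, abs_two]
    have : |y| ≤ 1 + y ^ 2 := by rw [abs_le]; constructor <;> nlinarith [sq_nonneg (y - 1), sq_nonneg (y + 1)]
    gcongr; linarith
  have h2 : ENNReal.ofReal (1 + |l|) * wt (13 / 4) l = wt (9 / 4) l := by
    unfold wt
    rw [← ENNReal.ofReal_mul (by positivity), show (-(9 / 4) : ℝ) = 1 + -(13 / 4) by norm_num, Real.rpow_add (by positivity),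
      Real.rpow_one]
  calc profMod (ut u) l ≤ ∫⁻ y, ENNReal.ofReal (2 * (1 + |l|)) * (ENNReal.ofReal (1 + y ^ 2) * ‖ut u l y‖ₑ) :=
        lintegral_mono fun y => by dsimp only; rw [← mul_assoc]; gcongr; exact h1 y
    _ ≤ ENNReal.ofReal (2 * (1 + |l|)) * (K * wt (13 / 4) l) := by
        rw [lintegral_const_mul' _ _ ENNReal.ofReal_ne_top]; gcongr; exact h l
    _ = 2 * K * wt (9 / 4) l := by
        rw [← h2, ENNReal.ofReal_mul (by norm_num), ENNReal.ofReal_ofNat]; ring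

/-- Lipschitz dependence of the scattering solution on `k`, after modulation. -/
lemma exists_modu_mu_sub_le (H : IsNice u C) (hc : cNorm u < 1) (s : ℝ) : ∃ K : ℝ≥0∞, K ≠ ∞ ∧ ∀ k κ l y,
    ‖modu κ l y * mu s u (k + κ) l y - mu s u k l y‖ₑ ≤ ‖κ‖ₑ * (K * wt (9 / 4) l) := by
  obtain ⟨K0, hK0, hB⟩ := H.profMod_le
  obtain ⟨K1, hK1, hP⟩ := H.prof_le
  obtain ⟨K2, hK2, hm⟩ := H.exists_maj_le hc
  have mk := measurable_ker H.meas
  have mU := measurable_ut H.meas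
  have mB := measurable_profMod mU
  have mM := measurable_maj H.meas
  set f : ℝ → ℝ≥0∞ := fun l => profMod (ut u) l + cv (profMod (ut u)) (maj u) l with hf
  have mf : Measurable f := mB.add (measurable_cv mB mM)
  obtain ⟨K3, hK3, hcv⟩ := exists_cv_le_wt (by norm_num : (1 : ℝ) < 9 / 4) hK0 hK2 hB
    (fun l => (hm l).trans (by gcongr; exact wt_anti (by norm_num) l)) mB mM
  obtain ⟨K4, hK4, hres⟩ := exists_res_le_wt (C := K1 + (K0 + K3)) mk mf
      (by norm_num : (1 : ℝ) < 9 / 4) (by finiteness)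
      (fun l => (ker_le_prof u l).trans ((hP l).trans
        (mul_le_mul' le_self_add (wt_anti (by norm_num) l))))
      (fun l => by
        calc f l ≤ K0 * wt (9 / 4) l + K3 * wt (9 / 4) l := add_le_add (hB l) (hcv l)
          _ = (K0 + K3) * wt (9 / 4) l := by ring
          _ ≤ (K1 + (K0 + K3)) * wt (9 / 4) l := mul_le_mul' le_add_self le_rfl)
      (by rwa [lintegral_ker H.meas])
  refine ⟨K4, hK4, fun k κ l y => ?_⟩
  have d1 := H.dom_mu hc s k
  have d2 := H.dom_mu hc s (k + κ)
  have main := enorm_le_res (D := fun l y => modu κ l y * mu s u (k + κ) l y - mu s u k l y)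
    (φ₀ := fun l => 2 * maj u l) (f := fun l => ‖κ‖ₑ * f l) mk (mf.const_mul _) (mM.const_mul _)
    (fun l y => by
      refine enorm_sub_le.trans ?_
      rw [enorm_mul, enorm_modu, one_mul, two_mul]
      exact add_le_add (d2.le l y) (d1.le l y)) (H.res_maj_ne_top hc _ (by finiteness)) ?_ l y
  · rw [res_const_mul enorm_ne_top] at main
    refine main.trans ?_
    gcongr
    exact hres l
  · intro φ mφ hφ l y
    have i1 := H.integrable_src hc s k l
    have i2 : Integrable fun y => modu κ l y * src (ut u) (mu s u (k + κ)) l y :=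
      (H.integrable_src hc s (k + κ) l).bdd_mul (c := 1)
        ((continuous_modu κ).comp (by fun_prop : Continuous fun y : ℝ => (l, y))).aestronglyMeasurable
        (Eventually.of_forall fun y => by rw [← toReal_enorm, enorm_modu]; rfl)
    -- Conjugation turns the equation at k + κ into the equation at k with modulated source, so both
    -- solutions are compared under one operator.
    have e : modu κ l y * mu s u (k + κ) l y - mu s u k l y =
        gop s k (fun l y => modu κ l y * src (ut u) (mu s u (k + κ)) l y + (-1) * src (ut u) (mu s u k) l y) l y := by
      have := gop_add s k (F := fun l y => modu κ l y * src (ut u) (mu s u (k + κ)) l y)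
        (G := fun l y => (-1) * src (ut u) (mu s u k) l y) (l := l) i2 (i1.const_mul _) y
      rw [this, gop_const_mul, H.mu_eq' hc, H.mu_eq' hc]
      unfold modu
      rw [gop_modulate]; ring
    rw [e]
    refine (enorm_gop_le s k _ l y).trans ?_
    have b := prof_modu_src_sub_le κ H.slab d1 d2 hφ l
    calc _ ≤ c1 * (‖κ‖ₑ * (‖(Real.sqrt (2 * Real.pi) : ℂ)‖ₑ * profMod (ut u) l + cv (profMod (ut u)) (maj u) l) +
            cv (prof (ut u)) φ l) := by
          gcongr
          refine le_trans (le_of_eq ?_) b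
          unfold prof
          refine lintegral_congr fun y => ?_
          congr 1; ring
      _ = ‖κ‖ₑ * ((c1 * ‖(Real.sqrt (2 * Real.pi) : ℂ)‖ₑ) * profMod (ut u) l + c1 * cv (profMod (ut u)) (maj u) l) +
            c1 * cv (prof (ut u)) φ l := by ring
      _ ≤ ‖κ‖ₑ * (1 * profMod (ut u) l + 1 * cv (profMod (ut u)) (maj u) l) + cv (ker u) φ l := by
          rw [c1_mul_sqrt]
          unfold ker
          rw [cv_const_mul_left c1_ne_top]
          gcongr
          exact c1_le_one
      _ = _ := by simp only [hf, one_mul]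

end IsNice

/-! ### From bounds on Θ to amplitude data. -/

lemma le_interp {X C A B θ : ℝ} (hX : 0 ≤ X) (hC : 0 ≤ C) (hA : 0 ≤ A) (hB : 0 ≤ B) (h0 : 0 ≤ θ) (h1 : θ ≤ 1)
    (ha : X ≤ C * A) (hb : X ≤ C * B) : X ≤ C * (A ^ θ * B ^ (1 - θ)) := by
  rcases hX.eq_or_lt with rfl | hX'
  · positivity
  rcases hC.eq_or_lt with rfl | hC'
  · simp at ha; linarith
  calc X = X ^ θ * X ^ (1 - θ) := by rw [← Real.rpow_add hX']; simp
    _ ≤ (C * A) ^ θ * (C * B) ^ (1 - θ) := by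
        gcongr
    _ = (C ^ θ * C ^ (1 - θ)) * (A ^ θ * B ^ (1 - θ)) := by
        rw [Real.mul_rpow hC hA, Real.mul_rpow hC hB]; ring
    _ = C * (A ^ θ * B ^ (1 - θ)) := by rw [← Real.rpow_add hC']; simp

lemma abs_pow_mul_rpow_le (p : ℝ) (n : ℕ) {s q : ℝ} (hp : p ≠ 0) (h : n + q ≤ s) (hq : 0 ≤ q) :
    |p| ^ n * (1 + |p|) ^ (-s) ≤ |p| ^ (-q) := by
  have hp0 : 0 < |p| := abs_pos.2 hp
  have h1 : (1 + |p|) ^ (-s) ≤ (1 + |p|) ^ (-(n + q)) :=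
    Real.rpow_le_rpow_of_exponent_le (by linarith) (by linarith)
  have h2 : (1 + |p|) ^ (-(n + q)) ≤ |p| ^ (-(n + q)) :=
    Real.rpow_le_rpow_of_nonpos hp0 (by linarith) (by have : (0 : ℝ) ≤ n := by positivity
                                                      linarith)
  calc |p| ^ n * (1 + |p|) ^ (-s) ≤ |p| ^ n * |p| ^ (-(n + q)) := by gcongr; exact h1.trans h2
    _ = |p| ^ (-q) := by rw [← Real.rpow_natCast, ← Real.rpow_add hp0]; congr 1; ring

lemma abs_pow_mul_rpow_le_one (p : ℝ) (n : ℕ) {s : ℝ} (h : n ≤ s) : |p| ^ n * (1 + |p|) ^ (-s) ≤ 1 := by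
  have h0 := abs_nonneg p
  calc |p| ^ n * (1 + |p|) ^ (-s) ≤ (1 + |p|) ^ n * (1 + |p|) ^ (-s) := by gcongr; linarith
    _ = (1 + |p|) ^ (n - s) := by rw [← Real.rpow_natCast, ← Real.rpow_add (by positivity)]; rfl
    _ ≤ 1 := Real.rpow_le_one_of_one_le_of_nonpos (by linarith) (by linarith)

lemma inv_one_add_sq_rpow_le {r R q θ : ℝ} (hR : 0 < R) (hr : R ≤ |r|) (hq : 0 ≤ q) (hθ : 0 ≤ θ) (h : q ≤ 2 * θ) :
    ((1 + r ^ 2)⁻¹) ^ θ ≤ R ^ (-q) := by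
  have h1 : 0 < |r| := hR.trans_le hr
  have h2 : |r| ^ q ≤ (1 + r ^ 2) ^ θ := by
    rcases le_total |r| 1 with h3 | h3
    · calc |r| ^ q ≤ 1 := Real.rpow_le_one h1.le h3 hq
        _ ≤ _ := Real.one_le_rpow (by nlinarith [sq_nonneg r]) hθ
    · calc |r| ^ q ≤ |r| ^ (2 * θ) := Real.rpow_le_rpow_of_exponent_le h3 h
        _ = (|r| ^ 2) ^ θ := by rw [← Real.rpow_natCast, ← Real.rpow_mul h1.le]; norm_num
        _ ≤ _ := by rw [sq_abs]; gcongr; linarith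
  rw [Real.inv_rpow (by positivity), Real.rpow_neg hR.le]
  gcongr
  exact (Real.rpow_le_rpow hR.le hr hq).trans h2

/-- Bounds for the oscillatory integrals `Θ[v](k,p)` with `v` among `u, xu, yu, y²u, xyu, x²u`. -/
structure ThetaData (Θ Θx Θy Θyy Θxy Θxx : ℝ → ℝ → ℂ) (C : ℝ) : Prop where
  C_nonneg : 0 ≤ C
  meas : Measurable fun z : ℝ × ℝ => Θ z.1 z.2
  meas_x : Measurable fun z : ℝ × ℝ => Θx z.1 z.2
  meas_y : Measurable fun z : ℝ × ℝ => Θy z.1 z.2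
  deriv : ∀ k p, HasDerivAt (Θ k) (Complex.I * ((2 * p + 2 * k) * Θy k p - Θx k p)) p
  deriv_x : ∀ k p, HasDerivAt (Θx k) (Complex.I * ((2 * p + 2 * k) * Θxy k p - Θxx k p)) p
  deriv_y : ∀ k p, HasDerivAt (Θy k) (Complex.I * ((2 * p + 2 * k) * Θyy k p - Θxy k p)) p
  dec : ∀ k p, ‖Θ k p‖ ≤ C * (1 + |p|) ^ (-(13 / 4) : ℝ)
  dec_y : ∀ k p, ‖Θy k p‖ ≤ C * (1 + |p|) ^ (-(13 / 4) : ℝ)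
  dec_yy : ∀ k p, ‖Θyy k p‖ ≤ C * (1 + |p|) ^ (-(13 / 4) : ℝ)
  dec_x : ∀ k p, ‖Θx k p‖ ≤ C * (1 + |p|) ^ (-(9 / 4) : ℝ)
  bdd_xy : ∀ k p, ‖Θxy k p‖ ≤ C
  bdd_xx : ∀ k p, ‖Θxx k p‖ ≤ C
  osc : ∀ k p, ‖Θ k p‖ ≤ C * (1 + (p * (p + 2 * k)) ^ 2)⁻¹
  osc_x : ∀ k p, ‖Θx k p‖ ≤ C * (1 + (p * (p + 2 * k)) ^ 2)⁻¹
  osc_y : ∀ k p, ‖Θy k p‖ ≤ C * (1 + (p * (p + 2 * k)) ^ 2)⁻¹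
  lip : ∀ k k' p, ‖Θ k p - Θ k' p‖ ≤ C * |k - k'| * (1 + |p|) ^ (-(9 / 4) : ℝ)
  lip_y : ∀ k k' p, ‖Θy k p - Θy k' p‖ ≤ C * |k - k'| * (1 + |p|) ^ (-(9 / 4) : ℝ)
  lip_x : ∀ k k' p, ‖Θx k p - Θx k' p‖ ≤ C * |k - k'| * (1 + |p|) ^ (-(5 / 4) : ℝ)

namespace ThetaData
variable {Θ Θx Θy Θyy Θxy Θxx : ℝ → ℝ → ℂ} {C : ℝ}

/-- The `p`-derivative of `p Θ(k,p)`. -/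
def dmul (Θ Θx Θy : ℝ → ℝ → ℂ) (k p : ℝ) : ℂ :=
  Θ k p + Complex.I * p * ((2 * p + 2 * k) * Θy k p - Θx k p)

lemma hasDerivAt_mul (h : ThetaData Θ Θx Θy Θyy Θxy Θxx C) (k p : ℝ) :
    HasDerivAt (fun p : ℝ => (p : ℂ) * Θ k p) (dmul Θ Θx Θy k p) p := by
  refine ((hasDerivAt_id p).ofReal_comp.mul (h.deriv k p)).congr_deriv ?_
  simp only [dmul, id, Complex.ofReal_one]; ring

/-- The factor p(2p + 2k) is split as p(p + 2k) + p². The first part is the phase itself, whose size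
is compensated by the oscillatory bound even when k is large; the second by decay in p. -/
lemma norm_dmul_le (k p : ℝ) : ‖dmul Θ Θx Θy k p‖ ≤
    ‖Θ k p‖ + |p * (p + 2 * k)| * ‖Θy k p‖ + |p| ^ 2 * ‖Θy k p‖ + |p| * ‖Θx k p‖ := by
  have e : dmul Θ Θx Θy k p = Θ k p + Complex.I * ((p * (p + 2 * k) : ℝ) : ℂ) * Θy k p +
      Complex.I * ((p ^ 2 : ℝ) : ℂ) * Θy k p - Complex.I * (p : ℂ) * Θx k p := by
    simp only [dmul]; push_cast; ring
  have hn : ∀ (a : ℝ) (z : ℂ), ‖Complex.I * (a : ℂ) * z‖ = |a| * ‖z‖ := fun a z => by simp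
  rw [e]
  refine (norm_sub_le _ _).trans (add_le_add ((norm_add_le _ _).trans (add_le_add ((norm_add_le _ _).trans
    (add_le_add le_rfl ?_)) ?_)) ?_) <;> rw [hn]
  rw [abs_pow]

lemma norm_le (h : ThetaData Θ Θx Θy Θyy Θxy Θxx C) (k p : ℝ) :
    ‖Θ k p‖ ≤ C ∧ ‖Θx k p‖ ≤ C ∧ ‖Θy k p‖ ≤ C ∧ |p| * ‖Θ k p‖ ≤ C ∧ |p| * ‖Θx k p‖ ≤ C ∧ |p| ^ 2 * ‖Θy k p‖ ≤ C ∧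
      |p| * ‖Θy k p‖ ≤ C ∧ |p| * ‖Θyy k p‖ ≤ C ∧ |p * (p + 2 * k)| * ‖Θy k p‖ ≤ C := by
  have hC := h.C_nonneg
  have key : ∀ {X s : ℝ} (n : ℕ), n ≤ s → X ≤ C * (1 + |p|) ^ (-s) → |p| ^ n * X ≤ C := by
    intro X s n hn hX
    have h0 := abs_nonneg p
    calc |p| ^ n * X ≤ |p| ^ n * (C * (1 + |p|) ^ (-s)) := by gcongr
      _ = C * (|p| ^ n * (1 + |p|) ^ (-s)) := by ring
      _ ≤ C * 1 := by gcongr; exact abs_pow_mul_rpow_le_one p n hn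
      _ = C := mul_one C
  refine ⟨?_, ?_, ?_, ?_, ?_, ?_, ?_, ?_, ?_⟩
  · simpa using key 0 (by norm_num) (h.dec k p)
  · simpa using key 0 (by norm_num) (h.dec_x k p)
  · simpa using key 0 (by norm_num) (h.dec_y k p)
  · simpa using key 1 (by norm_num) (h.dec k p)
  · simpa using key 1 (by norm_num) (h.dec_x k p)
  · exact key 2 (by norm_num) (h.dec_y k p)
  · simpa using key 1 (by norm_num) (h.dec_y k p)
  · simpa using key 1 (by norm_num) (h.dec_yy k p)
  · set r := p * (p + 2 * k)
    have h1 : |r| * (1 + r ^ 2)⁻¹ ≤ 1 := by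
      rw [← div_eq_mul_inv, div_le_one (by positivity), ← sq_abs]; nlinarith [sq_nonneg (|r| - 1)]
    calc |r| * ‖Θy k p‖ ≤ |r| * (C * (1 + r ^ 2)⁻¹) := by gcongr; exact h.osc_y k p
      _ = C * (|r| * (1 + r ^ 2)⁻¹) := by ring
      _ ≤ C * 1 := by gcongr
      _ = C := mul_one C

lemma norm_dmul_le_const (h : ThetaData Θ Θx Θy Θyy Θxy Θxx C) (k p : ℝ) : ‖dmul Θ Θx Θy k p‖ ≤ 4 * C := by
  obtain ⟨h1, h2, h3, h4, h5, h6, h7, h8, h9⟩ := h.norm_le k p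
  linarith [norm_dmul_le (Θ := Θ) (Θx := Θx) (Θy := Θy) k p]

/-- Here |p + 2k| ≥ 2|k| - |p| ≥ K: for large k the phase is large unless p is close to 0, which
turns oscillatory decay into a negative power of |p|K. -/
lemma le_abs_phase {K k p : ℝ} (hp : |p| < K) (hk : K ≤ |k|) : |p| * K ≤ |p * (p + 2 * k)| := by
  rw [abs_mul]
  gcongr
  have : |2 * k| - |p| ≤ |p + 2 * k| := by
    have := abs_sub_abs_le_abs_sub (2 * k) (-p)
    rw [abs_neg, sub_neg_eq_add, add_comm] at this
    exact this
  rw [abs_mul, abs_two] at this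
  linarith

/-- For |p| ≥ K the decay of order 13/4 loses one power to the factor p. For |p| < K ≤ |k| the
oscillatory bound is weakened to (|p|K)^(-7/4), leaving |p|^(-3/4), integrable at 0. -/
lemma tail_mul (h : ThetaData Θ Θx Θy Θyy Θxy Θxx C) {K : ℝ} (hK : 1 ≤ K) {k p : ℝ} (hp : p ≠ 0)
    (hc : K ≤ |p| ∨ K ≤ |k|) : |p| * ‖Θ k p‖ ≤ C * tailFn (K ^ (-(7 / 4) : ℝ)) (9 / 4) K p := by
  have hC := h.C_nonneg
  have hp0 : 0 < |p| := abs_pos.2 hp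
  unfold tailFn
  split_ifs with h1
  · calc |p| * ‖Θ k p‖ ≤ |p| * (C * (1 + |p|) ^ (-(13 / 4) : ℝ)) := by gcongr; exact h.dec k p
      _ = C * (|p| ^ 1 * (1 + |p|) ^ (-(13 / 4) : ℝ)) := by ring
      _ ≤ C * |p| ^ (-(9 / 4) : ℝ) := by
          gcongr; exact abs_pow_mul_rpow_le p 1 hp (by norm_num) (by norm_num)
  · have hk := hc.resolve_left h1
    have hr := le_abs_phase (not_le.1 h1) hk
    have hR : 0 < |p| * K := by positivity
    have := inv_one_add_sq_rpow_le (q := 7 / 4) (θ := 1) hR hr (by norm_num) (by norm_num) (by norm_num)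
    rw [Real.rpow_one, Real.mul_rpow hp0.le (by linarith)] at this
    calc |p| * ‖Θ k p‖ ≤ |p| * (C * (|p| ^ (-(7 / 4) : ℝ) * K ^ (-(7 / 4) : ℝ))) := by
          gcongr; exact (h.osc k p).trans (by gcongr)
      _ = C * (K ^ (-(7 / 4) : ℝ) * (|p| ^ (1 : ℝ) * |p| ^ (-(7 / 4) : ℝ))) := by rw [Real.rpow_one]; ring
      _ = _ := by rw [← Real.rpow_add hp0]; norm_num

/-- The same two cases as for pΘ, with up to two additional powers of p, or one of the phase, to
absorb. Each term interpolates decay in p with decay in the phase. -/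
lemma tail_dmul (h : ThetaData Θ Θx Θy Θyy Θxy Θxx C) {K : ℝ} (hK : 1 ≤ K) {k p : ℝ} (hp : p ≠ 0)
    (hc : K ≤ |p| ∨ K ≤ |k|) : ‖dmul Θ Θx Θy k p‖ ≤ 4 * C * tailFn (K ^ (-(3 / 4) : ℝ)) (5 / 4) K p := by
  have hC := h.C_nonneg
  have hp0 : 0 < |p| := abs_pos.2 hp
  have hP : 0 < 1 + |p| := by positivity
  set r := p * (p + 2 * k) with hr
  have hr0 : 0 < 1 + r ^ 2 := by positivity
  suffices hs : ∃ T, T = tailFn (K ^ (-(3 / 4) : ℝ)) (5 / 4) K p ∧ ‖Θ k p‖ ≤ C * T ∧ |r| * ‖Θy k p‖ ≤ C * T ∧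
      |p| ^ 2 * ‖Θy k p‖ ≤ C * T ∧ |p| * ‖Θx k p‖ ≤ C * T by
    obtain ⟨T, hT, h1, h2, h3, h4⟩ := hs
    rw [← hT]
    have := norm_dmul_le (Θ := Θ) (Θx := Θx) (Θy := Θy) k p
    rw [← hr] at this
    linarith
  refine ⟨_, rfl, ?_⟩
  unfold tailFn
  split_ifs with h1
  · have hp1 : 1 ≤ |p| := hK.trans h1
    have key : ∀ {X s : ℝ} (n : ℕ), n + 5 / 4 ≤ s → X ≤ C * (1 + |p|) ^ (-s) → |p| ^ n * X ≤ C * |p| ^ (-(5 / 4) : ℝ) := by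
      intro X s n hn hX
      calc |p| ^ n * X ≤ |p| ^ n * (C * (1 + |p|) ^ (-s)) := by gcongr
        _ = C * (|p| ^ n * (1 + |p|) ^ (-s)) := by ring
        _ ≤ _ := by gcongr; exact abs_pow_mul_rpow_le p n hp hn (by norm_num)
    refine ⟨by simpa using key 0 (by norm_num) (h.dec k p), ?_, key 2 (by norm_num) (h.dec_y k p),
      by simpa using key 1 (by norm_num) (h.dec_x k p)⟩
    -- Half of the oscillatory bound absorbs |r| exactly, and half of 13/4 is still larger than 5/4.
    have hi := le_interp (θ := 1 / 2) (norm_nonneg _) hC (by positivity) (by positivity) (by norm_num) (by norm_num)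
      (h.dec_y k p) (h.osc_y k p)
    rw [← hr] at hi
    have a1 : |r| * ((1 + r ^ 2)⁻¹) ^ (1 - 1 / 2 : ℝ) ≤ 1 := by
      rw [Real.inv_rpow (by positivity), ← div_eq_mul_inv, div_le_one (by positivity),
        show (1 - 1 / 2 : ℝ) = 1 / 2 by norm_num, ← Real.sqrt_eq_rpow]
      exact Real.abs_le_sqrt (by linarith)
    have a2 : ((1 + |p|) ^ (-(13 / 4) : ℝ)) ^ (1 / 2 : ℝ) ≤ |p| ^ (-(5 / 4) : ℝ) := by
      rw [← Real.rpow_mul hP.le]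
      have := abs_pow_mul_rpow_le p 0 (s := 13 / 8) (q := 5 / 4) hp (by norm_num) (by norm_num)
      rw [pow_zero, one_mul] at this
      refine le_trans (le_of_eq ?_) this
      norm_num
    calc |r| * ‖Θy k p‖ ≤ |r| * (C * (((1 + |p|) ^ (-(13 / 4) : ℝ)) ^ (1 / 2 : ℝ) * ((1 + r ^ 2)⁻¹) ^ (1 - 1 / 2 : ℝ))) := by gcongr
      _ = C * (((1 + |p|) ^ (-(13 / 4) : ℝ)) ^ (1 / 2 : ℝ) * (|r| * ((1 + r ^ 2)⁻¹) ^ (1 - 1 / 2 : ℝ))) := by ring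
      _ ≤ C * (|p| ^ (-(5 / 4) : ℝ) * 1) := by gcongr
      _ = _ := by ring
  · have hk := hc.resolve_left h1
    have hrK := le_abs_phase (not_le.1 h1) hk
    have hR : 0 < |p| * K := by positivity
    have eR : (|p| * K) ^ (-(3 / 4) : ℝ) = K ^ (-(3 / 4) : ℝ) * |p| ^ (-(3 / 4) : ℝ) := by
      rw [Real.mul_rpow hp0.le (by linarith), mul_comm]
    rw [← eR]
    rw [← hr] at hrK
    have b1 := inv_one_add_sq_rpow_le (q := 3 / 4) (θ := 1) hR hrK (by norm_num) (by norm_num) (by norm_num)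
    have b2 := inv_one_add_sq_rpow_le (q := 3 / 4) (θ := 3 / 8) hR hrK (by norm_num) (by norm_num) (by norm_num)
    rw [Real.rpow_one] at b1
    -- The weight 3/8 on (1 + r²)⁻¹ gives |r|^(-3/4). The remaining 5/8 of the decay absorbs p² when
    -- s = 13/4 and p when s = 9/4.
    have key : ∀ {X s : ℝ} (n : ℕ), 0 ≤ X → n ≤ s * (5 / 8) → X ≤ C * (1 + |p|) ^ (-s) → X ≤ C * (1 + r ^ 2)⁻¹ →
        |p| ^ n * X ≤ C * (|p| * K) ^ (-(3 / 4) : ℝ) := by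
      intro X s n hX hn ha hb
      have hi := le_interp (θ := 5 / 8) hX hC (by positivity) (by positivity) (by norm_num) (by norm_num) ha hb
      rw [← Real.rpow_mul hP.le, neg_mul, show (1 - 5 / 8 : ℝ) = 3 / 8 by norm_num] at hi
      calc |p| ^ n * X ≤ |p| ^ n * (C * ((1 + |p|) ^ (-(s * (5 / 8))) * ((1 + r ^ 2)⁻¹) ^ (3 / 8 : ℝ))) := by gcongr
        _ = C * ((|p| ^ n * (1 + |p|) ^ (-(s * (5 / 8)))) * ((1 + r ^ 2)⁻¹) ^ (3 / 8 : ℝ)) := by ring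
        _ ≤ C * (1 * (|p| * K) ^ (-(3 / 4) : ℝ)) := by
            gcongr; exact abs_pow_mul_rpow_le_one p n hn
        _ = _ := by ring
    refine ⟨(h.osc k p).trans (by gcongr), ?_, key 2 (norm_nonneg _) (by norm_num) (h.dec_y k p) (h.osc_y k p),
      by simpa using key 1 (norm_nonneg _) (by norm_num) (h.dec_x k p) (h.osc_x k p)⟩
    have b3 : |r| * (1 + r ^ 2)⁻¹ ≤ (|p| * K) ^ (-(3 / 4) : ℝ) := by
      have hrp : 0 < |r| := hR.trans_le hrK
      have b4 := inv_one_add_sq_rpow_le (q := 7 / 4) (θ := 1) hrp le_rfl (by norm_num) (by norm_num) (by norm_num)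
      rw [Real.rpow_one] at b4
      calc |r| * (1 + r ^ 2)⁻¹ ≤ |r| ^ (1 : ℝ) * |r| ^ (-(7 / 4) : ℝ) := by rw [Real.rpow_one]; gcongr
        _ = |r| ^ (-(3 / 4) : ℝ) := by rw [← Real.rpow_add hrp]; norm_num
        _ ≤ _ := Real.rpow_le_rpow_of_nonpos hR hrK (by norm_num)
    calc |r| * ‖Θy k p‖ ≤ |r| * (C * (1 + r ^ 2)⁻¹) := by gcongr; exact h.osc_y k p
      _ = C * (|r| * (1 + r ^ 2)⁻¹) := by ring
      _ ≤ _ := by gcongr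

/-- Changing k at fixed l moves both arguments of Θ(k, l - k), hence the two increments. -/
lemma lip_mul (h : ThetaData Θ Θx Θy Θyy Θxy Θxx C) (k k' p p' : ℝ) :
    ‖(p : ℂ) * Θ k p - p' * Θ k' p'‖ ≤ C * |k - k'| + 4 * C * |p - p'| := by
  have h1 : ‖(p : ℂ) * Θ k' p - p' * Θ k' p'‖ ≤ 4 * C * |p - p'| := by
    have := Convex.norm_image_sub_le_of_norm_hasDerivWithin_le (s := univ) (x := p') (y := p)
      (fun x _ => (h.hasDerivAt_mul k' x).hasDerivWithinAt) (fun x _ => h.norm_dmul_le_const k' x) convex_univ trivial trivial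
    simpa using this
  have h2 : ‖(p : ℂ) * Θ k p - p * Θ k' p‖ ≤ C * |k - k'| := by
    rw [← mul_sub, norm_mul, Complex.norm_real, Real.norm_eq_abs]
    have hC := h.C_nonneg
    calc |p| * ‖Θ k p - Θ k' p‖ ≤ |p| * (C * |k - k'| * (1 + |p|) ^ (-(9 / 4) : ℝ)) := by gcongr; exact h.lip k k' p
      _ = C * |k - k'| * (|p| ^ 1 * (1 + |p|) ^ (-(9 / 4) : ℝ)) := by ring
      _ ≤ C * |k - k'| * 1 := by gcongr; exact abs_pow_mul_rpow_le_one p 1 (by norm_num)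
      _ = _ := mul_one _
  calc _ = ‖((p : ℂ) * Θ k p - p * Θ k' p) + ((p : ℂ) * Θ k' p - p' * Θ k' p')‖ := by congr 1; ring
    _ ≤ _ := (norm_add_le _ _).trans (add_le_add h2 h1)

lemma lip_dmul_k (h : ThetaData Θ Θx Θy Θyy Θxy Θxx C) {K : ℝ} (hK : 1 ≤ K) {k k' p : ℝ} (hk : |k| ≤ K) :
    ‖dmul Θ Θx Θy k p - dmul Θ Θx Θy k' p‖ ≤ 8 * C * K ^ 2 * |k - k'| := by
  have hC := h.C_nonneg
  have hd := abs_nonneg (k - k')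
  have hp := abs_nonneg p
  have e : dmul Θ Θx Θy k p - dmul Θ Θx Θy k' p = (Θ k p - Θ k' p) + Complex.I * ((2 * p ^ 2 : ℝ) : ℂ) * (Θy k p - Θy k' p) +
      Complex.I * ((2 * k * p : ℝ) : ℂ) * (Θy k p - Θy k' p) + Complex.I * ((2 * (k - k') * p : ℝ) : ℂ) * Θy k' p -
      Complex.I * (p : ℂ) * (Θx k p - Θx k' p) := by
    simp only [dmul]; push_cast; ring
  have key : ∀ {X s : ℝ} (n : ℕ), n ≤ s → X ≤ C * |k - k'| * (1 + |p|) ^ (-s) → |p| ^ n * X ≤ C * |k - k'| := by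
    intro X s n hn hX
    calc |p| ^ n * X ≤ |p| ^ n * (C * |k - k'| * (1 + |p|) ^ (-s)) := by gcongr
      _ = C * |k - k'| * (|p| ^ n * (1 + |p|) ^ (-s)) := by ring
      _ ≤ C * |k - k'| * 1 := by gcongr; exact abs_pow_mul_rpow_le_one p n hn
      _ = _ := mul_one _
  have t1 := key 0 (by norm_num) (h.lip k k' p)
  have t2 := key 2 (by norm_num) (h.lip_y k k' p)
  have t3 := key 1 (by norm_num) (h.lip_y k k' p)
  have t5 := key 1 (by norm_num) (h.lip_x k k' p)
  have t4 := (h.norm_le k' p).2.2.2.2.2.2.1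
  rw [pow_zero, one_mul] at t1
  rw [pow_one] at t3 t5
  rw [e]
  have hn : ∀ (a : ℝ) (z : ℂ), ‖Complex.I * (a : ℂ) * z‖ = |a| * ‖z‖ := fun a z => by simp
  have step : ‖(Θ k p - Θ k' p) + Complex.I * ((2 * p ^ 2 : ℝ) : ℂ) * (Θy k p - Θy k' p) +
      Complex.I * ((2 * k * p : ℝ) : ℂ) * (Θy k p - Θy k' p) + Complex.I * ((2 * (k - k') * p : ℝ) : ℂ) * Θy k' p -
      Complex.I * (p : ℂ) * (Θx k p - Θx k' p)‖ ≤ ‖Θ k p - Θ k' p‖ + |2 * p ^ 2| * ‖Θy k p - Θy k' p‖ +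
      |2 * k * p| * ‖Θy k p - Θy k' p‖ + |2 * (k - k') * p| * ‖Θy k' p‖ + |p| * ‖Θx k p - Θx k' p‖ := by
    rw [← hn, ← hn, ← hn, ← hn]
    exact (norm_sub_le _ _).trans (add_le_add ((norm_add_le _ _).trans (add_le_add ((norm_add_le _ _).trans
      (add_le_add (norm_add_le _ _) le_rfl)) le_rfl)) le_rfl)
  refine step.trans ?_
  have a2 : |2 * p ^ 2| * ‖Θy k p - Θy k' p‖ ≤ 2 * (C * |k - k'|) := by
    rw [abs_mul, abs_two, abs_pow, mul_assoc]; linarith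
  have a3 : |2 * k * p| * ‖Θy k p - Θy k' p‖ ≤ 2 * K * (C * |k - k'|) := by
    rw [abs_mul, abs_mul, abs_two, mul_assoc]
    gcongr
  have a4 : |2 * (k - k') * p| * ‖Θy k' p‖ ≤ 2 * |k - k'| * C := by
    rw [abs_mul, abs_mul, abs_two, mul_assoc]
    gcongr
  have hX : 0 ≤ C * |k - k'| := by positivity
  have hK2 : K ≤ K ^ 2 := by nlinarith
  nlinarith [mul_le_mul_of_nonneg_right hK2 hX, mul_le_mul_of_nonneg_right hK hX]

/-- The `p`-derivative of `dmul`. -/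
lemma hasDerivAt_dmul (h : ThetaData Θ Θx Θy Θyy Θxy Θxx C) (k p : ℝ) :
    HasDerivAt (dmul Θ Θx Θy k) (Complex.I * ((2 * p + 2 * k) * Θy k p - Θx k p) +
      (Complex.I * ((2 * p + 2 * k) * Θy k p - Θx k p) +
        Complex.I * p * (2 * Θy k p + (2 * p + 2 * k) * (Complex.I * ((2 * p + 2 * k) * Θyy k p - Θxy k p)) -
          Complex.I * ((2 * p + 2 * k) * Θxy k p - Θxx k p)))) p := by
  have hid : HasDerivAt (fun p : ℝ => (p : ℂ)) 1 p := by
    simpa using (hasDerivAt_id p).ofReal_comp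
  have h1 := (((hid.const_mul 2).add_const (2 * k : ℂ)).mul (h.deriv_y k p)).sub (h.deriv_x k p)
  have h2 := (h.deriv k p).add ((hid.const_mul Complex.I).mul h1)
  refine h2.congr_deriv ?_
  simp only [Pi.mul_apply, Pi.sub_apply]
  ring

/-- The second p-derivative of pΘ contains (2p + 2k)² pΘ_yy. On the region |k|, |p| ≤ K the square
is at most 16K², and |p||Θ_yy| is bounded: this is the origin of the factor K². -/
lemma lip_dmul_p (h : ThetaData Θ Θx Θy Θyy Θxy Θxx C) {K : ℝ} (hK : 1 ≤ K) {k p p' : ℝ} (hk : |k| ≤ K) (hp : |p| ≤ K)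
    (hp' : |p'| ≤ K) : ‖dmul Θ Θx Θy k p - dmul Θ Θx Θy k p'‖ ≤ 40 * C * K ^ 2 * |p - p'| := by
  have hC := h.C_nonneg
  refine Convex.norm_image_sub_le_of_norm_hasDerivWithin_le (s := Icc (-K) K)
      (fun x _ => (h.hasDerivAt_dmul k x).hasDerivWithinAt) (fun x hx => ?_) (convex_Icc _ _)
      (abs_le.1 hp') (abs_le.1 hp)
  have hx : |x| ≤ K := abs_le.2 hx
  obtain ⟨n1, n2, n3, n4, n5, n6, n7, n8, n9⟩ := h.norm_le k x
  have nxy := h.bdd_xy k x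
  have nxx := h.bdd_xx k x
  set w : ℝ := 2 * x + 2 * k with hw
  have hwK : |w| ≤ 4 * K := by
    rw [abs_le] at *; constructor <;> linarith [hx.1, hx.2, hk.1, hk.2]
  have e : (2 * x + 2 * k : ℂ) = (w : ℂ) := by rw [hw]; push_cast; rfl
  rw [e]
  have hn : ∀ (a : ℝ) (z : ℂ), ‖(a : ℂ) * z‖ = |a| * ‖z‖ := fun a z => by simp
  have b1 : ‖(w : ℂ) * Θy k x - Θx k x‖ ≤ 4 * K * C + C := by
    refine (norm_sub_le _ _).trans (add_le_add ?_ n2)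
    rw [hn]; gcongr
  have b2 : ‖Complex.I * (x : ℂ) * (2 * Θy k x + w * (Complex.I * (w * Θyy k x - Θxy k x)) -
      Complex.I * (w * Θxy k x - Θxx k x))‖ ≤ 2 * C + (16 * K ^ 2 * C + 4 * K ^ 2 * C) + (4 * K ^ 2 * C + K * C) := by
    have e2 : Complex.I * (x : ℂ) * (2 * Θy k x + w * (Complex.I * (w * Θyy k x - Θxy k x)) -
      Complex.I * (w * Θxy k x - Θxx k x)) = Complex.I * (((2 * x : ℝ) : ℂ) * Θy k x) +
        (((w ^ 2 * x : ℝ) : ℂ) * -Θyy k x - ((w * x : ℝ) : ℂ) * -Θxy k x) - (((w * x : ℝ) : ℂ) * -Θxy k x - (x : ℂ) * -Θxx k x) := by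
      push_cast; linear_combination (w * x * Complex.I ^ 2 * 0 + (w ^ 2 * x * Θyy k x - w * x * Θxy k x - w * x * Θxy k x + x * Θxx k x)) * Complex.I_sq
    rw [e2]
    refine (norm_sub_le _ _).trans (add_le_add ((norm_add_le _ _).trans (add_le_add ?_ ((norm_sub_le _ _).trans (add_le_add ?_ ?_))))
      ((norm_sub_le _ _).trans (add_le_add ?_ ?_)))
    · rw [norm_mul, Complex.norm_I, one_mul, hn, abs_mul, abs_two, mul_assoc]; linarith
    · rw [hn, norm_neg, abs_mul, abs_pow, mul_assoc]
      calc |w| ^ 2 * (|x| * ‖Θyy k x‖) ≤ (4 * K) ^ 2 * C := by gcongr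
        _ = _ := by ring
    · rw [hn, norm_neg, abs_mul]
      calc |w| * |x| * ‖Θxy k x‖ ≤ (4 * K) * K * C := by gcongr
        _ = _ := by ring
    · rw [hn, norm_neg, abs_mul]
      calc |w| * |x| * ‖Θxy k x‖ ≤ (4 * K) * K * C := by gcongr
        _ = _ := by ring
    · rw [hn, norm_neg]; gcongr
  have hI : ∀ z : ℂ, ‖Complex.I * z‖ = ‖z‖ := fun z => by simp
  have b3 : ‖Complex.I * ((w : ℂ) * Θy k x - Θx k x)‖ ≤ 4 * K * C + C := by rw [hI]; exact b1
  refine (norm_add_le _ _).trans ((add_le_add b3 ((norm_add_le _ _).trans (add_le_add b3 b2))).trans ?_)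
  have hK2 : K ≤ K ^ 2 := by nlinarith
  nlinarith [mul_le_mul_of_nonneg_right hK2 hC, mul_le_mul_of_nonneg_right hK hC]

lemma lintegral_comp_affine {f : ℝ → ℝ≥0∞} (hf : Measurable f) {a : ℝ} (ha : a ≠ 0) (b : ℝ) :
    ENNReal.ofReal |a| * ∫⁻ x, f (a * x + b) = ∫⁻ x, f x := by
  have h1 : ∫⁻ x, f (x + b) = ∫⁻ x, f x := lintegral_add_right_eq_self f b
  rw [← h1]
  conv_rhs => rw [← Real.smul_map_volume_mul_left ha]
  rw [lintegral_smul_measure, lintegral_map (by fun_prop) (by fun_prop)]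
  rfl

/-- Interpolation with weight 2/5 on the decay gives (1 + |p|)^(-13/10) (1 + |r|)^(-6/5), up to a
constant. For fixed p ≠ 0 the substitution w = 2pk + p² has Jacobian 2|p|, which consumes the factor
p and makes the k-integral independent of p; then 13/10 > 1. -/
lemma integrable_mul (h : ThetaData Θ Θx Θy Θyy Θxy Θxx C) :
    Integrable fun z : ℝ × ℝ => ((z.2 - z.1 : ℝ) : ℂ) * Θ z.1 (z.2 - z.1) := by
  have hC := h.C_nonneg
  have mΘ : Measurable fun z : ℝ × ℝ => (z.2 : ℂ) * Θ z.1 z.2 := by have := h.meas; fun_prop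
  have mT : Measurable fun z : ℝ × ℝ => ((z.2 - z.1 : ℝ) : ℂ) * Θ z.1 (z.2 - z.1) :=
    mΘ.comp (by fun_prop : Measurable fun z : ℝ × ℝ => (z.1, z.2 - z.1))
  refine ⟨mT.aestronglyMeasurable, ?_⟩
  set g : ℝ → ℝ≥0∞ := fun w => ENNReal.ofReal ((1 + |w|) ^ (-(6 / 5) : ℝ)) with hg
  have mg : Measurable g := measurable_wt (6 / 5)
  have hgi : ∫⁻ w, g w < ∞ := lintegral_wt_lt_top (by norm_num)
  have hpt : ∀ k p : ℝ, ‖(p : ℂ) * Θ k p‖ₑ ≤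
      ENNReal.ofReal (4 * C) * wt (13 / 10) p * (ENNReal.ofReal |2 * p| * g (2 * p * k + p ^ 2)) := by
    intro k p
    set r := p * (p + 2 * k) with hr
    have hi := le_interp (θ := 2 / 5) (norm_nonneg _) hC (by positivity) (by positivity) (by norm_num) (by norm_num)
      (h.dec k p) (h.osc k p)
    rw [← hr, ← Real.rpow_mul (by positivity)] at hi
    have a1 : ((1 + r ^ 2)⁻¹) ^ (1 - 2 / 5 : ℝ) ≤ 4 * (1 + |r|) ^ (-(6 / 5) : ℝ) := by
      have h1 : (1 + |r|) ^ 2 ≤ 2 * (1 + r ^ 2) := by nlinarith [sq_abs r, sq_nonneg (|r| - 1)]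
      have h2 : (1 + |r|) ^ (6 / 5 : ℝ) ≤ 4 * (1 + r ^ 2) ^ (3 / 5 : ℝ) := by
        calc (1 + |r|) ^ (6 / 5 : ℝ) = ((1 + |r|) ^ 2) ^ (3 / 5 : ℝ) := by
              rw [← Real.rpow_natCast, ← Real.rpow_mul (by positivity)]; norm_num
          _ ≤ (2 * (1 + r ^ 2)) ^ (3 / 5 : ℝ) := by gcongr
          _ = 2 ^ (3 / 5 : ℝ) * (1 + r ^ 2) ^ (3 / 5 : ℝ) := by rw [Real.mul_rpow (by norm_num) (by positivity)]
          _ ≤ 4 * (1 + r ^ 2) ^ (3 / 5 : ℝ) := by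
              gcongr
              calc (2 : ℝ) ^ (3 / 5 : ℝ) ≤ 2 ^ (1 : ℝ) := Real.rpow_le_rpow_of_exponent_le (by norm_num) (by norm_num)
                _ ≤ 4 := by norm_num
      rw [show (1 - 2 / 5 : ℝ) = 3 / 5 by norm_num, Real.inv_rpow (by positivity), Real.rpow_neg (by positivity),
        ← div_eq_mul_inv, inv_le_comm₀ (by positivity) (by positivity), inv_div, div_le_iff₀ (by norm_num)]
      linarith
    have e1 : 2 * p * k + p ^ 2 = r := by rw [hr]; ring
    rw [hg, wt, ← ENNReal.ofReal_mul (abs_nonneg _), ← ENNReal.ofReal_mul (by positivity), ← ENNReal.ofReal_mul (by positivity),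
      ← ofReal_norm]
    apply ENNReal.ofReal_le_ofReal
    rw [e1, norm_mul, Complex.norm_real, Real.norm_eq_abs, abs_mul, abs_two]
    calc |p| * ‖Θ k p‖ ≤ |p| * (C * ((1 + |p|) ^ (-(13 / 4) * (2 / 5) : ℝ) * (4 * (1 + |r|) ^ (-(6 / 5) : ℝ)))) := by
          gcongr; exact hi.trans (by gcongr)
      _ = 4 * C * (1 + |p|) ^ (-(13 / 10) : ℝ) * (|p| * (1 + |r|) ^ (-(6 / 5) : ℝ)) := by
          rw [show (-(13 / 4) * (2 / 5) : ℝ) = -(13 / 10) by norm_num]; ring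
      _ ≤ 4 * C * (1 + |p|) ^ (-(13 / 10) : ℝ) * (2 * |p| * (1 + |r|) ^ (-(6 / 5) : ℝ)) := by
          gcongr; linarith [abs_nonneg p]
  have e1 : ∫⁻ z : ℝ × ℝ, ‖((z.2 - z.1 : ℝ) : ℂ) * Θ z.1 (z.2 - z.1)‖ₑ = ∫⁻ p : ℝ, ∫⁻ k : ℝ, ‖(p : ℂ) * Θ k p‖ₑ := by
    rw [Measure.volume_eq_prod, lintegral_prod _ mT.enorm.aemeasurable]
    have : ∀ k : ℝ, ∫⁻ l : ℝ, ‖((l - k : ℝ) : ℂ) * Θ k (l - k)‖ₑ = ∫⁻ p : ℝ, ‖(p : ℂ) * Θ k p‖ₑ := fun k =>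
      lintegral_sub_right_eq_self (fun p : ℝ => ‖(p : ℂ) * Θ k p‖ₑ) k
    simp only [this]
    rw [lintegral_lintegral_swap]
    exact mΘ.enorm.aemeasurable
  unfold HasFiniteIntegral
  rw [e1]
  calc ∫⁻ p : ℝ, ∫⁻ k : ℝ, ‖(p : ℂ) * Θ k p‖ₑ ≤ ∫⁻ p : ℝ, ENNReal.ofReal (4 * C) * wt (13 / 10) p * ∫⁻ w, g w := by
        refine lintegral_mono fun p => ?_
        by_cases hp : p = 0
        · simp [hp]
        calc ∫⁻ k : ℝ, ‖(p : ℂ) * Θ k p‖ₑ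
            ≤ ∫⁻ k : ℝ, ENNReal.ofReal (4 * C) * wt (13 / 10) p * (ENNReal.ofReal |2 * p| * g (2 * p * k + p ^ 2)) :=
              lintegral_mono fun k => hpt k p
          _ = _ := by
              rw [lintegral_const_mul' _ _ (ENNReal.mul_ne_top ENNReal.ofReal_ne_top (wt_ne_top _ _)),
                lintegral_const_mul' _ _ ENNReal.ofReal_ne_top, lintegral_comp_affine mg (by simpa using hp)]
    _ = ENNReal.ofReal (4 * C) * (∫⁻ p, wt (13 / 10) p) * ∫⁻ w, g w := by
        rw [lintegral_mul_const _ (by fun_prop), lintegral_const_mul' _ _ ENNReal.ofReal_ne_top]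
    _ < ∞ := ENNReal.mul_lt_top (ENNReal.mul_lt_top ENNReal.ofReal_lt_top (lintegral_wt_lt_top (by norm_num))) hgi

/-- The symbol `c (l-k) Θ(k,l-k)` satisfies the hypotheses of the oscillatory integral estimates. -/
theorem oscData (h : ThetaData Θ Θx Θy Θyy Θxy Θxx C) {c : ℂ} (hc : ‖c‖ ≤ 1) :
    OscData (fun k l => c * (((l - k : ℝ) : ℂ) * Θ k (l - k))) (fun k l => c * dmul Θ Θx Θy k (l - k)) (48 * C) := by
  have hC := h.C_nonneg
  have hcm : ∀ z : ℂ, ‖c * z‖ ≤ ‖z‖ := fun z => by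
    rw [norm_mul]; exact mul_le_of_le_one_left (norm_nonneg _) hc
  have hn : ∀ (a : ℝ) (z : ℂ), ‖(a : ℂ) * z‖ = |a| * ‖z‖ := fun a z => by simp
  have hmap : Measurable fun z : ℝ × ℝ => (z.1, z.2 - z.1) := by fun_prop
  have tn : ∀ {K q q' : ℝ} (x : ℝ), 1 ≤ K → 0 ≤ tailFn (K ^ q) q' K x := fun {K q q'} x hK =>
    tailFn_nonneg (Real.rpow_nonneg (by linarith) _) x
  refine ⟨by positivity, ?_, ?_, fun k => by simp, fun k l => ?_, fun k l => ?_, fun k l => ?_, ?_, ?_, fun k k' l => ?_, ?_, ?_⟩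
  · exact (((by have := h.meas; fun_prop : Measurable fun z : ℝ × ℝ => (z.2 : ℂ) * Θ z.1 z.2).comp hmap).const_mul c)
  · have m : Measurable fun z : ℝ × ℝ => dmul Θ Θx Θy z.1 z.2 := by
      have := h.meas; have := h.meas_x; have := h.meas_y
      unfold dmul; fun_prop
    exact (m.comp hmap).const_mul c
  · have h1 := (h.hasDerivAt_mul k (l - k)).comp_sub_const l k
    exact h1.const_mul c
  · refine (hcm _).trans ?_
    rw [hn]
    linarith [(h.norm_le k (l - k)).2.2.2.1]
  · exact (hcm _).trans (by linarith [h.norm_dmul_le_const k (l - k)])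
  · intro K hK k l hkl hcase
    refine (hcm _).trans ?_
    rw [hn]
    refine (h.tail_mul hK (sub_ne_zero.2 hkl.symm) hcase).trans ?_
    exact mul_le_mul_of_nonneg_right (by linarith) (tn _ hK)
  · intro K hK k l hkl hcase
    refine (hcm _).trans ((h.tail_dmul hK (sub_ne_zero.2 hkl.symm) hcase).trans ?_)
    exact mul_le_mul_of_nonneg_right (by linarith) (tn _ hK)
  · rw [← mul_sub]
    refine (hcm _).trans ((h.lip_mul k k' (l - k) (l - k')).trans ?_)
    rw [show l - k - (l - k') = -(k - k') by ring, abs_neg]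
    nlinarith [mul_nonneg hC (abs_nonneg (k - k'))]
  · intro K hK k k' l hk hk' hl hl'
    rw [← mul_sub]
    refine (hcm _).trans ?_
    have h1 := h.lip_dmul_k hK (k := k) (k' := k') (p := l - k) hk
    have h2 := h.lip_dmul_p hK (k := k') (p := l - k) (p' := l - k') hk' hl hl'
    rw [show l - k - (l - k') = -(k - k') by ring, abs_neg] at h2
    calc _ = ‖(dmul Θ Θx Θy k (l - k) - dmul Θ Θx Θy k' (l - k)) + (dmul Θ Θx Θy k' (l - k) - dmul Θ Θx Θy k' (l - k'))‖ := by
          congr 1; ring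
      _ ≤ _ := (norm_add_le _ _).trans (add_le_add h1 h2)
      _ = _ := by ring
  · exact h.integrable_mul.const_mul c

end ThetaData

/-! ### The oscillatory integrals Θ and their estimates. -/

/-- Measurable functions integrable on the plane and on every horizontal line. -/
structure Adm (v : ℝ × ℝ → ℝ) : Prop where
  slice : SliceInt v
  int : Integrable v

/-- The `L¹` norm of a horizontal slice. -/
def nv (v : ℝ × ℝ → ℝ) (y : ℝ) : ℝ := ∫ x, ‖v (x, y)‖

lemma nv_nonneg (v : ℝ × ℝ → ℝ) (y : ℝ) : 0 ≤ nv v y := integral_nonneg fun _ => norm_nonneg _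

lemma norm_ut_le (v : ℝ × ℝ → ℝ) (l y : ℝ) : ‖ut v l y‖ ≤ nv v y := by
  unfold ut nv
  rw [norm_mul, Complex.norm_real, Real.norm_of_nonneg (by positivity)]
  refine (mul_le_of_le_one_left (norm_nonneg _) inv_sqrt_two_pi_le_one).trans ?_
  refine (norm_integral_le_integral_norm _).trans (le_of_eq ?_)
  refine integral_congr_ae (Eventually.of_forall fun x => ?_)
  simp only [norm_mul, norm_cexp_neg_I_mul, one_mul, Complex.norm_real]

lemma Adm.slab {v : ℝ × ℝ → ℝ} (h : Adm v) : Slab (ut v) :=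
  ⟨measurable_ut h.slice.1, fun y => ⟨nv v y, fun l => norm_ut_le v l y⟩⟩

lemma Adm.integrable_nv {v : ℝ × ℝ → ℝ} (h : Adm v) : Integrable (nv v) := by
  have := h.int
  rw [Measure.volume_eq_prod] at this
  exact this.integral_norm_prod_right

lemma hasDerivAt_ut {v : ℝ × ℝ → ℝ} (h : Adm v) (hx : Adm fun z => z.1 * v z) (l y : ℝ) :
    HasDerivAt (fun l => ut v l y) (-Complex.I * ut (fun z => z.1 * v z) l y) l := by
  unfold ut
  rw [mul_left_comm, ← integral_const_mul]
  refine HasDerivAt.const_mul _ ?_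
  have := (hasDerivAt_integral_of_dominated_loc_of_deriv_le (μ := volume) (𝕜 := ℝ)
    (F := fun (l : ℝ) (x : ℝ) => Complex.exp (-Complex.I * l * x) * (v (x, y) : ℂ))
    (F' := fun (l : ℝ) (x : ℝ) => -Complex.I * (Complex.exp (-Complex.I * l * x) * ((x * v (x, y) : ℝ) : ℂ)))
    (x₀ := l) (s := univ) (bound := fun x => ‖x * v (x, y)‖) univ_mem
    (Eventually.of_forall fun l' => (integrable_cexp_mul (h.slice.2 y) l').1) (integrable_cexp_mul (h.slice.2 y) l)
    ((integrable_cexp_mul (hx.slice.2 y) l).const_mul _).1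
    (Eventually.of_forall fun x l' _ => ?_) (hx.slice.2 y).norm (Eventually.of_forall fun x l' _ => ?_)).2
  · exact this
  · rw [norm_mul, norm_mul, norm_neg, Complex.norm_I, one_mul, norm_cexp_neg_I_mul, one_mul, Complex.norm_real]
  · have hid : HasDerivAt (fun l : ℝ => (l : ℂ)) 1 l' := by simpa using (hasDerivAt_id l').ofReal_comp
    have h1 := (((hid.const_mul (-Complex.I)).mul_const (x : ℂ)).cexp).mul_const (v (x, y) : ℂ)
    refine h1.congr_deriv ?_
    push_cast; ring

lemma hasDerivAt_cnv {v : ℝ × ℝ → ℝ} (h : Adm v) (hx : Adm fun z => z.1 * v z) {m : ℝ → ℝ → ℂ} {φ : ℝ → ℝ≥0∞}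
    (hm : Dom m φ) (l y : ℝ) :
    HasDerivAt (fun l => cnv (ut v) m l y) (-Complex.I * cnv (ut fun z => z.1 * v z) m l y) l := by
  unfold cnv
  rw [← integral_const_mul]
  have := (hasDerivAt_integral_of_dominated_loc_of_deriv_le (μ := volume) (𝕜 := ℝ)
    (F := fun (l : ℝ) (l' : ℝ) => ut v (l - l') y * m l' y)
    (F' := fun (l : ℝ) (l' : ℝ) => -Complex.I * (ut (fun z => z.1 * v z) (l - l') y * m l' y))
    (x₀ := l) (s := univ) (bound := fun l' => nv (fun z => z.1 * v z) y * ‖m l' y‖) univ_mem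
    (Eventually.of_forall fun l'' => (integrable_cnv h.slab hm l'' y).1) (integrable_cnv h.slab hm l y)
    ((integrable_cnv hx.slab hm l y).const_mul _).1
    (Eventually.of_forall fun l' l'' _ => ?_) ((hm.integrable y).norm.const_mul _)
    (Eventually.of_forall fun l' l'' _ => ?_)).2
  · exact this
  · rw [norm_mul, norm_mul, norm_neg, Complex.norm_I, one_mul]
    gcongr
    exact norm_ut_le _ _ _
  · have h1 := ((hasDerivAt_ut h hx (l'' - l') y).comp_sub_const l'' l').mul_const (m l' y)
    refine h1.congr_deriv ?_
    ring

lemma hasDerivAt_src {v : ℝ × ℝ → ℝ} (h : Adm v) (hx : Adm fun z => z.1 * v z) {m : ℝ → ℝ → ℂ} {φ : ℝ → ℝ≥0∞}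
    (hm : Dom m φ) (l y : ℝ) :
    HasDerivAt (fun l => src (ut v) m l y) (-Complex.I * src (ut fun z => z.1 * v z) m l y) l := by
  unfold src
  refine (((hasDerivAt_ut h hx l y).const_mul _).add (hasDerivAt_cnv h hx hm l y)).congr_deriv ?_
  ring

lemma src_mul_snd (v : ℝ × ℝ → ℝ) (m : ℝ → ℝ → ℂ) (l y : ℝ) :
    src (ut fun z => z.2 * v z) m l y = y * src (ut v) m l y := by
  unfold src cnv
  simp only [ut_mul_snd, mul_assoc]
  rw [integral_const_mul]; ring

lemma norm_cnv_le (v : ℝ × ℝ → ℝ) {m : ℝ → ℝ → ℂ} {φ : ℝ → ℝ≥0∞} (hm : Dom m φ) (l y : ℝ) :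
    ‖cnv (ut v) m l y‖ ≤ nv v y * (∫⁻ l, φ l).toReal := by
  have h1 : ‖cnv (ut v) m l y‖ₑ ≤ ENNReal.ofReal (nv v y) * ∫⁻ l, φ l := by
    unfold cnv
    rw [← lintegral_const_mul' _ _ ENNReal.ofReal_ne_top]
    refine (enorm_integral_le_lintegral_enorm _).trans (lintegral_mono fun l' => ?_)
    dsimp only
    rw [enorm_mul]
    gcongr
    · rw [← ofReal_norm]; exact ENNReal.ofReal_le_ofReal (norm_ut_le v _ y)
    · exact hm.le l' y
  have h2 := ENNReal.toReal_mono (ENNReal.mul_ne_top ENNReal.ofReal_ne_top hm.lintegral_ne_top) h1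
  rwa [toReal_enorm, ENNReal.toReal_mul, ENNReal.toReal_ofReal (nv_nonneg v y)] at h2

lemma norm_src_le (v : ℝ × ℝ → ℝ) {m : ℝ → ℝ → ℂ} {φ : ℝ → ℝ≥0∞} (hm : Dom m φ) (l y : ℝ) :
    ‖src (ut v) m l y‖ ≤ (3 + (∫⁻ l, φ l).toReal) * nv v y := by
  have h3 : ‖(Real.sqrt (2 * Real.pi) : ℂ)‖ ≤ 3 := by
    rw [← toReal_enorm]
    exact ENNReal.toReal_mono (by norm_num) sqrt_two_pi_le
  unfold src
  refine (norm_add_le _ _).trans ?_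
  rw [norm_mul]
  have h4 := norm_cnv_le v hm l y
  have h5 := mul_le_mul h3 (norm_ut_le v l y) (norm_nonneg _) (by norm_num)
  linarith

/-- The phase `e^{ip(p+2k)y}`. -/
def phs (k p y : ℝ) : ℂ := Complex.exp (Complex.I * (p * (p + 2 * k)) * y)

lemma norm_phs (k p y : ℝ) : ‖phs k p y‖ = 1 := by
  unfold phs; rw [Complex.norm_exp]; simp

lemma enorm_phs (k p y : ℝ) : ‖phs k p y‖ₑ = 1 := by rw [← ofReal_norm, norm_phs, ENNReal.ofReal_one]

/-- The oscillatory integral `∫ e^{ip(p+2k)y} (√(2π) V + V * m)(p, y) dy`. -/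
def tht (V m : ℝ → ℝ → ℂ) (k p : ℝ) : ℂ := ∫ y, phs k p y * src V m p y

lemma enorm_tht_le (V m : ℝ → ℝ → ℂ) (k p : ℝ) : ‖tht V m k p‖ₑ ≤ prof (src V m) p := by
  unfold tht prof
  refine (enorm_integral_le_lintegral_enorm _).trans (le_of_eq (lintegral_congr fun y => ?_))
  rw [enorm_mul, enorm_phs, one_mul]

lemma measurable_tht {V : ℝ → ℝ → ℂ} (hV : Measurable fun z : ℝ × ℝ => V z.1 z.2) {m : ℝ → ℝ → ℝ → ℂ}
    (hm : Measurable fun z : ℝ × ℝ × ℝ => m z.1 z.2.1 z.2.2) :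
    Measurable fun z : ℝ × ℝ => tht V (m z.1) z.1 z.2 := by
  have m1 := measurable_cnv hV hm
  have m2 : Measurable fun z : ℝ × ℝ × ℝ => V z.2.1 z.2.2 :=
    hV.comp (by fun_prop : Measurable fun z : ℝ × ℝ × ℝ => (z.2.1, z.2.2))
  unfold tht
  apply StronglyMeasurable.measurable
  apply StronglyMeasurable.integral_prod_right (f := fun (z : ℝ × ℝ) (y : ℝ) => phs z.1 z.2 y * src V (m z.1) z.2 y)
  apply Measurable.stronglyMeasurable
  unfold Function.uncurry src phs
  have h1 := m1.comp (by fun_prop : Measurable fun z : (ℝ × ℝ) × ℝ => (z.1.1, z.1.2, z.2))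
  have h2 := m2.comp (by fun_prop : Measurable fun z : (ℝ × ℝ) × ℝ => (z.1.1, z.1.2, z.2))
  simp only [Function.comp_def] at h1 h2
  fun_prop

lemma Adm.integrable_src {v : ℝ × ℝ → ℝ} (h : Adm v) {m : ℝ → ℝ → ℂ} {φ : ℝ → ℝ≥0∞} (hm : Dom m φ) (l : ℝ) :
    Integrable (src (ut v) m l) :=
  Integrable.mono' (h.integrable_nv.const_mul _)
    (measurable_slice_left (measurable_src h.slab.meas hm.meas) l).aestronglyMeasurable
    (Eventually.of_forall fun y => norm_src_le v hm l y)

lemma continuous_phs (k p : ℝ) : Continuous (phs k p) := by unfold phs; fun_prop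

lemma integrable_phs_mul {f : ℝ → ℂ} (hf : Integrable f) (k p : ℝ) : Integrable fun y => phs k p y * f y :=
  hf.bdd_mul (c := 1) (continuous_phs k p).aestronglyMeasurable (Eventually.of_forall fun y => (norm_phs k p y).le)

/-- Differentiating the phase p(p + 2k)y brings down (2p + 2k)y and differentiating ũ brings down
-x. Both factors are moved onto the potential, so the derivative is expressed by integrals of the
same kind. -/
lemma hasDerivAt_tht {v : ℝ × ℝ → ℝ} (h : Adm v) (hx : Adm fun z => z.1 * v z) (hy : Adm fun z => z.2 * v z)
    {m : ℝ → ℝ → ℂ} {φ : ℝ → ℝ≥0∞} (hm : Dom m φ) (k p : ℝ) :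
    HasDerivAt (tht (ut v) m k) (Complex.I * ((2 * p + 2 * k) * tht (ut fun z => z.2 * v z) m k p -
      tht (ut fun z => z.1 * v z) m k p)) p := by
  set M := 3 + (∫⁻ l, φ l).toReal with hM
  have hM0 : 0 ≤ M := by positivity
  have ix := fun p => integrable_phs_mul (hx.integrable_src hm p) k p
  have iy := fun p => integrable_phs_mul (hy.integrable_src hm p) k p
  have i0 := fun p => integrable_phs_mul (h.integrable_src hm p) k p
  have e : Complex.I * ((2 * p + 2 * k) * tht (ut fun z => z.2 * v z) m k p - tht (ut fun z => z.1 * v z) m k p) =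
      ∫ y, Complex.I * ((2 * p + 2 * k) * (phs k p y * src (ut fun z => z.2 * v z) m p y) -
        phs k p y * src (ut fun z => z.1 * v z) m p y) := by
    rw [integral_const_mul, integral_sub ((iy p).const_mul _) (ix p), integral_const_mul]; rfl
  rw [e]
  refine (hasDerivAt_integral_of_dominated_loc_of_deriv_le (μ := volume) (𝕜 := ℝ)
    (F := fun p y => phs k p y * src (ut v) m p y)
    (F' := fun (p : ℝ) y => Complex.I * ((2 * p + 2 * k) * (phs k p y * src (ut fun z => z.2 * v z) m p y) -
        phs k p y * src (ut fun z => z.1 * v z) m p y))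
    (x₀ := p) (s := Metric.ball p 1) (bound := fun y => (2 * (|p| + 1) + 2 * |k|) * (M * nv (fun z => z.2 * v z) y) +
      M * nv (fun z => z.1 * v z) y) (Metric.ball_mem_nhds p one_pos)
    (Eventually.of_forall fun p => (i0 p).1) (i0 p)
    ((((iy p).const_mul _).sub (ix p)).const_mul _).1
    (Eventually.of_forall fun y q hq => ?_) ((hy.integrable_nv.const_mul M).const_mul _ |>.add (hx.integrable_nv.const_mul M))
    (Eventually.of_forall fun y q hq => ?_)).2
  · rw [norm_mul, Complex.norm_I, one_mul]
    refine (norm_sub_le _ _).trans ?_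
    rw [norm_mul, norm_mul, norm_mul, norm_phs, one_mul, one_mul]
    have hq' : |q| ≤ |p| + 1 := by
      rw [Metric.mem_ball, Real.dist_eq] at hq
      have := abs_sub_abs_le_abs_sub q p
      linarith
    have h1 : ‖(2 * q + 2 * k : ℂ)‖ ≤ 2 * (|p| + 1) + 2 * |k| := by
      refine (norm_add_le _ _).trans ?_
      simp only [norm_mul, Complex.norm_ofNat, Complex.norm_real, Real.norm_eq_abs]
      linarith
    gcongr
    · exact norm_src_le _ hm q y
    · exact norm_src_le _ hm q y
  · have hid : HasDerivAt (fun l : ℝ => (l : ℂ)) 1 q := by simpa using (hasDerivAt_id q).ofReal_comp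
    have h1 : HasDerivAt (fun q => phs k q y) (Complex.I * (2 * q + 2 * k) * y * phs k q y) q := by
      unfold phs
      refine ((((hid.mul (hid.add_const (2 * k : ℂ))).const_mul Complex.I).mul_const (y : ℂ)).cexp).congr_deriv ?_
      simp only [Pi.mul_apply]
      ring
    refine (h1.mul (hasDerivAt_src h hx hm q y)).congr_deriv ?_
    rw [src_mul_snd]; ring

/-- Translation in y acts on the integral as multiplication by a unimodular factor, the discrete
form of integration by parts in y. -/
lemma integral_phs_fwdDiff {f : ℝ → ℂ} (hf : Integrable f) (h k p : ℝ) (n : ℕ) :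
    Integrable (Δ_[h] ^[n] f) ∧
    ∫ y, phs k p y * Δ_[h] ^[n] f y = (Complex.exp (-(Complex.I * (p * (p + 2 * k)) * h)) - 1) ^ n * ∫ y, phs k p y * f y := by
  induction n with
  | zero => simpa using hf
  | succ n ih =>
    have i1 := ih.1
    have i2 := i1.comp_add_right h
    rw [Function.iterate_succ_apply']
    refine ⟨i2.sub i1, ?_⟩
    have e1 : ∫ y, phs k p y * Δ_[h] ^[n] f (y + h) = Complex.exp (-(Complex.I * (p * (p + 2 * k)) * h)) *
        ∫ y, phs k p y * Δ_[h] ^[n] f y := by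
      rw [← integral_const_mul, ← integral_add_right_eq_self
        (fun y => Complex.exp (-(Complex.I * (p * (p + 2 * k)) * h)) * (phs k p y * Δ_[h] ^[n] f y)) h]
      refine integral_congr_ae (Eventually.of_forall fun y => ?_)
      dsimp only
      rw [← mul_assoc]
      congr 1
      unfold phs
      rw [← Complex.exp_add]; congr 1; push_cast; ring
    calc ∫ y, phs k p y * fwdDiff h (Δ_[h] ^[n] f) y
        = ∫ y, (phs k p y * Δ_[h] ^[n] f (y + h) - phs k p y * Δ_[h] ^[n] f y) := by
          refine integral_congr_ae (Eventually.of_forall fun y => ?_)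
          simp only [fwdDiff]; ring
      _ = (∫ y, phs k p y * Δ_[h] ^[n] f (y + h)) - ∫ y, phs k p y * Δ_[h] ^[n] f y :=
          integral_sub (integrable_phs_mul i2 k p) (integrable_phs_mul i1 k p)
      _ = _ := by rw [e1, ih.2]; ring

/-- Decay in the phase from fourth differences of the integrand. -/
lemma norm_tht_le_of_fwdDiff {V m : ℝ → ℝ → ℂ} {k p : ℝ} (hi : Integrable (src V m p)) {K : ℝ} (hK : 0 ≤ K)
    (h0 : ‖tht V m k p‖ₑ ≤ ENNReal.ofReal K)
    (h4 : ∀ h : ℝ, 0 < h → h ≤ 1 → ∫⁻ y, ‖Δ_[h] ^[4] (src V m p) y‖ₑ ≤ ENNReal.ofReal (h ^ 2 * K)) :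
    ‖tht V m k p‖ ≤ 20 * K * (1 + (p * (p + 2 * k)) ^ 2)⁻¹ := by
  set r := p * (p + 2 * k) with hr
  have hpi := Real.pi_gt_three
  have hpi4 := Real.pi_lt_d2
  have hr1 : 0 < 1 + r ^ 2 := by positivity
  rw [← div_eq_mul_inv, le_div_iff₀ hr1]
  have hn := norm_nonneg (tht V m k p)
  have h0' : ‖tht V m k p‖ ≤ K := by
    rwa [← ofReal_norm, ENNReal.ofReal_le_ofReal_iff hK] at h0
  rcases lt_or_ge |r| Real.pi with hlt | hge
  · have : r ^ 2 ≤ 19 := by rw [← sq_abs]; nlinarith [abs_nonneg r]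
    nlinarith
  · have hl0 : 0 < |r| := by linarith
    -- With this step the unimodular factor is -1 and the fourth power gives 16; the bound h²K for
    -- fourth differences becomes decay r^(-2).
    set h := Real.pi / |r| with hh
    have hh0 : 0 < h := by positivity
    have hh1 : h ≤ 1 := (div_le_one hl0).2 hge
    have hexp : Complex.exp (-(Complex.I * (p * (p + 2 * k)) * h)) = -1 := by
      have e0 : Complex.I * (p * (p + 2 * k)) * h = Complex.I * ((r * h : ℝ) : ℂ) := by rw [hr]; push_cast; ring
      rw [e0]
      rcases le_total 0 r with hp | hn
      · have e : r * h = Real.pi := by rw [hh, abs_of_nonneg hp]; rw [abs_of_nonneg hp] at hl0; field_simp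
        rw [e, mul_comm, Complex.exp_neg, Complex.exp_pi_mul_I]; norm_num
      · have e : r * h = -Real.pi := by
          rw [hh, abs_of_nonpos hn]; rw [abs_of_nonpos hn] at hl0
          have : r ≠ 0 := by linarith
          field_simp
        rw [e, mul_comm]; push_cast
        rw [neg_mul, neg_neg, Complex.exp_pi_mul_I]
    have e4 := (integral_phs_fwdDiff hi h k p 4).2
    rw [hexp] at e4
    have b : ‖(16 : ℂ) * tht V m k p‖ₑ ≤ ENNReal.ofReal (h ^ 2 * K) := by
      have : (16 : ℂ) * tht V m k p = ∫ y, phs k p y * Δ_[h] ^[4] (src V m p) y := by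
        rw [e4, tht]; norm_num
      rw [this]
      refine (enorm_integral_le_lintegral_enorm _).trans (le_trans (le_of_eq (lintegral_congr fun y => ?_)) (h4 h hh0 hh1))
      rw [enorm_mul, enorm_phs, one_mul]
    rw [← ofReal_norm, ENNReal.ofReal_le_ofReal_iff (by positivity), norm_mul, Complex.norm_ofNat] at b
    have hr2 : h ^ 2 * r ^ 2 = Real.pi ^ 2 := by
      rw [hh, div_pow, sq_abs]
      have : r ≠ 0 := by rintro h; rw [h, abs_zero] at hl0; linarith
      field_simp
    have : 16 * (‖tht V m k p‖ * r ^ 2) ≤ Real.pi ^ 2 * K := by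
      rw [← hr2]; nlinarith [sq_nonneg r]
    have hpi2 : Real.pi ^ 2 * K ≤ 10 * K := by gcongr; nlinarith
    linarith

lemma norm_le_of_enorm_le_wt {z : ℂ} {K : ℝ≥0∞} (hK : K ≠ ∞) {s p : ℝ} (h : ‖z‖ₑ ≤ K * wt s p) :
    ‖z‖ ≤ K.toReal * (1 + |p|) ^ (-s) := by
  have h1 := ENNReal.toReal_mono (ENNReal.mul_ne_top hK (wt_ne_top _ _)) h
  have := abs_nonneg p
  rwa [toReal_enorm, ENNReal.toReal_mul, wt, ENNReal.toReal_ofReal (by positivity)] at h1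

lemma profMod_le_of_weight {V W : ℝ → ℝ → ℂ} {K : ℝ≥0∞} {s : ℝ}
    (hVW : ∀ l y : ℝ, ‖y‖ₑ * ‖V l y‖ₑ ≤ ENNReal.ofReal (1 + y ^ 2) * ‖W l y‖ₑ)
    (h : ∀ l, ∫⁻ y, ENNReal.ofReal (1 + y ^ 2) * ‖W l y‖ₑ ≤ K * wt (s + 1) l) (l : ℝ) : profMod V l ≤ 2 * K * wt s l := by
  have hl := abs_nonneg l
  have h1 : ‖2 * l‖ₑ ≤ 2 * ENNReal.ofReal (1 + |l|) := by
    rw [show (2 : ℝ≥0∞) = ENNReal.ofReal 2 by norm_num, ← ENNReal.ofReal_mul (by norm_num), ← ofReal_norm]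
    apply ENNReal.ofReal_le_ofReal
    rw [Real.norm_eq_abs, abs_mul, abs_two]
    linarith
  have h2 : ENNReal.ofReal (1 + |l|) * wt (s + 1) l = wt s l := by
    unfold wt
    rw [← ENNReal.ofReal_mul (by positivity), show -s = 1 + -(s + 1) by ring, Real.rpow_add (by positivity),
      Real.rpow_one]
  calc profMod V l ≤ ∫⁻ y, ‖2 * l‖ₑ * (ENNReal.ofReal (1 + y ^ 2) * ‖W l y‖ₑ) :=
        lintegral_mono fun y => by dsimp only; rw [enorm_mul (2 * l) y, mul_assoc]; exact mul_le_mul' le_rfl (hVW l y)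
    _ ≤ (2 * ENNReal.ofReal (1 + |l|)) * (K * wt (s + 1) l) := by
        rw [lintegral_const_mul' _ _ enorm_ne_top]; gcongr; exact h l
    _ = 2 * K * wt s l := by rw [← h2]; ring

/-- The phase at k + κ is the phase at k times the modulation e^{2iκpy}, which can be attached to
the source. -/
lemma tht_modu (V : ℝ → ℝ → ℂ) (m m' : ℝ → ℝ → ℂ) (k κ p : ℝ) (hi : Integrable (src V m p)) (hi' : Integrable (src V m' p)) :
    ‖tht V m' (k + κ) p - tht V m k p‖ₑ ≤ ∫⁻ y, ‖modu κ p y * src V m' p y - src V m p y‖ₑ := by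
  unfold tht
  rw [← integral_sub (integrable_phs_mul hi' _ _) (integrable_phs_mul hi _ _)]
  refine (enorm_integral_le_lintegral_enorm _).trans (le_of_eq (lintegral_congr fun y => ?_))
  have : phs (k + κ) p y = phs k p y * modu κ p y := by
    unfold phs modu
    rw [← Complex.exp_add]; congr 1; push_cast; ring
  rw [this, mul_assoc, ← mul_sub, enorm_mul, enorm_phs, one_mul]

namespace IsNice
variable {u : ℝ × ℝ → ℝ} {C : ℝ}

lemma adm_mul (h : IsNice u C) {w : ℝ × ℝ → ℝ} (hw : Measurable w) (hb : ∀ z, |w z| ≤ (1 + z.1 ^ 2) * (1 + z.2 ^ 2)) :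
    Adm (fun z => w z * u z) :=
  ⟨h.sliceInt_mul hw fun y => ⟨1 + y ^ 2, fun x => (hb (x, y)).trans (by dsimp only; linarith)⟩,
    (hw.mul h.meas).aestronglyMeasurable, (h.lintegral_weight_le hb).trans_lt ENNReal.ofReal_lt_top⟩

lemma abs_le_one_add_sq (x : ℝ) : |x| ≤ 1 + x ^ 2 := by
  rw [abs_le]; constructor <;> nlinarith [sq_nonneg (x - 1), sq_nonneg (x + 1)]

lemma adm_all (h : IsNice u C) : Adm u ∧ Adm (fun z => z.1 * u z) ∧ Adm (fun z => z.2 * u z) ∧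
    Adm (fun z => z.2 * (z.2 * u z)) ∧ Adm (fun z => z.1 * (z.2 * u z)) ∧ Adm (fun z => z.1 * (z.1 * u z)) := by
  have a : ∀ x : ℝ, 0 < 1 + x ^ 2 := fun x => by positivity
  have b : ∀ x : ℝ, 1 ≤ 1 + x ^ 2 := fun x => by nlinarith [sq_nonneg x]
  simp only [← mul_assoc]
  refine ⟨?_, h.adm_mul (by fun_prop) fun z => ?_, h.adm_mul (by fun_prop) fun z => ?_, h.adm_mul (by fun_prop) fun z => ?_,
    h.adm_mul (by fun_prop) fun z => ?_, h.adm_mul (by fun_prop) fun z => ?_⟩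
  · have := h.adm_mul (w := fun _ => 1) measurable_const fun z => by
      rw [abs_one]; exact one_le_mul_of_one_le_of_one_le (b _) (b _)
    simpa only [one_mul] using this
  · exact (abs_le_one_add_sq _).trans (le_mul_of_one_le_right (a _).le (b _))
  · exact (abs_le_one_add_sq _).trans (le_mul_of_one_le_left (a _).le (b _))
  · rw [← sq, abs_of_nonneg (sq_nonneg _)]
    exact (by linarith : z.2 ^ 2 ≤ 1 + z.2 ^ 2).trans (le_mul_of_one_le_left (a _).le (b _))
  · rw [abs_mul]
    exact mul_le_mul (abs_le_one_add_sq _) (abs_le_one_add_sq _) (abs_nonneg _) (a _).le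
  · rw [← sq, abs_of_nonneg (sq_nonneg _)]
    exact (by linarith : z.1 ^ 2 ≤ 1 + z.1 ^ 2).trans (le_mul_of_one_le_right (a _).le (b _))

/-- The decay of V in l passes to V * μ̃ because the majorant of the solution decays at least as
fast as the weight of order σ. -/
lemma exists_tht_le_wt (H : IsNice u C) (hc : cNorm u < 1) (s : ℝ) {V : ℝ → ℝ → ℂ} (hV : Measurable fun z : ℝ × ℝ => V z.1 z.2)
    {σ : ℝ} (hσ : 1 < σ) (hσ' : σ ≤ 13 / 4) {K : ℝ≥0∞} (hK : K ≠ ∞) (h : ∀ l, prof V l ≤ K * wt σ l) :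
    ∃ D : ℝ, 0 ≤ D ∧ ∀ k p, ‖tht V (mu s u k) k p‖ ≤ D * (1 + |p|) ^ (-σ) := by
  obtain ⟨K1, hK1, hm⟩ := H.exists_maj_le hc
  obtain ⟨K2, hK2, hcv⟩ := exists_cv_le_wt hσ hK hK1 h (fun l => (hm l).trans (by gcongr; exact wt_anti hσ' l))
    (measurable_prof hV) (measurable_maj H.meas)
  have hK3 : 3 * K + K2 ≠ ∞ := by finiteness
  refine ⟨(3 * K + K2).toReal, ENNReal.toReal_nonneg, fun k p => norm_le_of_enorm_le_wt hK3 ?_⟩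
  have hd := H.dom_mu hc s k
  refine (enorm_tht_le V _ k p).trans ((prof_src_le hV hd.meas hd.le p).trans ?_)
  rw [add_mul, mul_assoc]
  gcongr
  · exact h p
  · exact hcv p

/-- By the Leibniz rule a fourth difference of the source is O(h²), each difference of ũ or of the
solution being worth h^(1/2). Convergence of the l'-integral comes from the exponent 13/12 in the
bound for the solution. -/
lemma exists_tht_le_osc (H : IsNice u C) (hc : cNorm u < 1) (s : ℝ) {v : ℝ × ℝ → ℝ} (hv : Adm v) {E : ℝ≥0∞} (hE : E ≠ ∞)
    (hd : ∀ h : ℝ, 0 < h → h ≤ 1 → ∀ i ≤ 4, ∀ l, ∫⁻ y, ‖Δ_[h] ^[i] (fun y => ut v l y) y‖ₑ ≤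
      ENNReal.ofReal (h ^ (1 / 2 : ℝ)) ^ i * E) :
    ∃ D : ℝ, 0 ≤ D ∧ ∀ k p, ‖tht (ut v) (mu s u k) k p‖ ≤ D * (1 + (p * (p + 2 * k)) ^ 2)⁻¹ := by
  obtain ⟨K0, hK0, hM⟩ := H.exists_fwdDiff_mu_le hc s
  set M : ℝ → ℝ≥0∞ := fun l => K0 * wt (13 / 12) l with hMd
  have mM : Measurable M := (measurable_wt _).const_mul _
  have iM : ∫⁻ l, M l ≠ ∞ := lintegral_le_of_le_wt (by norm_num : (1 : ℝ) < 13 / 12) hK0 fun _ => le_rfl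
  have ij := H.lintegral_maj_ne_top hc
  have hP : ∀ l, prof (ut v) l ≤ E := fun l => by
    simpa [prof] using hd 1 one_pos le_rfl 0 (by norm_num) l
  set K := 3 * E + E * (∫⁻ l, maj u l) + 16 * E * ∫⁻ l, M l with hKd
  have hK : K ≠ ∞ := by finiteness
  refine ⟨20 * K.toReal, by positivity, fun k p => ?_⟩
  have hdom := H.dom_mu hc s k
  refine norm_tht_le_of_fwdDiff (hv.integrable_src hdom p) ENNReal.toReal_nonneg ?_ fun h h0 h1 => ?_
  · rw [ENNReal.ofReal_toReal hK]
    refine (enorm_tht_le _ _ k p).trans ((prof_src_le hv.slab.meas hdom.meas hdom.le p).trans ?_)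
    refine le_trans (add_le_add (mul_le_mul' le_rfl (hP p)) ?_) (le_self_add (b := 16 * E * ∫⁻ l, M l))
    unfold cv
    rw [← lintegral_const_mul' _ _ hE]
    exact lintegral_mono fun q => mul_le_mul' (hP _) le_rfl
  · have ht : ENNReal.ofReal (h ^ (1 / 2 : ℝ)) ^ 4 = ENNReal.ofReal (h ^ 2) := by
      rw [← ENNReal.ofReal_pow (by positivity), ← Real.rpow_natCast, ← Real.rpow_mul h0.le]
      norm_num
    rw [ENNReal.ofReal_mul (by positivity), ENNReal.ofReal_toReal hK]
    set t := ENNReal.ofReal (h ^ (1 / 2 : ℝ)) with htd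
    have e2 : src (ut v) (mu s u k) p = fun y => (Real.sqrt (2 * Real.pi) : ℂ) * ut v p y + cnv (ut v) (mu s u k) p y := rfl
    have e3 : ∀ y, Δ_[h] ^[4] (fun y => (Real.sqrt (2 * Real.pi) : ℂ) * ut v p y) y =
        (Real.sqrt (2 * Real.pi) : ℂ) * Δ_[h] ^[4] (ut v p) y := fun y =>
      congrFun (fwdDiff_iter_const_smul (R := ℂ) h (Real.sqrt (2 * Real.pi) : ℂ) (ut v p) 4) y
    have mfv : ∀ l, Measurable (ut v l) := fun l => measurable_slice_left hv.slab.meas l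
    have mU := measurable_fwdDiff_iter_real (mfv p) h 4
    have b2 : ∫⁻ y, ‖Δ_[h] ^[4] (cnv (ut v) (mu s u k) p) y‖ₑ ≤ t ^ 4 * (16 * E * ∫⁻ l, M l) := by
      refine (prof_fwdDiff_cnv_le hv.slab hdom h 4 p).trans ?_
      rw [← lintegral_const_mul' _ _ (by finiteness), ← lintegral_const_mul' _ _ (by finiteness)]
      refine lintegral_mono fun l' => ?_
      refine (lintegral_fwdDiff_mul_le (h := h) (t := t) 4 (mfv (p - l')) (measurable_slice_left hdom.meas l') (p := E) (M := M l')
        (fun i hi => hd h h0 h1 i hi _) (fun j hj y => hM j hj h h0 h1 k l' y)).trans (le_of_eq ?_)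
      ring
    calc ∫⁻ y, ‖Δ_[h] ^[4] (src (ut v) (mu s u k) p) y‖ₑ
        ≤ 3 * (t ^ 4 * E) + ∫⁻ y, ‖Δ_[h] ^[4] (cnv (ut v) (mu s u k) p) y‖ₑ := by
          rw [e2, fwdDiff_iter_add_fun]
          simp only [e3]
          refine (lintegral_mono fun y => enorm_add_le _ _).trans ?_
          rw [lintegral_add_left ((mU.const_mul _).enorm)]
          simp only [enorm_mul]
          rw [lintegral_const_mul' _ _ enorm_ne_top]
          gcongr
          · exact sqrt_two_pi_le
          · exact hd h h0 h1 4 le_rfl p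
      _ ≤ 3 * (t ^ 4 * E) + t ^ 4 * (16 * E * ∫⁻ l, M l) := by gcongr
      _ ≤ t ^ 4 * K := by
          rw [hKd, show t ^ 4 * (3 * E + E * (∫⁻ l, maj u l) + 16 * E * ∫⁻ l, M l) =
            (3 * (t ^ 4 * E) + t ^ 4 * (16 * E * ∫⁻ l, M l)) + t ^ 4 * (E * ∫⁻ l, maj u l) by ring]
          exact le_self_add
      _ = ENNReal.ofReal (h ^ 2) * K := by rw [ht]

/-- The shift of k acts on the phase, on the potential and on the solution; after modulation the
last two effects are controlled by `profMod` and by the Lipschitz bound of the modulated solution.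
-/
lemma exists_tht_lip (H : IsNice u C) (hc : cNorm u < 1) (s : ℝ) {v : ℝ × ℝ → ℝ} (hv : Adm v)
    {σ : ℝ} (hσ : 1 < σ) (hσ' : σ ≤ 9 / 4) {K : ℝ≥0∞} (hK : K ≠ ∞) (hP : ∀ l, prof (ut v) l ≤ K * wt σ l)
    (hB : ∀ l, profMod (ut v) l ≤ K * wt σ l) :
    ∃ D : ℝ, 0 ≤ D ∧ ∀ k k' p, ‖tht (ut v) (mu s u k) k p - tht (ut v) (mu s u k') k' p‖ ≤
      D * |k - k'| * (1 + |p|) ^ (-σ) := by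
  obtain ⟨K0, hK0, hD⟩ := H.exists_modu_mu_sub_le hc s
  obtain ⟨K1, hK1, hm⟩ := H.exists_maj_le hc
  have mP := measurable_prof hv.slab.meas
  obtain ⟨K2, hK2, hcv⟩ := exists_cv_le_wt hσ hK hK1 hB (fun l => (hm l).trans (by gcongr; exact wt_anti (by linarith) l))
    (measurable_profMod hv.slab.meas) (measurable_maj H.meas)
  obtain ⟨K3, hK3, hcv'⟩ := exists_cv_le_wt (g := fun l => K0 * wt (9 / 4) l) hσ hK hK0 hP (fun l => by gcongr; exact wt_anti hσ' l)
    mP ((measurable_wt _).const_mul _)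
  have hK4 : 3 * K + K2 + K3 ≠ ∞ := by finiteness
  refine ⟨(3 * K + K2 + K3).toReal, ENNReal.toReal_nonneg, fun k k' p => ?_⟩
  obtain ⟨κ, rfl⟩ : ∃ κ, k = k' + κ := ⟨k - k', by ring⟩
  have d1 := H.dom_mu hc s k'
  have d2 := H.dom_mu hc s (k' + κ)
  have b := (tht_modu (ut v) _ _ k' κ p (hv.integrable_src d1 p) (hv.integrable_src d2 p)).trans
    (prof_modu_src_sub_le (ψ := fun l => ‖κ‖ₑ * (K0 * wt (9 / 4) l)) κ hv.slab d1 d2 (fun l y => hD k' κ l y) p)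
  have b2 : ‖tht (ut v) (mu s u (k' + κ)) (k' + κ) p - tht (ut v) (mu s u k') k' p‖ₑ ≤
      (‖κ‖ₑ * (3 * K + K2 + K3)) * wt σ p := by
    refine b.trans ?_
    rw [cv_const_mul_right enorm_ne_top]
    calc _ ≤ ‖κ‖ₑ * (3 * (K * wt σ p) + K2 * wt σ p) + ‖κ‖ₑ * (K3 * wt σ p) := by
          gcongr
          · exact sqrt_two_pi_le
          · exact hB p
          · exact hcv p
          · exact hcv' p
      _ = _ := by ring
  have := norm_le_of_enorm_le_wt (ENNReal.mul_ne_top enorm_ne_top hK4) b2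
  rw [ENNReal.toReal_mul, toReal_enorm, Real.norm_eq_abs] at this
  rw [add_sub_cancel_left]
  refine this.trans (le_of_eq (by ring))

/-- The oscillatory integrals attached to a nice potential satisfy `ThetaData`. -/
theorem exists_thetaData (H : IsNice u C) (hc : cNorm u < 1) (s : ℝ) : ∃ Θx Θy Θyy Θxy Θxx : ℝ → ℝ → ℂ, ∃ D,
    ThetaData (fun k p => tht (ut u) (mu s u k) k p) Θx Θy Θyy Θxy Θxx D := by
  obtain ⟨A0, Ax, Ay, Ayy, Axy, Axx⟩ := H.adm_all
  obtain ⟨K0, hK0, hA⟩ := H.exists_ut_wt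
  obtain ⟨K1, hK1, hX⟩ := H.exists_ut_fst_wt
  have one_le : ∀ y : ℝ, 1 ≤ ENNReal.ofReal (1 + y ^ 2) := fun y => by
    rw [ENNReal.one_le_ofReal]; nlinarith [sq_nonneg y]
  have ab_le : ∀ y : ℝ, ‖y‖ₑ ≤ ENNReal.ofReal (1 + y ^ 2) := fun y => by
    rw [← ofReal_norm]; exact ENNReal.ofReal_le_ofReal (abs_le_one_add_sq y)
  have sq_le : ∀ y : ℝ, ‖y‖ₑ * ‖y‖ₑ ≤ ENNReal.ofReal (1 + y ^ 2) := fun y => by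
    rw [← ofReal_norm, ← ENNReal.ofReal_mul (norm_nonneg _)]
    apply ENNReal.ofReal_le_ofReal
    rw [Real.norm_eq_abs, abs_mul_abs_self]; nlinarith
  have ey : ∀ (w : ℝ × ℝ → ℝ) (l y : ℝ), ‖ut (fun z => z.2 * w z) l y‖ₑ = ‖y‖ₑ * ‖ut w l y‖ₑ := fun w l y => by
    rw [ut_mul_snd, enorm_mul, ← ofReal_norm (y : ℂ), Complex.norm_real, ofReal_norm]
  have P0 : ∀ l, prof (ut u) l ≤ K0 * wt (13 / 4) l := fun l => (H.lintegral_ut_le l).trans (hA l)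
  have Px : ∀ l, prof (ut fun z => z.1 * u z) l ≤ K1 * wt (9 / 4) l := fun l =>
    (lintegral_mono fun y => le_mul_of_one_le_left' (one_le y)).trans (hX l)
  have Py : ∀ l, prof (ut fun z => z.2 * u z) l ≤ K0 * wt (13 / 4) l := fun l =>
    (lintegral_mono fun y => by rw [ey]; exact mul_le_mul' (ab_le y) le_rfl).trans (hA l)
  have Pyy : ∀ l, prof (ut fun z => z.2 * (z.2 * u z)) l ≤ K0 * wt (13 / 4) l := fun l =>
    (lintegral_mono fun y => by rw [ey (fun z => z.2 * u z), ey, ← mul_assoc]; exact mul_le_mul' (sq_le y) le_rfl).trans (hA l)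
  have B0 : ∀ l, profMod (ut u) l ≤ 2 * K0 * wt (9 / 4) l :=
    profMod_le_of_weight (W := ut u) (fun l y => mul_le_mul' (ab_le y) le_rfl) (by norm_num; exact hA)
  have By : ∀ l, profMod (ut fun z => z.2 * u z) l ≤ 2 * K0 * wt (9 / 4) l :=
    profMod_le_of_weight (W := ut u) (fun l y => by rw [ey, ← mul_assoc]; exact mul_le_mul' (sq_le y) le_rfl)
      (by norm_num; exact hA)
  have Bx : ∀ l, profMod (ut fun z => z.1 * u z) l ≤ 2 * K1 * wt (5 / 4) l :=
    profMod_le_of_weight (W := ut fun z => z.1 * u z) (fun l y => mul_le_mul' (ab_le y) le_rfl) (by norm_num; exact hX)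
  have le2 : ∀ (K : ℝ≥0∞), K ≤ 2 * K := fun K => le_mul_of_one_le_left' (by norm_num)
  obtain ⟨D1, hD1, dec0⟩ := H.exists_tht_le_wt hc s A0.slab.meas (by norm_num) le_rfl hK0 P0
  obtain ⟨D2, hD2, decy⟩ := H.exists_tht_le_wt hc s Ay.slab.meas (by norm_num) le_rfl hK0 Py
  obtain ⟨D3, hD3, decyy⟩ := H.exists_tht_le_wt hc s Ayy.slab.meas (by norm_num) le_rfl hK0 Pyy
  obtain ⟨D4, hD4, decx⟩ := H.exists_tht_le_wt hc s Ax.slab.meas (by norm_num) (by norm_num) hK1 Px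
  have bdd : ∀ {v : ℝ × ℝ → ℝ}, Adm v → ∃ D : ℝ, 0 ≤ D ∧ ∀ k p, ‖tht (ut v) (mu s u k) k p‖ ≤ D := by
    intro v hv
    refine ⟨∫ y, (3 + (∫⁻ l, maj u l).toReal) * nv v y, integral_nonneg fun y =>
      mul_nonneg (by positivity) (nv_nonneg v y), fun k p => ?_⟩
    refine norm_integral_le_of_norm_le (hv.integrable_nv.const_mul _) (Eventually.of_forall fun y => ?_)
    rw [norm_mul, norm_phs, one_mul]
    exact norm_src_le v (H.dom_mu hc s k) p y
  obtain ⟨D5, hD5, bxy⟩ := bdd Axy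
  obtain ⟨D6, hD6, bxx⟩ := bdd Axx
  obtain ⟨D7, hD7, osc0⟩ := H.exists_tht_le_osc hc s A0 (E := ENNReal.ofReal (8 * C)) ENNReal.ofReal_ne_top
    fun h h0 h1 i hi l => (H.fwdDiff_ut_le h0 h1 hi l).1
  obtain ⟨D8, hD8, oscx⟩ := H.exists_tht_le_osc hc s Ax (E := ENNReal.ofReal (8 * C)) ENNReal.ofReal_ne_top
    fun h h0 h1 i hi l => (H.fwdDiff_ut_le h0 h1 hi l).2.1
  obtain ⟨D9, hD9, oscy⟩ := H.exists_tht_le_osc hc s Ay (E := ENNReal.ofReal (8 * C)) ENNReal.ofReal_ne_top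
    fun h h0 h1 i hi l => (H.fwdDiff_ut_le h0 h1 hi l).2.2
  obtain ⟨D10, hD10, lip0⟩ := H.exists_tht_lip hc s A0 (σ := 9 / 4) (by norm_num) le_rfl (K := 2 * K0) (by finiteness)
    (fun l => (P0 l).trans (mul_le_mul' (le2 _) (wt_anti (by norm_num) l))) B0
  obtain ⟨D11, hD11, lipy⟩ := H.exists_tht_lip hc s Ay (σ := 9 / 4) (by norm_num) le_rfl (K := 2 * K0) (by finiteness)
    (fun l => (Py l).trans (mul_le_mul' (le2 _) (wt_anti (by norm_num) l))) By
  obtain ⟨D12, hD12, lipx⟩ := H.exists_tht_lip hc s Ax (σ := 5 / 4) (by norm_num) (by norm_num) (K := 2 * K1) (by finiteness)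
    (fun l => (Px l).trans (mul_le_mul' (le2 _) (wt_anti (by norm_num) l))) Bx
  have mm := H.measurable_mu hc s
  have up : ∀ {X W d D : ℝ}, 0 ≤ W → d ≤ D → X ≤ d * W → X ≤ D * W := fun hW hd hX =>
    hX.trans (mul_le_mul_of_nonneg_right hd hW)
  have exy : (fun z : ℝ × ℝ => z.2 * (z.1 * u z)) = fun z => z.1 * (z.2 * u z) := by ext z; ring
  have w0 : ∀ (p s : ℝ), 0 ≤ (1 + |p|) ^ s := fun p s => by have := abs_nonneg p; positivity
  have w1 : ∀ r : ℝ, 0 ≤ (1 + r ^ 2)⁻¹ := fun r => by positivity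
  have upl : ∀ {X W d D a : ℝ}, 0 ≤ W → 0 ≤ a → d ≤ D → X ≤ d * a * W → X ≤ D * a * W := fun hW ha hd hX =>
    hX.trans (by gcongr)
  refine ⟨fun k p => tht (ut fun z => z.1 * u z) (mu s u k) k p, fun k p => tht (ut fun z => z.2 * u z) (mu s u k) k p,
    fun k p => tht (ut fun z => z.2 * (z.2 * u z)) (mu s u k) k p, fun k p => tht (ut fun z => z.1 * (z.2 * u z)) (mu s u k) k p,
    fun k p => tht (ut fun z => z.1 * (z.1 * u z)) (mu s u k) k p,
    D1 + D2 + D3 + D4 + D5 + D6 + D7 + D8 + D9 + D10 + D11 + D12, ?_⟩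
  exact {
    C_nonneg := by positivity
    meas := measurable_tht A0.slab.meas mm
    meas_x := measurable_tht Ax.slab.meas mm
    meas_y := measurable_tht Ay.slab.meas mm
    deriv := fun k p => hasDerivAt_tht A0 Ax Ay (H.dom_mu hc s k) k p
    deriv_x := fun k p => by
      have := hasDerivAt_tht Ax Axx (by rw [exy]; exact Axy) (H.dom_mu hc s k) k p
      rwa [exy] at this
    deriv_y := fun k p => hasDerivAt_tht Ay Axy Ayy (H.dom_mu hc s k) k p
    dec := fun k p => up (w0 _ _) (by linarith) (dec0 k p)
    dec_y := fun k p => up (w0 _ _) (by linarith) (decy k p)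
    dec_yy := fun k p => up (w0 _ _) (by linarith) (decyy k p)
    dec_x := fun k p => up (w0 _ _) (by linarith) (decx k p)
    bdd_xy := fun k p => (bxy k p).trans (by linarith)
    bdd_xx := fun k p => (bxx k p).trans (by linarith)
    osc := fun k p => up (w1 _) (by linarith) (osc0 k p)
    osc_x := fun k p => up (w1 _) (by linarith) (oscx k p)
    osc_y := fun k p => up (w1 _) (by linarith) (oscy k p)
    lip := fun k k' p => upl (w0 _ _) (abs_nonneg _) (by linarith) (lip0 k k' p)
    lip_y := fun k k' p => upl (w0 _ _) (abs_nonneg _) (by linarith) (lipy k k' p)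
    lip_x := fun k k' p => upl (w0 _ _) (abs_nonneg _) (by linarith) (lipx k k' p) }

lemma scatT_mu (s k l : ℝ) (u : ℝ × ℝ → ℝ) : scatT s u (mu s u) k l = if 0 < s * (l - k) then
    -Complex.I * ((1 / (2 * Real.pi) : ℝ) : ℂ) * tht (ut u) (mu s u k) k (l - k) else 0 := by
  unfold scatT tht phs
  congr 2
  refine integral_congr_ae (Eventually.of_forall fun y => ?_)
  dsimp only
  congr 2
  push_cast; ring

end IsNice

/-! ### Square-integrability of the Neumann series. -/

open scoped FourierTransform SchwartzMap in
/-- On `L¹ ∩ L²` the `L²` Fourier transform is given by the Fourier integral. -/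
lemma fourier_toLp_ae_eq {f : ℝ → ℂ} (h1 : Integrable f) (h2 : MemLp f 2 volume) :
    ((𝓕 (h2.toLp f) : Lp ℂ 2 (volume : Measure ℝ)) : ℝ → ℂ) =ᵐ[volume] 𝓕 f := by
  have hc : Continuous (𝓕 f) := VectorFourier.fourierIntegral_continuous Real.continuous_fourierChar continuous_inner h1
  refine ae_eq_of_integral_contDiff_smul_eq ((Lp.memLp _).locallyIntegrable (by norm_num)) hc.locallyIntegrable
    fun g hg hgc => ?_
  set φ : 𝓢(ℝ, ℂ) := HasCompactSupport.toSchwartzMap (f := fun x => (g x : ℂ))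
    (hgc.comp_left (g := fun x : ℝ => (x : ℂ)) (by simp)) (Complex.ofRealCLM.contDiff.comp hg) with hφ
  -- The two transforms are compared as distributions: the L² transform is moved to the test
  -- function by duality, and the Fourier integral by Fubini.
  have e := congrArg (fun T => T φ) (Lp.fourier_toTemperedDistribution_eq (h2.toLp f))
  simp only [TemperedDistribution.fourier_apply, Lp.toTemperedDistribution_apply] at e
  have e1 : ∫ x, (𝓕 φ) x • (h2.toLp f) x = ∫ x, (𝓕 φ) x • f x := by
    refine integral_congr_ae ?_
    filter_upwards [h2.coeFn_toLp] with x hx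
    rw [hx]
  have e2 : ∫ x, (𝓕 φ) x • f x = ∫ x, φ x • 𝓕 f x := by
    simpa using! (VectorFourier.integral_fourierIntegral_smul_eq_flip (L := innerₗ ℝ)
      Real.continuous_fourierChar continuous_inner φ.integrable h1)
  rw [e1, e2] at e
  have hs : ∀ x (z : ℂ), φ x • z = g x • z := fun x z => by
    show ((g x : ℝ) : ℂ) • z = _
    rw [Complex.real_smul, smul_eq_mul]
  simp only [hs] at e
  exact e.symm

lemma eLpNorm_two_sq {α : Type*} [MeasurableSpace α] (μ : Measure α) (f : α → ℂ) :
    eLpNorm f 2 μ ^ 2 = ∫⁻ x, ‖f x‖ₑ ^ 2 ∂μ := by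
  have := eLpNorm_nnreal_pow_eq_lintegral (p := 2) (μ := μ) (f := f) (by norm_num)
  simpa using this

open scoped FourierTransform in
/-- Plancherel for an integrable function, as an inequality in `[0, ∞]`. -/
lemma lintegral_sq_fourier_le {f : ℝ → ℂ} (h1 : Integrable f) :
    ∫⁻ κ : ℝ, ‖∫ η : ℝ, Complex.exp (Complex.I * κ * η) * f η‖ₑ ^ 2 ≤
      ENNReal.ofReal (2 * Real.pi) * ∫⁻ η, ‖f η‖ₑ ^ 2 := by
  have hpi := Real.pi_pos
  by_cases h2 : MemLp f 2 volume
  · have e1 : ∫⁻ w, ‖𝓕 f w‖ₑ ^ 2 = ∫⁻ η, ‖f η‖ₑ ^ 2 := by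
      rw [← eLpNorm_two_sq, ← eLpNorm_two_sq, ← eLpNorm_congr_ae (fourier_toLp_ae_eq h1 h2), ← eLpNorm_congr_ae h2.coeFn_toLp,
        ← Lp.enorm_def, ← Lp.enorm_def, ← ofReal_norm, ← ofReal_norm, Lp.norm_fourier_eq]
    have e2 : ∀ κ : ℝ, ∫ η : ℝ, Complex.exp (Complex.I * κ * η) * f η = 𝓕 f (-(1 / (2 * Real.pi)) * κ + 0) := fun κ => by
      rw [Real.fourier_real_eq_integral_exp_smul]
      refine integral_congr_ae (Eventually.of_forall fun η => ?_)
      dsimp only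
      rw [smul_eq_mul]
      congr 2
      push_cast
      have : (Real.pi : ℂ) ≠ 0 := by exact_mod_cast hpi.ne'
      field_simp
      ring
    have hc : Continuous (𝓕 f) := VectorFourier.fourierIntegral_continuous Real.continuous_fourierChar continuous_inner h1
    have e3 := ThetaData.lintegral_comp_affine (f := fun w => ‖𝓕 f w‖ₑ ^ 2) (by fun_prop) (a := -(1 / (2 * Real.pi)))
      (by rw [neg_ne_zero]; positivity) 0
    simp only [e2]
    rw [← e1, ← e3, ← mul_assoc, ← ENNReal.ofReal_mul (by positivity), abs_neg, abs_of_pos (by positivity),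
      mul_one_div_cancel (by positivity), ENNReal.ofReal_one, one_mul]
  -- An integrable f outside L² makes the right side infinite.
  · have : ∫⁻ η, ‖f η‖ₑ ^ 2 = ∞ := by
      by_contra h
      refine h2 ⟨h1.1, ?_⟩
      rw [← eLpNorm_two_sq] at h
      exact lt_top_iff_ne_top.2 fun h' => h (by rw [h']; rfl)
    rw [this, ENNReal.mul_top (by rw [Ne, ENNReal.ofReal_eq_zero, not_le]; positivity)]
    exact le_top

/-- Cauchy–Schwarz with a weight. -/
lemma sq_lintegral_mul_le {α : Type*} [MeasurableSpace α] {μ : Measure α} {w g : α → ℝ≥0∞} (hw : AEMeasurable w μ)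
    (hg : AEMeasurable g μ) : (∫⁻ x, w x * g x ∂μ) ^ 2 ≤ (∫⁻ x, w x ∂μ) * ∫⁻ x, w x * g x ^ 2 ∂μ := by
  have hh : (2 : ℝ).HolderConjugate 2 := Real.HolderConjugate.two_two
  have hr : AEMeasurable (fun x => w x ^ (1 / 2 : ℝ)) μ := hw.pow_const _
  have h := ENNReal.lintegral_mul_le_Lp_mul_Lq μ hh hr (hr.mul hg)
  have e0 : ∀ a : ℝ≥0∞, a ^ (1 / 2 : ℝ) * a ^ (1 / 2 : ℝ) = a := fun a => by
    rw [← ENNReal.rpow_add_of_nonneg _ _ (by norm_num) (by norm_num)]; norm_num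
  have e1 : ∀ a : ℝ≥0∞, (a ^ (1 / 2 : ℝ)) ^ (2 : ℝ) = a := fun a => by
    rw [← ENNReal.rpow_mul]; norm_num
  have e2 : ∀ a : ℝ≥0∞, (a ^ (1 / 2 : ℝ)) ^ 2 = a := fun a => by rw [sq, e0]
  simp only [Pi.mul_apply, ← mul_assoc, e0, ENNReal.mul_rpow_of_nonneg _ _ (by norm_num : (0 : ℝ) ≤ 2), e1] at h
  calc (∫⁻ x, w x * g x ∂μ) ^ 2 ≤ ((∫⁻ x, w x ∂μ) ^ (1 / 2 : ℝ) * (∫⁻ x, w x * g x ^ (2 : ℝ) ∂μ) ^ (1 / 2 : ℝ)) ^ 2 := by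
        gcongr
    _ = _ := by
        rw [mul_pow, e2, e2]
        simp

/-- `l`-mass of the potential at height `y`. -/
def mass (u : ℝ × ℝ → ℝ) (y : ℝ) : ℝ≥0∞ := ∫⁻ l, ‖ut u l y‖ₑ

lemma measurable_mass {u : ℝ × ℝ → ℝ} (hu : Measurable u) : Measurable (mass u) := by
  unfold mass
  exact Measurable.lintegral_prod_right' (f := fun z : ℝ × ℝ => ‖ut u z.2 z.1‖ₑ)
    ((measurable_ut hu).comp (measurable_swap (α := ℝ) (β := ℝ))).enorm

lemma c1_mul_lintegral_mass {u : ℝ × ℝ → ℝ} (hu : Measurable u) : c1 * ∫⁻ y, mass u y = cNorm u := by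
  rw [← lintegral_ker hu]
  unfold ker mass prof
  rw [lintegral_const_mul' _ _ c1_ne_top, lintegral_lintegral_swap]
  exact ((measurable_ut hu).comp (measurable_swap (α := ℝ) (β := ℝ))).enorm.aemeasurable

/-- The majorant of the scattering operator at a single `l`. -/
def bulk (u : ℝ × ℝ → ℝ) (g : ℝ → ℝ → ℝ≥0∞) (l : ℝ) : ℝ≥0∞ := ∫⁻ η, ∫⁻ l', ‖ut u (l - l') η‖ₑ * g l' η

lemma measurable_ut_sub {u : ℝ × ℝ → ℝ} (hu : Measurable u) :
    Measurable fun z : ℝ × ℝ × ℝ => ut u (z.1 - z.2.2) z.2.1 := by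
  have h1 := measurable_ut hu
  have h2 : Measurable fun z : ℝ × ℝ × ℝ => (z.1 - z.2.2, z.2.1) := by fun_prop
  have h3 := h1.comp h2
  simpa only [Function.comp_def] using h3

/-- Cauchy–Schwarz with respect to |ũ(l - l';η)| dl' dη, whose total mass does not depend on l;
integrating in l afterwards turns the remaining weight into `mass u η`. -/
lemma lintegral_sq_bulk_le {u : ℝ × ℝ → ℝ} (hu : Measurable u) {g : ℝ → ℝ → ℝ≥0∞}
    (hg : Measurable fun z : ℝ × ℝ => g z.1 z.2) :
    ∫⁻ l, bulk u g l ^ 2 ≤ (∫⁻ y, mass u y) * ∫⁻ η, mass u η * ∫⁻ l', g l' η ^ 2 := by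
  have m3 : Measurable fun z : ℝ × ℝ × ℝ => ‖ut u (z.1 - z.2.2) z.2.1‖ₑ := (measurable_ut_sub hu).enorm
  have mg3 : Measurable fun z : ℝ × ℝ × ℝ => g z.2.2 z.2.1 := hg.comp (by fun_prop : Measurable fun z : ℝ × ℝ × ℝ => (z.2.2, z.2.1))
  have sl : ∀ {F : ℝ × ℝ × ℝ → ℝ≥0∞}, Measurable F → ∀ l, Measurable fun p : ℝ × ℝ => F (l, p) := fun hF l =>
    hF.comp (by fun_prop : Measurable fun p : ℝ × ℝ => (l, p))
  have e1 : ∀ l, bulk u g l = ∫⁻ p : ℝ × ℝ, ‖ut u (l - p.2) p.1‖ₑ * g p.2 p.1 := fun l => by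
    have h : AEMeasurable (fun p : ℝ × ℝ => ‖ut u (l - p.2) p.1‖ₑ * g p.2 p.1) (volume.prod volume) :=
      ((sl m3 l).mul (sl mg3 l)).aemeasurable
    rw [Measure.volume_eq_prod, lintegral_prod _ h]
    rfl
  have e2 : ∀ l, ∫⁻ p : ℝ × ℝ, ‖ut u (l - p.2) p.1‖ₑ = ∫⁻ y, mass u y := fun l => by
    rw [Measure.volume_eq_prod, lintegral_prod _ (sl m3 l).aemeasurable]
    refine lintegral_congr fun y => ?_
    exact lintegral_sub_left_eq_self (fun l' => ‖ut u l' y‖ₑ) l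
  calc ∫⁻ l, bulk u g l ^ 2 ≤ ∫⁻ l, (∫⁻ y, mass u y) * ∫⁻ p : ℝ × ℝ, ‖ut u (l - p.2) p.1‖ₑ * g p.2 p.1 ^ 2 := by
        refine lintegral_mono fun l => ?_
        dsimp only
        rw [e1, ← e2 l]
        exact sq_lintegral_mul_le (sl m3 l).aemeasurable (sl mg3 l).aemeasurable
    _ = (∫⁻ y, mass u y) * ∫⁻ l, ∫⁻ p : ℝ × ℝ, ‖ut u (l - p.2) p.1‖ₑ * g p.2 p.1 ^ 2 := by
        rw [lintegral_const_mul]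
        exact (m3.mul (mg3.pow_const 2)).lintegral_prod_right'
    _ = (∫⁻ y, mass u y) * ∫⁻ p : ℝ × ℝ, ∫⁻ l, ‖ut u (l - p.2) p.1‖ₑ * g p.2 p.1 ^ 2 := by
        rw [lintegral_lintegral_swap]
        exact (m3.mul (mg3.pow_const 2)).aemeasurable
    _ = (∫⁻ y, mass u y) * ∫⁻ p : ℝ × ℝ, mass u p.1 * g p.2 p.1 ^ 2 := by
        congr 1
        refine lintegral_congr fun p => ?_
        have h1 : Measurable fun l => ‖ut u l p.1‖ₑ := (measurable_slice_right (measurable_ut hu) p.1).enorm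
        have h2 : Measurable fun l => ‖ut u (l - p.2) p.1‖ₑ := h1.comp (measurable_sub_const p.2)
        rw [lintegral_mul_const _ h2]
        congr 1
        exact lintegral_sub_right_eq_self (fun l => ‖ut u l p.1‖ₑ) p.2
    _ = _ := by
        have mm := measurable_mass hu
        rw [Measure.volume_eq_prod, lintegral_prod]
        · congr 1
          refine lintegral_congr fun η => ?_
          dsimp only
          rw [lintegral_const_mul]
          have := hg.comp (by fun_prop : Measurable fun l' : ℝ => (l', η))
          exact this.pow_const 2
        · have := hg.comp (by fun_prop : Measurable fun p : ℝ × ℝ => (p.2, p.1))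
          exact ((mm.comp measurable_fst).mul (this.pow_const 2)).aemeasurable

lemma prof_cnv_le_bulk (u : ℝ × ℝ → ℝ) (m : ℝ → ℝ → ℂ) (l : ℝ) :
    prof (cnv (ut u) m) l ≤ bulk u (fun l y => ‖m l y‖ₑ) l :=
  lintegral_mono fun y => (enorm_integral_le_lintegral_enorm _).trans (le_of_eq (lintegral_congr fun l' => enorm_mul _ _))

lemma measurable_enorm_section {m : ℝ → ℝ → ℝ → ℂ} (hm : Measurable fun z : ℝ × ℝ × ℝ => m z.1 z.2.1 z.2.2) (k : ℝ) :
    Measurable fun z : ℝ × ℝ => ‖m k z.1 z.2‖ₑ := (measurable_section hm k).enorm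

/-- The contraction estimate in `L^∞_y L²_{k,l}` for the terms of the Neumann series. -/
lemma lintegral_sq_ser_le (s : ℝ) {u : ℝ × ℝ → ℝ} (hu : Measurable u) {B : ℝ≥0∞}
    (h0 : ∀ y, ∫⁻ k, ∫⁻ l, ‖ser s u 0 k l y‖ₑ ^ 2 ≤ B) (N : ℕ) (y : ℝ) :
    ∫⁻ k, ∫⁻ l, ‖ser s u N k l y‖ₑ ^ 2 ≤ (cNorm u ^ N) ^ 2 * B := by
  induction N generalizing y with
  | zero => simpa using h0 y
  | succ N ih =>
    have mN := measurable_ser s hu N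
    have mm := measurable_mass hu
    have mX : Measurable fun z : ℝ × ℝ => ∫⁻ l, ‖ser s u N z.1 l z.2‖ₑ ^ 2 := by
      refine Measurable.lintegral_prod_right' (f := fun z : (ℝ × ℝ) × ℝ => ‖ser s u N z.1.1 z.2 z.1.2‖ₑ ^ 2) ?_
      exact (mN.comp (by fun_prop : Measurable fun z : (ℝ × ℝ) × ℝ => (z.1.1, z.2, z.1.2))).enorm.pow_const 2
    calc ∫⁻ k, ∫⁻ l, ‖ser s u (N + 1) k l y‖ₑ ^ 2
        ≤ ∫⁻ k, c1 ^ 2 * ((∫⁻ y, mass u y) * ∫⁻ η, mass u η * ∫⁻ l', ‖ser s u N k l' η‖ₑ ^ 2) := by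
          refine lintegral_mono fun k => ?_
          calc ∫⁻ l, ‖ser s u (N + 1) k l y‖ₑ ^ 2
              ≤ ∫⁻ l, c1 ^ 2 * bulk u (fun l y => ‖ser s u N k l y‖ₑ) l ^ 2 := by
                refine lintegral_mono fun l => ?_
                rw [← mul_pow]
                exact pow_le_pow_left' ((enorm_gop_le s k _ l y).trans (mul_le_mul' le_rfl (prof_cnv_le_bulk u _ l))) 2
            _ = c1 ^ 2 * ∫⁻ l, bulk u (fun l y => ‖ser s u N k l y‖ₑ) l ^ 2 :=
                lintegral_const_mul' _ _ (by have := c1_ne_top; finiteness)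
            _ ≤ _ := mul_le_mul' le_rfl (lintegral_sq_bulk_le hu (measurable_enorm_section mN k))
      _ = c1 ^ 2 * ((∫⁻ y, mass u y) * ∫⁻ k, ∫⁻ η, mass u η * ∫⁻ l', ‖ser s u N k l' η‖ₑ ^ 2) := by
          have m2 : Measurable fun z : ℝ × ℝ => mass u z.2 * ∫⁻ l, ‖ser s u N z.1 l z.2‖ₑ ^ 2 :=
            (mm.comp measurable_snd).mul mX
          have m3 : Measurable fun k => ∫⁻ η, mass u η * ∫⁻ l', ‖ser s u N k l' η‖ₑ ^ 2 := m2.lintegral_prod_right'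
          rw [lintegral_const_mul _ (m3.const_mul _), lintegral_const_mul _ m3]
      _ = c1 ^ 2 * ((∫⁻ y, mass u y) * ∫⁻ η, ∫⁻ k, mass u η * ∫⁻ l', ‖ser s u N k l' η‖ₑ ^ 2) := by
          rw [lintegral_lintegral_swap]
          exact ((mm.comp measurable_snd).mul mX).aemeasurable
      _ ≤ c1 ^ 2 * ((∫⁻ y, mass u y) * ∫⁻ η, mass u η * ((cNorm u ^ N) ^ 2 * B)) := by
          gcongr with η
          rw [lintegral_const_mul]
          · gcongr; exact ih η
          · exact mX.comp (by fun_prop : Measurable fun k : ℝ => (k, η))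
      _ = (c1 * ∫⁻ y, mass u y) ^ 2 * ((cNorm u ^ N) ^ 2 * B) := by
          rw [lintegral_mul_const _ mm]; ring
      _ = (cNorm u ^ (N + 1)) ^ 2 * B := by
          rw [c1_mul_lintegral_mass hu]; ring

/-- The domain of integration depends on s, l and y only, not on the integrand and so not on k; in
the degenerate case sl = 0 it is empty. -/
lemma exists_enorm_dirInt_le (s l y : ℝ) : ∃ S : Set ℝ, MeasurableSet S ∧ ∀ g : ℝ → ℂ, ‖dirInt s l y g‖ₑ ≤ ‖∫ η, S.indicator g η‖ₑ := by
  by_cases h1 : 0 < s * l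
  · refine ⟨Ioi y, measurableSet_Ioi, fun g => ?_⟩
    rw [dirInt, if_pos h1, enorm_neg, integral_indicator measurableSet_Ioi]
  · by_cases h2 : s * l < 0
    · refine ⟨Iic y, measurableSet_Iic, fun g => ?_⟩
      rw [dirInt, if_neg h1, if_pos h2, integral_indicator measurableSet_Iic]
    · refine ⟨∅, MeasurableSet.empty, fun g => ?_⟩
      rw [dirInt, if_neg h1, if_neg h2]
      simp

/-- Smoothing of the scattering operator in `k`. -/
lemma lintegral_sq_gop_le (s : ℝ) {F : ℝ → ℝ → ℂ} {l : ℝ} (hF : Integrable (F l)) (hl : l ≠ 0) (y : ℝ) :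
    ENNReal.ofReal |2 * l| * ∫⁻ k, ‖gop s k F l y‖ₑ ^ 2 ≤ ENNReal.ofReal (2 * Real.pi) * ∫⁻ η, ‖F l η‖ₑ ^ 2 := by
  obtain ⟨S, mS, hS⟩ := exists_enorm_dirInt_le s l y
  -- Up to a unimodular factor in y the kernel is e^{il²η} e^{2ilkη}. So the operator is, as a
  -- function of k, a Fourier transform of G at frequency 2lk, and Plancherel applies with Jacobian
  -- 2|l|.
  set G : ℝ → ℂ := S.indicator fun η => Complex.exp (Complex.I * l ^ 2 * η) * F l η with hG
  have iG : Integrable G := by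
    refine Integrable.indicator ?_ mS
    refine hF.bdd_mul (c := 1) (Continuous.aestronglyMeasurable (by fun_prop)) (Eventually.of_forall fun η => ?_)
    rw [Complex.norm_exp]
    simp [← Complex.ofReal_pow]
  set J : ℝ → ℂ := fun κ => ∫ η : ℝ, Complex.exp (Complex.I * κ * η) * G η with hJ
  have hcJ : Continuous J := by
    refine continuous_of_dominated (bound := fun η => ‖G η‖) (fun κ => ?_) (fun κ => Eventually.of_forall fun η => ?_) iG.norm
      (Eventually.of_forall fun η => by fun_prop)
    · exact (Continuous.aestronglyMeasurable (by fun_prop)).mul iG.1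
    · rw [norm_mul, Complex.norm_exp]; simp
  have key : ∀ k, ‖gop s k F l y‖ₑ ≤ ‖J (2 * l * k + 0)‖ₑ := fun k => by
    unfold gop
    rw [enorm_mul]
    have hc : ‖Complex.I * ((1 / Real.sqrt (2 * Real.pi) : ℝ) : ℂ)‖ₑ ≤ 1 := by
      rw [← ofReal_norm, norm_mul, Complex.norm_I, one_mul, Complex.norm_real, Real.norm_of_nonneg (by positivity)]
      exact ENNReal.ofReal_le_one.2 inv_sqrt_two_pi_le_one
    refine (mul_le_of_le_one_left' hc).trans ((hS _).trans (le_of_eq ?_))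
    have e : ∀ η, S.indicator (fun η : ℝ => Complex.exp (-Complex.I * l * (l + 2 * k) * (y - η)) * F l η) η =
        Complex.exp (-Complex.I * l * (l + 2 * k) * y) * (Complex.exp (Complex.I * (2 * l * k + 0 : ℝ) * η) * G η) := fun η => by
      by_cases hη : η ∈ S
      · rw [hG, indicator_of_mem hη, indicator_of_mem hη, ← mul_assoc, ← mul_assoc, ← Complex.exp_add, ← Complex.exp_add]
        congr 2; push_cast; ring
      · rw [hG, indicator_of_notMem hη, indicator_of_notMem hη]; ring
    simp only [e]
    rw [integral_const_mul, enorm_mul]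
    have h1 : ‖Complex.exp (-Complex.I * l * (l + 2 * k) * y)‖ₑ = 1 := by
      simpa using enorm_cexp_phase l k y 0
    rw [h1, one_mul]
  calc ENNReal.ofReal |2 * l| * ∫⁻ k, ‖gop s k F l y‖ₑ ^ 2
      ≤ ENNReal.ofReal |2 * l| * ∫⁻ k, ‖J (2 * l * k + 0)‖ₑ ^ 2 := by
        gcongr with k; exact key k
    _ = ∫⁻ κ, ‖J κ‖ₑ ^ 2 := ThetaData.lintegral_comp_affine (f := fun κ => ‖J κ‖ₑ ^ 2) (by fun_prop) (by simpa using hl) 0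
    _ ≤ ENNReal.ofReal (2 * Real.pi) * ∫⁻ η, ‖G η‖ₑ ^ 2 := lintegral_sq_fourier_le iG
    _ ≤ _ := by
        gcongr with η
        rw [hG]
        refine (enorm_indicator_le_enorm_self _ _).trans (le_of_eq ?_)
        rw [enorm_mul, ← ofReal_norm, Complex.norm_exp]
        simp [← Complex.ofReal_pow]

lemma gop_zero_left (s k : ℝ) (F : ℝ → ℝ → ℂ) (y : ℝ) : gop s k F 0 y = 0 := by
  simp [gop, dirInt]

/-- The first term of the Neumann series in `L^∞_y L²_{k,l}`. -/
lemma lintegral_sq_ser_zero_le (s : ℝ) {u : ℝ × ℝ → ℝ} (hu : Measurable u) (hp : ∀ l, prof (ut u) l ≠ ∞) (y : ℝ) :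
    ∫⁻ k, ∫⁻ l, ‖ser s u 0 k l y‖ₑ ^ 2 ≤ ENNReal.ofReal (2 * Real.pi) ^ 2 * normInv u ^ 2 := by
  have hpi := Real.pi_pos
  have mu := measurable_ut hu
  have hs2 : ‖(Real.sqrt (2 * Real.pi) : ℂ)‖ₑ ^ 2 = ENNReal.ofReal (2 * Real.pi) := by
    rw [← ofReal_norm, Complex.norm_real, Real.norm_of_nonneg (by positivity), ← ENNReal.ofReal_pow (by positivity),
      Real.sq_sqrt (by positivity)]
  have e0 : normInv u ^ 2 = ∫⁻ l, ∫⁻ η, ‖ut u l η‖ₑ ^ 2 / ‖l‖ₑ := by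
    unfold normInv
    rw [← ENNReal.rpow_natCast, ← ENNReal.rpow_mul, Measure.volume_eq_prod, lintegral_prod]
    · norm_num
    · exact ((mu.enorm.pow_const 2).div (measurable_fst.enorm)).aemeasurable
  have h1 : ∀ l, ∫⁻ k, ‖ser s u 0 k l y‖ₑ ^ 2 ≤ ENNReal.ofReal (2 * Real.pi) ^ 2 * ∫⁻ η, ‖ut u l η‖ₑ ^ 2 / ‖l‖ₑ := fun l => by
    by_cases hl : l = 0
    · subst hl
      have : ∀ k, ser s u 0 k 0 y = 0 := fun k => gop_zero_left s k (fun l y => (Real.sqrt (2 * Real.pi) : ℂ) * ut u l y) y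
      simp [this]
    · have hi : Integrable (fun η => (Real.sqrt (2 * Real.pi) : ℂ) * ut u l η) := (integrable_of_prof mu (hp l)).const_mul _
      have h := lintegral_sq_gop_le s (F := fun l η => (Real.sqrt (2 * Real.pi) : ℂ) * ut u l η) hi hl y
      simp only [enorm_mul, mul_pow, hs2] at h
      have hl0 : ‖l‖ₑ ≠ 0 := by simpa using hl
      have h2 : ‖l‖ₑ * ∫⁻ k, ‖ser s u 0 k l y‖ₑ ^ 2 ≤ ENNReal.ofReal (2 * Real.pi) ^ 2 * ∫⁻ η, ‖ut u l η‖ₑ ^ 2 := by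
        rw [lintegral_const_mul' _ _ ENNReal.ofReal_ne_top, ← mul_assoc, ← sq] at h
        refine le_trans (mul_le_mul' ?_ le_rfl) h
        rw [← ofReal_norm, Real.norm_eq_abs, abs_mul]
        apply ENNReal.ofReal_le_ofReal
        rw [abs_two]; linarith [abs_nonneg l]
      simp only [div_eq_mul_inv]
      rw [lintegral_mul_const' _ _ (by simpa using hl), ← mul_assoc, ← div_eq_mul_inv, ENNReal.le_div_iff_mul_le (Or.inl hl0) (Or.inl enorm_ne_top), mul_comm]
      exact h2
  have m0 := measurable_ser s hu 0
  have m1 : AEMeasurable (Function.uncurry fun k l => ‖ser s u 0 k l y‖ₑ ^ 2) (volume.prod volume) := by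
    have h1 : Measurable fun z : ℝ × ℝ => (z.1, z.2, y) := by fun_prop
    exact ((m0.comp h1).enorm.pow_const 2).aemeasurable
  rw [lintegral_lintegral_swap m1, e0, ← lintegral_const_mul' _ _ (by finiteness)]
  exact lintegral_mono h1

/-- Summation in `L²` of a geometrically decreasing series. -/
lemma lintegral_sq_tsum_le {α : Type*} [MeasurableSpace α] {μ : Measure α} {f : ℕ → α → ℝ≥0∞} (hf : ∀ N, Measurable (f N))
    {r B : ℝ≥0∞} (hr0 : r ≠ 0) (hr : r < 1) (h : ∀ N, ∫⁻ x, f N x ^ 2 ∂μ ≤ (r ^ N) ^ 2 * B) :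
    ∫⁻ x, (∑' N, f N x) ^ 2 ∂μ ≤ (1 - r)⁻¹ * ((1 - r)⁻¹ * B) := by
  have hrt : r ≠ ∞ := hr.ne_top
  have e : ∀ N : ℕ, r ^ N * r⁻¹ ^ N = 1 := fun N => by rw [← mul_pow, ENNReal.mul_inv_cancel hr0 hrt, one_pow]
  -- Cauchy–Schwarz on the counting measure with weights r^N; the quotients r^(-N) f_N are bounded
  -- in L² uniformly in N.
  have cs : ∀ x, (∑' N, f N x) ^ 2 ≤ (1 - r)⁻¹ * ∑' N, r ^ N * (r⁻¹ ^ N * f N x) ^ 2 := fun x => by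
    have := sq_lintegral_mul_le (μ := Measure.count) (w := fun N : ℕ => r ^ N) (g := fun N => r⁻¹ ^ N * f N x)
      (measurable_from_nat.aemeasurable) (measurable_from_nat.aemeasurable)
    simp only [lintegral_count, ← mul_assoc, e, one_mul, ENNReal.tsum_geometric] at this
    simpa only [mul_assoc] using this
  calc ∫⁻ x, (∑' N, f N x) ^ 2 ∂μ ≤ ∫⁻ x, (1 - r)⁻¹ * ∑' N, r ^ N * (r⁻¹ ^ N * f N x) ^ 2 ∂μ := lintegral_mono cs
    _ = (1 - r)⁻¹ * ∑' N, ∫⁻ x, r ^ N * (r⁻¹ ^ N * f N x) ^ 2 ∂μ := by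
        rw [lintegral_const_mul' _ _ (ENNReal.inv_ne_top.2 (tsub_pos_of_lt hr).ne'), lintegral_tsum]
        intro N
        exact (((hf N).const_mul _).pow_const 2 |>.const_mul _).aemeasurable
    _ ≤ (1 - r)⁻¹ * ∑' N, r ^ N * B := by
        gcongr with N
        have hfin : r⁻¹ ^ N ≠ ∞ := by have := ENNReal.inv_ne_top.2 hr0; finiteness
        simp only [mul_pow]
        rw [lintegral_const_mul' _ _ (by finiteness), lintegral_const_mul' _ _ (by finiteness)]
        calc r ^ N * ((r⁻¹ ^ N) ^ 2 * ∫⁻ x, f N x ^ 2 ∂μ) ≤ r ^ N * ((r⁻¹ ^ N) ^ 2 * ((r ^ N) ^ 2 * B)) := by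
              gcongr; exact h N
          _ = r ^ N * ((r ^ N * r⁻¹ ^ N) ^ 2 * B) := by ring
          _ = r ^ N * B := by rw [e]; ring
    _ = _ := by rw [ENNReal.tsum_mul_right, ENNReal.tsum_geometric]

/-- The bound in L²(dk dl) sums the geometric L² estimates of the terms; the bound in L²(dl) follows
from the pointwise majorant, which is both bounded and integrable in l. -/
lemma IsNice.isScatteringSolution_mu {u : ℝ × ℝ → ℝ} {C : ℝ} (H : IsNice u C) (hc : cNorm u < 1) (hn : normInv u ≠ ∞) (s : ℝ) :
    IsScatteringSolution s u (mu s u) := by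
  have hm := H.measurable_mu hc s
  refine ⟨⟨hm.aestronglyMeasurable, ?_⟩, ⟨hm.aestronglyMeasurable, ?_⟩, Eventually.of_forall fun z => H.mu_eq hc s _ _ _⟩
  · set B : ℝ≥0∞ := ENNReal.ofReal (2 * Real.pi) ^ 2 * normInv u ^ 2 with hB
    have hBf : B ≠ ∞ := by rw [hB]; finiteness
    -- The maximum keeps r nonzero, so that r⁻¹ is finite in the weighted Cauchy–Schwarz inequality.
    set r : ℝ≥0∞ := max (cNorm u) (1 / 2) with hr
    have hr1 : r < 1 := max_lt hc (by simp)
    have hr0 : r ≠ 0 := fun h => by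
      have : (1 / 2 : ℝ≥0∞) ≤ r := le_max_right _ _
      rw [h] at this; simp at this
    have hrs : 1 - r ≠ 0 := (tsub_pos_of_lt hr1).ne'
    have hfin : (1 - r)⁻¹ * ((1 - r)⁻¹ * B) ≠ ∞ := by have := ENNReal.inv_ne_top.2 hrs; finiteness
    refine ⟨((1 - r)⁻¹ * ((1 - r)⁻¹ * B)).toNNReal, Eventually.of_forall fun y => ?_⟩
    rw [ENNReal.coe_toNNReal hfin]
    have hy : Measurable fun z : ℝ × ℝ => (z.1, z.2, y) := by fun_prop
    have hs : ∀ N, Measurable fun z : ℝ × ℝ => ‖ser s u N z.1 z.2 y‖ₑ := fun N => by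
      have h1 := ((measurable_ser s H.meas N).comp hy).enorm
      simpa only [Function.comp_def] using h1
    refine le_trans (lintegral_mono fun z => pow_le_pow_left' enorm_tsum_le 2)
      (lintegral_sq_tsum_le (f := fun N (z : ℝ × ℝ) => ‖ser s u N z.1 z.2 y‖ₑ) hs hr0 hr1 fun N => ?_)
    rw [Measure.volume_eq_prod, lintegral_prod _ ((hs N).pow_const 2).aemeasurable]
    refine (lintegral_sq_ser_le s H.meas (lintegral_sq_ser_zero_le s H.meas H.prof_ut_ne_top) N y).trans ?_
    gcongr
    exact le_max_left _ _
  · obtain ⟨K, hK, h⟩ := H.exists_maj_le hc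
    have hfin : K * ∫⁻ l, maj u l ≠ ∞ := ENNReal.mul_ne_top hK (H.lintegral_maj_ne_top hc)
    refine ⟨(K * ∫⁻ l, maj u l).toNNReal, Eventually.of_forall fun z => ?_⟩
    rw [ENNReal.coe_toNNReal hfin, ← lintegral_const_mul' _ _ hK]
    refine lintegral_mono fun l => ?_
    rw [sq]
    refine mul_le_mul' ((enorm_mu_le s H.meas _ _ _).trans ((h l).trans (mul_le_of_le_one_right' (wt_le_one (by norm_num) l))))
      (enorm_mu_le s H.meas _ _ _)

/-! ### Uniqueness of scattering solutions. -/

lemma gop_congr (s k : ℝ) {F G : ℝ → ℝ → ℂ} {l : ℝ} (h : ∀ᵐ η, F l η = G l η) (y : ℝ) : gop s k F l y = gop s k G l y := by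
  unfold gop dirInt
  have h1 : ∀ S : Set ℝ, ∫ η in S, Complex.exp (-Complex.I * l * (l + 2 * k) * (y - η)) * F l η =
      ∫ η in S, Complex.exp (-Complex.I * l * (l + 2 * k) * (y - η)) * G l η := fun S =>
    integral_congr_ae ((ae_restrict_of_ae h).mono fun η hη => by dsimp only; rw [hη])
  simp only [h1]

lemma gop_sub (s k : ℝ) {F G : ℝ → ℝ → ℂ} {l : ℝ} (hF : Integrable (F l)) (hG : Integrable (G l)) (y : ℝ) :
    gop s k (fun l y => F l y - G l y) l y = gop s k F l y - gop s k G l y := by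
  have h := gop_add s k (F := F) (G := fun l y => (-1 : ℂ) * G l y) hF (hG.const_mul _) y
  rw [gop_const_mul] at h
  simpa only [neg_one_mul, ← sub_eq_add_neg] using h

lemma ae_ae_swap_of_ae_prod {p : ℝ × ℝ → Prop} (h : ∀ᵐ z : ℝ × ℝ, p z) : ∀ᵐ y : ℝ, ∀ᵐ x : ℝ, p (x, y) := by
  have h1 := (Measure.measurePreserving_swap (μ := (volume : Measure ℝ)) (ν := (volume : Measure ℝ))).quasiMeasurePreserving.ae h
  exact Measure.ae_ae_of_ae_prod h1

lemma measurable_bulk {u : ℝ × ℝ → ℝ} (hu : Measurable u) {g : ℝ → ℝ → ℝ≥0∞} (hg : Measurable fun z : ℝ × ℝ => g z.1 z.2) :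
    Measurable (bulk u g) := by
  unfold bulk
  refine Measurable.lintegral_prod_right' (f := fun z : ℝ × ℝ => ∫⁻ l', ‖ut u (z.1 - l') z.2‖ₑ * g l' z.2) ?_
  refine Measurable.lintegral_prod_right' (f := fun z : (ℝ × ℝ) × ℝ => ‖ut u (z.1.1 - z.2) z.1.2‖ₑ * g z.2 z.1.2) ?_
  have h1 := (measurable_ut_sub hu).enorm.comp (by fun_prop : Measurable fun z : (ℝ × ℝ) × ℝ => (z.1.1, z.1.2, z.2))
  have h2 := hg.comp (by fun_prop : Measurable fun z : (ℝ × ℝ) × ℝ => (z.2, z.1.2))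
  exact h1.mul h2

lemma IsNice.lintegral_mass_ne_top {u : ℝ × ℝ → ℝ} {C : ℝ} (H : IsNice u C) : ∫⁻ y, mass u y ≠ ∞ := by
  have h := H.lintegral_prof_ne_top
  unfold prof at h
  rw [lintegral_lintegral_swap] at h
  · exact h
  · exact (measurable_ut H.meas).enorm.aemeasurable

lemma add_sq_le_four_mul (a b : ℝ≥0∞) : (a + b) ^ 2 ≤ 4 * a ^ 2 + 4 * b ^ 2 := by
  have h : ∀ {a b : ℝ≥0∞}, a ≤ b → (a + b) ^ 2 ≤ 4 * b ^ 2 := fun {a b} h =>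
    (pow_le_pow_left' (add_le_add_left h b) 2).trans (le_of_eq (by ring))
  rcases le_total a b with hab | hab
  · exact (h hab).trans le_add_self
  · rw [add_comm a b]
    exact (h hab).trans le_self_add

/-- A solution known only in L²_l has no pointwise majorant; the L² bound for `bulk` nevertheless
makes its source integrable in y for almost every l, which additivity of the operator requires. -/
lemma ae_bulk_ne_top {u : ℝ × ℝ → ℝ} {C : ℝ} (H : IsNice u C) {f : ℝ → ℝ → ℂ} (hf : Measurable fun z : ℝ × ℝ => f z.1 z.2)
    {M : ℝ≥0∞} (hM : M ≠ ∞) (hb : ∀ᵐ y, ∫⁻ l, ‖f l y‖ₑ ^ 2 ≤ M) : ∀ᵐ l, bulk u (fun l y => ‖f l y‖ₑ) l ≠ ∞ := by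
  have hmass := H.lintegral_mass_ne_top
  have h1 : ∫⁻ l, bulk u (fun l y => ‖f l y‖ₑ) l ^ 2 ≠ ∞ := by
    refine ne_top_of_le_ne_top ?_ (lintegral_sq_bulk_le H.meas hf.enorm)
    refine ENNReal.mul_ne_top hmass (ne_top_of_le_ne_top (ENNReal.mul_ne_top hmass hM) ?_)
    rw [← lintegral_mul_const' _ _ hM]
    refine lintegral_mono_ae (hb.mono fun y hy => by gcongr)
  filter_upwards [ae_lt_top ((measurable_bulk H.meas hf.enorm).pow_const 2) h1] with l hl h
  rw [h] at hl
  simp at hl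

/-- Uniqueness for the scattering equation at a fixed `k`, in `L^∞_y L²_l`. -/
lemma ae_eq_mu_of_ae_eq_gop {u : ℝ × ℝ → ℝ} {C : ℝ} (H : IsNice u C) (hc : cNorm u < 1) (s k : ℝ) {f : ℝ → ℝ → ℂ}
    (hf : Measurable fun z : ℝ × ℝ => f z.1 z.2) {M : ℝ≥0∞} (hM : M ≠ ∞) (hb : ∀ᵐ y, ∫⁻ l, ‖f l y‖ₑ ^ 2 ≤ M)
    (he : ∀ᵐ y, ∀ᵐ l, f l y = gop s k (src (ut u) f) l y) : ∀ᵐ y, ∀ᵐ l, f l y = mu s u k l y := by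
  have hd := H.dom_mu hc s k
  have hmass := H.lintegral_mass_ne_top
  have mm := measurable_mass H.meas
  have mV := measurable_ut H.meas
  set d : ℝ → ℝ → ℂ := fun l y => f l y - mu s u k l y with hd'
  have md : Measurable fun z : ℝ × ℝ => d z.1 z.2 := hf.sub hd.meas
  have hfb := ae_bulk_ne_top H hf hM hb
  -- For almost every l both sources are integrable, so subtracting the equations is legitimate and
  -- the difference obeys the homogeneous bound.
  have key : ∀ᵐ l, ∀ y, ‖gop s k (src (ut u) f) l y - mu s u k l y‖ₑ ≤ c1 * bulk u (fun l y => ‖d l y‖ₑ) l := by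
    filter_upwards [hfb] with l hl y
    have ut_int : Integrable (fun y => (Real.sqrt (2 * Real.pi) : ℂ) * ut u l y) :=
      (integrable_of_prof mV (H.prof_ut_ne_top l)).const_mul _
    have i1 : Integrable (src (ut u) f l) :=
      ut_int.add (integrable_of_prof (measurable_cnv' mV hf) (ne_top_of_le_ne_top hl (prof_cnv_le_bulk u f l)))
    have i2 := H.integrable_src hc s k l
    rw [H.mu_eq' hc s k l y, ← gop_sub s k i1 i2]
    refine (enorm_gop_le _ _ _ _ _).trans (mul_le_mul' le_rfl (lintegral_mono_ae ?_))
    have mb : Measurable fun η => ∫⁻ l', ‖ut u (l - l') η‖ₑ * ‖f l' η‖ₑ := by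
      refine Measurable.lintegral_prod_right' (f := fun z : ℝ × ℝ => ‖ut u (l - z.2) z.1‖ₑ * ‖f z.2 z.1‖ₑ) ?_
      have h1 := (measurable_ut_sub H.meas).enorm.comp (by fun_prop : Measurable fun z : ℝ × ℝ => (l, z))
      have h2 := hf.enorm.comp (by fun_prop : Measurable fun z : ℝ × ℝ => (z.2, z.1))
      exact h1.mul h2
    filter_upwards [ae_lt_top mb hl] with η hη
    have j1 : Integrable fun l' => ut u (l - l') η * f l' η := by
      refine ⟨?_, ?_⟩
      · have h1 := (measurable_slice_right mV η).comp (measurable_id.const_sub l)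
        exact (h1.mul (measurable_slice_right hf η)).aestronglyMeasurable
      · rw [hasFiniteIntegral_iff_enorm]
        simpa only [enorm_mul] using hη
    have j2 := integrable_cnv H.slab hd l η
    have e : src (ut u) f l η - src (ut u) (mu s u k) l η = ∫ l', ut u (l - l') η * d l' η := by
      simp only [src, cnv, hd', mul_sub]
      rw [integral_sub j1 j2]; ring
    rw [e]
    refine (enorm_integral_le_lintegral_enorm _).trans (le_of_eq (lintegral_congr fun l' => enorm_mul _ _))
  have hD : ∀ᵐ y, ∫⁻ l, ‖d l y‖ₑ ^ 2 ≤ c1 ^ 2 * ((∫⁻ y, mass u y) * ∫⁻ η, mass u η * ∫⁻ l', ‖d l' η‖ₑ ^ 2) := by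
    filter_upwards [he] with y hy
    refine le_trans ?_ (mul_le_mul' le_rfl (lintegral_sq_bulk_le H.meas md.enorm))
    rw [← lintegral_const_mul' _ _ (by have := c1_ne_top; finiteness)]
    refine lintegral_mono_ae ?_
    filter_upwards [key, hy] with l h1 h2
    rw [← mul_pow]
    refine pow_le_pow_left' ?_ 2
    have h3 := h1 y
    rwa [← h2] at h3
  set W : ℝ≥0∞ := ∫⁻ η, mass u η * ∫⁻ l', ‖d l' η‖ₑ ^ 2 with hW
  have hWf : W ≠ ∞ := by
    obtain ⟨K, hK, hmaj⟩ := H.exists_maj_le hc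
    have hfin : K * ∫⁻ l, maj u l ≠ ∞ := ENNReal.mul_ne_top hK (H.lintegral_maj_ne_top hc)
    have hb2 : ∀ᵐ y, ∫⁻ l, ‖d l y‖ₑ ^ 2 ≤ 4 * M + 4 * (K * ∫⁻ l, maj u l) := by
      filter_upwards [hb] with y hy
      have mf : Measurable fun l => ‖f l y‖ₑ ^ 2 := (measurable_slice_right hf y).enorm.pow_const 2
      calc ∫⁻ l, ‖d l y‖ₑ ^ 2 ≤ ∫⁻ l, (4 * ‖f l y‖ₑ ^ 2 + 4 * (K * maj u l)) := by
            refine lintegral_mono fun l => ?_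
            have h1 : ‖d l y‖ₑ ≤ ‖f l y‖ₑ + ‖mu s u k l y‖ₑ := enorm_sub_le
            have h2 : ‖mu s u k l y‖ₑ ^ 2 ≤ K * maj u l := by
              rw [sq]
              exact mul_le_mul' ((enorm_mu_le s H.meas _ _ _).trans ((hmaj l).trans
                (mul_le_of_le_one_right' (wt_le_one (by norm_num) l)))) (enorm_mu_le s H.meas _ _ _)
            refine (pow_le_pow_left' h1 2).trans ((add_sq_le_four_mul _ _).trans ?_)
            gcongr
        _ = 4 * (∫⁻ l, ‖f l y‖ₑ ^ 2) + 4 * (K * ∫⁻ l, maj u l) := by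
            rw [lintegral_add_left (mf.const_mul 4), lintegral_const_mul _ mf, lintegral_const_mul' _ _ (by norm_num),
              lintegral_const_mul' _ _ hK]
        _ ≤ _ := by gcongr
    refine ne_top_of_le_ne_top (b := (∫⁻ y, mass u y) * (4 * M + 4 * (K * ∫⁻ l, maj u l))) (by finiteness) ?_
    rw [← lintegral_mul_const _ mm]
    exact lintegral_mono_ae (hb2.mono fun y hy => by gcongr)
  have hW0 : W = 0 := by
    -- The L² bound at height y is integrated against `mass`, which reproduces W with factor c².
    -- Since W is finite and c < 1, it vanishes.
    have h1 : W ≤ cNorm u ^ 2 * W := by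
      calc W ≤ ∫⁻ η, mass u η * (c1 ^ 2 * ((∫⁻ y, mass u y) * W)) :=
            lintegral_mono_ae (hD.mono fun y hy => by gcongr)
        _ = (c1 * ∫⁻ y, mass u y) ^ 2 * W := by rw [lintegral_mul_const _ mm]; ring
        _ = cNorm u ^ 2 * W := by rw [c1_mul_lintegral_mass H.meas]
    by_contra h0
    have h2 : cNorm u ^ 2 * W < 1 * W := ENNReal.mul_lt_mul_left h0 hWf (pow_lt_one₀ zero_le hc two_ne_zero)
    rw [one_mul] at h2
    exact absurd h1 (not_le.2 h2)
  filter_upwards [hD] with y hy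
  rw [hW0, mul_zero, mul_zero, nonpos_iff_eq_zero, lintegral_eq_zero_iff ((measurable_slice_right md y).enorm.pow_const 2)] at hy
  filter_upwards [hy] with l hl
  simpa [hd', sub_eq_zero] using hl

/-- Every scattering solution agrees with the Neumann series. -/
lemma ae_eq_mu {u : ℝ × ℝ → ℝ} {C : ℝ} (H : IsNice u C) (hc : cNorm u < 1) (s : ℝ) {m : ℝ → ℝ → ℝ → ℂ}
    (hm : IsScatteringSolution s u m) : ∀ᵐ k, ∀ᵐ y, ∀ᵐ l, m k l y = mu s u k l y := by
  obtain ⟨⟨ha, -⟩, ⟨-, M, hM⟩, heq⟩ := hm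
  -- A measurable representative; the source integrates over l', so replacing m on a null set
  -- changes it only for a null set of heights.
  set m' : ℝ → ℝ → ℝ → ℂ := fun k l y => ha.mk _ (k, l, y) with hm'
  have mm' : Measurable fun z : ℝ × ℝ × ℝ => m' z.1 z.2.1 z.2.2 := ha.stronglyMeasurable_mk.measurable
  have h1 : ∀ᵐ k, ∀ᵐ y, ∀ᵐ l, m k l y = m' k l y :=
    (Measure.ae_ae_of_ae_prod ha.ae_eq_mk).mono fun k hk => ae_ae_swap_of_ae_prod hk
  have h2 : ∀ᵐ k, ∀ᵐ y, ∫⁻ l, ‖m k l y‖ₑ ^ 2 ≤ M := Measure.ae_ae_of_ae_prod hM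
  have h3 : ∀ᵐ k, ∀ᵐ y, ∀ᵐ l, m k l y = gMu s u m k l y :=
    (Measure.ae_ae_of_ae_prod heq).mono fun k hk => ae_ae_swap_of_ae_prod hk
  filter_upwards [h1, h2, h3] with k k1 k2 k3
  have hsrc : ∀ l, ∀ᵐ η, convMu u m k l η = src (ut u) (m' k) l η := fun l => by
    filter_upwards [k1] with η hη
    rw [convMu_eq]
    unfold src cnv
    congr 1
    exact integral_congr_ae (hη.mono fun l' h => by dsimp only; rw [h])
  have h4 := ae_eq_mu_of_ae_eq_gop H hc s k (measurable_section mm' k) ENNReal.coe_ne_top (M := M) ?_ ?_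
  · filter_upwards [k1, h4] with y y1 y2
    filter_upwards [y1, y2] with l l1 l2
    rw [l1, l2]
  · filter_upwards [k1, k2] with y y1 y2
    refine (le_of_eq (lintegral_congr_ae ?_)).trans y2
    filter_upwards [y1] with l l1
    rw [l1]
  · filter_upwards [k1, k3] with y y1 y2
    filter_upwards [y1, y2] with l l1 l2
    rw [← l1, l2, gMu_eq_gop]
    exact gop_congr s k (hsrc l) y

lemma ae_scatT_eq {u : ℝ × ℝ → ℝ} {C : ℝ} (H : IsNice u C) (hc : cNorm u < 1) (s : ℝ) {m : ℝ → ℝ → ℝ → ℂ}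
    (hm : IsScatteringSolution s u m) : ∀ᵐ k, ∀ l, scatT s u m k l = scatT s u (mu s u) k l := by
  filter_upwards [ae_eq_mu H hc s hm] with k hk l
  unfold scatT
  congr 2
  refine integral_congr_ae ?_
  filter_upwards [hk] with y hy
  unfold convMu
  rw [integral_congr_ae (hy.mono fun l' h => by dsimp only; rw [h] : (fun l' => ut u (l - k - l') y * m k l' y) =ᵐ[volume]
    fun l' => ut u (l - k - l') y * mu s u k l' y)]

/-! ### Passage to a regular representative and conclusion. -/

lemma MemH45.congr_ae {u v : ℝ × ℝ → ℝ} (h : u =ᵐ[volume] v) (hu : MemH45 u) : MemH45 v := by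
  obtain ⟨h1, h2, ⟨w, hw, hw2⟩, ⟨w', hw', hw2'⟩⟩ := hu
  refine ⟨(memLp_congr_ae h).1 h1, (memLp_congr_ae ?_).1 h2, ⟨w, fun φ hφ => ?_, hw2⟩, ⟨w', fun φ hφ => ?_, hw2'⟩⟩
  · filter_upwards [h] with z hz
    rw [hz]
  · rw [← hw φ hφ]
    exact integral_congr_ae (h.mono fun z hz => by dsimp only; rw [hz])
  · rw [← hw' φ hφ]
    exact integral_congr_ae (h.mono fun z hz => by dsimp only; rw [hz])

/-- By Fubini almost every slice agrees almost everywhere, and then ũ agrees for all l at once.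
Norms, solutions and scattering data see ũ through integrals in y or the plane and are therefore
unchanged. -/
lemma ae_ut_eq {u v : ℝ × ℝ → ℝ} (h : u =ᵐ[volume] v) : ∀ᵐ y, ∀ l, ut u l y = ut v l y := by
  filter_upwards [ae_ae_swap_of_ae_prod h] with y hy l
  unfold ut
  congr 1
  exact integral_congr_ae (hy.mono fun x hx => by dsimp only; rw [hx])

section Congr
variable {u v : ℝ × ℝ → ℝ}

lemma cNorm_congr (h : ∀ᵐ y, ∀ l, ut u l y = ut v l y) : cNorm u = cNorm v := by
  unfold cNorm
  congr 1
  refine lintegral_congr_ae ((Measure.quasiMeasurePreserving_snd.ae h).mono fun z hz => ?_)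
  dsimp only
  rw [hz]

lemma normInv_congr (h : ∀ᵐ y, ∀ l, ut u l y = ut v l y) : normInv u = normInv v := by
  unfold normInv
  congr 1
  refine lintegral_congr_ae ((Measure.quasiMeasurePreserving_snd.ae h).mono fun z hz => ?_)
  dsimp only
  rw [hz]

lemma ae_convMu_eq (h : ∀ᵐ y, ∀ l, ut u l y = ut v l y) (m : ℝ → ℝ → ℝ → ℂ) (k l : ℝ) : ∀ᵐ y, convMu u m k l y = convMu v m k l y := by
  filter_upwards [h] with y hy
  unfold convMu
  simp only [hy]

lemma gMu_congr (h : ∀ᵐ y, ∀ l, ut u l y = ut v l y) (s : ℝ) (m : ℝ → ℝ → ℝ → ℂ) (k l y : ℝ) : gMu s u m k l y = gMu s v m k l y :=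
  gop_congr s k (F := convMu u m k) (G := convMu v m k) (ae_convMu_eq h m k l) y

lemma scatT_congr (h : ∀ᵐ y, ∀ l, ut u l y = ut v l y) (s : ℝ) (m : ℝ → ℝ → ℝ → ℂ) (k l : ℝ) : scatT s u m k l = scatT s v m k l := by
  unfold scatT
  congr 2
  refine integral_congr_ae ((ae_convMu_eq h m k (l - k)).mono fun y hy => ?_)
  dsimp only
  rw [hy]

lemma isScatteringSolution_congr (h : ∀ᵐ y, ∀ l, ut u l y = ut v l y) (s : ℝ) (m : ℝ → ℝ → ℝ → ℂ) : IsScatteringSolution s u m ↔ IsScatteringSolution s v m := by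
  unfold IsScatteringSolution
  simp only [gMu_congr h]

end Congr

/-- A potential has a regular representative. -/
lemma exists_ae_eq_isNice {u : ℝ × ℝ → ℝ} (hu : MemH45 u) : ∃ v C, u =ᵐ[volume] v ∧ IsNice v C := by
  have hm := hu.1.aestronglyMeasurable
  set w := hm.mk u with hw
  have mw : Measurable w := hm.stronglyMeasurable_mk.measurable
  have hww : MemH45 w := hu.congr_ae hm.ae_eq_mk
  obtain ⟨C, hC, -⟩ := exists_isNice_of_measurable mw hww
  set S : ℝ → ℝ≥0∞ := fun y => ∫⁻ x, ENNReal.ofReal (1 + x ^ 2) * ‖w (x, y)‖ₑ with hS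
  have mS2 : Measurable fun z : ℝ × ℝ => ENNReal.ofReal (1 + z.2 ^ 2) * ‖w (z.2, z.1)‖ₑ := by
    have h1 := mw.comp (measurable_swap (α := ℝ) (β := ℝ))
    have h2 : Measurable fun z : ℝ × ℝ => w (z.2, z.1) := h1
    fun_prop
  have mS : Measurable S := mS2.lintegral_prod_right'
  have hSf : ∀ᵐ y, S y < ∞ := by
    refine ae_lt_top mS (ne_top_of_le_ne_top ENNReal.ofReal_ne_top (le_trans ?_ hC))
    rw [Measure.volume_eq_prod, lintegral_prod_symm]
    · refine lintegral_mono fun y => lintegral_mono fun x => ?_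
      dsimp only
      gcongr
      nlinarith [mul_nonneg (sq_nonneg x) (sq_nonneg y), sq_nonneg y]
    · have : Measurable fun z : ℝ × ℝ => ENNReal.ofReal ((1 + z.1 ^ 2) * (1 + z.2 ^ 2)) * ‖w z‖ₑ := by fun_prop
      exact this.aemeasurable
  -- Horizontal lines with infinite weighted mass form a null set; setting u to 0 there makes every
  -- slice integrable, so the transform is a genuine integral everywhere.
  set v : ℝ × ℝ → ℝ := fun z => if S z.2 < ∞ then w z else 0 with hv
  have hwv : w =ᵐ[volume] v := by
    filter_upwards [Measure.quasiMeasurePreserving_snd.ae hSf] with z hz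
    rw [hv]; simp only [hz, if_true]
  have mv : Measurable v := Measurable.ite (measurableSet_lt (mS.comp measurable_snd) measurable_const) mw measurable_const
  obtain ⟨C', -, hC'⟩ := exists_isNice_of_measurable mv (hww.congr_ae hwv)
  refine ⟨v, C', hm.ae_eq_mk.trans hwv, hC' fun y => ?_⟩
  by_cases hy : S y < ∞
  · simp only [hv, hy, if_true]
    exact hy
  · simp [hv, hy]

lemma norm_neg_I_mul_inv_two_pi_le : ‖-Complex.I * ((1 / (2 * Real.pi) : ℝ) : ℂ)‖ ≤ 1 := by
  have := Real.pi_gt_three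
  rw [norm_mul, norm_neg, Complex.norm_I, one_mul, Complex.norm_real, Real.norm_of_nonneg (by positivity), div_le_one (by positivity)]
  linarith

lemma scatT_eq_zero {s k l : ℝ} (h : s * (l - k) < 0) (u : ℝ × ℝ → ℝ) (m : ℝ → ℝ → ℝ → ℂ) : scatT s u m k l = 0 :=
  if_neg h.not_gt

/-- The scattering data of a regular potential in terms of the smooth amplitude. -/
lemma ae_scatF_eq {u : ℝ × ℝ → ℝ} {C : ℝ} (H : IsNice u C) (hc : cNorm u < 1) {s : ℝ} {m : ℝ → ℝ → ℝ → ℂ}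
    (hm : IsScatteringSolution s u m) : ∀ᵐ z : ℝ × ℝ, 0 < s * (z.2 - z.1) → ((z.2 : ℂ) - z.1) * scatT s u m z.1 z.2 =
      -Complex.I * ((1 / (2 * Real.pi) : ℝ) : ℂ) * (((z.2 - z.1 : ℝ) : ℂ) * tht (ut u) (mu s u z.1) z.1 (z.2 - z.1)) := by
  filter_upwards [Measure.quasiMeasurePreserving_fst.ae (ae_scatT_eq H hc s hm)] with z hz h
  rw [hz, IsNice.scatT_mu, if_pos h]
  push_cast; ring

lemma decay_of_isNice {u : ℝ × ℝ → ℝ} {C : ℝ} (H : IsNice u C) (hc : cNorm u < 1) {mp mm : ℝ → ℝ → ℝ → ℂ}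
    (hp : IsScatteringSolution 1 u mp) (hm : IsScatteringSolution (-1) u mm) :
    Integrable (fun z : ℝ × ℝ => ((z.2 : ℂ) - z.1) * scatF u mp mm z.1 z.2) volume ∧
      ∀ δ : ℝ, 0 < δ →
        (∀ ε : ℝ, 0 < ε → ∃ t₀ : ℝ, 0 < t₀ ∧ ∀ t x y : ℝ, t₀ ≤ t → δ < aPar t x y →
          ‖u1 u mp mm t x y‖ ≤ ε * t⁻¹) ∧
        (∃ C : ℝ, ∀ t x y : ℝ, 0 < t → |aPar t x y| < δ →
          ‖u1 u mp mm t x y‖ ≤ C * t ^ (-(2 / 3) : ℝ)) ∧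
        (∃ C : ℝ, ∀ t x y : ℝ, 0 < t → aPar t x y < -δ →
          ‖u1 u mp mm t x y‖ ≤ C * t⁻¹) := by
  obtain ⟨_, _, _, _, _, _, Tp⟩ := H.exists_thetaData hc 1
  obtain ⟨_, _, _, _, _, _, Tm⟩ := H.exists_thetaData hc (-1)
  refine decay_of_oscData (Tp.oscData norm_neg_I_mul_inv_two_pi_le) (Tm.oscData norm_neg_I_mul_inv_two_pi_le) ?_ ?_
  · filter_upwards [ae_scatF_eq H hc hp] with z hz h
    have h1 : (-1 : ℝ) * (z.2 - z.1) < 0 := by linarith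
    rw [scatF, scatT_eq_zero h1, add_zero]
    exact hz (by linarith)
  · filter_upwards [ae_scatF_eq H hc hm] with z hz h
    have h1 : (1 : ℝ) * (z.2 - z.1) < 0 := by linarith
    rw [scatF, scatT_eq_zero h1, zero_add]
    exact hz (by linarith)

end

end KPI

theorem theorem4p1 (u : ℝ × ℝ → ℝ) (hu : KPI.MemE1w u)
    (hC1 : KPI.cNorm u < 1)
    (hC2 : KPI.normInv u < (1 - KPI.cNorm u) / 4)
    (hC2a : KPI.cTilde u < 1) :
    (∃ mp, KPI.IsScatteringSolution 1 u mp) ∧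
    (∃ mm, KPI.IsScatteringSolution (-1) u mm) ∧
    ∀ mp mm : ℝ → ℝ → ℝ → ℂ,
      KPI.IsScatteringSolution 1 u mp → KPI.IsScatteringSolution (-1) u mm →
      MeasureTheory.Integrable
        (fun z : ℝ × ℝ => ((z.2 : ℂ) - z.1) * KPI.scatF u mp mm z.1 z.2)
        MeasureTheory.volume ∧
      ∀ δ : ℝ, 0 < δ →
        (∀ ε : ℝ, 0 < ε → ∃ t₀ : ℝ, 0 < t₀ ∧ ∀ t x y : ℝ, t₀ ≤ t → δ < KPI.aPar t x y →
          ‖KPI.u1 u mp mm t x y‖ ≤ ε * t⁻¹) ∧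
        (∃ C : ℝ, ∀ t x y : ℝ, 0 < t → |KPI.aPar t x y| < δ →
          ‖KPI.u1 u mp mm t x y‖ ≤ C * t ^ (-(2 / 3) : ℝ)) ∧
        (∃ C : ℝ, ∀ t x y : ℝ, 0 < t → KPI.aPar t x y < -δ →
          ‖KPI.u1 u mp mm t x y‖ ≤ C * t⁻¹) := by
  obtain ⟨v, C, hv, H⟩ := KPI.exists_ae_eq_isNice hu.1
  have h := KPI.ae_ut_eq hv
  have hc : KPI.cNorm v < 1 := by rwa [← KPI.cNorm_congr h]
  -- A strict upper bound in [0, ∞] gives finiteness, which puts the first Neumann term into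
  -- L^∞_y(L²_{k,l}).
  have hn : KPI.normInv v ≠ ⊤ := by rw [← KPI.normInv_congr h]; exact hC2.ne_top
  refine ⟨⟨_, (KPI.isScatteringSolution_congr h 1 _).2 (H.isScatteringSolution_mu hc hn 1)⟩,
    ⟨_, (KPI.isScatteringSolution_congr h (-1) _).2 (H.isScatteringSolution_mu hc hn (-1))⟩, fun mp mm hp hm => ?_⟩
  have hd := KPI.decay_of_isNice H hc ((KPI.isScatteringSolution_congr h 1 _).1 hp) ((KPI.isScatteringSolution_congr h (-1) _).1 hm)
  simpa only [KPI.u1, KPI.scatF, KPI.scatT_congr h] using hd
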